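/- Notation. For $F:[0,\infty)\to\mathbb R$ put $\Delta_0F(r)=F(r)-F(r/2)$ and $\Delta_{k+1}F(r)=\Delta_kF(r)-2^{k+1}\Delta_kF(r/2)$. For a compactly supported finite measure $\mu$ on $\mathbb R^d$, $\alpha>0$, $p,q\in[1,\infty)$, $k=\lceil\alpha+d-1\rceil$ and $F_\mu(r,y)=\mu(\{x:|x-y|\le r\})$, let $$\|\mu\|_{\mathrm{SBE}^{\alpha,p}_q}=\bigl\|r^{-\alpha-d}\,(\Delta_k)_rF_\mu(r,y)\bigr\|_{L^q(\mathbb R^d,dy;\,L^p((0,\infty),dr/r))}.$$ The occupation measure of $\omega:[0,T]\to\mathbb R^d$ is $\mu^\omega_{s,t}=\int_s^t\delta_{\omega_r}\,dr$. For $r>0$, $C^{r\text{-var}}([0,T];E)$ is the set of continuous paths $x$ with finite seminorm $\|x\|_{r\text{-var}}=\sup\bigl(\sum_i\|x_{t_{i+1}}-x_{t_i}\|_E^r\bigr)^{1/r}$, the supremum being over all partitions of $[0,T]$; as a normed space it carries the norm $\|x\|_\infty+\|x\|_{r\text{-var}}$. For $t\mapsto\mu^\omega_{0,t}$ and $E=\mathrm{SBE}^{\alpha,p}_q$,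 the increments are $\mu^\omega_{0,t}-\mu^\omega_{0,s}=\mu^\omega_{s,t}$, $s\le t$. A control is a continuous superadditive function $\rho\ge0$ on $\{0\le s\le t\le T\}$ that vanishes on the diagonal. Proposition 6.3. Let $d\ge1$, $p_1,q_1,p_2\in[1,\infty)$, $q_2\in[1,\infty]$, $\alpha_1>0$, $\alpha_2\in\mathbb R$, $r_1,r_2,r_3>0$ be such that $$1<\frac1{q_1}+\frac1{p_2}<1+\frac{\alpha_1+\alpha_2}{d},\qquad \frac1{r_1}+\frac1{r_2}>1,$$ and let $\gamma_0=\alpha_1+\alpha_2-d\bigl(\frac1{q_1}+\frac1{p_2}-1\bigr)$ and $R\in\mathbb R$. Let $T>0$, let $\omega:[0,T]\to\mathbb R^d$ be continuous with $\operatorname{diam}\omega([0,T])\le R$ and $\mu^\omega_{0,\cdot}\in C^{r_1\text{-var}}([0,T];\mathrm{SBE}^{\alpha_1,p_1}_{q_1})$, let $f\in C^{r_2\text{-var}}([0,T];B^{\alpha_2}_{p_2,q_2}(\mathbb R^d;\mathbb R^d))$ and $\theta\in C^{r_3\text{-var}}([0,T];\mathbb R^d)$. Write $M=\|\mu^\omega_{0,\cdot}\|_{r_1\text{-var}}$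 (with values in $\mathrm{SBE}^{\alpha_1,p_1}_{q_1}$), and let $\|f\|_{r_2\text{-var}}$ and $\|f\|_\infty=\sup_t\|f(t)\|_{B^{\alpha_2}_{p_2,q_2}}$ be the seminorm and the sup norm of $f$. Below, $\lesssim$ means inequality up to a finite constant that depends only on $d$, on the exponents in play (including $\gamma$ and $\lambda$) and on $R$. (i) Let $\gamma\in(0,1)$, $\gamma\le\gamma_0$, $\frac1{r_1}+\frac\gamma{r_3}>1$. Then the nonlinear Young integral $\mathscr I(\theta)_t=\int_0^tf(s,\theta_s-\omega_s)\,ds$ is well defined in $C^{r_1\text{-var}}([0,T];\mathbb R^d)$: for all $s\le t$ the convolution $f(s,\cdot)\star\mu^\omega_{s,t}$ is a bounded continuous function, and there is exactly one continuous path $\mathscr I(\theta):[0,T]\to\mathbb R^d$ with $\mathscr I(\theta)_0=0$ such that, for some controls $\rho,\sigma$ and some $a,b>0$ with $a+b>1$, $$\bigl|\mathscr I(\theta)_t-\mathscr I(\theta)_s-\bigl(f(s,\cdot)\star\mu^\omega_{s,t}\bigr)(\theta_s)\bigr|\le\rho_{s,t}^a\,\sigma_{s,t}^b,\qquad 0\le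 s\le t\le T.$$ This path is in $C^{r_1\text{-var}}([0,T];\mathbb R^d)$, and $$\|\mathscr I(\theta)\|_{r_1\text{-var}}\lesssim\bigl(\|f\|_{r_2\text{-var}}+(1+\|\theta\|_{r_3\text{-var}}^\gamma)\|f\|_\infty\bigr)M.$$ (ii) Let $\theta^1,\theta^2\in C^{r_3\text{-var}}([0,T];\mathbb R^d)$, $\gamma\in(0,1)$ with $\gamma\le\gamma_0$, and $\lambda\in(0,1)$ with $\frac1{r_1}+\frac{\gamma(1-\lambda)}{r_3}>1$. Then $$\|\mathscr I(\theta^1)-\mathscr I(\theta^2)\|_{r_1\text{-var}}\lesssim M\bigl(\|f\|_\infty+\|f\|_{r_2\text{-var}}\bigr)\|\theta^1-\theta^2\|_\infty^{\lambda\gamma}\bigl(\|\theta^1-\theta^2\|_\infty+\|\theta^1\|_{r_3\text{-var}}+\|\theta^2\|_{r_3\text{-var}}\bigr)^{\gamma(1-\lambda)}.$$ (iii) Suppose $\gamma_0>1$, and let $\gamma\in(0,1)$, $\gamma\le\gamma_0-1$, $\frac1{r_1}+\frac\gamma{r_3}>1$. Then $\theta\mapsto\mathscr I(\theta)$ is Fréchet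 differentiable at every point as a map from $C^{r_3\text{-var}}([0,T];\mathbb R^d)$ to $C^{r_1\text{-var}}([0,T];\mathbb R^d)$, and the operator norm of its derivative satisfies $$\|D\mathscr I(\theta)\|\lesssim M\bigl(\|f\|_{r_2\text{-var}}+(1+\|\theta\|_{r_3\text{-var}}^\gamma)\|f\|_\infty\bigr).$$ -/

import Mathlib

open MeasureTheory Set Filter Topology
open scoped ENNReal NNReal SchwartzMap FourierTransform BoundedContinuousFunction

noncomputable section

namespace SBEPaths

/-! ### Finite `r`-variation of two-parameter increments -/

section Variation

variable {ι : Type*}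

/-- The `r`-variation `sup (∑ᵢ d(tᵢ, tᵢ₊₁) ^ r) ^ (1 / r)` of an `ℝ≥0∞`-valued increment `d(s, t)`
(a distance between the positions at the times `s ≤ t` of a path), the supremum being over all
finite monotone sequences of times. -/
def pVar [Preorder ι] (d : ι → ι → ℝ≥0∞) (r : ℝ) : ℝ≥0∞ :=
  (⨆ P : ℕ × {u : ℕ → ι // Monotone u},
    ∑ i ∈ Finset.range P.1, d (P.2.1 i) (P.2.1 (i + 1)) ^ r) ^ (1 / r)

/-- The path with increments `d` is continuous and has finite `r`-variation. -/
structure IsCVar [LinearOrder ι] [TopologicalSpace ι] (d : ι → ι → ℝ≥0∞) (r : ℝ) : Prop where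
  continuous : ∀ t, Tendsto (fun s => d (min s t) (max s t)) (𝓝 t) (𝓝 0)
  finite : pVar d r ≠ ∞

/-- Increments `‖θ_t - θ_s‖` of a path in a normed group. -/
def normIncr {F : Type*} [NormedAddCommGroup F] (θ : ι → F) (s t : ι) : ℝ≥0∞ := ‖θ t - θ s‖ₑ

variable [Preorder ι]

theorem sum_le_of_pVar {d : ι → ι → ℝ≥0∞} {r : ℝ} (hr : 0 < r) (n : ℕ) {u : ℕ → ι}
    (hu : Monotone u) : ∑ i ∈ Finset.range n, d (u i) (u (i + 1)) ^ r ≤ pVar d r ^ r := by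
  unfold pVar
  rw [← ENNReal.rpow_mul, one_div_mul_cancel hr.ne', ENNReal.rpow_one]
  exact le_iSup (fun P : ℕ × {u : ℕ → ι // Monotone u} =>
    ∑ i ∈ Finset.range P.1, d (P.2.1 i) (P.2.1 (i + 1)) ^ r) ⟨n, ⟨u, hu⟩⟩

theorem pVar_le {d : ι → ι → ℝ≥0∞} {r : ℝ} (hr : 0 < r) {c : ℝ≥0∞}
    (h : ∀ (n : ℕ) (u : ℕ → ι), Monotone u →
      (∑ i ∈ Finset.range n, d (u i) (u (i + 1)) ^ r) ≤ c ^ r) : pVar d r ≤ c := by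
  unfold pVar
  rw [one_div, ENNReal.rpow_inv_le_iff hr]
  exact iSup_le fun P => h P.1 P.2.1 P.2.2

theorem pVar_mono {d d' : ι → ι → ℝ≥0∞} {r : ℝ} (hr : 0 < r)
    (h : ∀ s t, d s t ≤ d' s t) : pVar d r ≤ pVar d' r :=
  pVar_le hr fun n _ hu => le_trans
    (Finset.sum_le_sum fun _ _ => ENNReal.rpow_le_rpow (h _ _) hr.le) (sum_le_of_pVar hr n hu)

theorem pVar_const_mul_le (d : ι → ι → ℝ≥0∞) {r : ℝ} (hr : 0 < r) (c : ℝ≥0∞) :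
    pVar (fun s t => c * d s t) r ≤ c * pVar d r := by
  refine pVar_le hr fun n u hu => ?_
  rw [ENNReal.mul_rpow_of_nonneg _ _ hr.le]
  simp_rw [ENNReal.mul_rpow_of_nonneg _ _ hr.le]
  rw [← Finset.mul_sum]
  gcongr
  exact sum_le_of_pVar hr n hu

theorem pVar_add_le (d d' : ι → ι → ℝ≥0∞) {r : ℝ} (hr : 1 ≤ r) :
    pVar (fun s t => d s t + d' s t) r ≤ pVar d r + pVar d' r := by
  have hr0 : 0 < r := by linarith
  refine pVar_le hr0 fun n u hu => ?_
  rw [← ENNReal.rpow_inv_le_iff hr0, ← one_div]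
  refine (ENNReal.Lp_add_le _ _ _ hr).trans (add_le_add ?_ ?_) <;>
  · rw [one_div, ENNReal.rpow_inv_le_iff hr0]
    exact sum_le_of_pVar hr0 n hu

theorem pVar_add_ne_top (d d' : ι → ι → ℝ≥0∞) {r : ℝ} (hr : 0 < r) (h : pVar d r ≠ ∞)
    (h' : pVar d' r ≠ ∞) : pVar (fun s t => d s t + d' s t) r ≠ ∞ := by
  have key : ∀ a b : ℝ≥0∞, (a + b) ^ r ≤ 2 ^ r * (a ^ r + b ^ r) := by
    intro a b
    rcases le_total a b with hab | hab
    · calc (a + b) ^ r ≤ (2 * b) ^ r := by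
            rw [two_mul]; exact ENNReal.rpow_le_rpow (by gcongr) hr.le
        _ = 2 ^ r * b ^ r := ENNReal.mul_rpow_of_nonneg _ _ hr.le
        _ ≤ _ := by gcongr; exact le_add_self
    · calc (a + b) ^ r ≤ (2 * a) ^ r := by
            rw [two_mul]; exact ENNReal.rpow_le_rpow (by gcongr) hr.le
        _ = 2 ^ r * a ^ r := ENNReal.mul_rpow_of_nonneg _ _ hr.le
        _ ≤ _ := by gcongr; exact le_self_add
  have hfin : (2 : ℝ≥0∞) ^ r * (pVar d r ^ r + pVar d' r ^ r) ≠ ∞ :=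
    ENNReal.mul_ne_top (ENNReal.rpow_ne_top_of_nonneg hr.le (by simp))
      (ENNReal.add_ne_top.2 ⟨ENNReal.rpow_ne_top_of_nonneg hr.le h,
        ENNReal.rpow_ne_top_of_nonneg hr.le h'⟩)
  refine ne_top_of_le_ne_top (ENNReal.rpow_ne_top_of_nonneg (by positivity : (0 : ℝ) ≤ r⁻¹) hfin)
    (pVar_le hr fun n u hu => ?_)
  rw [← ENNReal.rpow_mul, inv_mul_cancel₀ hr.ne', ENNReal.rpow_one]
  calc _ ≤ ∑ i ∈ Finset.range n, 2 ^ r * (d (u i) (u (i + 1)) ^ r + d' (u i) (u (i + 1)) ^ r) :=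
        Finset.sum_le_sum fun i _ => key _ _
    _ ≤ _ := by
        rw [← Finset.mul_sum, Finset.sum_add_distrib]
        gcongr
        · exact sum_le_of_pVar hr n hu
        · exact sum_le_of_pVar hr n hu

theorem pVar_zero {r : ℝ} (hr : 0 < r) : pVar (fun _ _ : ι => (0 : ℝ≥0∞)) r = 0 :=
  le_antisymm (pVar_le hr fun n u _ => by simp [ENNReal.zero_rpow_of_pos hr]) bot_le

end Variation

/-! ### The normed space `C^{r-var}([0,T]; F)` -/

section VarPath

variable {T r : ℝ} {F : Type*} [NormedAddCommGroup F]

/-- A continuous path of finite `r`-variation with `r < 1` is constant. -/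
theorem eq_of_pVar_lt_one (hr0 : 0 < r) (hr1 : r < 1) (θ : C(Icc (0 : ℝ) T, F))
    (h : pVar (normIncr θ) r ≠ ∞) (s t : Icc (0 : ℝ) T) : θ s = θ t := by
  wlog hst : s ≤ t generalizing s t
  · exact (this t s (le_of_not_ge hst)).symm
  set V := pVar (normIncr θ) r ^ r with hV
  have hVtop : V ≠ ∞ := ENNReal.rpow_ne_top_of_nonneg hr0.le h
  have bound : ∀ ε : ℝ≥0, 0 < ε → ‖θ t - θ s‖ₑ ≤ (ε : ℝ≥0∞) ^ (1 - r) * V := by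
    intro ε hε
    have huc : UniformContinuous θ := CompactSpace.uniformContinuous_of_continuous θ.continuous
    obtain ⟨δ, hδ, hδ'⟩ := Metric.uniformContinuous_iff.1 huc ε (by exact_mod_cast hε)
    obtain ⟨n, hn⟩ := exists_nat_gt ((t - s : ℝ) / δ)
    have hst' : (s : ℝ) ≤ t := hst
    have hn0 : (0 : ℝ) < n := lt_of_le_of_lt (div_nonneg (by linarith) hδ.le) hn
    have hlen : ((t : ℝ) - s) / n < δ := by
      rw [div_lt_iff₀ hδ] at hn
      rw [div_lt_iff₀ hn0]; linarith
    have hq0 : 0 ≤ ((t : ℝ) - s) / n := div_nonneg (by linarith) hn0.le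
    let u : ℕ → Icc (0 : ℝ) T := fun i => ⟨s + ((t : ℝ) - s) / n * (min i n : ℕ), by
      constructor
      · have := s.2.1
        positivity
      · have h1 : ((min i n : ℕ) : ℝ) ≤ n := by exact_mod_cast min_le_right i n
        have h2 : ((t : ℝ) - s) / n * (min i n : ℕ) ≤ ((t : ℝ) - s) / n * n := by gcongr
        rw [div_mul_cancel₀ _ hn0.ne'] at h2
        have := t.2.2
        linarith⟩
    have hu : Monotone u := by
      intro i j hij
      have : ((min i n : ℕ) : ℝ) ≤ (min j n : ℕ) := by
        exact_mod_cast min_le_min_right n hij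
      change (s : ℝ) + ((t : ℝ) - s) / n * (min i n : ℕ)
        ≤ s + ((t : ℝ) - s) / n * (min j n : ℕ)
      gcongr
    have hu0 : u 0 = s := Subtype.ext (by simp [u])
    have hun : u n = t := Subtype.ext (by simp [u, div_mul_cancel₀ _ hn0.ne'])
    have htel : θ t - θ s = ∑ i ∈ Finset.range n, (θ (u (i + 1)) - θ (u i)) := by
      rw [Finset.sum_range_sub (fun i => θ (u i)), hu0, hun]
    have hstep : ∀ i ∈ Finset.range n, ‖θ (u (i + 1)) - θ (u i)‖ₑ
        ≤ (ε : ℝ≥0∞) ^ (1 - r) * normIncr θ (u i) (u (i + 1)) ^ r := by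
      intro i hi
      have hi' : i + 1 ≤ n := Finset.mem_range.1 hi
      have hd : dist (u (i + 1)) (u i) < δ := by
        rw [Subtype.dist_eq, Real.dist_eq]
        have h1 : min (i + 1) n = i + 1 := min_eq_left hi'
        have h2 : min i n = i := min_eq_left (by omega)
        have : ((u (i + 1) : ℝ) - u i) = ((t : ℝ) - s) / n := by
          simp only [u, h1, h2]; push_cast; ring
        rw [this, abs_of_nonneg hq0]; exact hlen
      have h1 := hδ' hd
      have h2 : ‖θ (u (i + 1)) - θ (u i)‖ₑ ≤ ε := by
        rw [dist_eq_norm] at h1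
        rw [enorm_eq_nnnorm]
        exact_mod_cast h1.le
      calc ‖θ (u (i + 1)) - θ (u i)‖ₑ
          = ‖θ (u (i + 1)) - θ (u i)‖ₑ ^ (1 - r) * ‖θ (u (i + 1)) - θ (u i)‖ₑ ^ r := by
            rw [← ENNReal.rpow_add_of_nonneg _ _ (by linarith) hr0.le]; simp
        _ ≤ _ := by
            unfold normIncr
            gcongr
    calc ‖θ t - θ s‖ₑ ≤ ∑ i ∈ Finset.range n, ‖θ (u (i + 1)) - θ (u i)‖ₑ := by
          rw [htel]; exact enorm_sum_le _ _
      _ ≤ ∑ i ∈ Finset.range n, (ε : ℝ≥0∞) ^ (1 - r) * normIncr θ (u i) (u (i + 1)) ^ r :=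
          Finset.sum_le_sum hstep
      _ ≤ _ := by
          rw [← Finset.mul_sum]
          gcongr
          exact sum_le_of_pVar hr0 n hu
  have hlim : Tendsto (fun ε : ℝ≥0 => (ε : ℝ≥0∞) ^ (1 - r) * V) (𝓝[>] 0) (𝓝 0) := by
    have h1 : Tendsto (fun ε : ℝ≥0 => (ε : ℝ≥0∞) ^ (1 - r)) (𝓝[>] 0) (𝓝 0) := by
      have hc : Continuous (fun ε : ℝ≥0 => (ε : ℝ≥0∞) ^ (1 - r)) :=
        ENNReal.continuous_rpow_const.comp ENNReal.continuous_coe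
      have := (hc.tendsto 0).mono_left (nhdsWithin_le_nhds (s := Ioi 0))
      simpa [ENNReal.zero_rpow_of_pos (by linarith : 0 < 1 - r)] using this
    simpa using ENNReal.Tendsto.mul_const h1 (Or.inr hVtop)
  have h0 : ‖θ t - θ s‖ₑ ≤ 0 :=
    ge_of_tendsto hlim (eventually_nhdsWithin_of_forall fun ε hε => bound ε hε)
  have h1 : θ t - θ s = 0 := enorm_eq_zero.1 (le_antisymm h0 bot_le)
  exact (sub_eq_zero.1 h1).symm

theorem pVar_normIncr_add_le (hr : 0 < r) (θ η : C(Icc (0 : ℝ) T, F))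
    (hθ : pVar (normIncr θ) r ≠ ∞) (hη : pVar (normIncr η) r ≠ ∞) :
    pVar (normIncr (θ + η : C(Icc (0 : ℝ) T, F))) r
      ≤ pVar (normIncr θ) r + pVar (normIncr η) r := by
  rcases lt_or_ge r 1 with h1 | h1
  · have : ∀ s t, normIncr (θ + η : C(Icc (0 : ℝ) T, F)) s t ≤ 0 := by
      intro s t
      simp [normIncr, eq_of_pVar_lt_one hr h1 θ hθ s t, eq_of_pVar_lt_one hr h1 η hη s t]
    refine (pVar_mono hr this).trans ?_
    rw [pVar_zero hr]
    exact bot_le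
  · refine (pVar_mono hr fun s t => ?_).trans (pVar_add_le _ _ h1)
    simp only [normIncr, ContinuousMap.add_apply]
    rw [add_sub_add_comm]
    exact enorm_add_le _ _

variable [NormedSpace ℝ F]

theorem pVar_normIncr_smul_le (hr : 0 < r) (c : ℝ) (θ : C(Icc (0 : ℝ) T, F)) :
    pVar (normIncr (c • θ : C(Icc (0 : ℝ) T, F))) r ≤ ‖c‖ₑ * pVar (normIncr θ) r := by
  refine (pVar_mono hr fun s t => ?_).trans (pVar_const_mul_le _ hr _)
  simp only [normIncr, ContinuousMap.smul_apply]
  rw [← smul_sub, enorm_smul]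

variable (T r F) in
/-- Continuous paths `[0,T] → F` of finite `r`-variation, as a subspace of all continuous paths. -/
def varSubmodule [hr : Fact (0 < r)] : Submodule ℝ C(Icc (0 : ℝ) T, F) where
  carrier := {θ | pVar (normIncr θ) r ≠ ∞}
  zero_mem' := by
    have : normIncr ((0 : C(Icc (0 : ℝ) T, F)) : Icc (0 : ℝ) T → F) = fun _ _ => 0 := by
      funext s t; simp [normIncr]
    simp only [mem_ofPred_eq]
    rw [this, pVar_zero hr.out]; simp
  add_mem' {θ η} hθ hη :=
    ne_top_of_le_ne_top (ENNReal.add_ne_top.2 ⟨hθ, hη⟩) (pVar_normIncr_add_le hr.out θ η hθ hη)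
  smul_mem' c θ hθ :=
    ne_top_of_le_ne_top (ENNReal.mul_ne_top enorm_ne_top hθ) (pVar_normIncr_smul_le hr.out c θ)

variable (T r F) in
/-- The space `C^{r-var}([0,T]; F)`. -/
def VarPath [Fact (0 < r)] : Type _ := varSubmodule T r F

namespace VarPath

variable [hr : Fact (0 < r)]

instance : AddCommGroup (VarPath T r F) := inferInstanceAs (AddCommGroup (varSubmodule T r F))

instance : Module ℝ (VarPath T r F) := inferInstanceAs (Module ℝ (varSubmodule T r F))

/-- The underlying continuous path. -/
def toC (θ : VarPath T r F) : C(Icc (0 : ℝ) T, F) := θ.1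

/-- The `r`-variation seminorm. -/
def var (θ : VarPath T r F) : ℝ≥0∞ := pVar (normIncr θ.toC) r

theorem var_ne_top (θ : VarPath T r F) : θ.var ≠ ∞ := θ.2

/-- The norm `‖θ‖ = ‖θ‖_∞ + ‖θ‖_{r-var}` on `C^{r-var}([0,T]; F)`. -/
instance : NormedAddCommGroup (VarPath T r F) :=
  AddGroupNorm.toNormedAddCommGroup
    { toFun := fun θ => ‖θ.toC‖ + θ.var.toReal
      map_zero' := by
        have h1 : (0 : VarPath T r F).toC = 0 := rfl
        have h2 : (0 : VarPath T r F).var = 0 := by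
          unfold var
          rw [h1]
          have : normIncr ((0 : C(Icc (0 : ℝ) T, F)) : Icc (0 : ℝ) T → F) = fun _ _ => 0 := by
            funext s t; simp [normIncr]
          rw [this, pVar_zero hr.out]
        rw [h1, h2]; simp
      add_le' := fun θ η => by
        have h1 : ‖(θ + η).toC‖ ≤ ‖θ.toC‖ + ‖η.toC‖ := norm_add_le θ.toC η.toC
        have h2 : (θ + η).var.toReal ≤ θ.var.toReal + η.var.toReal := by
          rw [← ENNReal.toReal_add θ.var_ne_top η.var_ne_top]
          exact ENNReal.toReal_mono (ENNReal.add_ne_top.2 ⟨θ.var_ne_top, η.var_ne_top⟩)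
            (pVar_normIncr_add_le hr.out θ.toC η.toC θ.2 η.2)
        linarith
      neg' := fun θ => by
        have h1 : (-θ).toC = -θ.toC := rfl
        have h2 : (-θ).var = θ.var := by
          unfold var
          rw [h1]
          congr 1
          funext s t
          simp only [normIncr, ContinuousMap.neg_apply]
          rw [← neg_sub', enorm_neg]
        rw [h1, h2, norm_neg]
      eq_zero_of_map_eq_zero' := fun θ h => by
        have h1 : ‖θ.toC‖ = 0 :=
          le_antisymm (by linarith [ENNReal.toReal_nonneg (a := θ.var)]) (norm_nonneg _)
        exact Subtype.ext (norm_eq_zero.1 h1) }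

theorem norm_def (θ : VarPath T r F) : ‖θ‖ = ‖θ.toC‖ + θ.var.toReal := rfl

instance : NormedSpace ℝ (VarPath T r F) where
  norm_smul_le c θ := by
    rw [norm_def, norm_def, mul_add]
    have h1 : ‖(c • θ).toC‖ ≤ ‖c‖ * ‖θ.toC‖ := norm_smul_le c θ.toC
    have h2 : (c • θ).var.toReal ≤ ‖c‖ * θ.var.toReal := by
      have h3 := ENNReal.toReal_mono (ENNReal.mul_ne_top enorm_ne_top θ.var_ne_top)
        (pVar_normIncr_smul_le hr.out c θ.toC)
      rw [ENNReal.toReal_mul, toReal_enorm] at h3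
      exact h3
    linarith

end VarPath

end VarPath

/-! ### Besov spaces -/

section Besov

/-- The Euclidean space `ℝᵈ`. -/
abbrev Euc (d : ℕ) : Type := EuclideanSpace ℝ (Fin d)

/-- `ℝᵈ`-valued tempered distributions on `ℝᵈ`. -/
abbrev VecDistribution (d : ℕ) : Type := 𝓢(Euc d, ℝ) →L[ℝ] Euc d

variable {d : ℕ}

/-- A smooth radial cut-off: `1` on the unit ball and `0` outside the ball of radius `√2`. -/
def cutoff (ξ : Euc d) : ℂ := (Real.smoothTransition (2 - ‖ξ‖ ^ 2) : ℂ)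

/-- The symbols of the inhomogeneous Littlewood–Paley decomposition: `φ₀` is the cut-off and
`φₙ(ξ) = φ₀(2⁻ⁿ ξ) - φ₀(2⁻⁽ⁿ⁻¹⁾ ξ)` for `n ≥ 1`. -/
def dyadicSymbol : ℕ → Euc d → ℂ
  | 0 => cutoff
  | n + 1 => fun ξ => cutoff (((2 : ℝ) ^ (n + 1))⁻¹ • ξ) - cutoff (((2 : ℝ) ^ n)⁻¹ • ξ)

theorem contDiff_cutoff : ContDiff ℝ (⊤ : ℕ∞) (cutoff : Euc d → ℂ) :=
  Complex.ofRealCLM.contDiff.comp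
    (Real.smoothTransition.contDiff.comp (contDiff_const.sub (contDiff_norm_sq ℝ)))

theorem hasCompactSupport_cutoff : HasCompactSupport (cutoff : Euc d → ℂ) := by
  refine HasCompactSupport.of_support_subset_isCompact
    (isCompact_closedBall (0 : Euc d) 2) fun ξ hξ => ?_
  by_contra hnot
  simp only [mem_closedBall_zero_iff, not_le] at hnot
  refine hξ ?_
  simp only [cutoff, Complex.ofReal_eq_zero]
  exact Real.smoothTransition.zero_of_nonpos (by nlinarith)

theorem contDiff_dyadicSymbol (n : ℕ) : ContDiff ℝ (⊤ : ℕ∞) (dyadicSymbol n : Euc d → ℂ) := by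
  cases n with
  | zero => exact contDiff_cutoff
  | succ n =>
    exact (contDiff_cutoff.comp (contDiff_const_smul _)).sub
      (contDiff_cutoff.comp (contDiff_const_smul _))

theorem hasCompactSupport_dyadicSymbol (n : ℕ) :
    HasCompactSupport (dyadicSymbol n : Euc d → ℂ) := by
  cases n with
  | zero => exact hasCompactSupport_cutoff
  | succ n =>
    exact (hasCompactSupport_cutoff.comp_smul (by positivity)).sub
      (hasCompactSupport_cutoff.comp_smul (by positivity))

/-- The convolution kernel of the `n`-th Littlewood–Paley projector: the inverse Fourier transform
of `φₙ`. It is real, since `φₙ` is real and even. -/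
def dyadicKernel (n : ℕ) : 𝓢(Euc d, ℝ) :=
  SchwartzMap.postcompCLM (𝕜 := ℝ) Complex.reCLM
    (𝓕⁻ ((hasCompactSupport_dyadicSymbol n).toSchwartzMap (contDiff_dyadicSymbol n) :
      𝓢(Euc d, ℂ)) : 𝓢(Euc d, ℂ))

/-- The test function `y ↦ φ(x - y)`. -/
def reflectTranslate (φ : 𝓢(Euc d, ℝ)) (x : Euc d) : 𝓢(Euc d, ℝ) :=
  SchwartzMap.compSubConstCLM ℝ x
    (SchwartzMap.compCLMOfContinuousLinearEquiv ℝ (ContinuousLinearEquiv.neg ℝ) φ)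

/-- The `n`-th Littlewood–Paley block of `f`, i.e. the smooth function `f ⋆ Kₙ`. -/
def lpBlock (f : VecDistribution d) (n : ℕ) (x : Euc d) : Euc d :=
  f (reflectTranslate (dyadicKernel n) x)

/-- The `ℓ^q` norm of a sequence in `[0, ∞]`, for `0 < q ≤ ∞`. -/
def seqNorm (q : ℝ≥0∞) (a : ℕ → ℝ≥0∞) : ℝ≥0∞ :=
  if q = ∞ then ⨆ n, a n else (∑' n, a n ^ q.toReal) ^ (1 / q.toReal)

/-- The norm of the Besov space `B^s_{p,q}(ℝᵈ; ℝᵈ)`; a tempered distribution belongs to the space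
when it is finite. -/
def besovNorm (s p : ℝ) (q : ℝ≥0∞) (f : VecDistribution d) : ℝ≥0∞ :=
  seqNorm q fun n =>
    ENNReal.ofReal ((2 : ℝ) ^ ((n : ℝ) * s)) * eLpNorm (lpBlock f n) (ENNReal.ofReal p) volume

variable {T : ℝ}

/-- Increments `‖f_t - f_s‖` in `B^s_{p,q}`. -/
def besovIncr (σ p : ℝ) (q : ℝ≥0∞) (f : Icc (0 : ℝ) T → VecDistribution d)
    (s t : Icc (0 : ℝ) T) : ℝ≥0∞ :=
  besovNorm σ p q (f t - f s)

/-- The seminorm of `C^{r-var}([0,T]; B^s_{p,q})`. -/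
def besovVar (σ p : ℝ) (q : ℝ≥0∞) (r : ℝ) (f : Icc (0 : ℝ) T → VecDistribution d) : ℝ≥0∞ :=
  pVar (besovIncr σ p q f) r

/-- The norm of `L^∞(0,T; B^s_{p,q})`, for continuous `f`. -/
def besovSup (σ p : ℝ) (q : ℝ≥0∞) (f : Icc (0 : ℝ) T → VecDistribution d) : ℝ≥0∞ :=
  ⨆ t, besovNorm σ p q (f t)

/-- `f ∈ C^{r-var}([0,T]; B^s_{p,q})`. -/
structure MemVarBesov (σ p : ℝ) (q : ℝ≥0∞) (r : ℝ) (f : Icc (0 : ℝ) T → VecDistribution d) :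
    Prop where
  mem : ∀ t, besovNorm σ p q (f t) ≠ ∞
  isCVar : IsCVar (besovIncr σ p q f) r

end Besov

/-! ### Small ball estimates and occupation measures -/

section SBE

variable {d : ℕ}

/-- The operators `Δ₀F(r) = F(r) - F(r/2)`, `Δₖ₊₁F(r) = ΔₖF(r) - 2^{k+1} ΔₖF(r/2)`. -/
def diffOp : ℕ → (ℝ → ℝ) → ℝ → ℝ
  | 0, F, r => F r - F (r / 2)
  | k + 1, F, r => diffOp k F r - 2 ^ (k + 1) * diffOp k F (r / 2)

/-- The quantity `‖μ‖` of the class `SBE_q^{α,p}`: with `k = ⌈α + d - 1⌉` and `F(r) = μ(B̄(y, r))`,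
the norm of `r^{-α-d} ΔₖF(r)` in `L^q(dy; L^p(dr/r))`, for finite `p` and `q`. -/
def sbeNorm (α p q : ℝ) (μ : Measure (Euc d)) : ℝ≥0∞ :=
  (∫⁻ y : Euc d,
    ((∫⁻ r in Ioi (0 : ℝ),
        ‖r ^ (-α - d) * diffOp ⌈α + d - 1⌉₊ (fun ρ => μ.real (Metric.closedBall y ρ)) r‖ₑ ^ p
          / ENNReal.ofReal r) ^ (1 / p)) ^ q) ^ (1 / q)

variable {T : ℝ}

/-- The occupation measure `μ^ω_{s,t} = ∫_s^t δ_{ω_r} dr`. -/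
def occupation (ω : C(Icc (0 : ℝ) T, Euc d)) (s t : Icc (0 : ℝ) T) : Measure (Euc d) :=
  (((volume : Measure ℝ).comap (Subtype.val : Icc (0 : ℝ) T → ℝ)).restrict (Ioc s t)).map ω

/-- Increments of the path `t ↦ μ^ω_{0,t}` in `SBE_q^{α,p}`; for `s ≤ t` the difference
`μ^ω_{0,t} - μ^ω_{0,s}` is the measure `μ^ω_{s,t}`. -/
def sbeIncr (α p q : ℝ) (ω : C(Icc (0 : ℝ) T, Euc d)) (s t : Icc (0 : ℝ) T) : ℝ≥0∞ :=
  sbeNorm α p q (occupation ω s t)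

/-- The seminorm of `t ↦ μ^ω_{0,t}` in `C^{r-var}([0,T]; SBE_q^{α,p})`. -/
def sbeVar (α p q r : ℝ) (ω : C(Icc (0 : ℝ) T, Euc d)) : ℝ≥0∞ :=
  pVar (sbeIncr α p q ω) r

end SBE

/-! ### The nonlinear Young integral -/

section Young

variable {d : ℕ} {T : ℝ}

/-- The bounded continuous function `g` is the convolution `f ⋆ μ` of a tempered distribution and
a compactly supported finite measure: `⟨f ⋆ μ, φ⟩ = ∫ ⟨f, φ(· + y)⟩ μ(dy)`. -/
def IsConvolution (f : VecDistribution d) (μ : Measure (Euc d)) (g : Euc d →ᵇ Euc d) : Prop :=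
  ∀ φ : 𝓢(Euc d, ℝ),
    ∫ x, φ x • g x = ∫ y, f (SchwartzMap.compSubConstCLM ℝ (-y) φ) ∂μ

/-- A control on `{(s,t) : 0 ≤ s ≤ t ≤ T}`: nonnegative, continuous, superadditive and zero on the
diagonal. -/
structure IsControl (w : Icc (0 : ℝ) T → Icc (0 : ℝ) T → ℝ) : Prop where
  nonneg : ∀ s t, s ≤ t → 0 ≤ w s t
  diag : ∀ t, w t t = 0
  superadd : ∀ s u t, s ≤ u → u ≤ t → w s u + w u t ≤ w s t
  continuousOn : ContinuousOn (fun z : Icc (0 : ℝ) T × Icc (0 : ℝ) T => w z.1 z.2)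
    {z | z.1 ≤ z.2}

/-- `I` is the nonlinear Young integral `t ↦ ∫₀ᵗ f(s, θ_s - ω_s) ds`: the path that starts at `0`
and is sewn from the local descriptions
`χ_{st} = ∫_s^t f(s, θ_s - ω_r) dr = (f(s,·) ⋆ μ^ω_{s,t})(θ_s)`, i.e.
`|I_t - I_s - χ_{st}| ≤ ρ(s,t)^a σ(s,t)^b` for some controls `ρ`, `σ` and exponents `a + b > 1`. -/
def IsYoungIntegral (ω : C(Icc (0 : ℝ) T, Euc d)) (f : Icc (0 : ℝ) T → VecDistribution d)
    (θ I : C(Icc (0 : ℝ) T, Euc d)) : Prop :=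
  (∀ t : Icc (0 : ℝ) T, (t : ℝ) = 0 → I t = 0) ∧
  ∃ g : Icc (0 : ℝ) T → Icc (0 : ℝ) T → (Euc d →ᵇ Euc d),
    (∀ s t, s ≤ t → IsConvolution (f s) (occupation ω s t) (g s t)) ∧
    ∃ (ρ σ : Icc (0 : ℝ) T → Icc (0 : ℝ) T → ℝ) (a b : ℝ),
      IsControl ρ ∧ IsControl σ ∧ 0 < a ∧ 0 < b ∧ 1 < a + b ∧
      ∀ s t, s ≤ t → ‖I t - I s - g s t (θ s)‖ ≤ ρ s t ^ a * σ s t ^ b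

end Young

end SBEPaths

end

open SBEPaths

noncomputable section

namespace SBEPaths

/-! ### Sewing -/

section Sewing

variable {ι E : Type*} [LinearOrder ι] [NormedAddCommGroup E]

/-! The integral is sewn from the local descriptions `χ_{st} = (f_s ⋆ μ_{s,t})(θ_s)`, so everything
rests on one analytic estimate: if `f` lies in the Besov space and `μ` has finite `sbeNorm` and
support in a ball of radius `R`, then `f ⋆ μ` is bounded and `γ`-Hölder with norm at most a constant
times the product of the two norms, and so is its derivative when `γ ≤ γ₀ - 1`.

For that estimate, let `b_j` be the coefficients of `Δ_k F(r) = ∑ b_j F(r / 2^j)`. The layer cake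
formula turns the average over `μ` of `∑ b_j exp(-π |2^j v|²)`, dilated, into a weighted integral of
`Δ_k` of the ball masses. Averages of `μ` against such a kernel `A_n` at scale `2^{-n}` are
therefore of size `2^{-nα₁}` in `L^{q₁}` (`exists_sbe_average_bound`). The Fourier transform of the
combination does not vanish near infinity, because the slowest Gaussian has a nonzero coefficient.
Dividing by it gives a reproducing identity `K_n = A_n * H_n * K_n` for the Littlewood–Paley
kernels, with `H_n` a dilated Schwartz function (`exists_adapted_kernels`); the block of index zero
is handled by a bound on the mass of `μ`. Hence the `n`-th block of `f ⋆ μ` is a convolution of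
three factors, `H_n`, `A_n * μ` and the block of `f`. A trilinear Young inequality bounds it by
`2^{-nγ₀}`, each derivative costing `2^n` (`exists_block_estimates`), and the resulting lacunary
series is Hölder continuous.

For the sewing, `μ_{s,t}` is additive in time. The defect `χ_{st} - χ_{sr} - χ_{rt}` then involves
only the change of `f` and of `θ` over `[s,r]`, measured against `μ_{r,t}`, and it is bounded by
products of powers of controls whose exponents add up to more than one. The controls come from the
variation of each path up to time `t`, which is continuous in `t` when the path is
(`varUpTo_continuous`).

All three claims use the same abstract bounds `IsSewable`, with four fields: the evaluation of the
convolution along `θ`, the difference of the evaluations along `θ¹` and `θ²`, the derivative field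
applied to a direction, and the first-order Taylor remainder. Errors with vanishing sums along
uniform partitions (`IsNegligible`) do not affect the sewn path. This gives uniqueness, and it
identifies differences, sums and remainders of integrals with the paths sewn from the corresponding
fields. -/

/-- A nonnegative superadditive function on `{s ≤ t}`. -/
structure IsSuperadd (W : ι → ι → ℝ) : Prop where
  nonneg : ∀ s t, s ≤ t → 0 ≤ W s t
  superadd : ∀ s u t, s ≤ u → u ≤ t → W s u + W u t ≤ W s t

theorem IsSuperadd.diag {W : ι → ι → ℝ} (hW : IsSuperadd W) (t : ι) : W t t = 0 := by
  have h1 := hW.superadd t t t le_rfl le_rfl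
  have h2 := hW.nonneg t t le_rfl
  linarith

theorem IsSuperadd.mono {W : ι → ι → ℝ} (hW : IsSuperadd W) {s s' t' t : ι} (h1 : s ≤ s')
    (h2 : s' ≤ t') (h3 : t' ≤ t) : W s' t' ≤ W s t := by
  have h4 := hW.superadd s s' t h1 (h2.trans h3)
  have h5 := hW.superadd s' t' t h2 h3
  have h6 := hW.nonneg s s' h1
  have h7 := hW.nonneg t' t h3
  linarith

/-- The constant of the sewing estimate. -/
def sewConst (z : ℝ) : ℝ := 2 / (1 - 2 ^ (1 - z))

theorem sewConst_pos {z : ℝ} (hz : 1 < z) : 0 < sewConst z := by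
  have : (2 : ℝ) ^ (1 - z) < 1 := Real.rpow_lt_one_of_one_lt_of_neg (by norm_num) (by linarith)
  unfold sewConst
  exact div_pos two_pos (by linarith)

/-- This fixed-point equation closes the induction in `norm_sum_sub_le`: two halves of the control
contribute the factor `2 ^ (1 - z)`, two defects contribute the `2`. -/
theorem sewConst_eq {z : ℝ} (hz : 1 < z) :
    sewConst z * 2 ^ (1 - z) + 2 = sewConst z := by
  have : (2 : ℝ) ^ (1 - z) < 1 := Real.rpow_lt_one_of_one_lt_of_neg (by norm_num) (by linarith)
  unfold sewConst
  have h : (1 : ℝ) - 2 ^ (1 - z) ≠ 0 := by linarith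
  field_simp
  ring

/-- Strong induction on the number of intervals. The partition is cut around one interval so that
the blocks on either side carry at most half of the control each. Joining the two blocks and the
interval costs two defects, and since `z > 1` the halves contribute strictly less than the whole, so
the constant does not depend on the number of points. -/
theorem norm_sum_sub_le {z : ℝ} (hz : 1 < z) {χ : ι → ι → E} (hχ : ∀ t, χ t t = 0)
    {W : ι → ι → ℝ} (hW : IsSuperadd W)
    (h : ∀ s u t, s ≤ u → u ≤ t → ‖χ s t - χ s u - χ u t‖ ≤ W s t ^ z)
    {u : ℕ → ι} (hu : Monotone u) (n : ℕ) : ∀ a : ℕ,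
    ‖∑ i ∈ Finset.Ico a (a + n), χ (u i) (u (i + 1)) - χ (u a) (u (a + n))‖
      ≤ sewConst z * W (u a) (u (a + n)) ^ z := by
  induction n using Nat.strong_induction_on with
  | _ n ih =>
    intro a
    rcases Nat.eq_zero_or_pos n with rfl | hn
    · simp only [add_zero, Finset.Ico_self, Finset.sum_empty, hχ, sub_zero, norm_zero, hW.diag]
      rw [Real.zero_rpow (by linarith)]; simp
    set w := W (u a) (u (a + n)) with hw
    have hw0 : 0 ≤ w := hW.nonneg _ _ (hu (by omega))
    -- `j` is the last index below `n` whose initial block carries at most half. Either the next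
    -- block carries more than half, and superadditivity bounds what follows, or nothing follows.
    -- The single interval from `j` to `j + 1` may carry almost everything; no continuity of `W` is
    -- needed.
    obtain ⟨j, hj, h1, h2⟩ : ∃ j < n, W (u a) (u (a + j)) ≤ w / 2 ∧
        W (u (a + j + 1)) (u (a + n)) ≤ w / 2 := by
      classical
      let P : ℕ → Prop := fun j => W (u a) (u (a + j)) ≤ w / 2
      have hP0 : P 0 := by simp only [P, add_zero, hW.diag]; linarith
      refine ⟨Nat.findGreatest P (n - 1), ?_, Nat.findGreatest_spec (P := P) (Nat.zero_le _) hP0, ?_⟩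
      · have := Nat.findGreatest_le (P := P) (n - 1); omega
      · set j := Nat.findGreatest P (n - 1) with hj
        have hjn : j ≤ n - 1 := Nat.findGreatest_le (P := P) (n - 1)
        rcases hjn.lt_or_eq with hlt | heq
        · have hnP : ¬ P (j + 1) := Nat.findGreatest_is_greatest (lt_add_one j) (by omega)
          simp only [P, not_le] at hnP
          have := hW.superadd (u a) (u (a + j + 1)) (u (a + n)) (hu (by omega)) (hu (by omega))
          rw [← add_assoc] at hnP
          linarith
        · have : a + j + 1 = a + n := by omega
          rw [this, hW.diag]; linarith
    have hz0 : 0 ≤ z := by linarith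
    have e1 := ih j hj a
    have e2 := ih (n - (j + 1)) (by omega) (a + j + 1)
    have hidx : a + j + 1 + (n - (j + 1)) = a + n := by omega
    rw [hidx] at e2
    have d1 := h (u a) (u (a + j + 1)) (u (a + n)) (hu (by omega)) (hu (by omega))
    have d2 := h (u a) (u (a + j)) (u (a + j + 1)) (hu (by omega)) (hu (by omega))
    have d2' : W (u a) (u (a + j + 1)) ^ z ≤ w ^ z :=
      Real.rpow_le_rpow (hW.nonneg _ _ (hu (by omega)))
        (hW.mono le_rfl (hu (by omega)) (hu (by omega))) hz0
    have e1' : W (u a) (u (a + j)) ^ z ≤ (w / 2) ^ z :=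
      Real.rpow_le_rpow (hW.nonneg _ _ (hu (by omega))) h1 hz0
    have e2' : W (u (a + j + 1)) (u (a + n)) ^ z ≤ (w / 2) ^ z :=
      Real.rpow_le_rpow (hW.nonneg _ _ (hu (by omega))) h2 hz0
    have hsum : ∑ i ∈ Finset.Ico a (a + n), χ (u i) (u (i + 1))
        = ∑ i ∈ Finset.Ico a (a + j), χ (u i) (u (i + 1)) + χ (u (a + j)) (u (a + j + 1))
          + ∑ i ∈ Finset.Ico (a + j + 1) (a + n), χ (u i) (u (i + 1)) := by
      rw [← Finset.sum_Ico_consecutive _ (show a ≤ a + j + 1 by omega)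
        (show a + j + 1 ≤ a + n by omega), Finset.sum_Ico_succ_top (by omega)]
    set S1 := ∑ i ∈ Finset.Ico a (a + j), χ (u i) (u (i + 1))
    set S2 := ∑ i ∈ Finset.Ico (a + j + 1) (a + n), χ (u i) (u (i + 1))
    have hdec : ∑ i ∈ Finset.Ico a (a + n), χ (u i) (u (i + 1)) - χ (u a) (u (a + n))
        = (S1 - χ (u a) (u (a + j))) + (S2 - χ (u (a + j + 1)) (u (a + n)))
          - (χ (u a) (u (a + n)) - χ (u a) (u (a + j + 1)) - χ (u (a + j + 1)) (u (a + n)))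
          - (χ (u a) (u (a + j + 1)) - χ (u a) (u (a + j)) - χ (u (a + j)) (u (a + j + 1))) := by
      rw [hsum]; abel
    rw [hdec]
    have hK := sewConst_pos hz
    have hpow : 2 * (w / 2) ^ z = 2 ^ (1 - z) * w ^ z := by
      rw [Real.div_rpow hw0 (by norm_num), Real.rpow_sub (by norm_num), Real.rpow_one]
      ring
    calc _ ≤ sewConst z * (w / 2) ^ z + sewConst z * (w / 2) ^ z + w ^ z + w ^ z := by
          refine (norm_sub_le _ _).trans (add_le_add ((norm_sub_le _ _).trans
            (add_le_add ((norm_add_le _ _).trans (add_le_add ?_ ?_)) d1)) (d2.trans d2'))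
          · exact e1.trans (by gcongr)
          · exact e2.trans (by gcongr)
      _ = (sewConst z * 2 ^ (1 - z) + 2) * w ^ z := by linear_combination sewConst z * hpow
      _ = _ := by rw [sewConst_eq hz]

/-- The position of a point is the number of smaller points, so sums up to `t` are sums over a range
of that length. Past the last point the enumeration stays constant. -/
theorem exists_monotone_enum (P : Finset ι) (hP : P.Nonempty) :
    ∃ u : ℕ → ι, Monotone u ∧ ∀ t ∈ P, u (P.filter (· < t)).card = t := by
  have hc : 0 < P.card := hP.card_pos
  refine ⟨fun i => P.orderEmbOfFin rfl ⟨min i (P.card - 1), by omega⟩, fun i j hij => ?_,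
    fun t ht => ?_⟩
  · refine (P.orderEmbOfFin rfl).monotone ?_
    simp only [Fin.mk_le_mk]
    omega
  · have : t ∈ Set.range (P.orderEmbOfFin rfl) := by simpa using ht
    obtain ⟨k, rfl⟩ := this
    have hcard : (P.filter (· < P.orderEmbOfFin rfl k)).card = k := by
      have : P.filter (· < P.orderEmbOfFin rfl k)
          = (Finset.Iio k).map (P.orderEmbOfFin rfl).toEmbedding := by
        ext x
        simp only [Finset.mem_filter, Finset.mem_map, Finset.mem_Iio]
        constructor
        · rintro ⟨hx, hlt⟩
          have : x ∈ Set.range (P.orderEmbOfFin rfl) := by simpa using hx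
          obtain ⟨l, rfl⟩ := this
          exact ⟨l, (P.orderEmbOfFin rfl).lt_iff_lt.1 hlt, rfl⟩
        · rintro ⟨l, hl, rfl⟩
          exact ⟨Finset.orderEmbOfFin_mem _ _ _, (P.orderEmbOfFin rfl).lt_iff_lt.2 hl⟩
      rw [this, Finset.card_map, Fin.card_Iio]
    simp only [hcard]
    congr 1
    ext
    have := k.2
    simp only
    omega

/-- Convergence of Riemann sums is replaced by compactness. The sums over finite sets of times
satisfy the sewing bound uniformly, bounded sets of `E` are relatively compact, and the bound
survives any limit. -/
theorem exists_sewing [ProperSpace E] {z : ℝ} (hz : 1 < z) {χ : ι → ι → E} (hχ : ∀ t, χ t t = 0)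
    {W : ι → ι → ℝ} (hW : IsSuperadd W)
    (h : ∀ s u t, s ≤ u → u ≤ t → ‖χ s t - χ s u - χ u t‖ ≤ W s t ^ z)
    {t₀ : ι} (h₀ : ∀ t, t₀ ≤ t) :
    ∃ I : ι → E, I t₀ = 0 ∧
      ∀ s t, s ≤ t → ‖I t - I s - χ s t‖ ≤ sewConst z * W s t ^ z := by
  classical
  choose u hu hut using exists_monotone_enum (ι := ι)
  let J : Finset ι → ι → E := fun P t =>
    if hP : P.Nonempty then
      ∑ i ∈ Finset.range (P.filter (· < t)).card, χ (u P hP i) (u P hP (i + 1)) else 0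
  have hJ0 : ∀ P, J P t₀ = 0 := by
    intro P
    simp only [J]
    split_ifs with hP
    · have : P.filter (· < t₀) = ∅ := Finset.filter_eq_empty_iff.2 fun x _ => not_lt.2 (h₀ x)
      rw [this]; simp
    · rfl
  have hJ : ∀ P : Finset ι, ∀ s ∈ P, ∀ t ∈ P, s ≤ t →
      ‖J P t - J P s - χ s t‖ ≤ sewConst z * W s t ^ z := by
    intro P s hs t ht hst
    have hP : P.Nonempty := ⟨s, hs⟩
    have hcard : (P.filter (· < s)).card ≤ (P.filter (· < t)).card :=
      Finset.card_le_card fun x hx => by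
        simp only [Finset.mem_filter] at hx ⊢
        exact ⟨hx.1, hx.2.trans_le hst⟩
    have key := norm_sum_sub_le hz hχ hW h (hu P hP)
      ((P.filter (· < t)).card - (P.filter (· < s)).card) (P.filter (· < s)).card
    rw [Nat.add_sub_cancel' hcard, hut P hP s hs, hut P hP t ht,
      Finset.sum_Ico_eq_sub _ hcard] at key
    simpa only [J, dif_pos hP] using key
  -- One ultrafilter finer than refinement of finite sets selects limits at all times
  -- simultaneously, and every given time eventually belongs to the set.
  let 𝒰 : Ultrafilter (Finset ι) := Ultrafilter.of atTop
  have h𝒰 : (𝒰 : Filter (Finset ι)) ≤ atTop := Ultrafilter.of_le _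
  have hmem : ∀ t, ∀ᶠ P in (𝒰 : Filter (Finset ι)), t ∈ P := fun t =>
    h𝒰 ((eventually_ge_atTop {t}).mono fun P hP => hP (Finset.mem_singleton_self t))
  have hlim : ∀ t, ∃ x, Tendsto (fun P => J P t) 𝒰 (𝓝 x) := by
    intro t
    have hb : ∀ᶠ P in (𝒰 : Filter (Finset ι)),
        J P t ∈ Metric.closedBall (χ t₀ t) (sewConst z * W t₀ t ^ z) := by
      filter_upwards [hmem t, hmem t₀] with P h1 h2
      have := hJ P t₀ h2 t h1 (h₀ t)
      rw [hJ0, sub_zero] at this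
      rwa [mem_closedBall_iff_norm]
    obtain ⟨x, -, hx⟩ := (isCompact_closedBall (χ t₀ t)
      (sewConst z * W t₀ t ^ z)).ultrafilter_le_nhds (𝒰.map fun P => J P t) (by
        rw [le_principal_iff]; exact hb)
    exact ⟨x, hx⟩
  choose I hI using hlim
  refine ⟨I, ?_, fun s t hst => ?_⟩
  · refine tendsto_nhds_unique (hI t₀) ?_
    simp only [hJ0]; exact tendsto_const_nhds
  · refine le_of_tendsto (((hI t).sub (hI s)).sub_const (χ s t)).norm ?_
    filter_upwards [hmem s, hmem t] with P h1 h2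
    exact hJ P s h1 t h2 hst

/-- Sums of errors over partitions converging to zero pass the sewing estimate on. -/
theorem norm_incr_sub_le_of_tendsto {z : ℝ} (hz : 1 < z) {χ : ι → ι → E} (hχ : ∀ t, χ t t = 0)
    {W : ι → ι → ℝ} (hW : IsSuperadd W)
    (h : ∀ s u t, s ≤ u → u ≤ t → ‖χ s t - χ s u - χ u t‖ ≤ W s t ^ z)
    {I : ι → E} {e : ι → ι → ℝ} (hI : ∀ s t, s ≤ t → ‖I t - I s - χ s t‖ ≤ e s t)
    {s t : ι} {u : ℕ → ℕ → ι} (hu : ∀ n, Monotone (u n)) (hu0 : ∀ n, 0 < n → u n 0 = s)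
    (hun : ∀ n, 0 < n → u n n = t)
    (he : Tendsto (fun n => ∑ i ∈ Finset.range n, e (u n i) (u n (i + 1))) atTop (𝓝 0)) :
    ‖I t - I s - χ s t‖ ≤ sewConst z * W s t ^ z := by
  have key : ∀ n, 0 < n → ‖I t - I s - χ s t‖ ≤
      ∑ i ∈ Finset.range n, e (u n i) (u n (i + 1)) + sewConst z * W s t ^ z := by
    intro n hn
    have h1 := norm_sum_sub_le hz hχ hW h (hu n) n 0
    rw [zero_add, hu0 n hn, hun n hn, ← Finset.range_eq_Ico] at h1
    have h2 : I t - I s = ∑ i ∈ Finset.range n, (I (u n (i + 1)) - I (u n i)) := by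
      rw [Finset.sum_range_sub (fun i => I (u n i)), hu0 n hn, hun n hn]
    have h3 : I t - I s - χ s t
        = ∑ i ∈ Finset.range n, (I (u n (i + 1)) - I (u n i) - χ (u n i) (u n (i + 1)))
          + (∑ i ∈ Finset.range n, χ (u n i) (u n (i + 1)) - χ s t) := by
      rw [Finset.sum_sub_distrib, h2]; abel
    rw [h3]
    refine (norm_add_le _ _).trans (add_le_add ((norm_sum_le _ _).trans ?_) h1)
    exact Finset.sum_le_sum fun i _ => hI _ _ (hu n (Nat.le_succ i))
  have := he.add_const (sewConst z * W s t ^ z)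
  rw [zero_add] at this
  exact ge_of_tendsto this ((eventually_gt_atTop 0).mono key)

end Sewing

/-! ### Operations that preserve superadditivity -/

section SuperaddConstructions

variable {ι : Type*} [LinearOrder ι]

theorem IsSuperadd.add {V W : ι → ι → ℝ} (hV : IsSuperadd V) (hW : IsSuperadd W) :
    IsSuperadd fun s t => V s t + W s t where
  nonneg s t h := add_nonneg (hV.nonneg s t h) (hW.nonneg s t h)
  superadd s u t h1 h2 := by
    have := hV.superadd s u t h1 h2
    have := hW.superadd s u t h1 h2
    linarith

theorem IsSuperadd.const_mul {W : ι → ι → ℝ} (hW : IsSuperadd W) {c : ℝ} (hc : 0 ≤ c) :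
    IsSuperadd fun s t => c * W s t where
  nonneg s t h := mul_nonneg hc (hW.nonneg s t h)
  superadd s u t h1 h2 := by
    have := mul_le_mul_of_nonneg_left (hW.superadd s u t h1 h2) hc
    linarith

theorem isSuperadd_sub {V : ι → ℝ} (hV : Monotone V) : IsSuperadd fun s t => V t - V s where
  nonneg s t h := sub_nonneg.2 (hV h)
  superadd s u t _ _ := by linarith

/-- Two-term Hölder inequality. After normalising by the sums all quantities lie in `[0,1]`, so the
exponents may be lowered to `p/(p+q)` and `q/(p+q)`; the weighted arithmetic-geometric mean
inequality then sums to one. -/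
theorem rpow_mul_rpow_add_le {a₁ a₂ b₁ b₂ p q : ℝ} (ha₁ : 0 ≤ a₁) (ha₂ : 0 ≤ a₂) (hb₁ : 0 ≤ b₁)
    (hb₂ : 0 ≤ b₂) (hp : 0 < p) (hq : 0 < q) (hpq : 1 ≤ p + q) :
    a₁ ^ p * b₁ ^ q + a₂ ^ p * b₂ ^ q ≤ (a₁ + a₂) ^ p * (b₁ + b₂) ^ q := by
  rcases (add_nonneg ha₁ ha₂).eq_or_lt with ha | ha
  · have h1 : a₁ = 0 := by linarith
    have h2 : a₂ = 0 := by linarith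
    simp [h1, h2, Real.zero_rpow hp.ne']
  rcases (add_nonneg hb₁ hb₂).eq_or_lt with hb | hb
  · have h1 : b₁ = 0 := by linarith
    have h2 : b₂ = 0 := by linarith
    simp [h1, h2, Real.zero_rpow hq.ne']
  have main : ∀ x y : ℝ, 0 ≤ x → x ≤ 1 → 0 ≤ y → y ≤ 1 →
      x ^ p * y ^ q ≤ p / (p + q) * x + q / (p + q) * y := by
    intro x y hx hx1 hy hy1
    have hs : 0 < p + q := by linarith
    have h1 := Real.geom_mean_le_arith_mean2_weighted (w₁ := p / (p + q)) (w₂ := q / (p + q))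
      (by positivity) (by positivity) hx hy (by field_simp)
    refine le_trans (mul_le_mul ?_ ?_ (by positivity) (by positivity)) h1
    · exact Real.rpow_le_rpow_of_exponent_ge' hx hx1 (by positivity)
        (div_le_self hp.le hpq)
    · exact Real.rpow_le_rpow_of_exponent_ge' hy hy1 (by positivity)
        (div_le_self hq.le hpq)
  have h1 := main (a₁ / (a₁ + a₂)) (b₁ / (b₁ + b₂)) (by positivity)
    (div_le_one_of_le₀ (by linarith) ha.le) (by positivity)
    (div_le_one_of_le₀ (by linarith) hb.le)
  have h2 := main (a₂ / (a₁ + a₂)) (b₂ / (b₁ + b₂)) (by positivity)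
    (div_le_one_of_le₀ (by linarith) ha.le) (by positivity)
    (div_le_one_of_le₀ (by linarith) hb.le)
  rw [Real.div_rpow ha₁ ha.le, Real.div_rpow hb₁ hb.le] at h1
  rw [Real.div_rpow ha₂ ha.le, Real.div_rpow hb₂ hb.le] at h2
  have hA : 0 < (a₁ + a₂) ^ p := Real.rpow_pos_of_pos ha p
  have hB : 0 < (b₁ + b₂) ^ q := Real.rpow_pos_of_pos hb q
  have h3 : (a₁ ^ p * b₁ ^ q + a₂ ^ p * b₂ ^ q) / ((a₁ + a₂) ^ p * (b₁ + b₂) ^ q) ≤ 1 := by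
    calc _ = a₁ ^ p / (a₁ + a₂) ^ p * (b₁ ^ q / (b₁ + b₂) ^ q)
          + a₂ ^ p / (a₁ + a₂) ^ p * (b₂ ^ q / (b₁ + b₂) ^ q) := by field_simp
      _ ≤ _ := add_le_add h1 h2
      _ = 1 := by field_simp; ring
  rwa [div_le_one (mul_pos hA hB)] at h3

theorem IsSuperadd.rpow_mul_rpow {V W : ι → ι → ℝ} (hV : IsSuperadd V) (hW : IsSuperadd W)
    {p q : ℝ} (hp : 0 < p) (hq : 0 < q) (hpq : 1 ≤ p + q) :
    IsSuperadd fun s t => V s t ^ p * W s t ^ q where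
  nonneg s t h := mul_nonneg (Real.rpow_nonneg (hV.nonneg s t h) _)
    (Real.rpow_nonneg (hW.nonneg s t h) _)
  superadd s u t h1 h2 := by
    have hV1 := hV.nonneg s u h1
    have hV2 := hV.nonneg u t h2
    have hW1 := hW.nonneg s u h1
    have hW2 := hW.nonneg u t h2
    refine (rpow_mul_rpow_add_le hV1 hV2 hW1 hW2 hp hq hpq).trans ?_
    have hV3 := hV.superadd s u t h1 h2
    have hW3 := hW.superadd s u t h1 h2
    have hV4 := hV.nonneg s t (h1.trans h2)
    gcongr

end SuperaddConstructions

/-! ### Uniform partitions -/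

section Uniform

variable {T : ℝ}

/-- The points of the partition of `[s, t]` into `n` intervals of the same length. -/
def unifPart (s t : Icc (0 : ℝ) T) (hst : s ≤ t) (n i : ℕ) : Icc (0 : ℝ) T :=
  -- The minimum with `1` freezes the sequence at `t` after index `n`, so that it is monotone on all
  -- of `ℕ`.
  ⟨s + ((t : ℝ) - s) * (min ((i : ℝ) / n) 1), by
    have hst' : (s : ℝ) ≤ t := hst
    have h1 : 0 ≤ min ((i : ℝ) / n) 1 := le_min (by positivity) zero_le_one
    have h2 : min ((i : ℝ) / n) 1 ≤ 1 := min_le_right _ _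
    have := s.2.1
    have := t.2.2
    constructor <;> nlinarith⟩

theorem unifPart_mono (s t : Icc (0 : ℝ) T) (hst : s ≤ t) (n : ℕ) :
    Monotone (unifPart s t hst n) := by
  intro i j hij
  have hst' : (s : ℝ) ≤ t := hst
  change (s : ℝ) + ((t : ℝ) - s) * (min ((i : ℝ) / n) 1)
    ≤ s + ((t : ℝ) - s) * (min ((j : ℝ) / n) 1)
  have : (0 : ℝ) ≤ (t : ℝ) - s := by linarith
  gcongr

theorem unifPart_zero (s t : Icc (0 : ℝ) T) (hst : s ≤ t) (n : ℕ) :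
    unifPart s t hst n 0 = s := Subtype.ext (by simp [unifPart])

theorem unifPart_self (s t : Icc (0 : ℝ) T) (hst : s ≤ t) {n : ℕ} (hn : 0 < n) :
    unifPart s t hst n n = t := by
  refine Subtype.ext ?_
  have : (n : ℝ) ≠ 0 := by positivity
  simp [unifPart, div_self this]

theorem dist_unifPart_le (s t : Icc (0 : ℝ) T) (hst : s ≤ t) {n : ℕ} (hn : 0 < n) (i : ℕ) :
    dist (unifPart s t hst n i) (unifPart s t hst n (i + 1)) ≤ ((t : ℝ) - s) / n := by
  have hst' : (0 : ℝ) ≤ (t : ℝ) - s := sub_nonneg.2 hst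
  have hn' : (0 : ℝ) < n := by exact_mod_cast hn
  rw [dist_comm, Subtype.dist_eq, Real.dist_eq]
  simp only [unifPart]
  rw [add_sub_add_left_eq_sub, ← mul_sub, abs_mul, abs_of_nonneg hst', div_eq_mul_one_div ((t : ℝ) - s)]
  refine mul_le_mul_of_nonneg_left ?_ hst'
  refine (abs_min_sub_min_le_max _ _ _ _).trans ?_
  rw [sub_self, abs_zero, ← sub_div]
  simp

/-- Uniform continuity on the compact triangle `s ≤ t`, compared with the diagonal. -/
theorem IsControl.exists_small {w : Icc (0 : ℝ) T → Icc (0 : ℝ) T → ℝ} (hw : IsControl w)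
    {ε : ℝ} (hε : 0 < ε) : ∃ δ > 0, ∀ s t, s ≤ t → dist s t < δ → w s t < ε := by
  set D : Set (Icc (0 : ℝ) T × Icc (0 : ℝ) T) := {z | z.1 ≤ z.2}
  have hD : IsCompact D := (isClosed_le continuous_fst continuous_snd).isCompact
  have huc := hD.uniformContinuousOn_of_continuous hw.continuousOn
  obtain ⟨δ, hδ, h⟩ := Metric.uniformContinuousOn_iff.1 huc ε hε
  refine ⟨δ, hδ, fun s t hst hd => ?_⟩
  have := h (s, t) hst (s, s) (le_refl s) (by
    rw [Prod.dist_eq]; simpa [dist_comm t s] using hd)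
  simp only [hw.diag, dist_zero_right, Real.norm_eq_abs] at this
  exact (le_abs_self _).trans_lt this

theorem IsControl.isSuperadd {w : Icc (0 : ℝ) T → Icc (0 : ℝ) T → ℝ} (hw : IsControl w) :
    IsSuperadd w := ⟨hw.nonneg, hw.superadd⟩

theorem IsSuperadd.sum_le {ι : Type*} [LinearOrder ι] {W : ι → ι → ℝ} (hW : IsSuperadd W)
    {u : ℕ → ι} (hu : Monotone u) (n : ℕ) :
    ∑ i ∈ Finset.range n, W (u i) (u (i + 1)) ≤ W (u 0) (u n) := by
  induction n with
  | zero => simp [hW.diag]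
  | succ n ih =>
    rw [Finset.sum_range_succ]
    have := hW.superadd (u 0) (u n) (u (n + 1)) (hu (Nat.zero_le _)) (hu (Nat.le_succ _))
    linarith

/-- Powers larger than one of a control have vanishing sums along uniform partitions. -/
theorem IsControl.tendsto_sum_rpow {w : Icc (0 : ℝ) T → Icc (0 : ℝ) T → ℝ} (hw : IsControl w)
    {y : ℝ} (hy : 1 < y) {s t : Icc (0 : ℝ) T} (hst : s ≤ t) :
    Tendsto (fun n => ∑ i ∈ Finset.range n,
      w (unifPart s t hst n i) (unifPart s t hst n (i + 1)) ^ y) atTop (𝓝 0) := by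
  have hpos : 0 < y - 1 := by linarith
  have hw0 := hw.nonneg s t hst
  rw [Metric.tendsto_atTop]
  intro ε hε
  -- On a fine partition each term is `w ^ (y - 1) * w ≤ η ^ (y - 1) * w`, and superadditivity sums
  -- the last factors to at most `w s t`.
  obtain ⟨η, hη, hη'⟩ : ∃ η : ℝ, 0 < η ∧ η ^ (y - 1) * w s t < ε := by
    have hc : Tendsto (fun η : ℝ => η ^ (y - 1) * w s t) (𝓝[>] 0) (𝓝 0) := by
      have h1 := (Real.continuousAt_rpow_const (0 : ℝ) (y - 1) (Or.inr hpos.le)).tendsto.mono_left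
        (nhdsWithin_le_nhds (s := Ioi 0))
      rw [Real.zero_rpow hpos.ne'] at h1
      simpa using h1.mul_const (w s t)
    obtain ⟨η, h1, h2⟩ := ((hc.eventually (gt_mem_nhds hε)).and self_mem_nhdsWithin).exists
    exact ⟨η, h2, h1⟩
  obtain ⟨δ, hδ, hδ'⟩ := hw.exists_small hη
  obtain ⟨N, hN⟩ := exists_nat_gt (((t : ℝ) - s) / δ)
  have hst' : (0 : ℝ) ≤ (t : ℝ) - s := sub_nonneg.2 hst
  have hN0 : (0 : ℝ) < N := lt_of_le_of_lt (by positivity) hN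
  refine ⟨N, fun n hn => ?_⟩
  have hn0 : (0 : ℝ) < n := lt_of_lt_of_le hN0 (by exact_mod_cast hn)
  have hn1 : 0 < n := by exact_mod_cast hn0
  have hmesh : ((t : ℝ) - s) / n < δ := by
    rw [div_lt_iff₀ hδ] at hN
    rw [div_lt_iff₀ hn0]
    have : (N : ℝ) ≤ n := by exact_mod_cast hn
    nlinarith
  have hu := unifPart_mono s t hst n
  have hnn : ∀ i, 0 ≤ w (unifPart s t hst n i) (unifPart s t hst n (i + 1)) :=
    fun i => hw.nonneg _ _ (hu (Nat.le_succ i))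
  rw [Real.dist_eq, sub_zero, abs_of_nonneg (Finset.sum_nonneg fun i _ =>
    Real.rpow_nonneg (hnn i) _)]
  refine lt_of_le_of_lt ?_ hη'
  calc _ ≤ ∑ i ∈ Finset.range n, η ^ (y - 1) *
        w (unifPart s t hst n i) (unifPart s t hst n (i + 1)) := by
        refine Finset.sum_le_sum fun i _ => ?_
        have h1 := (hδ' _ _ (hu (Nat.le_succ i))
          ((dist_unifPart_le s t hst hn1 i).trans_lt hmesh)).le
        have h2 : y = (y - 1) + 1 := by ring
        conv_lhs => rw [h2, Real.rpow_add_one' (hnn i) (by linarith)]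
        have := Real.rpow_le_rpow (hnn i) h1 hpos.le
        have := hnn i
        gcongr
    _ ≤ _ := by
        rw [← Finset.mul_sum]
        have := hw.isSuperadd.sum_le hu n
        rw [unifPart_zero, unifPart_self _ _ _ hn1] at this
        gcongr

end Uniform

/-! ### The variation of a path as a continuous additive control -/

section VariationControl

variable {T : ℝ} {X : Type*} [PseudoMetricSpace X]

/-- The `r`-th power of the `r`-variation of `x` on `[0, t]`. -/
def varUpTo (x : Icc (0 : ℝ) T → X) (r : ℝ) (t : Icc (0 : ℝ) T) : ℝ :=
  sSup {σ | ∃ (n : ℕ) (u : ℕ → Icc (0 : ℝ) T), Monotone u ∧ (∀ i, u i ≤ t) ∧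
    σ = ∑ i ∈ Finset.range n, dist (x (u i)) (x (u (i + 1))) ^ r}

variable {x : Icc (0 : ℝ) T → X} {r K : ℝ}

/-- The bound `hK` is what makes the real supremum meaningful; for an unbounded set it would be the
default value zero. -/
theorem sum_le_varUpTo
    (hK : ∀ (n : ℕ) (u : ℕ → Icc (0 : ℝ) T), Monotone u →
      ∑ i ∈ Finset.range n, dist (x (u i)) (x (u (i + 1))) ^ r ≤ K)
    {t : Icc (0 : ℝ) T} (n : ℕ) {u : ℕ → Icc (0 : ℝ) T} (hu : Monotone u) (hut : ∀ i, u i ≤ t) :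
    ∑ i ∈ Finset.range n, dist (x (u i)) (x (u (i + 1))) ^ r ≤ varUpTo x r t := by
  refine le_csSup ⟨K, ?_⟩ ⟨n, u, hu, hut, rfl⟩
  rintro _ ⟨n, u, hu, -, rfl⟩
  exact hK n u hu

theorem varUpTo_le {t : Icc (0 : ℝ) T} {C : ℝ}
    (h : ∀ (n : ℕ) (u : ℕ → Icc (0 : ℝ) T), Monotone u → (∀ i, u i ≤ t) →
      ∑ i ∈ Finset.range n, dist (x (u i)) (x (u (i + 1))) ^ r ≤ C) : varUpTo x r t ≤ C := by
  refine csSup_le ⟨_, 0, fun _ => t, monotone_const, fun _ => le_rfl, rfl⟩ ?_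
  rintro _ ⟨n, u, hu, hut, rfl⟩
  exact h n u hu hut

theorem varUpTo_nonneg
    (hK : ∀ (n : ℕ) (u : ℕ → Icc (0 : ℝ) T), Monotone u →
      ∑ i ∈ Finset.range n, dist (x (u i)) (x (u (i + 1))) ^ r ≤ K) (t : Icc (0 : ℝ) T) :
    0 ≤ varUpTo x r t := by
  simpa using sum_le_varUpTo hK (t := t) 0 (u := fun _ => t) monotone_const (fun _ => le_rfl)

theorem varUpTo_add_le
    (hK : ∀ (n : ℕ) (u : ℕ → Icc (0 : ℝ) T), Monotone u →
      ∑ i ∈ Finset.range n, dist (x (u i)) (x (u (i + 1))) ^ r ≤ K)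
    {s t : Icc (0 : ℝ) T} (hst : s ≤ t) :
    varUpTo x r s + dist (x s) (x t) ^ r ≤ varUpTo x r t := by
  rw [← le_sub_iff_add_le]
  refine varUpTo_le fun n u hu hus => ?_
  rw [le_sub_iff_add_le]
  -- A partition of `[0,s]` is extended by the points `s` and `t`. The additional jump from its last
  -- point to `s` only helps.
  let v : ℕ → Icc (0 : ℝ) T := fun i => if i ≤ n then u i else if i = n + 1 then s else t
  have hv : Monotone v := by
    intro i j hij
    simp only [v]
    split_ifs
    all_goals first
      | omega
      | exact le_rfl
      | exact hu hij
      | exact hus _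
      | exact (hus _).trans hst
  have hvt : ∀ i, v i ≤ t := by
    intro i
    simp only [v]
    split_ifs
    exacts [(hus _).trans hst, hst, le_rfl]
  have key := sum_le_varUpTo hK (n + 2) hv hvt
  rw [Finset.sum_range_succ, Finset.sum_range_succ] at key
  have h1 : ∑ i ∈ Finset.range n, dist (x (v i)) (x (v (i + 1))) ^ r
      = ∑ i ∈ Finset.range n, dist (x (u i)) (x (u (i + 1))) ^ r := by
    refine Finset.sum_congr rfl fun i hi => ?_
    have := Finset.mem_range.1 hi
    simp only [v, if_pos (show i ≤ n by omega), if_pos (show i + 1 ≤ n by omega)]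
  have h2 : v (n + 1) = s := by simp [v]
  have h3 : v (n + 1 + 1) = t := by simp [v]
  rw [h1, h2, h3] at key
  have : 0 ≤ dist (x (v n)) (x s) ^ r := Real.rpow_nonneg dist_nonneg r
  linarith

theorem varUpTo_mono
    (hK : ∀ (n : ℕ) (u : ℕ → Icc (0 : ℝ) T), Monotone u →
      ∑ i ∈ Finset.range n, dist (x (u i)) (x (u (i + 1))) ^ r ≤ K) :
    Monotone (varUpTo x r) := fun s t hst => by
  have := varUpTo_add_le hK hst
  have : 0 ≤ dist (x s) (x t) ^ r := Real.rpow_nonneg dist_nonneg r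
  linarith

theorem sum_le_varUpTo_sub
    (hK : ∀ (n : ℕ) (u : ℕ → Icc (0 : ℝ) T), Monotone u →
      ∑ i ∈ Finset.range n, dist (x (u i)) (x (u (i + 1))) ^ r ≤ K)
    {u : ℕ → Icc (0 : ℝ) T} (hu : Monotone u) (n : ℕ) :
    ∑ i ∈ Finset.range n, dist (x (u i)) (x (u (i + 1))) ^ r
      ≤ varUpTo x r (u n) - varUpTo x r (u 0) := by
  rw [← Finset.sum_range_sub (fun i => varUpTo x r (u i))]
  refine Finset.sum_le_sum fun i _ => ?_
  have := varUpTo_add_le hK (hu (Nat.le_succ i))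
  simp only [Nat.succ_eq_add_one] at this
  linarith

/-- The variation does not jump to the right. -/
theorem exists_varUpTo_le_add (hr : 0 < r) (hx : Continuous x)
    (hK : ∀ (n : ℕ) (u : ℕ → Icc (0 : ℝ) T), Monotone u →
      ∑ i ∈ Finset.range n, dist (x (u i)) (x (u (i + 1))) ^ r ≤ K)
    {t : Icc (0 : ℝ) T} (ht : (Ioi t).Nonempty) {ε : ℝ} (hε : 0 < ε) :
    ∃ s, t < s ∧ varUpTo x r s ≤ varUpTo x r t + ε := by
  set V := varUpTo x r with hV
  have hVm : Monotone V := varUpTo_mono hK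
  have hbdd : BddBelow (V '' Ioi t) := ⟨0, by rintro _ ⟨s, -, rfl⟩; exact varUpTo_nonneg hK s⟩
  -- `m` is the right limit of the variation at `t`; the point is that it does not exceed the value
  -- at `t`.
  set m := sInf (V '' Ioi t) with hm
  have hm1 : ∀ s, t < s → m ≤ V s := fun s hs => csInf_le hbdd ⟨s, hs, rfl⟩
  suffices hmain : ∀ ε > 0, m ≤ V t + 2 * ε by
    have h1 : m ≤ V t := le_of_forall_pos_le_add fun ε hε => by
      have := hmain (ε / 2) (by positivity); linarith
    obtain ⟨_, ⟨s, hs, rfl⟩, h2⟩ := exists_lt_of_csInf_lt (ht.image V)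
      (show sInf (V '' Ioi t) < V t + ε by linarith)
    exact ⟨s, hs, h2.le⟩
  clear hε ε
  intro ε hε
  have hB : ∀ a b : Icc (0 : ℝ) T, dist (x a) (x b) ^ r ≤ K := by
    intro a b
    wlog hab : a ≤ b generalizing a b
    · rw [dist_comm]; exact this b a (le_of_not_ge hab)
    have := varUpTo_add_le hK hab
    have h0 := varUpTo_nonneg hK a
    have : varUpTo x r b ≤ K := varUpTo_le fun n u hu _ => hK n u hu
    linarith
  have hK0 : 0 ≤ K := by simpa using hK 0 (fun _ => t) monotone_const
  have hB' : ∀ a b : Icc (0 : ℝ) T, dist (x a) (x b) ∈ Icc 0 (K ^ r⁻¹) := fun a b =>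
    ⟨dist_nonneg, by
      rw [Real.le_rpow_inv_iff_of_pos dist_nonneg hK0 hr]; exact hB a b⟩
  -- For general `r > 0` the power is not Lipschitz on the half-line; uniform continuity on the
  -- bounded range of distances is enough.
  have huc : UniformContinuousOn (fun y : ℝ => y ^ r) (Icc 0 (K ^ r⁻¹)) :=
    isCompact_Icc.uniformContinuousOn_of_continuous
      (continuous_id.rpow_const fun _ => Or.inr hr.le).continuousOn
  obtain ⟨η, hη, hη'⟩ := Metric.uniformContinuousOn_iff.1 huc ε hε
  have hnear : ∀ᶠ v in 𝓝[>] t, ∀ w ∈ Ioc t v, dist (x t) (x w) < η := by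
    have h1 : ∀ᶠ w in 𝓝[>] t, dist (x t) (x w) < η := by
      have : Tendsto (fun w => dist (x t) (x w)) (𝓝 t) (𝓝 (dist (x t) (x t))) :=
        (continuous_const.dist hx).tendsto t
      rw [dist_self] at this
      exact (this.mono_left nhdsWithin_le_nhds).eventually (gt_mem_nhds hη)
    obtain ⟨b, hb⟩ := ht
    obtain ⟨c, hc, hc'⟩ := (mem_nhdsGT_iff_exists_Ioo_subset' hb).1 h1
    filter_upwards [Ioo_mem_nhdsGT hc] with v hv w hw
    exact hc' ⟨hw.1, hw.2.trans_lt hv.2⟩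
  obtain ⟨b, hb⟩ := ht
  have : (𝓝[>] t).NeBot := by
    refine mem_closure_iff_nhdsWithin_neBot.1 ?_
    rw [closure_Ioi' ⟨b, hb⟩]; exact self_mem_Ici
  obtain ⟨s, hs, hts⟩ := (hnear.and self_mem_nhdsWithin).exists
  have hts : t < s := hts
  -- A partition of `[0,s]` is cut at its first point beyond `t`. The increments after that point
  -- add up to at most `V s - m`. The increments before it, together with the crossing increment
  -- redirected to `t`, add up to at most `V t`, and the redirection costs at most `ε` because `x`
  -- is nearly constant just after `t`. Taking the supremum bounds `m`.
  have hclaim : V s ≤ V s + V t - m + 2 * ε := by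
    have h0 : V t ≤ V s := hVm hts.le
    have hms := hm1 s hts
    refine varUpTo_le fun n u hu hus => ?_
    by_cases hex : ∃ k, k ≤ n ∧ t < u k
    · classical
      set k := Nat.find hex with hk
      obtain ⟨hkn, hkt⟩ := Nat.find_spec hex
      rw [← hk] at hkn hkt
      have htail : ∑ i ∈ Finset.Ico k n, dist (x (u i)) (x (u (i + 1))) ^ r ≤ V s - m := by
        have := sum_le_varUpTo_sub hK (u := fun i => u (k + i)) (fun i j hij => hu (by omega)) (n - k)
        rw [Finset.sum_Ico_eq_sum_range]
        refine this.trans ?_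
        have h1 := hm1 _ hkt
        have h2 : V (u (k + (n - k))) ≤ V s := hVm (hus _)
        simp only [add_zero, ← hV]
        linarith
      rw [← Finset.sum_range_add_sum_Ico _ hkn]
      rcases Nat.eq_zero_or_pos k with hk0 | hkpos
      · have h5 : Finset.range k = ∅ := by rw [hk0, Finset.range_zero]
        rw [h5, Finset.sum_empty]
        have := varUpTo_nonneg hK t
        linarith
      · obtain ⟨j, hj⟩ : ∃ j, k = j + 1 := ⟨k - 1, by omega⟩
        have hjt : u j ≤ t := by
          have := Nat.find_min hex (show j < Nat.find hex by omega)
          push Not at this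
          exact this (by omega)
        rw [hj, Finset.sum_range_succ, ← hj]
        have h1 := sum_le_varUpTo_sub hK hu j
        have h2 := varUpTo_nonneg hK (u 0)
        have h3 := varUpTo_add_le hK hjt
        have h4 : dist (x (u j)) (x (u k)) ^ r < dist (x (u j)) (x t) ^ r + ε := by
          have h5 := hη' _ (hB' (u j) (u k)) _ (hB' (u j) t) (by
            rw [Real.dist_eq, dist_comm (x (u j)), dist_comm (x (u j))]
            refine (abs_dist_sub_le _ _ _).trans_lt ?_
            rw [dist_comm]
            exact hs _ ⟨hkt, hus _⟩)
          rw [Real.dist_eq] at h5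
          have := le_abs_self (dist (x (u j)) (x (u k)) ^ r - dist (x (u j)) (x t) ^ r)
          linarith
        linarith
    · push Not at hex
      have := sum_le_varUpTo_sub hK hu n
      have h1 := hVm (hex n le_rfl)
      have h2 := varUpTo_nonneg hK (u 0)
      linarith
  linarith

/-- From below, a nearly optimal partition truncated at `s` has a sum that is continuous in `s`.
From above, monotonicity handles earlier times and `exists_varUpTo_le_add` later ones. -/
theorem varUpTo_continuous (hr : 0 < r) (hx : Continuous x)
    (hK : ∀ (n : ℕ) (u : ℕ → Icc (0 : ℝ) T), Monotone u →
      ∑ i ∈ Finset.range n, dist (x (u i)) (x (u (i + 1))) ^ r ≤ K) :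
    Continuous (varUpTo x r) := by
  rw [continuous_iff_continuousAt]
  intro t
  rw [ContinuousAt, tendsto_order]
  constructor
  · intro c hc
    have hc' : c < varUpTo x r t := hc
    obtain ⟨_, ⟨n, u, hu, hut, rfl⟩, h⟩ := exists_lt_of_lt_csSup
      (by exact ⟨_, 0, fun _ => t, monotone_const, fun _ => le_rfl, rfl⟩) hc'
    have hF : Continuous fun s : Icc (0 : ℝ) T =>
        ∑ i ∈ Finset.range n, dist (x (min (u i) s)) (x (min (u (i + 1)) s)) ^ r := by
      refine continuous_finsetSum _ fun i _ => ?_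
      refine Continuous.rpow_const ?_ fun _ => Or.inr hr.le
      exact (hx.comp (continuous_const.min continuous_id)).dist
        (hx.comp (continuous_const.min continuous_id))
    have h' : c < ∑ i ∈ Finset.range n, dist (x (min (u i) t)) (x (min (u (i + 1)) t)) ^ r := by
      simpa only [min_eq_left (hut _)] using h
    filter_upwards [hF.continuousAt.eventually (lt_mem_nhds h')] with s hs
    exact lt_of_lt_of_le hs (sum_le_varUpTo hK n (fun i j hij => min_le_min_right s (hu hij))
      fun i => min_le_right _ _)
  · intro c hc
    by_cases ht : (Ioi t).Nonempty
    · obtain ⟨s, hs, h⟩ := exists_varUpTo_le_add hr hx hK ht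
        (show 0 < (c - varUpTo x r t) / 2 by linarith)
      filter_upwards [gt_mem_nhds hs] with v hv
      have := varUpTo_mono hK hv.le
      linarith
    · filter_upwards with v
      have : v ≤ t := by
        by_contra hv
        exact ht ⟨v, not_le.1 hv⟩
      exact (varUpTo_mono hK this).trans_lt hc

/-- The interval `[0, T]`, to be metrized by the increments of a path. -/
structure TimePoint (T : ℝ) where
  /-- The underlying time. -/
  time : Icc (0 : ℝ) T

/-- A continuous path of finite `r`-variation is controlled by the increments of a continuous
monotone function. -/
theorem exists_control_of_isCVar {d : Icc (0 : ℝ) T → Icc (0 : ℝ) T → ℝ≥0∞} (hr : 0 < r)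
    (hd : IsCVar d r) (h₁ : ∀ s u t, s ≤ u → u ≤ t → d s t ≤ d s u + d u t)
    (h₂ : ∀ s u t, s ≤ u → u ≤ t → d s u ≤ d s t + d u t)
    (h₃ : ∀ s u t, s ≤ u → u ≤ t → d u t ≤ d s t + d s u) :
    ∃ V : Icc (0 : ℝ) T → ℝ, Monotone V ∧ Continuous V ∧
      (∀ s t, s ≤ t → (d s t).toReal ^ r ≤ V t - V s) ∧
      ∀ s t, V t - V s ≤ (pVar d r).toReal ^ r := by
  have hfin : ∀ s t, s ≤ t → d s t ≠ ∞ := by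
    intro s t hst htop
    have := sum_le_of_pVar (d := d) hr 1 (u := fun i => if i = 0 then s else t) (by
      intro i j hij
      simp only
      split_ifs <;> first | omega | exact hst | exact le_rfl)
    simp only [Finset.sum_range_one, if_true, if_neg one_ne_zero, zero_add, htop,
      ENNReal.top_rpow_of_pos hr, top_le_iff] at this
    exact ENNReal.rpow_ne_top_of_nonneg hr.le hd.finite this
  have hdiag : ∀ t, d t t = 0 := by
    intro t
    refine le_antisymm (ENNReal.le_of_forall_pos_le_add fun ε hε _ => ?_) bot_le
    have := (hd.continuous t).eventually (ge_mem_nhds (show (0 : ℝ≥0∞) < ε by exact_mod_cast hε))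
    simpa using this.self_of_nhds
  let D : Icc (0 : ℝ) T → Icc (0 : ℝ) T → ℝ := fun s t => (d (min s t) (max s t)).toReal
  have hD : ∀ s t, s ≤ t → D s t = (d s t).toReal := fun s t h => by
    simp [D, min_eq_left h, max_eq_right h]
  have hDc : ∀ s t, D s t = D t s := fun s t => by simp only [D, min_comm, max_comm]
  have e₁ : ∀ s u t, s ≤ u → u ≤ t → D s t ≤ D s u + D u t := fun s u t a b => by
    rw [hD _ _ a, hD _ _ b, hD _ _ (a.trans b), ← ENNReal.toReal_add (hfin _ _ a) (hfin _ _ b)]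
    exact ENNReal.toReal_mono (ENNReal.add_ne_top.2 ⟨hfin _ _ a, hfin _ _ b⟩) (h₁ s u t a b)
  have e₂ : ∀ s u t, s ≤ u → u ≤ t → D s u ≤ D s t + D u t := fun s u t a b => by
    rw [hD _ _ a, hD _ _ b, hD _ _ (a.trans b),
      ← ENNReal.toReal_add (hfin _ _ (a.trans b)) (hfin _ _ b)]
    exact ENNReal.toReal_mono (ENNReal.add_ne_top.2 ⟨hfin _ _ (a.trans b), hfin _ _ b⟩)
      (h₂ s u t a b)
  have e₃ : ∀ s u t, s ≤ u → u ≤ t → D u t ≤ D s t + D s u := fun s u t a b => by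
    rw [hD _ _ a, hD _ _ b, hD _ _ (a.trans b),
      ← ENNReal.toReal_add (hfin _ _ (a.trans b)) (hfin _ _ a)]
    exact ENNReal.toReal_mono (ENNReal.add_ne_top.2 ⟨hfin _ _ (a.trans b), hfin _ _ a⟩)
      (h₃ s u t a b)
  -- The three hypotheses are the triangle inequality for the three possible positions of the
  -- intermediate point relative to an ordered pair.
  have htri : ∀ s u t, D s t ≤ D s u + D u t := by
    intro s u t
    wlog hst : s ≤ t generalizing s t
    · rw [hDc s t, hDc s u, hDc u t, add_comm]
      exact this t s (le_of_not_ge hst)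
    rcases le_total u s with h | h
    · have := e₃ u s t h hst
      rw [hDc s u]; linarith
    · rcases le_total u t with h' | h'
      · exact e₁ s u t h h'
      · have := e₂ s t u hst h'
        rw [hDc u t]; linarith
  -- The increments themselves metrize time, and the path becomes the identity map. The wrapper
  -- keeps this metric apart from the usual one on the interval.
  let _ : PseudoMetricSpace (TimePoint T) :=
    { dist := fun a b => D a.time b.time
      dist_self := fun a => by
        rw [hD _ _ le_rfl, hdiag]; simp
      dist_comm := fun a b => hDc a.time b.time
      dist_triangle := fun a b c => htri a.time b.time c.1 }
  let x : Icc (0 : ℝ) T → TimePoint T := TimePoint.mk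
  have hdist : ∀ s t, dist (x s) (x t) = D s t := fun _ _ => rfl
  have hx : Continuous x := by
    rw [continuous_iff_continuousAt]
    intro t
    rw [ContinuousAt, tendsto_iff_dist_tendsto_zero]
    have := (ENNReal.tendsto_toReal ENNReal.zero_ne_top).comp (hd.continuous t)
    simpa [Function.comp_def, hdist, D] using this
  have hK : ∀ (n : ℕ) (u : ℕ → Icc (0 : ℝ) T), Monotone u →
      ∑ i ∈ Finset.range n, dist (x (u i)) (x (u (i + 1))) ^ r ≤ (pVar d r).toReal ^ r := by
    intro n u hu
    have h1 := ENNReal.toReal_mono (ENNReal.rpow_ne_top_of_nonneg hr.le hd.finite)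
      (sum_le_of_pVar (d := d) hr n hu)
    rw [ENNReal.toReal_sum fun i _ => ENNReal.rpow_ne_top_of_nonneg hr.le
      (hfin _ _ (hu (Nat.le_succ i))), ← ENNReal.toReal_rpow] at h1
    refine le_trans (le_of_eq (Finset.sum_congr rfl fun i _ => ?_)) h1
    rw [hdist, hD _ _ (hu (Nat.le_succ i)), ENNReal.toReal_rpow]
  refine ⟨varUpTo x r, varUpTo_mono hK, varUpTo_continuous hr hx hK, fun s t hst => ?_,
    fun s t => ?_⟩
  · have := varUpTo_add_le hK hst
    rw [hdist, hD _ _ hst] at this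
    linarith
  · have h1 : varUpTo x r t ≤ _ := varUpTo_le fun n u hu _ => hK n u hu
    have := varUpTo_nonneg hK s
    linarith

end VariationControl

/-! ### Young-type sewing with several controls -/

section YoungSewing

variable {T : ℝ} {κ : Type*} [Fintype κ]

/-- The control `∑ⱼ Aⱼ^{1/z} V(s,t)^{a/z} Vⱼ(s,t)^{bⱼ/z}` whose `z`-th power dominates
`V(s,t)^a ∑ⱼ Aⱼ Vⱼ(s,t)^{bⱼ}`. -/
def youngControl (V : Icc (0 : ℝ) T → ℝ) (a : ℝ) (A : κ → ℝ) (U : κ → Icc (0 : ℝ) T → ℝ)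
    (b : κ → ℝ) (z : ℝ) (s t : Icc (0 : ℝ) T) : ℝ :=
  ∑ j, A j ^ z⁻¹ * ((V t - V s) ^ (a / z) * (U j t - U j s) ^ (b j / z))

variable {V : Icc (0 : ℝ) T → ℝ} {a : ℝ} {A : κ → ℝ} {U : κ → Icc (0 : ℝ) T → ℝ}
  {b : κ → ℝ} {z : ℝ}

theorem isControl_of_isSuperadd {W : Icc (0 : ℝ) T → Icc (0 : ℝ) T → ℝ} (hW : IsSuperadd W)
    (hc : Continuous fun p : Icc (0 : ℝ) T × Icc (0 : ℝ) T => W p.1 p.2) : IsControl W :=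
  ⟨hW.nonneg, hW.diag, hW.superadd, hc.continuousOn⟩

/-- The condition `z ≤ a + b j` says that the exponents `a / z` and `b j / z` add up to at least
one, which is what a product of powers of superadditive functions needs to be superadditive. -/
theorem isControl_youngControl (hV : Monotone V) (hVc : Continuous V) (ha : 0 < a)
    (hA : ∀ j, 0 ≤ A j) (hU : ∀ j, Monotone (U j)) (hUc : ∀ j, Continuous (U j))
    (hb : ∀ j, 0 < b j) (hz : 1 < z) (hzb : ∀ j, z ≤ a + b j) :
    IsControl (youngControl V a A U b z) := by
  have hz0 : 0 < z := by linarith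
  have hterm : ∀ j, IsSuperadd fun s t =>
      A j ^ z⁻¹ * ((V t - V s) ^ (a / z) * (U j t - U j s) ^ (b j / z)) := fun j =>
    ((isSuperadd_sub hV).rpow_mul_rpow (isSuperadd_sub (hU j)) (by positivity)
      (div_pos (hb j) hz0) (by rw [← add_div, one_le_div hz0]; exact hzb j)).const_mul
      (Real.rpow_nonneg (hA j) _)
  refine isControl_of_isSuperadd ⟨fun s t h => ?_, fun s u t h1 h2 => ?_⟩ ?_
  · exact Finset.sum_nonneg fun j _ => (hterm j).nonneg s t h
  · unfold youngControl
    rw [← Finset.sum_add_distrib]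
    exact Finset.sum_le_sum fun j _ => (hterm j).superadd s u t h1 h2
  · unfold youngControl
    refine continuous_finsetSum _ fun j _ => continuous_const.mul (Continuous.mul ?_ ?_)
    · exact Continuous.rpow_const ((hVc.comp continuous_snd).sub (hVc.comp continuous_fst))
        fun _ => Or.inr (by positivity)
    · exact Continuous.rpow_const (((hUc j).comp continuous_snd).sub ((hUc j).comp continuous_fst))
        fun _ => Or.inr (div_pos (hb j) hz0).le

omit [Fintype κ] in
theorem youngControl_term_rpow (hV : Monotone V) (hA : ∀ j, 0 ≤ A j) (hU : ∀ j, Monotone (U j))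
    (hz : 1 < z) {s t : Icc (0 : ℝ) T} (hst : s ≤ t) (j : κ) :
    (A j ^ z⁻¹ * ((V t - V s) ^ (a / z) * (U j t - U j s) ^ (b j / z))) ^ z
      = (V t - V s) ^ a * (A j * (U j t - U j s) ^ b j) := by
  have hz0 : z ≠ 0 := by linarith
  have h1 : 0 ≤ V t - V s := sub_nonneg.2 (hV hst)
  have h2 : 0 ≤ U j t - U j s := sub_nonneg.2 (hU j hst)
  have h3 := hA j
  rw [Real.mul_rpow (by positivity) (by positivity), Real.mul_rpow (by positivity) (by positivity),
    ← Real.rpow_mul h3, ← Real.rpow_mul h1, ← Real.rpow_mul h2, inv_mul_cancel₀ hz0,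
    Real.rpow_one, div_mul_cancel₀ _ hz0, div_mul_cancel₀ _ hz0]
  ring

/-- Powers `z ≥ 1` are superadditive on nonnegative numbers. This lets a sum of products of controls
enter the sewing lemma, which accepts a power of one control only. -/
theorem sum_le_youngControl_rpow (hV : Monotone V) (hA : ∀ j, 0 ≤ A j)
    (hU : ∀ j, Monotone (U j)) (hz : 1 < z) {s t : Icc (0 : ℝ) T} (hst : s ≤ t) :
    (V t - V s) ^ a * ∑ j, A j * (U j t - U j s) ^ b j ≤ youngControl V a A U b z s t ^ z := by
  have h1 : 0 ≤ V t - V s := sub_nonneg.2 (hV hst)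
  set y : κ → ℝ := fun j => A j ^ z⁻¹ * ((V t - V s) ^ (a / z) * (U j t - U j s) ^ (b j / z))
    with hy
  have hy0 : ∀ j, 0 ≤ y j := fun j => by
    have h2 : 0 ≤ U j t - U j s := sub_nonneg.2 (hU j hst)
    have h3 := hA j
    positivity
  have hY : youngControl V a A U b z s t = ∑ j, y j := rfl
  have hY0 : 0 ≤ ∑ j, y j := Finset.sum_nonneg fun j _ => hy0 j
  rw [hY, Finset.mul_sum]
  calc _ = ∑ j, y j ^ z := Finset.sum_congr rfl fun j _ =>
        (youngControl_term_rpow hV hA hU hz hst j).symm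
    _ ≤ ∑ j, (∑ j, y j) ^ (z - 1) * y j := by
        refine Finset.sum_le_sum fun j _ => ?_
        have hsplit : z = (z - 1) + 1 := by ring
        conv_lhs => rw [hsplit, Real.rpow_add_one' (hy0 j) (by linarith)]
        have h4 := hy0 j
        have h5 : y j ≤ ∑ j, y j := Finset.single_le_sum (fun i _ => hy0 i) (Finset.mem_univ j)
        have h6 : 0 ≤ z - 1 := by linarith
        gcongr
    _ = _ := by
        rw [← Finset.mul_sum]
        have hsplit : z = (z - 1) + 1 := by ring
        conv_rhs => rw [hsplit, Real.rpow_add_one' hY0 (by linarith)]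

/-- The power mean inequality translates the sewing bound back, at the price of a power of the
number of controls. -/
theorem youngControl_rpow_le (hV : Monotone V) (hA : ∀ j, 0 ≤ A j)
    (hU : ∀ j, Monotone (U j)) (hz : 1 < z) {s t : Icc (0 : ℝ) T} (hst : s ≤ t) :
    youngControl V a A U b z s t ^ z
      ≤ (Fintype.card κ : ℝ) ^ (z - 1) * ((V t - V s) ^ a * ∑ j, A j * (U j t - U j s) ^ b j) := by
  have h1 : 0 ≤ V t - V s := sub_nonneg.2 (hV hst)
  unfold youngControl
  refine (Real.rpow_sum_le_const_mul_sum_rpow_of_nonneg Finset.univ hz.le fun j _ => ?_).trans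
    (le_of_eq ?_)
  · have h2 : 0 ≤ U j t - U j s := sub_nonneg.2 (hU j hst)
    have h3 := hA j
    positivity
  · rw [Finset.card_univ]
    congr 1
    rw [Finset.mul_sum]
    exact Finset.sum_congr rfl fun j _ => youngControl_term_rpow hV hA hU hz hst j

/-- Errors whose sums over uniform partitions vanish. -/
def IsNegligible (e : Icc (0 : ℝ) T → Icc (0 : ℝ) T → ℝ) : Prop :=
  ∀ s t (hst : s ≤ t), Tendsto (fun n => ∑ i ∈ Finset.range n,
    e (unifPart s t hst n i) (unifPart s t hst n (i + 1))) atTop (𝓝 0)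

theorem IsNegligible.add {e e' : Icc (0 : ℝ) T → Icc (0 : ℝ) T → ℝ} (h : IsNegligible e)
    (h' : IsNegligible e') : IsNegligible fun s t => e s t + e' s t := fun s t hst => by
  simpa [Finset.sum_add_distrib] using (h s t hst).add (h' s t hst)

theorem IsNegligible.const_mul {e : Icc (0 : ℝ) T → Icc (0 : ℝ) T → ℝ} (h : IsNegligible e)
    (c : ℝ) : IsNegligible fun s t => c * e s t := fun s t hst => by
  simpa [← Finset.mul_sum] using (h s t hst).const_mul c

theorem IsNegligible.mono {e e' : Icc (0 : ℝ) T → Icc (0 : ℝ) T → ℝ} (h : IsNegligible e)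
    (h0 : ∀ s t, s ≤ t → 0 ≤ e' s t) (hle : ∀ s t, s ≤ t → e' s t ≤ e s t) :
    IsNegligible e' := fun s t hst => by
  have hu := fun n => unifPart_mono s t hst n
  exact squeeze_zero (fun n => Finset.sum_nonneg fun i _ => h0 _ _ (hu n (Nat.le_succ i)))
    (fun n => Finset.sum_le_sum fun i _ => hle _ _ (hu n (Nat.le_succ i))) (h s t hst)

theorem IsControl.isNegligible_rpow {w : Icc (0 : ℝ) T → Icc (0 : ℝ) T → ℝ} (hw : IsControl w)
    {y : ℝ} (hy : 1 < y) : IsNegligible fun s t => w s t ^ y := fun _ _ hst =>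
  hw.tendsto_sum_rpow hy hst

/-- The product is at most `(ρ + σ) ^ (a + b)`. Errors of this form are exactly those that
`IsYoungIntegral` admits, so uniqueness of the integral holds against every choice of controls and
exponents. -/
theorem IsControl.isNegligible_rpow_mul_rpow {ρ σ : Icc (0 : ℝ) T → Icc (0 : ℝ) T → ℝ}
    (hρ : IsControl ρ) (hσ : IsControl σ) {a b : ℝ} (ha : 0 < a) (hb : 0 < b) (hab : 1 < a + b) :
    IsNegligible fun s t => ρ s t ^ a * σ s t ^ b := by
  have hc : IsControl fun s t => ρ s t + σ s t :=
    ⟨(hρ.isSuperadd.add hσ.isSuperadd).nonneg, fun t => by simp [hρ.diag, hσ.diag],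
      (hρ.isSuperadd.add hσ.isSuperadd).superadd, hρ.continuousOn.add hσ.continuousOn⟩
  refine (hc.isNegligible_rpow hab).mono (fun s t h => ?_) fun s t h => ?_
  · exact mul_nonneg (Real.rpow_nonneg (hρ.nonneg s t h) _) (Real.rpow_nonneg (hσ.nonneg s t h) _)
  · have h1 := hρ.nonneg s t h
    have h2 := hσ.nonneg s t h
    rw [Real.rpow_add' (by positivity) (by linarith)]
    gcongr <;> linarith

variable {E : Type*} [NormedAddCommGroup E] {χ : Icc (0 : ℝ) T → Icc (0 : ℝ) T → E}

/-- A path close to `χ` with a negligible error satisfies the sewing bound. -/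
theorem norm_incr_sub_le_young (hχ : ∀ t, χ t t = 0) (hV : Monotone V) (hVc : Continuous V)
    (ha : 0 < a) (hA : ∀ j, 0 ≤ A j) (hU : ∀ j, Monotone (U j)) (hUc : ∀ j, Continuous (U j))
    (hb : ∀ j, 0 < b j) (hz : 1 < z) (hzb : ∀ j, z ≤ a + b j)
    (hδ : ∀ s u t, s ≤ u → u ≤ t → ‖χ s t - χ s u - χ u t‖
      ≤ (V t - V s) ^ a * ∑ j, A j * (U j t - U j s) ^ b j)
    {I : Icc (0 : ℝ) T → E} {e : Icc (0 : ℝ) T → Icc (0 : ℝ) T → ℝ} (he : IsNegligible e)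
    (hI : ∀ s t, s ≤ t → ‖I t - I s - χ s t‖ ≤ e s t) {s t : Icc (0 : ℝ) T} (hst : s ≤ t) :
    ‖I t - I s - χ s t‖ ≤ sewConst z * ((Fintype.card κ : ℝ) ^ (z - 1) *
      ((V t - V s) ^ a * ∑ j, A j * (U j t - U j s) ^ b j)) := by
  have hW := isControl_youngControl hV hVc ha hA hU hUc hb hz hzb
  refine (norm_incr_sub_le_of_tendsto hz hχ hW.isSuperadd (fun s u t h1 h2 =>
    (hδ s u t h1 h2).trans (sum_le_youngControl_rpow hV hA hU hz (h1.trans h2))) hI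
    (fun n => unifPart_mono s t hst n) (fun n _ => unifPart_zero s t hst n)
    (fun n hn => unifPart_self s t hst hn) (he s t hst)).trans ?_
  have := sewConst_pos hz
  gcongr
  exact youngControl_rpow_le hV hA hU hz hst

/-- Sewing with several controls: existence. -/
theorem exists_young_sewing [ProperSpace E] (hχ : ∀ t, χ t t = 0) (hV : Monotone V)
    (hVc : Continuous V)
    (ha : 0 < a) (hA : ∀ j, 0 ≤ A j) (hU : ∀ j, Monotone (U j)) (hUc : ∀ j, Continuous (U j))
    (hb : ∀ j, 0 < b j) (hz : 1 < z) (hzb : ∀ j, z ≤ a + b j)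
    (hδ : ∀ s u t, s ≤ u → u ≤ t → ‖χ s t - χ s u - χ u t‖
      ≤ (V t - V s) ^ a * ∑ j, A j * (U j t - U j s) ^ b j) (hT : 0 < T) :
    ∃ I : Icc (0 : ℝ) T → E, (∀ t : Icc (0 : ℝ) T, (t : ℝ) = 0 → I t = 0) ∧
      ∃ w, IsControl w ∧ ∀ s t, s ≤ t → ‖I t - I s - χ s t‖ ≤ w s t ^ z := by
  have hW := isControl_youngControl hV hVc ha hA hU hUc hb hz hzb
  obtain ⟨I, hI0, hI⟩ := exists_sewing hz hχ hW.isSuperadd (fun s u t h1 h2 =>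
    (hδ s u t h1 h2).trans (sum_le_youngControl_rpow hV hA hU hz (h1.trans h2)))
    (t₀ := ⟨0, le_rfl, hT.le⟩) (fun t => t.2.1)
  have hK := (sewConst_pos hz).le
  -- The sewing constant is absorbed into the control, so that the error is a pure power.
  refine ⟨I, fun t ht => ?_, fun s t => sewConst z ^ z⁻¹ * youngControl V a A U b z s t, ?_,
    fun s t hst => (hI s t hst).trans (le_of_eq ?_)⟩
  · have : t = ⟨0, le_rfl, hT.le⟩ := Subtype.ext ht
    rw [this, hI0]
  · have h1 := hW.isSuperadd.const_mul (Real.rpow_nonneg hK z⁻¹)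
    exact ⟨h1.nonneg, h1.diag, h1.superadd, continuousOn_const.mul hW.continuousOn⟩
  · rw [Real.mul_rpow (Real.rpow_nonneg hK _) (hW.nonneg s t hst), ← Real.rpow_mul hK,
      inv_mul_cancel₀ (by linarith), Real.rpow_one]

/-- In the remainder the controls `U j` are replaced by their totals `u j`, which leaves a multiple
of `(V t - V s) ^ a`. For `a = 1 / r` this is a bound on the `r`-variation. -/
theorem norm_incr_le_young (hV : Monotone V)
    (hA : ∀ j, 0 ≤ A j) (hU : ∀ j, Monotone (U j)) (hb : ∀ j, 0 < b j)
    {P K : ℝ} {u : κ → ℝ} (hK : 0 ≤ K) (hu : ∀ j s t, U j t - U j s ≤ u j)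
    (hP : ∀ s t, s ≤ t → ‖χ s t‖ ≤ P * (V t - V s) ^ a)
    {I : Icc (0 : ℝ) T → E}
    (hI : ∀ s t, s ≤ t → ‖I t - I s - χ s t‖
      ≤ K * ((V t - V s) ^ a * ∑ j, A j * (U j t - U j s) ^ b j))
    {s t : Icc (0 : ℝ) T} (hst : s ≤ t) :
    ‖I t - I s‖ ≤ (P + K * ∑ j, A j * u j ^ b j) * (V t - V s) ^ a := by
  have h1 : 0 ≤ V t - V s := sub_nonneg.2 (hV hst)
  calc ‖I t - I s‖ = ‖χ s t + (I t - I s - χ s t)‖ := by congr 1; abel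
    _ ≤ P * (V t - V s) ^ a + K * ((V t - V s) ^ a * ∑ j, A j * (U j t - U j s) ^ b j) :=
        (norm_add_le _ _).trans (add_le_add (hP s t hst) (hI s t hst))
    _ ≤ P * (V t - V s) ^ a + K * ((V t - V s) ^ a * ∑ j, A j * u j ^ b j) := by
        gcongr with j
        · exact hA j
        · exact sub_nonneg.2 (hU j hst)
        · exact (hb j).le
        · exact hu j s t
    _ = _ := by ring

/-- The `r`-th powers of the increments are dominated by `Q ^ r` times increments of `V`, and these
telescope. -/
theorem pVar_normIncr_le {r Q M : ℝ} (hr : 0 < r) (hQ : 0 ≤ Q) (hM : 0 ≤ M) (hV : Monotone V)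
    (hVM : ∀ s t, V t - V s ≤ M ^ r)
    {I : Icc (0 : ℝ) T → E} (hI : ∀ s t, s ≤ t → ‖I t - I s‖ ≤ Q * (V t - V s) ^ (1 / r)) :
    pVar (normIncr I) r ≤ ENNReal.ofReal (Q * M) := by
  refine pVar_le hr fun n u hu => ?_
  have hterm : ∀ i, normIncr I (u i) (u (i + 1)) ^ r
      ≤ ENNReal.ofReal (Q ^ r * (V (u (i + 1)) - V (u i))) := by
    intro i
    have h1 : 0 ≤ V (u (i + 1)) - V (u i) := sub_nonneg.2 (hV (hu (Nat.le_succ i)))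
    rw [normIncr, ← ofReal_norm, ENNReal.ofReal_rpow_of_nonneg (norm_nonneg _) hr.le]
    refine ENNReal.ofReal_le_ofReal ?_
    refine (Real.rpow_le_rpow (norm_nonneg _) (hI _ _ (hu (Nat.le_succ i))) hr.le).trans
      (le_of_eq ?_)
    rw [Real.mul_rpow hQ (by positivity), ← Real.rpow_mul h1, one_div_mul_cancel hr.ne',
      Real.rpow_one]
  refine (Finset.sum_le_sum fun i _ => hterm i).trans ?_
  rw [← ENNReal.ofReal_sum_of_nonneg fun i _ => mul_nonneg (Real.rpow_nonneg hQ r)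
    (sub_nonneg.2 (hV (hu (Nat.le_succ i)))),
    ENNReal.ofReal_rpow_of_nonneg (mul_nonneg hQ hM) hr.le]
  refine ENNReal.ofReal_le_ofReal ?_
  rw [← Finset.mul_sum, Finset.sum_range_sub (fun i => V (u i)), Real.mul_rpow hQ hM]
  have := hVM (u 0) (u n)
  gcongr

theorem continuous_of_norm_incr_le {Q : ℝ} (ha : 0 < a) (hVc : Continuous V)
    {I : Icc (0 : ℝ) T → E} (hI : ∀ s t, s ≤ t → ‖I t - I s‖ ≤ Q * (V t - V s) ^ a) :
    Continuous I := by
  rw [continuous_iff_continuousAt]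
  intro t
  rw [ContinuousAt, tendsto_iff_norm_sub_tendsto_zero]
  have hQabs : ∀ x : ℝ, ∀ y, y ≤ Q * x ^ a → y ≤ |Q| * |x| ^ a := fun x y h => by
    refine h.trans ((le_abs_self _).trans ?_)
    rw [abs_mul]
    gcongr
    exact Real.abs_rpow_le_abs_rpow x a
  have hc' : Tendsto (fun s => |Q| * |V s - V t| ^ a) (𝓝 t) (𝓝 0) := by
    have h1 : Continuous fun s => |Q| * |V s - V t| ^ a :=
      continuous_const.mul ((hVc.sub continuous_const).abs.rpow_const fun _ => Or.inr ha.le)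
    have := h1.tendsto t
    simpa only [sub_self, abs_zero, Real.zero_rpow ha.ne', mul_zero] using this
  refine squeeze_zero (fun _ => norm_nonneg _) (fun s => ?_) hc'
  rcases le_total s t with h | h
  · rw [norm_sub_rev, abs_sub_comm]; exact hQabs _ _ (hI s t h)
  · exact hQabs _ _ (hI t s h)

end YoungSewing

/-! ### A trilinear Young inequality -/

section Trilinear

variable {d : ℕ}

theorem one_sub_one_div_nonneg {p : ℝ} (hp : 1 ≤ p) : 0 ≤ 1 - 1 / p := by
  rw [sub_nonneg, div_le_one (by linarith)]; exact hp

/-- Young's inequality for the trilinear form `∫∫ f(z) k(x - z - v) G(v)`, with the norm of the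
kernel interpolated between `L¹` and `L^∞`. -/
theorem lintegral_trilinear_le {p q : ℝ} (hp : 1 ≤ p) (hq : 1 ≤ q) (hpq : 1 ≤ 1 / q + 1 / p)
    {f k G : Euc d → ℝ≥0∞} (hf : Measurable f) (hk : Measurable k) (hG : Measurable G)
    {S L : ℝ≥0∞} (hS : ∀ x, k x ≤ S) (hL : ∫⁻ x, k x ≤ L) (x : Euc d) :
    ∫⁻ a : Euc d × Euc d, f a.1 * k (x - a.1 - a.2) * G a.2
      ≤ S ^ (1 / q + 1 / p - 1) * L ^ (1 - (1 / q + 1 / p - 1))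
        * (∫⁻ z, f z ^ p) ^ (1 / p) * (∫⁻ v, G v ^ q) ^ (1 / q) := by
  have hp0 : 0 < p := by linarith
  have hq0 : 0 < q := by linarith
  set κ := 1 / q + 1 / p - 1 with hκ
  have hκ0 : 0 ≤ κ := by linarith
  have hp' : 0 ≤ 1 - 1 / p := one_sub_one_div_nonneg hp
  have hq' : 0 ≤ 1 - 1 / q := one_sub_one_div_nonneg hq
  have hkm : Measurable fun a : Euc d × Euc d => k (x - a.1 - a.2) :=
    hk.comp (by fun_prop)
  -- Hölder's inequality with three factors, each omitting one of the functions and hence integrable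
  -- over the product. The exponents `κ`, `1 - 1/q`, `1 - 1/p` add up to one and reproduce `f` and
  -- `G`; the kernel is left with the power `1 - κ`, and its remaining power `κ` is bounded by `S`.
  let F : Fin 3 → Euc d × Euc d → ℝ≥0∞ :=
    ![fun a => f a.1 ^ p * G a.2 ^ q, fun a => f a.1 ^ p * k (x - a.1 - a.2),
      fun a => G a.2 ^ q * k (x - a.1 - a.2)]
  let w : Fin 3 → ℝ := ![κ, 1 - 1 / q, 1 - 1 / p]
  have hpt : ∀ a : Euc d × Euc d, f a.1 * k (x - a.1 - a.2) * G a.2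
      ≤ S ^ κ * ∏ i, F i a ^ w i := by
    intro a
    simp only [Fin.prod_univ_three, F, w, Matrix.cons_val_zero, Matrix.cons_val_one,
      Matrix.cons_val]
    set y := f a.1
    set g := G a.2
    set m := k (x - a.1 - a.2)
    have hy : y = (y ^ p) ^ κ * (y ^ p) ^ (1 - 1 / q) := by
      rw [← ENNReal.rpow_add_of_nonneg _ _ hκ0 hq', ← ENNReal.rpow_mul]
      have : p * (κ + (1 - 1 / q)) = 1 := by rw [hκ]; field_simp; ring
      rw [this, ENNReal.rpow_one]
    have hg : g = (g ^ q) ^ κ * (g ^ q) ^ (1 - 1 / p) := by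
      rw [← ENNReal.rpow_add_of_nonneg _ _ hκ0 hp', ← ENNReal.rpow_mul]
      have : q * (κ + (1 - 1 / p)) = 1 := by rw [hκ]; field_simp; ring
      rw [this, ENNReal.rpow_one]
    have hm : m = m ^ κ * (m ^ (1 - 1 / q) * m ^ (1 - 1 / p)) := by
      rw [← ENNReal.rpow_add_of_nonneg _ _ hq' hp',
        ← ENNReal.rpow_add_of_nonneg _ _ hκ0 (add_nonneg hq' hp')]
      have : κ + (1 - 1 / q + (1 - 1 / p)) = 1 := by rw [hκ]; ring
      rw [this, ENNReal.rpow_one]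
    rw [ENNReal.mul_rpow_of_nonneg _ _ hκ0, ENNReal.mul_rpow_of_nonneg _ _ hq',
      ENNReal.mul_rpow_of_nonneg _ _ hp']
    calc y * m * g = ((y ^ p) ^ κ * (y ^ p) ^ (1 - 1 / q)) *
          (m ^ κ * (m ^ (1 - 1 / q) * m ^ (1 - 1 / p))) *
          ((g ^ q) ^ κ * (g ^ q) ^ (1 - 1 / p)) := by rw [← hy, ← hg, ← hm]
      _ ≤ ((y ^ p) ^ κ * (y ^ p) ^ (1 - 1 / q)) *
          (S ^ κ * (m ^ (1 - 1 / q) * m ^ (1 - 1 / p))) *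
          ((g ^ q) ^ κ * (g ^ q) ^ (1 - 1 / p)) := by
          gcongr
          exact hS _
      _ = _ := by ring
  have hF : ∀ i, AEMeasurable (F i) (volume : Measure (Euc d × Euc d)) := by
    intro i
    fin_cases i
    · exact ((hf.comp measurable_fst).pow_const p).aemeasurable.mul
        ((hG.comp measurable_snd).pow_const q).aemeasurable
    · exact ((hf.comp measurable_fst).pow_const p).aemeasurable.mul hkm.aemeasurable
    · exact ((hG.comp measurable_snd).pow_const q).aemeasurable.mul hkm.aemeasurable
  have hw : ∀ i, 0 ≤ w i := by
    intro i
    fin_cases i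
    exacts [hκ0, hq', hp']
  have hw1 : ∑ i, w i = 1 := by
    simp only [Fin.sum_univ_three, w, Matrix.cons_val_zero, Matrix.cons_val_one, Matrix.cons_val]
    rw [hκ]; ring
  set N := ∫⁻ z, f z ^ p with hN
  set M := ∫⁻ v, G v ^ q with hM
  have hfp : Measurable fun z => f z ^ p := hf.pow_const p
  have hGq : Measurable fun z => G z ^ q := hG.pow_const q
  have I0 : ∫⁻ a, F 0 a = N * M := by
    simp only [F, Matrix.cons_val_zero]
    rw [Measure.volume_eq_prod, lintegral_prod_mul hfp.aemeasurable hGq.aemeasurable]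
  have I1 : ∫⁻ a, F 1 a ≤ N * L := by
    have h1 : AEMeasurable (fun a : Euc d × Euc d => f a.1 ^ p * k (x - a.1 - a.2))
      (volume.prod volume) := hF 1
    change ∫⁻ a : Euc d × Euc d, f a.1 ^ p * k (x - a.1 - a.2) ≤ _
    rw [Measure.volume_eq_prod, lintegral_prod _ h1]
    have : ∀ z, ∫⁻ v, f z ^ p * k (x - z - v) ≤ f z ^ p * L := fun z => by
      rw [lintegral_const_mul _ (show Measurable fun v => k (x - z - v) from hk.comp (by fun_prop)),
        lintegral_sub_left_eq_self k (x - z)]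
      gcongr
    refine (lintegral_mono this).trans ?_
    rw [lintegral_mul_const _ hfp]
  have I2 : ∫⁻ a, F 2 a ≤ M * L := by
    have h2 : AEMeasurable (fun a : Euc d × Euc d => G a.2 ^ q * k (x - a.1 - a.2))
      (volume.prod volume) := hF 2
    change ∫⁻ a : Euc d × Euc d, G a.2 ^ q * k (x - a.1 - a.2) ≤ _
    rw [Measure.volume_eq_prod, lintegral_prod_symm _ h2]
    have : ∀ v, ∫⁻ z, G v ^ q * k (x - z - v) ≤ G v ^ q * L := fun v => by
      rw [lintegral_const_mul _ (show Measurable fun z => k (x - z - v) from hk.comp (by fun_prop))]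
      have h1 : (fun z => k (x - z - v)) = fun z => k ((x - v) - z) := by
        funext z; congr 1; abel
      rw [h1, lintegral_sub_left_eq_self k (x - v)]
      gcongr
    refine (lintegral_mono this).trans ?_
    rw [lintegral_mul_const _ hGq]
  calc _ ≤ ∫⁻ a, S ^ κ * ∏ i, F i a ^ w i := lintegral_mono hpt
    _ = S ^ κ * ∫⁻ a, ∏ i, F i a ^ w i := by
        refine lintegral_const_mul'' _ ?_
        exact Finset.aemeasurable_fun_prod _ fun i _ => (hF i).pow_const _
    _ ≤ S ^ κ * ∏ i, (∫⁻ a, F i a) ^ w i := by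
        gcongr
        exact ENNReal.lintegral_prod_norm_pow_le Finset.univ (fun i _ => hF i) hw1 fun i _ => hw i
    _ ≤ S ^ κ * ((N * M) ^ κ * (N * L) ^ (1 - 1 / q) * (M * L) ^ (1 - 1 / p)) := by
        simp only [Fin.prod_univ_three, w, Matrix.cons_val_zero, Matrix.cons_val_one,
          Matrix.cons_val]
        gcongr
        exact I0.le
    _ = S ^ κ * ((L ^ (1 - 1 / q) * L ^ (1 - 1 / p)) * (N ^ κ * N ^ (1 - 1 / q))
          * (M ^ κ * M ^ (1 - 1 / p))) := by
        rw [ENNReal.mul_rpow_of_nonneg _ _ hκ0, ENNReal.mul_rpow_of_nonneg _ _ hq',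
          ENNReal.mul_rpow_of_nonneg _ _ hp']
        ring
    _ = _ := by
        rw [← ENNReal.rpow_add_of_nonneg _ _ hq' hp', ← ENNReal.rpow_add_of_nonneg _ _ hκ0 hq',
          ← ENNReal.rpow_add_of_nonneg _ _ hκ0 hp']
        have e1 : 1 - 1 / q + (1 - 1 / p) = 1 - κ := by rw [hκ]; ring
        have e2 : κ + (1 - 1 / q) = 1 / p := by rw [hκ]; ring
        have e3 : κ + (1 - 1 / p) = 1 / q := by rw [hκ]; ring
        rw [e1, e2, e3]
        ring

end Trilinear

/-! ### Averages of translates of a Schwartz function -/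

section Jets

variable {d : ℕ}

/-- The translate `x ↦ φ (x + u)`. -/
abbrev shift (u : Euc d) (φ : 𝓢(Euc d, ℝ)) : 𝓢(Euc d, ℝ) :=
  SchwartzMap.compSubConstCLM ℝ (-u) φ

theorem shift_apply (u : Euc d) (φ : 𝓢(Euc d, ℝ)) (x : Euc d) : shift u φ x = φ (x + u) := by
  simp [shift]

theorem shift_coe (u : Euc d) (φ : 𝓢(Euc d, ℝ)) :
    ((shift u φ : 𝓢(Euc d, ℝ)) : Euc d → ℝ) = fun x => φ (x + u) :=
  funext (shift_apply u φ)

theorem iteratedFDeriv_shift (j : ℕ) (u : Euc d) (φ : 𝓢(Euc d, ℝ)) (x : Euc d) :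
    iteratedFDeriv ℝ j (shift u φ) x = iteratedFDeriv ℝ j φ (x + u) := by
  rw [shift_coe, iteratedFDeriv_comp_add_right]

/-- Since `‖x‖ ≤ (1 + ‖x + u‖) (1 + ‖u‖)`, moving the argument by `u` costs only a polynomial factor
in `u`. -/
theorem exists_jet_bound (φ : 𝓢(Euc d, ℝ)) (k j : ℕ) :
    ∃ C, 0 ≤ C ∧ ∀ x u, ‖x‖ ^ k * ‖iteratedFDeriv ℝ j φ (x + u)‖ ≤ C * (1 + ‖u‖) ^ k := by
  refine ⟨2 ^ k * (Finset.Iic (k, j)).sup (fun m => SchwartzMap.seminorm ℝ m.1 m.2) φ,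
    by positivity, fun x u => ?_⟩
  have h1 := SchwartzMap.one_add_le_sup_seminorm_apply (𝕜 := ℝ) (m := (k, j)) le_rfl le_rfl φ
    (x + u)
  have h2 : ‖x‖ ≤ (1 + ‖x + u‖) * (1 + ‖u‖) := by
    have h3 : ‖x‖ ≤ ‖x + u‖ + ‖u‖ := by simpa using norm_sub_le (x + u) u
    nlinarith [norm_nonneg (x + u), norm_nonneg u]
  calc ‖x‖ ^ k * ‖iteratedFDeriv ℝ j φ (x + u)‖
      ≤ ((1 + ‖x + u‖) * (1 + ‖u‖)) ^ k * ‖iteratedFDeriv ℝ j φ (x + u)‖ := by gcongr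
    _ = ((1 + ‖x + u‖) ^ k * ‖iteratedFDeriv ℝ j φ (x + u)‖) * (1 + ‖u‖) ^ k := by
        rw [mul_pow]; ring
    _ ≤ _ := by gcongr

theorem hasFDerivAt_iteratedFDeriv (φ : 𝓢(Euc d, ℝ)) (j : ℕ) (x : Euc d) :
    HasFDerivAt (iteratedFDeriv ℝ j φ) (fderiv ℝ (iteratedFDeriv ℝ j φ) x) x :=
  ((φ.smooth (j + 1)).differentiable_iteratedFDeriv (by exact_mod_cast lt_add_one j) x).hasFDerivAt

theorem norm_jet_sub_le (φ : 𝓢(Euc d, ℝ)) (k j : ℕ) :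
    ∃ C, 0 ≤ C ∧ ∀ (R : ℝ) (x u u' : Euc d), ‖u‖ ≤ R → ‖u'‖ ≤ R →
      ‖x‖ ^ k * ‖iteratedFDeriv ℝ j φ (x + u) - iteratedFDeriv ℝ j φ (x + u')‖
        ≤ C * (1 + R) ^ k * ‖u - u'‖ := by
  obtain ⟨C, hC, h⟩ := exists_jet_bound φ k (j + 1)
  refine ⟨C, hC, fun R x u u' hu hu' => ?_⟩
  have hderiv : ∀ ξ : Euc d, HasFDerivAt (fun ξ => ‖x‖ ^ k • iteratedFDeriv ℝ j φ (x + ξ))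
      (‖x‖ ^ k • fderiv ℝ (iteratedFDeriv ℝ j φ) (x + ξ)) ξ := fun ξ =>
    ((hasFDerivAt_comp_add_left x).2 (hasFDerivAt_iteratedFDeriv φ j (x + ξ))).fun_const_smul _
  have := (convex_closedBall (0 : Euc d) R).norm_image_sub_le_of_norm_hasFDerivWithin_le
    (f := fun ξ => ‖x‖ ^ k • iteratedFDeriv ℝ j φ (x + ξ)) (C := C * (1 + R) ^ k)
    (fun ξ _ => (hderiv ξ).hasFDerivWithinAt) (fun ξ hξ => ?_)
    (mem_closedBall_zero_iff.2 hu') (mem_closedBall_zero_iff.2 hu)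
  · rwa [← smul_sub, norm_smul, norm_pow, norm_norm] at this
  · rw [norm_smul, norm_pow, norm_norm, norm_fderiv_iteratedFDeriv]
    refine (h x ξ).trans ?_
    have := mem_closedBall_zero_iff.1 hξ
    gcongr

/-- The weighted derivative `x ↦ ‖x‖ ^ k D^j φ(x)` as a bounded continuous function. -/
def jet (k j : ℕ) (φ : 𝓢(Euc d, ℝ)) : Euc d →ᵇ (Euc d [×j]→L[ℝ] ℝ) :=
  BoundedContinuousFunction.ofNormedAddCommGroup (fun x => ‖x‖ ^ k • iteratedFDeriv ℝ j φ x)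
    ((continuous_norm.pow k).smul
      ((φ.smooth j).continuous_iteratedFDeriv (by exact_mod_cast le_rfl)))
    (SchwartzMap.seminorm ℝ k j φ) fun x => by
      rw [norm_smul, norm_pow, norm_norm]
      exact SchwartzMap.le_seminorm ℝ k j φ x

theorem jet_apply (k j : ℕ) (φ : 𝓢(Euc d, ℝ)) (x : Euc d) :
    jet k j φ x = ‖x‖ ^ k • iteratedFDeriv ℝ j φ x := rfl

theorem norm_smul_sub_smul {V : Type*} [SeminormedAddCommGroup V] [NormedSpace ℝ V] (c : ℝ)
    (a b : V) : ‖c • a - c • b‖ = ‖c‖ * ‖a - b‖ := by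
  rw [← smul_sub, norm_smul]

theorem norm_jet_sub (k j : ℕ) (φ ψ : 𝓢(Euc d, ℝ)) (x : Euc d) :
    ‖jet k j φ x - jet k j ψ x‖
      = ‖x‖ ^ k * ‖iteratedFDeriv ℝ j φ x - iteratedFDeriv ℝ j ψ x‖ := by
  refine (norm_smul_sub_smul (‖x‖ ^ k) _ _).trans ?_
  rw [norm_pow, norm_norm]

/-- The space of finitely many bounded weighted derivatives. -/
def JetSpace (d : ℕ) (s : Finset (ℕ × ℕ)) : Type :=
  (p : s) → Euc d →ᵇ (Euc d [×p.1.2]→L[ℝ] ℝ)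

instance (s : Finset (ℕ × ℕ)) : NormedAddCommGroup (JetSpace d s) :=
  inferInstanceAs (NormedAddCommGroup ((p : s) → Euc d →ᵇ (Euc d [×p.1.2]→L[ℝ] ℝ)))

instance (s : Finset (ℕ × ℕ)) : NormedSpace ℝ (JetSpace d s) :=
  inferInstanceAs (NormedSpace ℝ ((p : s) → Euc d →ᵇ (Euc d [×p.1.2]→L[ℝ] ℝ)))

instance (s : Finset (ℕ × ℕ)) : CompleteSpace (JetSpace d s) :=
  inferInstanceAs (CompleteSpace ((p : s) → Euc d →ᵇ (Euc d [×p.1.2]→L[ℝ] ℝ)))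

/-- Finitely many weighted derivatives. -/
def jetMap (s : Finset (ℕ × ℕ)) : 𝓢(Euc d, ℝ) →ₗ[ℝ] JetSpace d s where
  toFun φ := fun p => jet p.1.1 p.1.2 φ
  map_add' φ ψ := by
    funext p
    ext1 x
    change ‖x‖ ^ p.1.1 • iteratedFDeriv ℝ p.1.2 ((φ : Euc d → ℝ) + (ψ : Euc d → ℝ)) x
      = ‖x‖ ^ p.1.1 • iteratedFDeriv ℝ p.1.2 φ x + ‖x‖ ^ p.1.1 • iteratedFDeriv ℝ p.1.2 ψ x
    rw [iteratedFDeriv_add_apply (φ.smooth _).contDiffAt (ψ.smooth _).contDiffAt, smul_add]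
  map_smul' c φ := by
    funext p
    ext1 x
    change ‖x‖ ^ p.1.1 • iteratedFDeriv ℝ p.1.2 (c • (φ : Euc d → ℝ)) x
      = c • ‖x‖ ^ p.1.1 • iteratedFDeriv ℝ p.1.2 φ x
    rw [iteratedFDeriv_const_smul_apply (φ.smooth _).contDiffAt, smul_comm]

theorem norm_jetSpace_le {s : Finset (ℕ × ℕ)} {F : JetSpace d s} {C : ℝ} (hC : 0 ≤ C)
    (h : ∀ (p : s) x, ‖F p x‖ ≤ C) : ‖F‖ ≤ C :=
  (pi_norm_le_iff_of_nonneg (x := (F : (p : s) → Euc d →ᵇ (Euc d [×p.1.2]→L[ℝ] ℝ))) hC).2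
    fun p => (BoundedContinuousFunction.norm_le hC).2 (h p)

theorem norm_apply_le_jetSpace {s : Finset (ℕ × ℕ)} (F : JetSpace d s) (p : s) (x : Euc d) :
    ‖F p x‖ ≤ ‖F‖ :=
  ((F p).norm_coe_le_norm x).trans
    (norm_le_pi_norm (F : (p : s) → Euc d →ᵇ (Euc d [×p.1.2]→L[ℝ] ℝ)) p)

/-- Evaluation of a component at a point. -/
def jetEval (s : Finset (ℕ × ℕ)) (p : s) (x : Euc d) :
    JetSpace d s →L[ℝ] (Euc d [×p.1.2]→L[ℝ] ℝ) :=
  LinearMap.mkContinuous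
    { toFun := fun F => F p x
      map_add' := fun _ _ => rfl
      map_smul' := fun _ _ => rfl } 1
    fun F => by rw [one_mul]; exact norm_apply_le_jetSpace F p x

theorem jetEval_apply (s : Finset (ℕ × ℕ)) (p : s) (x : Euc d) (F : JetSpace d s) :
    jetEval s p x F = F p x := rfl

theorem jetMap_apply (s : Finset (ℕ × ℕ)) (φ : 𝓢(Euc d, ℝ)) (p : s) (x : Euc d) :
    jetMap s φ p x = ‖x‖ ^ p.1.1 • iteratedFDeriv ℝ p.1.2 φ x := rfl

theorem seminorm_le_norm_jetMap (s : Finset (ℕ × ℕ)) (φ : 𝓢(Euc d, ℝ)) {p : ℕ × ℕ} (hp : p ∈ s) :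
    SchwartzMap.seminorm ℝ p.1 p.2 φ ≤ ‖jetMap s φ‖ := by
  refine SchwartzMap.seminorm_le_bound ℝ _ _ _ (norm_nonneg _) fun x => ?_
  have h1 := norm_apply_le_jetSpace (jetMap s φ) ⟨p, hp⟩ x
  rwa [jetMap_apply, norm_smul, norm_pow, norm_norm] at h1

theorem exists_norm_jetMap_shift_le (s : Finset (ℕ × ℕ)) (φ : 𝓢(Euc d, ℝ)) :
    ∃ (C : ℝ) (N : ℕ), 0 ≤ C ∧ ∀ u, ‖jetMap s (shift u φ)‖ ≤ C * (1 + ‖u‖) ^ N := by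
  choose C hC h using fun p : ℕ × ℕ => exists_jet_bound φ p.1 p.2
  refine ⟨∑ p ∈ s, C p, ∑ p ∈ s, p.1, Finset.sum_nonneg fun p _ => hC p, fun u => ?_⟩
  have hpos : 0 ≤ (∑ p ∈ s, C p) * (1 + ‖u‖) ^ (∑ p ∈ s, p.1) :=
    mul_nonneg (Finset.sum_nonneg fun p _ => hC p) (by positivity)
  refine norm_jetSpace_le hpos fun p x => ?_
  rw [jetMap_apply, norm_smul, norm_pow, norm_norm, iteratedFDeriv_shift]
  refine (h p.1 x u).trans ?_
  gcongr
  · exact Finset.sum_nonneg fun p _ => hC p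
  · exact Finset.single_le_sum (fun p _ => hC p) p.2
  · linarith [norm_nonneg u]
  · exact Finset.single_le_sum (f := fun p : ℕ × ℕ => p.1) (fun p _ => Nat.zero_le _) p.2

/-- Together with the polynomial bound this makes translates Bochner integrable in the Banach space
`JetSpace` against weights with all moments. Integrals valued in the Schwartz space itself are
thereby avoided. -/
theorem continuous_jetMap_shift (s : Finset (ℕ × ℕ)) (φ : 𝓢(Euc d, ℝ)) :
    Continuous fun u => jetMap s (shift u φ) := by
  choose C hC h using fun p : ℕ × ℕ => norm_jet_sub_le φ p.1 p.2
  rw [continuous_iff_continuousAt]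
  intro u₀
  rw [ContinuousAt, tendsto_iff_norm_sub_tendsto_zero]
  set B := ∑ p ∈ s, C p * (1 + (‖u₀‖ + 1)) ^ p.1 with hB
  have hc : Tendsto (fun u => B * ‖u - u₀‖) (𝓝 u₀) (𝓝 0) := by
    have : Continuous fun u => B * ‖u - u₀‖ := by fun_prop
    simpa using this.tendsto u₀
  have hpos : ∀ p ∈ s, 0 ≤ C p * (1 + (‖u₀‖ + 1)) ^ p.1 := fun p _ =>
    mul_nonneg (hC p) (by positivity)
  refine squeeze_zero' (Eventually.of_forall fun _ => norm_nonneg _) ?_ hc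
  filter_upwards [Metric.ball_mem_nhds u₀ one_pos] with u hu
  have hu1 : ‖u‖ ≤ ‖u₀‖ + 1 := by
    have h1 := mem_ball_iff_norm.1 hu
    have h2 : ‖u‖ ≤ ‖u - u₀‖ + ‖u₀‖ := by simpa using norm_add_le (u - u₀) u₀
    linarith
  refine norm_jetSpace_le (mul_nonneg (Finset.sum_nonneg hpos) (norm_nonneg _)) fun p x => ?_
  change ‖jet p.1.1 p.1.2 (shift u φ) x - jet p.1.1 p.1.2 (shift u₀ φ) x‖ ≤ _
  rw [norm_jet_sub, iteratedFDeriv_shift, iteratedFDeriv_shift]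
  refine (h p.1 _ x u u₀ hu1 (by linarith)).trans ?_
  gcongr
  exact Finset.single_le_sum hpos p.2

/-- A tempered distribution factors through finitely many weighted derivatives. -/
theorem exists_functional_jetMap (g : 𝓢(Euc d, ℝ) →L[ℝ] ℝ) :
    ∃ (s : Finset (ℕ × ℕ)) (L : JetSpace d s →L[ℝ] ℝ),
      ∀ φ, g φ = L (jetMap s φ) := by
  classical
  let q : Seminorm ℝ 𝓢(Euc d, ℝ) := (normSeminorm ℝ ℝ).comp g.toLinearMap
  have hq : Continuous q := g.continuous.norm
  obtain ⟨s₀, C, -, hC⟩ :=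
    Seminorm.bound_of_continuous (schwartz_withSeminorms ℝ (Euc d) ℝ) q hq
  -- Including the function values makes `jetMap` injective, so the functional is well defined on
  -- its range.
  set s := insert (0, 0) s₀ with hs
  have hinj : Function.Injective (jetMap (d := d) s) := by
    intro φ ψ h
    ext x
    have h1 : jet 0 0 φ x 0 = jet 0 0 ψ x 0 :=
      congrArg (fun F => jetEval s ⟨(0, 0), Finset.mem_insert_self _ _⟩ x F 0) h
    simpa [jet_apply] using h1
  have hbound : ∀ φ, ‖g φ‖ ≤ C * ‖jetMap s φ‖ := by
    intro φ
    have h1 : ‖g φ‖ ≤ C * (s₀.sup (schwartzSeminormFamily ℝ (Euc d) ℝ)) φ := hC φ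
    refine h1.trans ?_
    gcongr
    refine Seminorm.finset_sup_apply_le (norm_nonneg _) fun p hp => ?_
    exact seminorm_le_norm_jetMap s φ (Finset.mem_insert_of_mem hp)
  let e := LinearEquiv.ofInjective (jetMap (d := d) s) hinj
  let g₀ : LinearMap.range (jetMap (d := d) s) →ₗ[ℝ] ℝ := g.toLinearMap ∘ₗ e.symm.toLinearMap
  have hg₀ : ∀ y, ‖g₀ y‖ ≤ C * ‖y‖ := by
    intro y
    obtain ⟨φ, rfl⟩ := e.surjective y
    have h1 : g₀ (e φ) = g φ := by simp [g₀]
    have h2 : ‖e φ‖ = ‖jetMap s φ‖ := rfl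
    rw [h1, h2]
    exact hbound φ
  -- Hahn–Banach is needed because averages of translates are formed in all of `JetSpace`; they need
  -- not lie in the range of `jetMap`.
  obtain ⟨L, hL, -⟩ := exists_extension_norm_eq _ (g₀.mkContinuous C hg₀)
  refine ⟨s, L, fun φ => ?_⟩
  have h1 := hL (e φ)
  have h2 : g₀.mkContinuous C hg₀ (e φ) = g φ := by simp [g₀]
  rw [h2] at h1
  exact h1.symm

/-! ### Weighted averages of translates as functions and as jets -/

section Average

variable {ν : Measure (Euc d)} {w : Euc d → ℝ}

theorem norm_iteratedFDeriv_le_seminorm (φ : 𝓢(Euc d, ℝ)) (j : ℕ) (x : Euc d) :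
    ‖iteratedFDeriv ℝ j φ x‖ ≤ SchwartzMap.seminorm ℝ 0 j φ := by
  simpa using SchwartzMap.le_seminorm ℝ 0 j φ x

theorem hasFDerivAt_average {G : Type*} [NormedAddCommGroup G] [NormedSpace ℝ G] {g : Euc d → G}
    (hw : Integrable w ν) (hg : Continuous g) (hg' : Continuous (fderiv ℝ g))
    (hd : ∀ x, HasFDerivAt g (fderiv ℝ g x) x) {C₀ C₁ : ℝ} (h₀ : ∀ x, ‖g x‖ ≤ C₀)
    (h₁ : ∀ x, ‖fderiv ℝ g x‖ ≤ C₁) (v : Euc d) :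
    HasFDerivAt (fun v => ∫ u, w u • g (v + u) ∂ν) (∫ u, w u • fderiv ℝ g (v + u) ∂ν) v := by
  refine hasFDerivAt_integral_of_dominated_of_fderiv_le (s := univ)
    (F := fun v u => w u • g (v + u)) (F' := fun v u => w u • fderiv ℝ g (v + u))
    (bound := fun u => ‖w u‖ * C₁) univ_mem ?_ ?_ ?_ ?_ ?_ ?_
  · exact Eventually.of_forall fun v => hw.aestronglyMeasurable.smul
      (hg.comp (continuous_const.add continuous_id)).aestronglyMeasurable
  · exact hw.smul_bdd C₀ (hg.comp (continuous_const.add continuous_id)).aestronglyMeasurable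
      (Eventually.of_forall fun u => h₀ _)
  · exact hw.aestronglyMeasurable.smul
      (hg'.comp (continuous_const.add continuous_id)).aestronglyMeasurable
  · refine Eventually.of_forall fun u v _ => ?_
    rw [norm_smul]
    gcongr
    exact h₁ _
  · exact hw.norm.mul_const _
  · exact Eventually.of_forall fun u v _ =>
      ((hasFDerivAt_comp_add_right u).2 (hd (v + u))).fun_const_smul _

theorem fderiv_average_apply {G : Type*} [NormedAddCommGroup G] [NormedSpace ℝ G]
    {g : Euc d → G}
    (hw : Integrable w ν) (hg : Continuous g) (hg' : Continuous (fderiv ℝ g))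
    (hd : ∀ x, HasFDerivAt g (fderiv ℝ g x) x) {C₀ C₁ : ℝ} (h₀ : ∀ x, ‖g x‖ ≤ C₀)
    (h₁ : ∀ x, ‖fderiv ℝ g x‖ ≤ C₁) (v m : Euc d) :
    fderiv ℝ (fun v => ∫ u, w u • g (v + u) ∂ν) v m = ∫ u, w u • fderiv ℝ g (v + u) m ∂ν := by
  have hint : Integrable (fun u => w u • fderiv ℝ g (v + u)) ν :=
    hw.smul_bdd C₁ (hg'.comp (continuous_const.add continuous_id)).aestronglyMeasurable
      (Eventually.of_forall fun u => h₁ _)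
  rw [(hasFDerivAt_average hw hg hg' hd h₀ h₁ v).fderiv, ContinuousLinearMap.integral_apply hint]
  rfl

theorem continuous_iteratedFDeriv_schwartz (φ : 𝓢(Euc d, ℝ)) (j : ℕ) :
    Continuous (iteratedFDeriv ℝ j φ) :=
  (φ.smooth j).continuous_iteratedFDeriv (by exact_mod_cast le_rfl)

theorem continuous_fderiv_iteratedFDeriv (φ : 𝓢(Euc d, ℝ)) (j : ℕ) :
    Continuous (fderiv ℝ (iteratedFDeriv ℝ j φ)) :=
  ((φ.smooth (j + 1)).iteratedFDeriv_right (m := 1) (by norm_cast; omega)).continuous_fderiv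
    (by simp)

theorem norm_fderiv_iteratedFDeriv_le_seminorm (φ : 𝓢(Euc d, ℝ)) (j : ℕ) (x : Euc d) :
    ‖fderiv ℝ (iteratedFDeriv ℝ j φ) x‖ ≤ SchwartzMap.seminorm ℝ 0 (j + 1) φ := by
  rw [norm_fderiv_iteratedFDeriv]
  exact norm_iteratedFDeriv_le_seminorm φ (j + 1) x

/-- Repeated differentiation under the integral sign, dominated by the bounded derivatives of `φ`.
-/
theorem iteratedFDeriv_average (hw : Integrable w ν) (φ : 𝓢(Euc d, ℝ)) (j : ℕ) :
    iteratedFDeriv ℝ j (fun v => ∫ u, w u • φ (v + u) ∂ν)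
      = fun v => ∫ u, w u • iteratedFDeriv ℝ j φ (v + u) ∂ν := by
  have hint : ∀ j v, Integrable (fun u => w u • iteratedFDeriv ℝ j φ (v + u)) ν := fun j v =>
    hw.smul_bdd (SchwartzMap.seminorm ℝ 0 j φ) ((continuous_iteratedFDeriv_schwartz φ j).comp
      (continuous_const.add continuous_id)).aestronglyMeasurable
      (Eventually.of_forall fun u => norm_iteratedFDeriv_le_seminorm φ j _)
  induction j with
  | zero =>
    funext v
    ext m
    rw [iteratedFDeriv_zero_apply, ContinuousMultilinearMap.integral_apply (hint 0 v)]
    simp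
  | succ j ih =>
    funext v
    ext m
    rw [iteratedFDeriv_succ_apply_left, ih, ContinuousMultilinearMap.integral_apply (hint (j + 1) v),
      fderiv_average_apply hw (continuous_iteratedFDeriv_schwartz φ j)
        (continuous_fderiv_iteratedFDeriv φ j) (hasFDerivAt_iteratedFDeriv φ j)
        (norm_iteratedFDeriv_le_seminorm φ j) (norm_fderiv_iteratedFDeriv_le_seminorm φ j)]
    have hint' : Integrable (fun u => w u • fderiv ℝ (iteratedFDeriv ℝ j φ) (v + u) (m 0)) ν := by
      refine hw.smul_bdd (SchwartzMap.seminorm ℝ 0 (j + 1) φ * ‖m 0‖)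
        (((continuous_fderiv_iteratedFDeriv φ j).comp
          (continuous_const.add continuous_id)).clm_apply continuous_const).aestronglyMeasurable
        (Eventually.of_forall fun u => ?_)
      exact ContinuousLinearMap.le_of_opNorm_le _ (norm_fderiv_iteratedFDeriv_le_seminorm φ j _) _
    rw [ContinuousMultilinearMap.integral_apply hint']
    refine integral_congr_ae (Eventually.of_forall fun u => ?_)
    simp only [smul_apply, iteratedFDeriv_succ_apply_left]

variable (hw : ∀ k : ℕ, Integrable (fun u => ‖u‖ ^ k * w u) ν)
include hw

theorem integrable_of_moments : Integrable w ν := by simpa using hw 0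

theorem integrable_one_add_pow (N : ℕ) : Integrable (fun u => (1 + ‖u‖) ^ N * ‖w u‖) ν := by
  have : (fun u : Euc d => (1 + ‖u‖) ^ N * ‖w u‖)
      = fun u => ∑ m ∈ Finset.range (N + 1), (N.choose m : ℝ) * ‖‖u‖ ^ m * w u‖ := by
    funext u
    rw [add_comm, add_pow, Finset.sum_mul]
    refine Finset.sum_congr rfl fun m _ => ?_
    rw [norm_mul, norm_pow, norm_norm]
    ring
  rw [this]
  exact integrable_finsetSum _ fun m _ => (hw m).norm.const_mul _

theorem integrable_smul_jetMap (s : Finset (ℕ × ℕ)) (φ : 𝓢(Euc d, ℝ)) :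
    Integrable (fun u => w u • jetMap s (shift u φ)) ν := by
  obtain ⟨C, N, hC, h⟩ := exists_norm_jetMap_shift_le s φ
  refine ((integrable_one_add_pow hw N).const_mul C).mono'
    ((integrable_of_moments hw).aestronglyMeasurable.smul
      (continuous_jetMap_shift s φ).aestronglyMeasurable) (Eventually.of_forall fun u => ?_)
  rw [norm_smul]
  calc ‖w u‖ * ‖jetMap s (shift u φ)‖ ≤ ‖w u‖ * (C * (1 + ‖u‖) ^ N) := by gcongr; exact h u
    _ = _ := by ring

/-- The Bochner integral of the jets depends only on the averaged function, whether or not that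
function is known to be Schwartz. -/
theorem integral_smul_jetMap_apply (s : Finset (ℕ × ℕ)) (φ : 𝓢(Euc d, ℝ)) (p : s) (x : Euc d) :
    (∫ u, w u • jetMap s (shift u φ) ∂ν) p x
      = ‖x‖ ^ p.1.1 • iteratedFDeriv ℝ p.1.2 (fun v => ∫ u, w u • φ (v + u) ∂ν) x := by
  have h1 := (jetEval s p x).integral_comp_comm (integrable_smul_jetMap hw s φ)
  rw [← jetEval_apply, ← h1, iteratedFDeriv_average (integrable_of_moments hw), ← integral_smul]
  refine integral_congr_ae (Eventually.of_forall fun u => ?_)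
  simp only [map_smul]
  rw [jetEval_apply, jetMap_apply, iteratedFDeriv_shift, smul_comm]

end Average

/-! ### Exchanging distributions with averages -/

section Exchange

variable {F : Type*} [NormedAddCommGroup F] [NormedSpace ℝ F] (f : 𝓢(Euc d, ℝ) →L[ℝ] F)

/-- A tempered distribution has finite order, and finitely many weighted derivatives of a translate
grow polynomially. -/
theorem exists_norm_apply_shift_le [FiniteDimensional ℝ F] (φ : 𝓢(Euc d, ℝ)) :
    ∃ (C : ℝ) (N : ℕ), 0 ≤ C ∧ ∀ u, ‖f (shift u φ)‖ ≤ C * (1 + ‖u‖) ^ N := by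
  let q : Seminorm ℝ 𝓢(Euc d, ℝ) := (normSeminorm ℝ F).comp f.toLinearMap
  have hq : Continuous q := f.continuous.norm
  obtain ⟨s, C, -, hC⟩ :=
    Seminorm.bound_of_continuous (schwartz_withSeminorms ℝ (Euc d) ℝ) q hq
  obtain ⟨C', N, hC', h⟩ := exists_norm_jetMap_shift_le s φ
  refine ⟨C * C', N, by positivity, fun u => ?_⟩
  have h1 : ‖f (shift u φ)‖ ≤ C * (s.sup (schwartzSeminormFamily ℝ (Euc d) ℝ)) (shift u φ) :=
    hC _
  refine h1.trans ?_
  rw [mul_assoc]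
  gcongr
  refine le_trans ?_ (h u)
  exact Seminorm.finset_sup_apply_le (norm_nonneg _) fun p hp => seminorm_le_norm_jetMap s _ hp

theorem continuous_apply_shift (φ : 𝓢(Euc d, ℝ)) : Continuous fun u => f (shift u φ) := by
  let q : Seminorm ℝ 𝓢(Euc d, ℝ) := (normSeminorm ℝ F).comp f.toLinearMap
  have hq : Continuous q := f.continuous.norm
  obtain ⟨s, C, -, hC⟩ :=
    Seminorm.bound_of_continuous (schwartz_withSeminorms ℝ (Euc d) ℝ) q hq
  rw [continuous_iff_continuousAt]
  intro u₀
  rw [ContinuousAt, tendsto_iff_norm_sub_tendsto_zero]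
  have hc : Tendsto (fun u => C * ‖jetMap s (shift u φ) - jetMap s (shift u₀ φ)‖)
      (𝓝 u₀) (𝓝 0) := by
    have : Continuous fun u => C * ‖jetMap s (shift u φ) - jetMap s (shift u₀ φ)‖ :=
      continuous_const.mul ((continuous_jetMap_shift s φ).sub continuous_const).norm
    simpa using this.tendsto u₀
  refine squeeze_zero (fun _ => norm_nonneg _) (fun u => ?_) hc
  rw [← map_sub f, ← map_sub (jetMap s)]
  have h1 : ‖f (shift u φ - shift u₀ φ)‖
      ≤ C * (s.sup (schwartzSeminormFamily ℝ (Euc d) ℝ)) (shift u φ - shift u₀ φ) := hC _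
  refine h1.trans ?_
  gcongr
  exact Seminorm.finset_sup_apply_le (norm_nonneg _) fun p hp => seminorm_le_norm_jetMap s _ hp

variable [FiniteDimensional ℝ F] {ν ν' : Measure (Euc d)} {w w' : Euc d → ℝ}

theorem integrable_smul_apply_shift (hw : ∀ k : ℕ, Integrable (fun u => ‖u‖ ^ k * w u) ν)
    (φ : 𝓢(Euc d, ℝ)) : Integrable (fun u => w u • f (shift u φ)) ν := by
  obtain ⟨C, N, hC, h⟩ := exists_norm_apply_shift_le f φ
  refine ((integrable_one_add_pow hw N).const_mul C).mono'
    ((integrable_of_moments hw).aestronglyMeasurable.smul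
      (continuous_apply_shift f φ).aestronglyMeasurable) (Eventually.of_forall fun u => ?_)
  rw [norm_smul]
  calc ‖w u‖ * ‖f (shift u φ)‖ ≤ ‖w u‖ * (C * (1 + ‖u‖) ^ N) := by gcongr; exact h u
    _ = _ := by ring

/-- A tempered distribution commutes with averages of translates: equal averages of test functions
have equal averaged pairings. -/
theorem integral_apply_shift_eq (hw : ∀ k : ℕ, Integrable (fun u => ‖u‖ ^ k * w u) ν)
    (hw' : ∀ k : ℕ, Integrable (fun u => ‖u‖ ^ k * w' u) ν') {φ φ' : 𝓢(Euc d, ℝ)}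
    (h : ∀ v, ∫ u, w u * φ (v + u) ∂ν = ∫ u, w' u * φ' (v + u) ∂ν') :
    ∫ u, w u • f (shift u φ) ∂ν = ∫ u, w' u • f (shift u φ') ∂ν' := by
  -- After testing with a functional, the distribution factors as a bounded functional `L` of jets.
  -- `L` commutes with Bochner integrals, and the two jet integrals coincide because the averaged
  -- functions do.
  refine (SeparatingDual.eq_iff_forall_dual_eq (R := ℝ)).2 fun ℓ => ?_
  rw [← ℓ.integral_comp_comm (integrable_smul_apply_shift f hw φ),
    ← ℓ.integral_comp_comm (integrable_smul_apply_shift f hw' φ')]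
  obtain ⟨s, L, hL⟩ := exists_functional_jetMap (ℓ.comp f)
  have key : ∀ ψ u, ℓ (f (shift u ψ)) = L (jetMap s (shift u ψ)) := fun ψ u => hL _
  have key' : ∀ (c : ℝ) ψ u, ℓ (c • f (shift u ψ)) = L (c • jetMap s (shift u ψ)) := fun c ψ u => by
    rw [ℓ.map_smul, key, L.map_smul]
  simp_rw [key']
  rw [L.integral_comp_comm (integrable_smul_jetMap hw s φ),
    L.integral_comp_comm (integrable_smul_jetMap hw' s φ')]
  congr 1
  funext p
  refine BoundedContinuousFunction.ext fun x => ?_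
  rw [integral_smul_jetMap_apply hw, integral_smul_jetMap_apply hw']
  simp only [smul_eq_mul, h]

/-- When the average is itself a Schwartz function it is compared with the trivial average against a
Dirac mass at the origin. -/
theorem apply_eq_integral_shift (hw : ∀ k : ℕ, Integrable (fun u => ‖u‖ ^ k * w u) ν)
    {φ Φ : 𝓢(Euc d, ℝ)} (h : ∀ v, Φ v = ∫ u, w u * φ (v + u) ∂ν) :
    f Φ = ∫ u, w u • f (shift u φ) ∂ν := by
  have hd : ∀ k : ℕ, Integrable (fun u : Euc d => ‖u‖ ^ k * (1 : ℝ)) (Measure.dirac 0) :=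
    fun k => integrable_dirac (by simp)
  rw [integral_apply_shift_eq f hw hd (φ' := Φ) fun v => by rw [integral_dirac, ← h v]; simp,
    integral_dirac]
  simp [shift]

end Exchange

end Jets

/-! ### Real kernels with prescribed Fourier symbols -/

section Kernels

variable {d : ℕ}

/-- The real part of the inverse Fourier transform of a symbol. -/
def realKernel (s : 𝓢(Euc d, ℂ)) : 𝓢(Euc d, ℝ) :=
  SchwartzMap.postcompCLM (𝕜 := ℝ) Complex.reCLM (𝓕⁻ s : 𝓢(Euc d, ℂ))

theorem realKernel_apply (s : 𝓢(Euc d, ℂ)) (x : Euc d) :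
    realKernel s x = ((𝓕⁻ s : 𝓢(Euc d, ℂ)) x).re := rfl

/-- A modulated symbol has a reflected translate of the kernel as its transform. With the
self-adjointness of the Fourier transform this produces convolutions with the kernel. -/
theorem fourierInv_apply_sub (s : 𝓢(Euc d, ℂ)) (u v : Euc d) :
    𝓕 (fun ξ => Real.fourierChar (inner ℝ ξ v) • s ξ) u = (𝓕⁻ s : 𝓢(Euc d, ℂ)) (v - u) := by
  rw [SchwartzMap.fourierInv_coe, Real.fourierInv_eq, Real.fourier_eq]
  refine integral_congr_ae (Eventually.of_forall fun ξ => ?_)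
  simp only
  rw [smul_smul, ← AddChar.map_add_eq_mul, inner_sub_right, neg_add_eq_sub]

theorem integrable_fourierChar_smul (s : 𝓢(Euc d, ℂ)) (v : Euc d) :
    Integrable fun ξ => Real.fourierChar (inner ℝ ξ v) • s ξ := by
  refine s.integrable.mono (Continuous.aestronglyMeasurable ?_)
    (Eventually.of_forall fun ξ => by rw [Circle.norm_smul])
  have h1 : Continuous fun ξ : Euc d => Real.fourierChar (inner ℝ ξ v) :=
    Real.continuous_fourierChar.comp (by fun_prop)
  exact h1.smul s.continuous

/-- Convolution of a real function with a real kernel multiplies the symbols. -/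
theorem realKernel_eq_integral {A : Euc d → ℝ} (hA : Integrable A) {s s' : 𝓢(Euc d, ℂ)}
    (h : ∀ ξ, 𝓕 (fun u => (A u : ℂ)) ξ * s ξ = s' ξ) (v : Euc d) :
    realKernel s' v = ∫ u, A u * realKernel s (v - u) := by
  have hA' : Integrable fun u => (A u : ℂ) := hA.ofReal
  have h1 : (𝓕⁻ s' : 𝓢(Euc d, ℂ)) v = ∫ u, (A u : ℂ) • (𝓕⁻ s : 𝓢(Euc d, ℂ)) (v - u) := by
    -- The transform is moved from the merely integrable `A` onto the modulated symbol, so no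
    -- inversion theorem for `A` is required.
    have h2 := VectorFourier.integral_fourierIntegral_smul_eq_flip (L := innerₗ (Euc d))
      Real.continuous_fourierChar continuous_inner hA' (integrable_fourierChar_smul s v)
    have h3 : ∀ u, VectorFourier.fourierIntegral Real.fourierChar volume (innerₗ (Euc d)).flip
        (fun ξ => Real.fourierChar (inner ℝ ξ v) • s ξ) u = (𝓕⁻ s : 𝓢(Euc d, ℂ)) (v - u) := by
      intro u
      rw [← fourierInv_apply_sub, flip_innerₗ]
      rfl
    simp_rw [h3] at h2
    rw [← h2, SchwartzMap.fourierInv_coe, Real.fourierInv_eq]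
    refine integral_congr_ae (Eventually.of_forall fun ξ => ?_)
    simp only
    rw [← h ξ, smul_comm, smul_eq_mul]
    rfl
  have hint : Integrable fun u => (A u : ℂ) • (𝓕⁻ s : 𝓢(Euc d, ℂ)) (v - u) :=
    hA'.smul_bdd (SchwartzMap.seminorm ℝ 0 0 (𝓕⁻ s : 𝓢(Euc d, ℂ)))
      ((𝓕⁻ s : 𝓢(Euc d, ℂ)).continuous.comp
        (continuous_const.sub continuous_id)).aestronglyMeasurable
      (Eventually.of_forall fun u => SchwartzMap.norm_le_seminorm ℝ _ _)
  rw [realKernel_apply, h1, ← Complex.reCLM_apply, ← Complex.reCLM.integral_comp_comm hint]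
  refine integral_congr_ae (Eventually.of_forall fun u => ?_)
  simp [realKernel_apply]

/-- Conjugation reverses the character, and the substitution `ξ ↦ -ξ` undoes this for an even real
symbol; taking real parts then loses nothing. -/
theorem ofReal_realKernel {s : 𝓢(Euc d, ℂ)} (hre : ∀ ξ, (starRingEnd ℂ) (s ξ) = s ξ)
    (heven : ∀ ξ, s (-ξ) = s ξ) (x : Euc d) :
    (realKernel s x : ℂ) = (𝓕⁻ s : 𝓢(Euc d, ℂ)) x := by
  rw [realKernel_apply]
  refine Complex.conj_eq_iff_re.1 ?_
  rw [SchwartzMap.fourierInv_coe, Real.fourierInv_eq, ← integral_conj,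
    ← integral_neg_eq_self]
  refine integral_congr_ae (Eventually.of_forall fun ξ => ?_)
  simp only [Circle.smul_def, smul_eq_mul, map_mul, hre, heven, inner_neg_left]
  rw [AddChar.map_neg_eq_inv, Circle.coe_inv_eq_conj, Complex.conj_conj]

theorem fourier_realKernel {s : 𝓢(Euc d, ℂ)} (hre : ∀ ξ, (starRingEnd ℂ) (s ξ) = s ξ)
    (heven : ∀ ξ, s (-ξ) = s ξ) (ξ : Euc d) :
    𝓕 (fun u => (realKernel s u : ℂ)) ξ = s ξ := by
  simp_rw [ofReal_realKernel hre heven]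
  change 𝓕 ((𝓕⁻ s : 𝓢(Euc d, ℂ)) : Euc d → ℂ) ξ = s ξ
  rw [← SchwartzMap.fourier_coe, FourierTransform.fourier_fourierInv_eq]

/-- The `L¹`-normalized dilation. -/
def dilate (c : ℝ) (A : Euc d → ℝ) (x : Euc d) : ℝ := c ^ d * A (c • x)

theorem integral_comp_smul_euc {F : Type*} [NormedAddCommGroup F] [NormedSpace ℝ F] {c : ℝ}
    (hc : 0 < c) (g : Euc d → F) : (c ^ d) • ∫ x, g (c • x) = ∫ x, g x := by
  rw [Measure.integral_comp_smul_of_nonneg volume g c (hR := hc.le), finrank_euclideanSpace_fin, smul_smul,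
    mul_inv_cancel₀ (by positivity), one_smul]

theorem fourier_dilate {c : ℝ} (hc : 0 < c) (A : Euc d → ℝ) (ξ : Euc d) :
    𝓕 (fun u => (dilate c A u : ℂ)) ξ = 𝓕 (fun u => (A u : ℂ)) (c⁻¹ • ξ) := by
  rw [Real.fourier_eq, Real.fourier_eq, ← integral_comp_smul_euc hc
    (fun v => Real.fourierChar (-inner ℝ v (c⁻¹ • ξ)) • (A v : ℂ)), ← integral_smul]
  refine integral_congr_ae (Eventually.of_forall fun u => ?_)
  simp only [dilate, real_inner_smul_left, real_inner_smul_right]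
  rw [← mul_assoc, inv_mul_cancel₀ hc.ne', one_mul, smul_comm]
  congr 1
  simp

theorem integrable_dilate_moment {c : ℝ} (hc : 0 < c) {A : Euc d → ℝ}
    (hA : ∀ k : ℕ, Integrable fun u => ‖u‖ ^ k * A u) (k : ℕ) :
    Integrable fun u => ‖u‖ ^ k * dilate c A u := by
  have h1 := ((hA k).comp_smul hc.ne').const_mul (c ^ d * (c ^ k)⁻¹)
  refine h1.congr (Eventually.of_forall fun u => ?_)
  simp only [dilate, norm_smul, Real.norm_eq_abs, abs_of_pos hc, mul_pow]
  field_simp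

/-- The kernel `K` is reproduced by convolution with `A` and `H`. -/
def IsReproducing (A H : Euc d → ℝ) (K : 𝓢(Euc d, ℝ)) : Prop :=
  ∃ J : 𝓢(Euc d, ℝ), (∀ v, K v = ∫ u, A u * J (v - u)) ∧ ∀ v, J v = ∫ u, H u * K (v - u)

/-- The dilated symbol. -/
def dilateSymbol (c : ℝ) (hc : c ≠ 0) (s : 𝓢(Euc d, ℂ)) : 𝓢(Euc d, ℂ) :=
  SchwartzMap.compCLMOfContinuousLinearEquiv ℝ
    (ContinuousLinearEquiv.smulLeft (Units.mk0 c⁻¹ (inv_ne_zero hc))) s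

theorem dilateSymbol_apply (c : ℝ) (hc : c ≠ 0) (s : 𝓢(Euc d, ℂ)) (ξ : Euc d) :
    dilateSymbol c hc s ξ = s (c⁻¹ • ξ) := rfl

theorem integrable_of_moment {A : Euc d → ℝ} (hA : ∀ k : ℕ, Integrable fun u => ‖u‖ ^ k * A u) :
    Integrable A := by simpa using hA 0

/-- On the Fourier side the intermediate function has symbol `sJ = sH s`, and multiplying it by the
transform of `A` returns `s`. Both relations are preserved when all arguments are scaled by `c⁻¹`.
-/
theorem isReproducing_dilate {A : Euc d → ℝ} (hA : ∀ k : ℕ, Integrable fun u => ‖u‖ ^ k * A u)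
    {sH sJ s : 𝓢(Euc d, ℂ)} (hre : ∀ ξ, (starRingEnd ℂ) (sH ξ) = sH ξ)
    (heven : ∀ ξ, sH (-ξ) = sH ξ) (h₁ : ∀ ξ, 𝓕 (fun u => (A u : ℂ)) ξ * sJ ξ = s ξ)
    (h₂ : ∀ ξ, sH ξ * s ξ = sJ ξ) {c : ℝ} (hc : 0 < c) :
    IsReproducing (dilate c A) (dilate c (realKernel sH))
      (realKernel (dilateSymbol c hc.ne' s)) := by
  refine ⟨realKernel (dilateSymbol c hc.ne' sJ), fun v => realKernel_eq_integral
    (integrable_of_moment (integrable_dilate_moment hc hA)) (fun ξ => ?_) v,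
    fun v => realKernel_eq_integral (integrable_of_moment (integrable_dilate_moment hc
      fun k => ?_)) (fun ξ => ?_) v⟩
  · rw [fourier_dilate hc, dilateSymbol_apply, dilateSymbol_apply, h₁]
  · have := ((realKernel sH).integrable_pow_mul volume k)
    refine this.mono (Continuous.aestronglyMeasurable ?_) (Eventually.of_forall fun u => ?_)
    · exact (continuous_norm.pow k).mul (realKernel sH).continuous
    · simp
  · rw [fourier_dilate hc, fourier_realKernel hre heven, dilateSymbol_apply, dilateSymbol_apply, h₂]

theorem cutoff_eq_one {ξ : Euc d} (h : ‖ξ‖ ≤ 1) : cutoff ξ = 1 := by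
  unfold cutoff
  rw [Real.smoothTransition.one_of_one_le (by nlinarith [norm_nonneg ξ])]
  simp

theorem cutoff_eq_zero {ξ : Euc d} (h : 2 ≤ ‖ξ‖ ^ 2) : cutoff ξ = 0 := by
  unfold cutoff
  rw [Real.smoothTransition.zero_of_nonpos (by linarith)]
  simp

theorem conj_cutoff (ξ : Euc d) : (starRingEnd ℂ) (cutoff ξ) = cutoff ξ := Complex.conj_ofReal _

theorem cutoff_congr {ξ η : Euc d} (h : ‖ξ‖ = ‖η‖) : cutoff ξ = cutoff η := by
  unfold cutoff; rw [h]

/-- The cut-off at scale `c`, as a Schwartz function. -/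
def cutoffS (d : ℕ) : 𝓢(Euc d, ℂ) := hasCompactSupport_cutoff.toSchwartzMap contDiff_cutoff

theorem cutoffS_apply (ξ : Euc d) : cutoffS d ξ = cutoff ξ := rfl

theorem dyadicKernel_eq (n : ℕ) : dyadicKernel n = realKernel
    ((hasCompactSupport_dyadicSymbol n).toSchwartzMap (contDiff_dyadicSymbol n) :
      𝓢(Euc d, ℂ)) := rfl

/-- The cut-off at twice the scale equals one on the support of the cut-off, so convolution with its
kernel fixes `dyadicKernel 0`. At low frequencies the transform of a Gaussian combination may
vanish, so no division is attempted here. -/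
theorem exists_isReproducing_zero : ∃ H : 𝓢(Euc d, ℝ),
    IsReproducing H H (dyadicKernel 0 : 𝓢(Euc d, ℝ)) := by
  set s := dilateSymbol 2 two_ne_zero (cutoffS d) with hs
  have hs' : ∀ ξ : Euc d, s ξ = cutoff ((2 : ℝ)⁻¹ • ξ) := fun ξ => rfl
  have hre : ∀ ξ, (starRingEnd ℂ) (s ξ) = s ξ := fun ξ => conj_cutoff _
  have heven : ∀ ξ, s (-ξ) = s ξ := fun ξ => cutoff_congr (by simp)
  have hm : ∀ ξ, s ξ * cutoffS d ξ = cutoffS d ξ := by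
    intro ξ
    rw [cutoffS_apply, hs']
    rcases le_or_gt 2 (‖ξ‖ ^ 2) with h | h
    · rw [cutoff_eq_zero h, mul_zero]
    · rw [cutoff_eq_one, one_mul]
      rw [norm_smul, norm_inv, Real.norm_ofNat]
      nlinarith [norm_nonneg ξ]
  refine ⟨realKernel s, realKernel (cutoffS d), fun v => realKernel_eq_integral
    (realKernel s).integrable (fun ξ => ?_) v, fun v => realKernel_eq_integral
    (realKernel s).integrable (fun ξ => ?_) v⟩
  · rw [fourier_realKernel hre heven, hm]; rfl
  · rw [fourier_realKernel hre heven]; exact hm ξ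

/-- Dilated reproducing kernels, for a kernel whose Fourier transform does not vanish near
infinity. -/
theorem exists_isReproducing_succ {A : Euc d → ℝ}
    (hA : ∀ k : ℕ, Integrable fun u => ‖u‖ ^ k * A u) {W : Euc d → ℝ}
    (hW : ∀ ξ, 𝓕 (fun u => (A u : ℂ)) ξ = W ξ) (hWs : ContDiff ℝ (⊤ : ℕ∞) W)
    (heven : ∀ ξ, W (-ξ) = W ξ) {ρ : ℝ} (hρ : ∀ ξ, ρ ≤ ‖ξ‖ → W ξ ≠ 0) :
    ∃ l : ℝ, 0 < l ∧ ∃ H : 𝓢(Euc d, ℝ), ∀ n : ℕ,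
      IsReproducing (dilate (2 ^ (n + 1) * l) A) (dilate (2 ^ (n + 1)) H)
        (dyadicKernel (n + 1) : 𝓢(Euc d, ℝ)) := by
  set ε : ℝ := 4 * max ρ 1 with hε
  have hε0 : 0 < ε := by positivity
  have hW0 : ∀ ξ : Euc d, 4⁻¹ ≤ ‖ξ‖ → W (ε • ξ) ≠ 0 := by
    intro ξ hξ
    refine hρ _ ?_
    rw [norm_smul, Real.norm_eq_abs, abs_of_pos hε0]
    calc ρ ≤ max ρ 1 := le_max_left _ _
      _ = ε * 4⁻¹ := by rw [hε]; ring
      _ ≤ _ := by gcongr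
  have hWs' : ContDiff ℝ (⊤ : ℕ∞) fun ξ => ((W (ε • ξ) : ℝ) : ℂ) :=
    Complex.ofRealCLM.contDiff.comp (hWs.comp (contDiff_const_smul _))
  -- division of a symbol supported away from the origin
  have hdiv : ∀ s : Euc d → ℂ, ContDiff ℝ (⊤ : ℕ∞) s → (∀ ξ, ‖ξ‖ ≤ 4⁻¹ → s ξ = 0) →
      ContDiff ℝ (⊤ : ℕ∞) fun ξ => s ξ * ((W (ε • ξ) : ℝ) : ℂ)⁻¹ := by
    intro s hs hs0
    rw [contDiff_iff_contDiffAt]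
    intro ξ
    rcases lt_or_ge ‖ξ‖ 4⁻¹ with h | h
    · have : (fun ξ => s ξ * ((W (ε • ξ) : ℝ) : ℂ)⁻¹) =ᶠ[𝓝 ξ] fun _ => 0 := by
        filter_upwards [(isOpen_lt continuous_norm continuous_const).mem_nhds h] with η hη
        rw [hs0 η (le_of_lt hη), zero_mul]
      exact contDiffAt_const.congr_of_eventuallyEq this
    · exact hs.contDiffAt.mul (hWs'.contDiffAt.inv (by exact_mod_cast hW0 ξ h))
  set ψ : Euc d → ℂ := fun ξ => cutoff ξ - cutoff ((2 : ℝ) • ξ) with hψ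
  -- A wider annular cut-off, equal to one wherever `ψ` is nonzero and zero for `‖ξ‖ ≤ 1/4`.
  -- Dividing it by the transform of `A` gives the symbol of `H`.
  set Ψ : Euc d → ℂ := fun ξ => cutoff ((2 : ℝ)⁻¹ • ξ) - cutoff ((4 : ℝ) • ξ) with hΨ
  have hψs : ContDiff ℝ (⊤ : ℕ∞) ψ :=
    contDiff_cutoff.sub (contDiff_cutoff.comp (contDiff_const_smul _))
  have hΨs : ContDiff ℝ (⊤ : ℕ∞) Ψ :=
    (contDiff_cutoff.comp (contDiff_const_smul _)).sub
      (contDiff_cutoff.comp (contDiff_const_smul _))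
  have hψc : HasCompactSupport ψ :=
    hasCompactSupport_cutoff.sub (hasCompactSupport_cutoff.comp_smul (by positivity))
  have hΨc : HasCompactSupport Ψ :=
    (hasCompactSupport_cutoff.comp_smul (by positivity)).sub
      (hasCompactSupport_cutoff.comp_smul (by positivity))
  have hΨ0 : ∀ ξ, ‖ξ‖ ≤ 4⁻¹ → Ψ ξ = 0 := by
    intro ξ hξ
    simp only [hΨ]
    rw [cutoff_eq_one, cutoff_eq_one, sub_self]
    · rw [norm_smul, Real.norm_ofNat]; linarith
    · rw [norm_smul, norm_inv, Real.norm_ofNat]; linarith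
  have hψ0 : ∀ ξ, ‖ξ‖ ≤ 2⁻¹ → ψ ξ = 0 := by
    intro ξ hξ
    simp only [hψ]
    rw [cutoff_eq_one (by linarith), cutoff_eq_one, sub_self]
    rw [norm_smul, Real.norm_ofNat]; linarith
  have hm : ∀ ξ, Ψ ξ * ψ ξ = ψ ξ := by
    intro ξ
    rcases le_or_gt ‖ξ‖ 2⁻¹ with h | h
    · rw [hψ0 ξ h, mul_zero]
    rcases le_or_gt 2 (‖ξ‖ ^ 2) with h' | h'
    · have : ψ ξ = 0 := by
        simp only [hψ]
        rw [cutoff_eq_zero h', cutoff_eq_zero, sub_self]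
        rw [norm_smul, Real.norm_ofNat]; nlinarith
      rw [this, mul_zero]
    · have : Ψ ξ = 1 := by
        simp only [hΨ]
        rw [cutoff_eq_one, cutoff_eq_zero, sub_zero]
        · rw [norm_smul, Real.norm_ofNat]; nlinarith
        · rw [norm_smul, norm_inv, Real.norm_ofNat]; nlinarith [norm_nonneg ξ]
      rw [this, one_mul]
  let s : 𝓢(Euc d, ℂ) := hψc.toSchwartzMap hψs
  let sJ : 𝓢(Euc d, ℂ) := HasCompactSupport.toSchwartzMap (hψc.mul_right)
    (hdiv ψ hψs fun ξ hξ => hψ0 ξ (by linarith))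
  let sH : 𝓢(Euc d, ℂ) := HasCompactSupport.toSchwartzMap (hΨc.mul_right) (hdiv Ψ hΨs hΨ0)
  have hsH : ∀ ξ, sH ξ = Ψ ξ * ((W (ε • ξ) : ℝ) : ℂ)⁻¹ := fun ξ => rfl
  have hsJ : ∀ ξ, sJ ξ = ψ ξ * ((W (ε • ξ) : ℝ) : ℂ)⁻¹ := fun ξ => rfl
  have hs : ∀ ξ, s ξ = ψ ξ := fun ξ => rfl
  refine ⟨ε⁻¹, by positivity, realKernel sH, fun n => ?_⟩
  have hA' := integrable_dilate_moment (c := ε⁻¹) (by positivity) hA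
  have h := isReproducing_dilate (A := dilate ε⁻¹ A) hA' (sH := sH) (sJ := sJ) (s := s)
    (fun ξ => by rw [hsH, map_mul, map_inv₀, Complex.conj_ofReal, hΨ]
                 simp only [map_sub, conj_cutoff])
    (fun ξ => by rw [hsH, hsH, smul_neg, heven, hΨ]
                 simp only [smul_neg]
                 rw [cutoff_congr (norm_neg _), cutoff_congr (norm_neg _)])
    (fun ξ => by
      rw [fourier_dilate (by positivity), inv_inv, hW, hsJ, hs]
      rcases le_or_gt ‖ξ‖ 2⁻¹ with h | h
      · rw [hψ0 ξ h]; simp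
      · have : ((W (ε • ξ) : ℝ) : ℂ) ≠ 0 := by
          exact_mod_cast hW0 ξ (by linarith)
        field_simp)
    (fun ξ => by rw [hsH, hs, hsJ, mul_right_comm, hm])
    (c := 2 ^ (n + 1)) (by positivity)
  have e1 : dilate (2 ^ (n + 1)) (dilate ε⁻¹ A) = dilate (2 ^ (n + 1) * ε⁻¹) A := by
    funext x
    simp only [dilate, smul_smul, mul_pow]
    rw [mul_comm ε⁻¹]
    ring
  have e2 : (dyadicKernel (n + 1) : 𝓢(Euc d, ℝ))
      = realKernel (dilateSymbol (2 ^ (n + 1)) (by positivity) s) := by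
    rw [dyadicKernel_eq]
    congr 1
    ext ξ
    rw [dilateSymbol_apply, hs]
    change cutoff (((2 : ℝ) ^ (n + 1))⁻¹ • ξ) - cutoff (((2 : ℝ) ^ n)⁻¹ • ξ)
      = cutoff (((2 : ℝ) ^ (n + 1))⁻¹ • ξ) - cutoff ((2 : ℝ) • ((2 : ℝ) ^ (n + 1))⁻¹ • ξ)
    rw [smul_smul]
    congr 4
    field_simp
    ring
  rw [e1] at h
  rw [e2]
  exact h

end Kernels

/-! ### Gaussian kernels adapted to the difference operators -/

section DiffOp

/-- The value `b 0 = 1` serves the mass bound, where only the largest ball meets the measure. The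
nonzero last coefficient makes the slowest Gaussian survive at high frequency. The vanishing beyond
`k + 1` aligns the two sums in the recursion. -/
theorem exists_diffOp_eq_sum (k : ℕ) : ∃ b : ℕ → ℝ, b 0 = 1 ∧ b (k + 1) ≠ 0 ∧
    (∀ j, k + 1 < j → b j = 0) ∧
    ∀ F r, diffOp k F r = ∑ j ∈ Finset.range (k + 2), b j * F (r / 2 ^ j) := by
  induction k with
  | zero =>
    refine ⟨fun j => if j = 0 then 1 else if j = 1 then -1 else 0, by simp, by simp,
      fun j hj => ?_, fun F r => ?_⟩
    · have h1 : j ≠ 0 := by omega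
      have h2 : j ≠ 1 := by omega
      simp [h1, h2]
    · simp [diffOp, Finset.sum_range_succ]
      ring
  | succ k ih =>
    obtain ⟨b, h0, h1, h2, h⟩ := ih
    refine ⟨fun j => b j - 2 ^ (k + 1) * (if j = 0 then 0 else b (j - 1)), by simp [h0], ?_,
      fun j hj => ?_, fun F r => ?_⟩
    · simp [h2 (k + 1 + 1) (by omega), h1]
    · have hj0 : j ≠ 0 := by omega
      simp [h2 j (by omega), h2 (j - 1) (by omega), hj0]
    · simp only [diffOp, h]
      rw [Finset.sum_congr rfl fun j _ => sub_mul _ _ _, Finset.sum_sub_distrib]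
      congr 1
      · rw [Finset.sum_range_succ _ (k + 2), h2 (k + 2) (by omega)]
        ring
      · rw [Finset.sum_range_succ' _ (k + 2), Finset.mul_sum]
        simp only [Nat.add_eq_zero_iff, one_ne_zero, and_false, if_false, if_true, mul_zero,
          zero_mul, add_zero, Nat.add_sub_cancel]
        refine Finset.sum_congr rfl fun j _ => ?_
        rw [mul_assoc, div_div, pow_succ' 2 j]

end DiffOp

section Gauss

variable {d : ℕ}

theorem pow_mul_exp_neg_le {b : ℝ} (hb : 0 < b) (m : ℕ) :
    ∃ C : ℝ, ∀ t : ℝ, 0 ≤ t → t ^ m * Real.exp (-b * t ^ 2) ≤ C := by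
  refine ⟨1 + m.factorial / b ^ m, fun t ht => ?_⟩
  have h1 := Real.pow_div_factorial_le_exp (b * t ^ 2) (by positivity) m
  have hpos := Real.exp_pos (b * t ^ 2)
  have h2 : (t ^ 2) ^ m * Real.exp (-b * t ^ 2) ≤ m.factorial / b ^ m := by
    rw [neg_mul, Real.exp_neg, ← div_eq_mul_inv, div_le_div_iff₀ hpos (by positivity)]
    rw [div_le_iff₀ (by positivity), mul_pow] at h1
    linarith
  have h3 : t ^ m ≤ 1 + (t ^ 2) ^ m := by
    rcases le_total t 1 with h | h
    · have : t ^ m ≤ 1 := pow_le_one₀ ht h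
      have : 0 ≤ (t ^ 2) ^ m := by positivity
      linarith
    · have : t ^ m ≤ (t ^ 2) ^ m := by gcongr; nlinarith
      linarith
  have h4 : Real.exp (-b * t ^ 2) ≤ 1 := Real.exp_le_one_iff.2 (by nlinarith [sq_nonneg t])
  have h5 := Real.exp_pos (-b * t ^ 2)
  nlinarith

theorem integrable_moment_gaussian {b : ℝ} (hb : 0 < b) (k : ℕ) :
    Integrable fun u : Euc d => ‖u‖ ^ k * Real.exp (-b * ‖u‖ ^ 2) := by
  obtain ⟨C, hC⟩ := pow_mul_exp_neg_le hb (k + (volume : Measure (Euc d)).integrablePower)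
  have := integrable_of_le_of_pow_mul_le (μ := (volume : Measure (Euc d))) (k := k) (C₁ := 1)
    (C₂ := C) (f := fun u : Euc d => Real.exp (-b * ‖u‖ ^ 2)) (fun u => ?_) (fun u => ?_)
    (Continuous.aestronglyMeasurable (by fun_prop))
  · simpa using this
  · rw [Real.norm_eq_abs, abs_of_pos (Real.exp_pos _), Real.exp_le_one_iff]
    nlinarith [sq_nonneg ‖u‖]
  · rw [Real.norm_eq_abs, abs_of_pos (Real.exp_pos _)]
    exact hC _ (norm_nonneg u)

/-- Combinations of dilated Gaussians. -/
def gaussComb (b : ℕ → ℝ) (m : ℕ) (v : Euc d) : ℝ :=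
  ∑ j ∈ Finset.range m, b j * Real.exp (-(Real.pi * 4 ^ j) * ‖v‖ ^ 2)

theorem continuous_gaussComb (b : ℕ → ℝ) (m : ℕ) : Continuous (gaussComb (d := d) b m) := by
  unfold gaussComb; fun_prop

theorem norm_gaussComb_le (b : ℕ → ℝ) (m : ℕ) (v : Euc d) :
    ‖gaussComb b m v‖ ≤ ∑ j ∈ Finset.range m, ‖b j‖ := by
  refine (norm_sum_le _ _).trans (Finset.sum_le_sum fun j _ => ?_)
  rw [norm_mul, Real.norm_eq_abs (Real.exp _), abs_of_pos (Real.exp_pos _)]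
  refine mul_le_of_le_one_right (norm_nonneg _) (Real.exp_le_one_iff.2 ?_)
  have : 0 ≤ Real.pi * 4 ^ j * ‖v‖ ^ 2 := by positivity
  linarith

theorem integrable_moment_gaussComb (b : ℕ → ℝ) (m k : ℕ) :
    Integrable fun u : Euc d => ‖u‖ ^ k * gaussComb b m u := by
  simp only [gaussComb, Finset.mul_sum]
  refine integrable_finsetSum _ fun j _ => ?_
  have := (integrable_moment_gaussian (d := d) (b := Real.pi * 4 ^ j) (by positivity) k).const_mul
    (b j)
  refine this.congr (Eventually.of_forall fun u => ?_)
  ring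

/-- The Fourier transform of `gaussComb`. -/
def gaussCombHat (d : ℕ) (b : ℕ → ℝ) (m : ℕ) (ξ : Euc d) : ℝ :=
  ∑ j ∈ Finset.range m, b j * ((((4 : ℝ) ^ j)⁻¹) ^ ((d : ℝ) / 2)
    * Real.exp (-(Real.pi * (4 ^ j)⁻¹) * ‖ξ‖ ^ 2))

theorem fourier_gaussComb (b : ℕ → ℝ) (m : ℕ) (ξ : Euc d) :
    𝓕 (fun u : Euc d => (gaussComb b m u : ℂ)) ξ = gaussCombHat d b m ξ := by
  have h1 : ∀ j : ℕ, 𝓕 (fun u : Euc d => Complex.exp (-((Real.pi * 4 ^ j : ℝ) : ℂ) * ‖u‖ ^ 2)) ξ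
      = (((((4 : ℝ) ^ j)⁻¹) ^ ((d : ℝ) / 2)
        * Real.exp (-(Real.pi * (4 ^ j)⁻¹) * ‖ξ‖ ^ 2) : ℝ) : ℂ) := by
    intro j
    rw [fourier_gaussian_innerProductSpace (by rw [Complex.ofReal_re]; positivity),
      Complex.ofReal_mul ((((4 : ℝ) ^ j)⁻¹) ^ ((d : ℝ) / 2)),
      Complex.ofReal_cpow (show (0 : ℝ) ≤ ((4 : ℝ) ^ j)⁻¹ by positivity), Complex.ofReal_exp,
      finrank_euclideanSpace_fin]
    have hpi : (Real.pi : ℂ) ≠ 0 := by exact_mod_cast Real.pi_ne_zero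
    congr 2
    · push_cast
      field_simp
    · push_cast
      rfl
    · push_cast
      field_simp
  have hint : ∀ j : ℕ, Integrable fun u : Euc d =>
      Complex.exp (-((Real.pi * 4 ^ j : ℝ) : ℂ) * ‖u‖ ^ 2) := by
    intro j
    have := (integrable_moment_gaussian (d := d) (b := Real.pi * 4 ^ j) (by positivity) 0).ofReal
      (𝕜 := ℂ)
    refine this.congr (Eventually.of_forall fun u => ?_)
    simp
  have h2 : (fun u : Euc d => (gaussComb b m u : ℂ)) = fun u => ∑ j ∈ Finset.range m,
      (b j : ℂ) • Complex.exp (-((Real.pi * 4 ^ j : ℝ) : ℂ) * ‖u‖ ^ 2) := by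
    funext u
    simp [gaussComb]
  rw [h2, Real.fourier_eq]
  simp only [Finset.smul_sum]
  rw [integral_finsetSum _ fun j _ => ?_]
  · unfold gaussCombHat
    rw [Complex.ofReal_sum]
    refine Finset.sum_congr rfl fun j _ => ?_
    rw [Complex.ofReal_mul (b j), ← h1, Real.fourier_eq, ← integral_const_mul]
    refine integral_congr_ae (Eventually.of_forall fun u => ?_)
    simp only
    rw [smul_comm, smul_eq_mul]
  · exact (Real.fourierIntegral_convergent_iff ξ).2 ((hint j).smul (b j : ℂ))

theorem contDiff_gaussCombHat (b : ℕ → ℝ) (m : ℕ) :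
    ContDiff ℝ (⊤ : ℕ∞) (gaussCombHat d b m) := by
  unfold gaussCombHat
  refine ContDiff.sum fun j _ => contDiff_const.mul (contDiff_const.mul
    (Real.contDiff_exp.comp (contDiff_const.mul (contDiff_norm_sq ℝ))))

/-- The slowest Gaussian dominates at infinity. -/
theorem exists_gaussCombHat_ne_zero {b : ℕ → ℝ} {m : ℕ} (hb : b m ≠ 0) :
    ∃ ρ : ℝ, ∀ ξ : Euc d, ρ ≤ ‖ξ‖ → gaussCombHat d b (m + 1) ξ ≠ 0 := by
  set c : ℕ → ℝ := fun j => b j * (((4 : ℝ) ^ j)⁻¹) ^ ((d : ℝ) / 2) with hc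
  have hcm : c m ≠ 0 := mul_ne_zero hb (by positivity)
  -- The slowest exponential, the one with the factor `4 ^ (-m)`, is factored out. Every other term
  -- then decays and `g` tends to `c m`.
  set g : ℝ → ℝ := fun t => ∑ j ∈ Finset.range m, c j *
    Real.exp (-(Real.pi * ((4 ^ j)⁻¹ - (4 ^ m)⁻¹) * t)) + c m with hg
  have hlim : Tendsto g atTop (𝓝 (c m)) := by
    have h1 : Tendsto (fun t => ∑ j ∈ Finset.range m, c j *
        Real.exp (-(Real.pi * ((4 ^ j)⁻¹ - (4 ^ m)⁻¹) * t))) atTop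
        (𝓝 (∑ j ∈ Finset.range m, c j * 0)) := by
      refine tendsto_finsetSum _ fun j hj => Tendsto.const_mul _ ?_
      refine Real.tendsto_exp_neg_atTop_nhds_zero.comp (Tendsto.const_mul_atTop ?_ tendsto_id)
      refine mul_pos Real.pi_pos (sub_pos.2 ?_)
      exact inv_strictAnti₀ (by positivity)
        (pow_lt_pow_right₀ (by norm_num) (Finset.mem_range.1 hj))
    simpa using h1.add_const (c m)
  obtain ⟨t₀, ht₀⟩ := (hlim.eventually_ne hcm).exists_forall_of_atTop
  refine ⟨max t₀ 1, fun ξ hξ => ?_⟩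
  have h1 : t₀ ≤ ‖ξ‖ ^ 2 := by
    have h2 := le_trans (le_max_left _ _) hξ
    have h3 := le_trans (le_max_right _ _) hξ
    nlinarith
  have h4 : gaussCombHat d b (m + 1) ξ
      = Real.exp (-(Real.pi * (4 ^ m)⁻¹) * ‖ξ‖ ^ 2) * g (‖ξ‖ ^ 2) := by
    rw [hg]
    simp only [gaussCombHat]
    rw [Finset.sum_range_succ, mul_add, Finset.mul_sum]
    congr 1
    · refine Finset.sum_congr rfl fun j _ => ?_
      rw [hc]
      simp only
      rw [mul_left_comm (Real.exp _), ← Real.exp_add, mul_assoc]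
      congr 3
      ring
    · rw [hc]; ring
  rw [h4]
  exact mul_ne_zero (Real.exp_pos _).ne' (ht₀ _ h1)

/-- The weight with `e^{-π x²} = ∫_{r > x} w(r) dr` after scaling. -/
def gaussWeight (l r : ℝ) : ℝ := 2 * Real.pi * l ^ 2 * r * Real.exp (-(Real.pi * l ^ 2) * r ^ 2)

theorem gaussWeight_nonneg {l r : ℝ} (hr : 0 ≤ r) : 0 ≤ gaussWeight l r := by
  unfold gaussWeight; positivity

theorem hasDerivAt_exp_gauss (l r : ℝ) :
    HasDerivAt (fun r => -Real.exp (-(Real.pi * l ^ 2) * r ^ 2)) (gaussWeight l r) r := by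
  have h := (((hasDerivAt_id r).pow 2).const_mul (-(Real.pi * l ^ 2))).exp.neg
  refine h.congr_deriv ?_
  unfold gaussWeight
  simp
  ring

theorem tendsto_exp_gauss {l : ℝ} (hl : 0 < l) :
    Tendsto (fun r => -Real.exp (-(Real.pi * l ^ 2) * r ^ 2)) atTop (𝓝 0) := by
  have h1 : Tendsto (fun r : ℝ => Real.pi * l ^ 2 * r ^ 2) atTop atTop :=
    Tendsto.const_mul_atTop (by positivity) (tendsto_pow_atTop two_ne_zero)
  have h2 := (Real.tendsto_exp_neg_atTop_nhds_zero.comp h1).neg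
  simpa [Function.comp_def, neg_mul] using h2

theorem integrableOn_gaussWeight {l x : ℝ} (hl : 0 < l) (hx : 0 ≤ x) :
    IntegrableOn (gaussWeight l) (Ioi x) :=
  integrableOn_Ioi_deriv_of_nonneg' (fun r _ => hasDerivAt_exp_gauss l r)
    (fun _ hr => gaussWeight_nonneg (hx.trans (le_of_lt hr))) (tendsto_exp_gauss hl)

theorem integral_gaussWeight {l x : ℝ} (hl : 0 < l) (hx : 0 ≤ x) :
    ∫ r in Ioi x, gaussWeight l r = Real.exp (-(Real.pi * l ^ 2) * x ^ 2) := by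
  rw [integral_Ioi_of_hasDerivAt_of_nonneg' (fun r _ => hasDerivAt_exp_gauss l r)
    (fun _ hr => gaussWeight_nonneg (hx.trans (le_of_lt hr))) (tendsto_exp_gauss hl)]
  ring

/-- Layer cake formula for Gaussian averages. -/
theorem integral_gauss_eq {l : ℝ} (hl : 0 < l) (μ : Measure (Euc d)) [IsFiniteMeasure μ]
    (v : Euc d) {c : ℝ} (hc : 0 < c) :
    ∫ y, Real.exp (-(Real.pi * l ^ 2) * (c * dist y v) ^ 2) ∂μ
      = ∫ r in Ioi (0 : ℝ), μ.real (Metric.closedBall v (r / c)) * gaussWeight l r := by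
  -- Fubini on this set: integrating first in `r` gives the Gaussian, integrating first in `y` gives
  -- the mass of a ball.
  set S : Set (Euc d × ℝ) := {a | c * dist a.1 v ≤ a.2} with hS
  have hSm : MeasurableSet S := (isClosed_le (by fun_prop) (by fun_prop)).measurableSet
  have hint : Integrable (S.indicator fun a : Euc d × ℝ => gaussWeight l a.2)
      (μ.prod (volume.restrict (Ioi (0 : ℝ)))) :=
    ((integrableOn_gaussWeight hl le_rfl).integrable.comp_snd μ).indicator hSm
  have h1 : ∀ y, ∫ r in Ioi (0 : ℝ), S.indicator (fun a : Euc d × ℝ => gaussWeight l a.2) (y, r)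
      = Real.exp (-(Real.pi * l ^ 2) * (c * dist y v) ^ 2) := by
    intro y
    have hx : 0 ≤ c * dist y v := by positivity
    rw [← integral_gaussWeight hl hx]
    have h2 : (fun r => S.indicator (fun a : Euc d × ℝ => gaussWeight l a.2) (y, r))
        = (Ici (c * dist y v)).indicator (gaussWeight l) := rfl
    rw [h2, setIntegral_indicator measurableSet_Ici]
    refine setIntegral_congr_set ?_
    have h3 : (Ioi (0 : ℝ) ∩ Ici (c * dist y v) : Set ℝ) =ᵐ[volume]
        (Ioi (0 : ℝ) ∩ Ioi (c * dist y v) : Set ℝ) := (ae_eq_refl _).inter Ioi_ae_eq_Ici.symm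
    refine h3.trans (Eventually.of_forall fun r => ?_)
    simp only [eq_iff_iff]
    exact ⟨fun h => h.2, fun h => ⟨lt_of_le_of_lt hx h, h⟩⟩
  have h4 : ∀ r, ∫ y, S.indicator (fun a : Euc d × ℝ => gaussWeight l a.2) (y, r) ∂μ
      = μ.real (Metric.closedBall v (r / c)) * gaussWeight l r := by
    intro r
    have h2 : (fun y => S.indicator (fun a : Euc d × ℝ => gaussWeight l a.2) (y, r))
        = (Metric.closedBall v (r / c)).indicator fun _ => gaussWeight l r := by
      funext y
      simp only [Set.indicator, hS, mem_ofPred_eq, Metric.mem_closedBall, le_div_iff₀ hc,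
        mul_comm c]
    rw [h2, integral_indicator_const _ measurableSet_closedBall, smul_eq_mul]
  have h5 := integral_integral_swap (f := fun y r =>
    S.indicator (fun a : Euc d × ℝ => gaussWeight l a.2) (y, r)) hint
  simp_rw [h1, h4] at h5
  exact h5

/-- Averages of Gaussian combinations, in terms of difference operators of ball masses. -/
theorem integral_dilate_gaussComb {b : ℕ → ℝ} {m : ℕ} {l : ℝ} (hl : 0 < l) (μ : Measure (Euc d))
    [IsFiniteMeasure μ] (v : Euc d) :
    ∫ y, dilate l (gaussComb b m) (v - y) ∂μ = l ^ d * ∫ r in Ioi (0 : ℝ),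
      (∑ j ∈ Finset.range m, b j * μ.real (Metric.closedBall v (r / 2 ^ j))) * gaussWeight l r := by
  -- As `4 ^ j = (2 ^ j) ^ 2`, the `j`-th Gaussian is the basic one at distance scaled by `2 ^ j`;
  -- the layer cake formula converts this scaling into the radius `r / 2 ^ j` of the difference
  -- operator.
  have h1 : ∀ y, dilate l (gaussComb b m) (v - y) = l ^ d * ∑ j ∈ Finset.range m,
      b j * Real.exp (-(Real.pi * l ^ 2) * (2 ^ j * dist y v) ^ 2) := by
    intro y
    unfold dilate gaussComb
    congr 1
    refine Finset.sum_congr rfl fun j _ => ?_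
    rw [norm_smul, Real.norm_eq_abs, mul_pow, sq_abs, ← dist_eq_norm, dist_comm v y, mul_pow,
      ← pow_mul, mul_comm j 2, pow_mul]
    norm_num
    left
    ring
  have hint : ∀ j, Integrable (fun y => b j *
      Real.exp (-(Real.pi * l ^ 2) * (2 ^ j * dist y v) ^ 2)) μ := by
    intro j
    refine Integrable.const_mul (Integrable.of_bound
      (Continuous.aestronglyMeasurable (by fun_prop)) 1 (Eventually.of_forall fun y => ?_)) _
    rw [Real.norm_eq_abs, abs_of_pos (Real.exp_pos _), Real.exp_le_one_iff]
    have : 0 ≤ Real.pi * l ^ 2 * (2 ^ j * dist y v) ^ 2 := by positivity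
    linarith
  have hint' : ∀ j, IntegrableOn (fun r => b j *
      (μ.real (Metric.closedBall v (r / 2 ^ j)) * gaussWeight l r)) (Ioi (0 : ℝ)) := by
    intro j
    refine Integrable.const_mul (Integrable.bdd_mul (c := μ.real univ)
      (integrableOn_gaussWeight hl le_rfl) ?_ (Eventually.of_forall fun r => ?_)) _
    · have hmono : Monotone fun r : ℝ => μ.real (Metric.closedBall v (r / 2 ^ j)) :=
        fun r s hrs => measureReal_mono (Metric.closedBall_subset_closedBall (by gcongr))
      exact hmono.measurable.aestronglyMeasurable
    · rw [Real.norm_eq_abs, abs_of_nonneg measureReal_nonneg]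
      exact measureReal_mono (subset_univ _)
  simp_rw [h1]
  rw [integral_const_mul, integral_finsetSum _ fun j _ => hint j]
  congr 1
  simp_rw [integral_const_mul, integral_gauss_eq hl μ v (show (0 : ℝ) < 2 ^ _ by positivity),
    Finset.sum_mul, mul_assoc]
  rw [integral_finsetSum _ fun j _ => hint' j]
  simp_rw [integral_const_mul]

end Gauss

/-! ### Small ball estimates -/

section SbeEstimates

variable {d : ℕ}

theorem div_eq_mul_rpow {p : ℝ} (hp : 0 < p) (a c : ℝ≥0∞) :
    a ^ p / c = (a * c⁻¹ ^ (1 / p)) ^ p := by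
  rw [ENNReal.mul_rpow_of_nonneg _ _ hp.le, ← ENNReal.rpow_mul, one_div_mul_cancel hp.ne',
    ENNReal.rpow_one, div_eq_mul_inv]

/-- Jensen's inequality with respect to a weight dominated by `dr / r`. -/
theorem lintegral_mul_le_of_le_div {p : ℝ} (hp : 1 ≤ p) {h ρ : ℝ → ℝ≥0∞} (hh : Measurable h)
    (hρm : Measurable ρ) {K L : ℝ≥0∞} (hρ : ∀ r : ℝ, 0 < r → ρ r ≤ K / ENNReal.ofReal r)
    (hL : ∫⁻ r in Ioi (0 : ℝ), ρ r ≤ L) :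
    ∫⁻ r in Ioi (0 : ℝ), h r * ρ r ≤ K ^ (1 / p) * L ^ (1 - 1 / p)
      * (∫⁻ r in Ioi (0 : ℝ), h r ^ p / ENNReal.ofReal r) ^ (1 / p) := by
  have hp0 : 0 < p := by linarith
  have hp1 : 0 ≤ 1 - 1 / p := one_sub_one_div_nonneg hp
  have hp2 : 0 ≤ 1 / p := by positivity
  set f : ℝ → ℝ≥0∞ := fun r => h r ^ p / ENNReal.ofReal r with hf
  have hfm : Measurable f := by
    refine (hh.pow_const p).div ENNReal.measurable_ofReal
  -- Only the power `1/p` of the weight is compared with `K / r`; the complementary power keeps its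
  -- own integral for Hölder's inequality.
  have hpt : ∀ r ∈ Ioi (0 : ℝ), h r * ρ r ≤ K ^ (1 / p) * (f r ^ (1 / p) * ρ r ^ (1 - 1 / p)) := by
    intro r hr
    have h1 : f r ^ (1 / p) = h r * (ENNReal.ofReal r)⁻¹ ^ (1 / p) := by
      rw [hf]
      simp only
      rw [div_eq_mul_rpow hp0, ← ENNReal.rpow_mul, mul_one_div_cancel hp0.ne', ENNReal.rpow_one]
    have h2 : ρ r = ρ r ^ (1 / p) * ρ r ^ (1 - 1 / p) := by
      rw [← ENNReal.rpow_add_of_nonneg _ _ hp2 hp1]; simp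
    have h3 : ρ r ^ (1 / p) ≤ K ^ (1 / p) * (ENNReal.ofReal r)⁻¹ ^ (1 / p) := by
      rw [← ENNReal.mul_rpow_of_nonneg _ _ hp2, ← div_eq_mul_inv]
      exact ENNReal.rpow_le_rpow (hρ r hr) hp2
    calc h r * ρ r = h r * (ρ r ^ (1 / p) * ρ r ^ (1 - 1 / p)) := by rw [← h2]
      _ ≤ h r * ((K ^ (1 / p) * (ENNReal.ofReal r)⁻¹ ^ (1 / p)) * ρ r ^ (1 - 1 / p)) := by gcongr
      _ = _ := by rw [h1]; ring
  calc ∫⁻ r in Ioi (0 : ℝ), h r * ρ r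
      ≤ ∫⁻ r in Ioi (0 : ℝ), K ^ (1 / p) * (f r ^ (1 / p) * ρ r ^ (1 - 1 / p)) :=
        setLIntegral_mono' measurableSet_Ioi hpt
    _ = K ^ (1 / p) * ∫⁻ r in Ioi (0 : ℝ), f r ^ (1 / p) * ρ r ^ (1 - 1 / p) := by
        rw [lintegral_const_mul]
        exact (hfm.pow_const _).mul (hρm.pow_const _)
    _ ≤ K ^ (1 / p) * ((∫⁻ r in Ioi (0 : ℝ), f r) ^ (1 / p)
          * (∫⁻ r in Ioi (0 : ℝ), ρ r) ^ (1 - 1 / p)) := by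
        gcongr
        exact ENNReal.lintegral_mul_norm_pow_le hfm.aemeasurable hρm.aemeasurable hp2 hp1
          (by ring)
    _ ≤ K ^ (1 / p) * ((∫⁻ r in Ioi (0 : ℝ), f r) ^ (1 / p) * L ^ (1 - 1 / p)) := by
        gcongr
    _ = _ := by ring

/-- Scaling bounds for the weight `r ^ β` times `gaussWeight`. -/
theorem exists_gaussWeight_bounds {β : ℝ} (hβ : 0 < β) : ∃ C : ℝ, 0 < C ∧ ∀ l : ℝ, 0 < l →
    (∀ r : ℝ, 0 < r → r ^ β * gaussWeight l r ≤ l ^ (-β) * C / r) ∧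
    ∫⁻ r in Ioi (0 : ℝ), ENNReal.ofReal (r ^ β * gaussWeight l r)
      ≤ ENNReal.ofReal (l ^ (-β) * C) := by
  -- The weight at unit scale. The weight at scale `l` is `l ^ (-β)` times the `L¹`-normalised
  -- dilation of `κ`, so both bounds reduce to `l = 1`.
  set κ : ℝ → ℝ := fun s => 2 * Real.pi * (s ^ (β + 1) * Real.exp (-Real.pi * s ^ 2)) with hκ
  have hint : IntegrableOn κ (Ioi 0) :=
    (integrableOn_rpow_mul_exp_neg_mul_sq Real.pi_pos (by linarith)).const_mul _
  obtain ⟨C₁, hC₁⟩ := pow_mul_exp_neg_le Real.pi_pos ⌈β + 2⌉₊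
  have hbound : ∀ s : ℝ, 0 < s → s * κ s ≤ 2 * Real.pi * (1 + C₁) := by
    intro s hs
    have h1 : s ^ (β + 2) ≤ 1 + s ^ ⌈β + 2⌉₊ := by
      rcases le_total s 1 with h | h
      · have h2 : s ^ (β + 2) ≤ 1 := Real.rpow_le_one hs.le h (by linarith)
        have h3 : 0 ≤ s ^ ⌈β + 2⌉₊ := by positivity
        linarith
      · have h2 : s ^ (β + 2) ≤ s ^ ((⌈β + 2⌉₊ : ℕ) : ℝ) :=
          Real.rpow_le_rpow_of_exponent_le h (Nat.le_ceil _)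
        rw [Real.rpow_natCast] at h2
        linarith
    have h4 : Real.exp (-Real.pi * s ^ 2) ≤ 1 :=
      Real.exp_le_one_iff.2 (by nlinarith [Real.pi_pos, sq_nonneg s])
    have h5 := Real.exp_pos (-Real.pi * s ^ 2)
    have h6 : s * s ^ (β + 1) = s ^ (β + 2) := by
      rw [show β + 2 = (β + 1) + 1 by ring, Real.rpow_add hs (β + 1) 1, Real.rpow_one, mul_comm]
    calc s * κ s = 2 * Real.pi * (s ^ (β + 2) * Real.exp (-Real.pi * s ^ 2)) := by
          rw [hκ, ← h6]; ring
      _ ≤ 2 * Real.pi * ((1 + s ^ ⌈β + 2⌉₊) * Real.exp (-Real.pi * s ^ 2)) := by gcongr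
      _ ≤ _ := by
          have := hC₁ s hs.le
          gcongr
          nlinarith
  set C := max 1 (max (2 * Real.pi * (1 + C₁)) (∫ s in Ioi (0 : ℝ), κ s)) with hC
  have hC0 : 0 < C := lt_of_lt_of_le one_pos (le_max_left _ _)
  refine ⟨C, hC0, fun l hl => ?_⟩
  have hkey : ∀ r : ℝ, 0 < r → r ^ β * gaussWeight l r = l ^ (-β) * (l * κ (l * r)) := by
    intro r hr
    simp only [hκ, gaussWeight]
    rw [Real.mul_rpow hl.le hr.le, Real.rpow_add hl, Real.rpow_add hr, Real.rpow_one,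
      Real.rpow_one, Real.rpow_neg hl.le, mul_pow, ← mul_assoc (-Real.pi)]
    have : l ^ β ≠ 0 := (Real.rpow_pos_of_pos hl β).ne'
    field_simp
  have hlβ : 0 < l ^ (-β) := Real.rpow_pos_of_pos hl _
  refine ⟨fun r hr => ?_, ?_⟩
  · rw [hkey r hr, le_div_iff₀ hr]
    have h1 := hbound (l * r) (by positivity)
    calc l ^ (-β) * (l * κ (l * r)) * r = l ^ (-β) * (l * r * κ (l * r)) := by ring
      _ ≤ _ := by
        gcongr
        exact h1.trans ((le_max_left _ _).trans (le_max_right _ _))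
  · rw [setLIntegral_congr_fun measurableSet_Ioi fun r hr => by rw [hkey r hr]]
    have h1 : IntegrableOn (fun r => l ^ (-β) * (l * κ (l * r))) (Ioi (0 : ℝ)) := by
      have h2 := (integrableOn_Ioi_comp_mul_left_iff κ 0 hl).2 (by simpa using hint)
      exact (h2.const_mul l).const_mul _
    rw [← ofReal_integral_eq_lintegral_ofReal h1]
    · refine ENNReal.ofReal_le_ofReal ?_
      rw [integral_const_mul, integral_const_mul, integral_comp_mul_left_Ioi κ 0 hl, mul_zero,
        smul_eq_mul, ← mul_assoc l, mul_inv_cancel₀ hl.ne', one_mul]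
      gcongr
      exact (le_max_right _ _).trans (le_max_right _ _)
    · refine (ae_restrict_iff' measurableSet_Ioi).2 (Eventually.of_forall fun r hr => ?_)
      have : 0 < l * r := mul_pos hl hr
      simp only [hκ, Pi.zero_apply]
      positivity

/-- The local quantity in the definition of `sbeNorm`. -/
def sbeLocal (α p : ℝ) (μ : Measure (Euc d)) (y : Euc d) : ℝ≥0∞ :=
  (∫⁻ r in Ioi (0 : ℝ),
    ‖r ^ (-α - d) * diffOp ⌈α + d - 1⌉₊ (fun ρ => μ.real (Metric.closedBall y ρ)) r‖ₑ ^ p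
      / ENNReal.ofReal r) ^ (1 / p)

theorem sbeNorm_eq (α p q : ℝ) (μ : Measure (Euc d)) :
    sbeNorm α p q μ = (∫⁻ y, sbeLocal α p μ y ^ q) ^ (1 / q) := rfl

theorem measurable_diffOp_ball (k : ℕ) (μ : Measure (Euc d)) [SFinite μ] :
    Measurable fun a : Euc d × ℝ => diffOp k (fun ρ => μ.real (Metric.closedBall a.1 ρ)) a.2 := by
  obtain ⟨b, -, -, -, hb⟩ := exists_diffOp_eq_sum k
  simp_rw [hb]
  have h1 : Measurable fun a : Euc d × ℝ => μ (Metric.closedBall a.1 a.2) := by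
    have hS : MeasurableSet {x : (Euc d × ℝ) × Euc d | dist x.2 x.1.1 ≤ x.1.2} :=
      (isClosed_le (by fun_prop) (by fun_prop)).measurableSet
    exact measurable_measure_prodMk_left hS
  refine Finset.measurable_sum _ fun j _ => Measurable.const_mul ?_ _
  exact (h1.comp (measurable_fst.prodMk (measurable_snd.div_const _))).ennreal_toReal

theorem measurable_sbe_integrand (α : ℝ) (μ : Measure (Euc d)) [SFinite μ] :
    Measurable fun a : Euc d × ℝ => ‖a.2 ^ (-α - d)
      * diffOp ⌈α + d - 1⌉₊ (fun ρ => μ.real (Metric.closedBall a.1 ρ)) a.2‖ₑ :=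
  ((measurable_snd.pow_const _).mul (measurable_diffOp_ball _ μ)).enorm

theorem measurable_sbeLocal (α p : ℝ) (μ : Measure (Euc d)) [SFinite μ] :
    Measurable (sbeLocal α p μ) := by
  refine Measurable.pow_const (Measurable.lintegral_prod_right' (f := fun a : Euc d × ℝ =>
    ‖a.2 ^ (-α - d) * diffOp ⌈α + d - 1⌉₊ (fun ρ => μ.real (Metric.closedBall a.1 ρ)) a.2‖ₑ ^ p
      / ENNReal.ofReal a.2) ?_) _
  exact ((measurable_sbe_integrand α μ).pow_const p).div
    (ENNReal.measurable_ofReal.comp measurable_snd)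

/-- Triangle inequality for `sbeNorm`. -/
theorem sbeNorm_le_add {α p q : ℝ} (hp : 1 ≤ p) (hq : 1 ≤ q) {μ μ₁ μ₂ : Measure (Euc d)}
    [SFinite μ₁] [SFinite μ₂]
    (h : ∀ y r, |diffOp ⌈α + d - 1⌉₊ (fun ρ => μ.real (Metric.closedBall y ρ)) r|
      ≤ |diffOp ⌈α + d - 1⌉₊ (fun ρ => μ₁.real (Metric.closedBall y ρ)) r|
        + |diffOp ⌈α + d - 1⌉₊ (fun ρ => μ₂.real (Metric.closedBall y ρ)) r|) :
    sbeNorm α p q μ ≤ sbeNorm α p q μ₁ + sbeNorm α p q μ₂ := by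
  have hp0 : 0 < p := by linarith
  have hlocal : ∀ y, sbeLocal α p μ y ≤ (sbeLocal α p μ₁ + sbeLocal α p μ₂) y := by
    intro y
    simp only [Pi.add_apply, sbeLocal, div_eq_mul_rpow hp0]
    refine le_trans ?_ (ENNReal.lintegral_Lp_add_le ?_ ?_ hp)
    · refine ENNReal.rpow_le_rpow (lintegral_mono fun r => ENNReal.rpow_le_rpow ?_ hp0.le)
        (by positivity)
      simp only [Pi.add_apply]
      rw [← add_mul]
      gcongr
      simp only [enorm_mul]
      rw [← mul_add]
      gcongr
      rw [Real.enorm_eq_ofReal_abs, Real.enorm_eq_ofReal_abs, Real.enorm_eq_ofReal_abs,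
        ← ENNReal.ofReal_add (abs_nonneg _) (abs_nonneg _)]
      exact ENNReal.ofReal_le_ofReal (h y r)
    all_goals
      refine Measurable.aemeasurable (Measurable.mul ?_ ?_)
      · exact (measurable_sbe_integrand α _).comp (measurable_const.prodMk measurable_id)
      · exact (ENNReal.measurable_ofReal.inv).pow_const _
  rw [sbeNorm_eq, sbeNorm_eq, sbeNorm_eq]
  refine le_trans ?_ (ENNReal.lintegral_Lp_add_le (measurable_sbeLocal α p μ₁).aemeasurable
    (measurable_sbeLocal α p μ₂).aemeasurable hq)
  exact ENNReal.rpow_le_rpow (lintegral_mono fun y => ENNReal.rpow_le_rpow (hlocal y)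
    (by linarith)) (by positivity)

theorem diffOp_add (k : ℕ) (F G : ℝ → ℝ) (r : ℝ) :
    diffOp k (fun ρ => F ρ + G ρ) r = diffOp k F r + diffOp k G r := by
  induction k generalizing r with
  | zero => simp [diffOp]; ring
  | succ k ih => simp [diffOp, ih]; ring

/-- Averages against the adapted Gaussian kernels are controlled by `sbeNorm`. -/
theorem exists_sbe_average_bound {α p : ℝ} (hα : 0 < α) (hp : 1 ≤ p) {b : ℕ → ℝ}
    (hb : ∀ F r, diffOp ⌈α + d - 1⌉₊ F r
      = ∑ j ∈ Finset.range (⌈α + d - 1⌉₊ + 2), b j * F (r / 2 ^ j)) :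
    ∃ C : ℝ, 0 < C ∧ ∀ (l : ℝ), 0 < l → ∀ (μ : Measure (Euc d)) [IsFiniteMeasure μ] (v : Euc d),
      ‖∫ y, dilate l (gaussComb b (⌈α + d - 1⌉₊ + 2)) (v - y) ∂μ‖ₑ
        ≤ ENNReal.ofReal (C * l ^ (-α)) * sbeLocal α p μ v := by
  unfold sbeLocal
  generalize ⌈α + d - 1⌉₊ = k at hb ⊢
  have hp0 : 0 < p := by linarith
  have hp1 : 0 ≤ 1 - 1 / p := one_sub_one_div_nonneg hp
  have hp2 : 0 ≤ 1 / p := by positivity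
  have hβ : 0 < α + d := by positivity
  obtain ⟨C, hC, h⟩ := exists_gaussWeight_bounds hβ
  refine ⟨C, hC, fun l hl μ _ v => ?_⟩
  obtain ⟨h1, h2⟩ := h l hl
  obtain ⟨D, hDm, hD⟩ : ∃ D : ℝ → ℝ, Measurable D ∧
      ∀ r, diffOp k (fun ρ => μ.real (Metric.closedBall v ρ)) r = D r :=
    ⟨_, (measurable_diffOp_ball k μ).comp (measurable_const.prodMk measurable_id), fun _ => rfl⟩
  simp only [hD]
  set K : ℝ≥0∞ := ENNReal.ofReal (l ^ (-(α + d)) * C) with hK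
  have hKpos : 0 < l ^ (-(α + d)) * C := mul_pos (Real.rpow_pos_of_pos hl _) hC
  -- The power `r ^ (α + d)` is moved from the integrand to the weight. Its total mass and its
  -- density against `dr / r` are both of size `l ^ (-α - d)`, so the two powers of `K` recombine;
  -- the factor `l ^ d` of the dilation leaves `l ^ (-α)`.
  have hj := lintegral_mul_le_of_le_div hp (h := fun r => ‖r ^ (-α - d) * D r‖ₑ)
    (ρ := fun r => ENNReal.ofReal (r ^ (α + d) * gaussWeight l r)) (K := K) (L := K)
    ((measurable_id.pow_const _).mul hDm).enorm
    (by unfold gaussWeight; fun_prop)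
    (fun r hr => by
      rw [hK, ← ENNReal.ofReal_div_of_pos hr]
      exact ENNReal.ofReal_le_ofReal (h1 r hr)) h2
  have hKK : K ^ (1 / p) * K ^ (1 - 1 / p) = K := by
    rw [← ENNReal.rpow_add_of_nonneg _ _ hp2 hp1]; simp
  rw [hKK] at hj
  have hD' : ∀ r, ∑ j ∈ Finset.range (k + 2),
      b j * μ.real (Metric.closedBall v (r / 2 ^ j)) = D r := fun r => by
    rw [← hD, hb]
  rw [integral_dilate_gaussComb hl, enorm_mul]
  simp_rw [hD']
  have h3 : ‖∫ r in Ioi (0 : ℝ), D r * gaussWeight l r‖ₑ ≤ K *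
      (∫⁻ r in Ioi (0 : ℝ), ‖r ^ (-α - d) * D r‖ₑ ^ p / ENNReal.ofReal r) ^ (1 / p) := by
    refine (enorm_integral_le_lintegral_enorm _).trans (le_trans (le_of_eq ?_) hj)
    refine setLIntegral_congr_fun measurableSet_Ioi fun r hr => ?_
    have hr0 : (0 : ℝ) < r := hr
    have hw : 0 ≤ r ^ (α + d) * gaussWeight l r :=
      mul_nonneg (Real.rpow_nonneg hr0.le _) (gaussWeight_nonneg hr0.le)
    rw [← Real.enorm_of_nonneg hw, ← enorm_mul]
    congr 1
    have : r ^ (-α - d) * r ^ (α + (d : ℝ)) = 1 := by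
      rw [← Real.rpow_add hr0]; ring_nf; exact Real.rpow_zero r
    calc D r * gaussWeight l r = (r ^ (-α - d) * r ^ (α + (d : ℝ))) * (D r * gaussWeight l r) := by
          rw [this, one_mul]
      _ = _ := by ring
  calc ‖l ^ d‖ₑ * ‖∫ r in Ioi (0 : ℝ), D r * gaussWeight l r‖ₑ
      ≤ ‖l ^ d‖ₑ * (K *
        (∫⁻ r in Ioi (0 : ℝ), ‖r ^ (-α - d) * D r‖ₑ ^ p / ENNReal.ofReal r) ^ (1 / p)) := by gcongr
    _ = _ := by
      rw [← mul_assoc, Real.enorm_of_nonneg (by positivity), hK,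
        ← ENNReal.ofReal_mul (by positivity)]
      congr 2
      rw [neg_add, Real.rpow_add hl, Real.rpow_neg hl.le (d : ℝ), Real.rpow_natCast]
      field_simp

/-- The mass of a measure with bounded support is controlled by `sbeNorm`. -/
theorem exists_mass_bound (hd : 0 < d) {α p q : ℝ} (hα : 0 < α) (hp : 1 ≤ p) (hq : 1 ≤ q)
    (R : ℝ) : ∃ C : ℝ≥0∞, C ≠ ∞ ∧ ∀ (μ : Measure (Euc d)) [IsFiniteMeasure μ] (x₀ : Euc d),
      μ (Metric.closedBall x₀ R)ᶜ = 0 → μ univ ≤ C * sbeNorm α p q μ := by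
  have hp0 : 0 < p := by linarith
  have hq0 : 0 < q := by linarith
  set ρ : ℝ := max R 1 with hρ
  have hρ0 : 0 < ρ := lt_of_lt_of_le one_pos (le_max_right _ _)
  set c₁ : ℝ≥0∞ := ENNReal.ofReal ((8 * ρ) ^ (-α - d)) with hc₁
  have hc₁0 : c₁ ≠ 0 := by
    rw [hc₁]; simp only [ne_eq, ENNReal.ofReal_eq_zero, not_le]; positivity
  set c₂ : ℝ≥0∞ := (c₁ ^ p / ENNReal.ofReal (8 * ρ) * ENNReal.ofReal ρ) ^ (1 / p) with hc₂
  have hc₂0 : c₂ ≠ 0 := by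
    rw [hc₂]
    refine (ENNReal.rpow_pos (pos_iff_ne_zero.2 (mul_ne_zero ?_ ?_)) ?_).ne'
    · refine ENNReal.div_ne_zero.2 ⟨(ENNReal.rpow_pos (pos_iff_ne_zero.2 hc₁0)
        ENNReal.ofReal_ne_top).ne', ENNReal.ofReal_ne_top⟩
    · simpa using hρ0
    · refine ENNReal.mul_ne_top (ENNReal.div_ne_top (ENNReal.rpow_ne_top_of_nonneg hp0.le
        ENNReal.ofReal_ne_top) ?_) ENNReal.ofReal_ne_top
      simpa using hρ0
  set c₃ : ℝ≥0∞ := (volume (Metric.ball (0 : Euc d) (ρ / 2))) ^ (1 / q) with hc₃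
  have hvol : volume (Metric.ball (0 : Euc d) (ρ / 2)) ≠ 0 :=
    (Metric.measure_ball_pos volume _ (by positivity)).ne'
  have hc₃0 : c₃ ≠ 0 := (ENNReal.rpow_pos (pos_iff_ne_zero.2 hvol) measure_ball_lt_top.ne).ne'
  refine ⟨(c₂ * c₃)⁻¹, ENNReal.inv_ne_top.2 (mul_ne_zero hc₂0 hc₃0), fun μ _ x₀ hμ => ?_⟩
  have hsupp : ∀ S : Set (Euc d), Disjoint S (Metric.closedBall x₀ ρ) → μ S = 0 := by
    intro S hS
    have h1 : S ⊆ (Metric.closedBall x₀ R)ᶜ := fun x hx hx' => Set.disjoint_left.1 hS hx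
      (Metric.closedBall_subset_closedBall (le_max_left _ _) hx')
    exact measure_mono_null h1 hμ
  have hfull : ∀ S : Set (Euc d), Metric.closedBall x₀ ρ ⊆ S → μ.real S = μ.real univ := by
    intro S hS
    have h1 : μ Sᶜ = 0 := hsupp _ (Set.disjoint_left.2 fun x hx hx' => hx (hS hx'))
    exact measureReal_congr (ae_eq_univ.2 h1)
  -- Centres near `x₀ + e` are at distance between `5ρ` and `6ρ` from `x₀`. For `7ρ < r < 8ρ` the
  -- ball of radius `r` contains the support, while all balls of radius `r / 2 ^ j` with `j ≥ 1`
  -- miss it, so the difference operator returns the full mass.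
  let e : Euc d := EuclideanSpace.single ⟨0, hd⟩ (11 / 2 * ρ)
  have he : ‖e‖ = 11 / 2 * ρ := by
    simp only [e, PiLp.norm_single]
    rw [Real.norm_eq_abs, abs_of_pos (by positivity)]
  obtain ⟨b, hb0, -, -, hb⟩ := exists_diffOp_eq_sum ⌈α + d - 1⌉₊
  have hD : ∀ y ∈ Metric.ball (x₀ + e) (ρ / 2), ∀ r ∈ Ioo (7 * ρ) (8 * ρ),
      diffOp ⌈α + d - 1⌉₊ (fun ρ => μ.real (Metric.closedBall y ρ)) r = μ.real univ := by
    intro y hy r hr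
    rw [Metric.mem_ball, dist_eq_norm] at hy
    have hy1 : ‖y - x₀‖ ≤ 6 * ρ := by
      have : y - x₀ = (y - (x₀ + e)) + e := by abel
      rw [this]
      refine (norm_add_le _ _).trans ?_
      rw [he]; linarith
    have hy2 : 5 * ρ ≤ ‖y - x₀‖ := by
      have h3 : e = (y - x₀) - (y - (x₀ + e)) := by abel
      have h4 : ‖e‖ ≤ ‖y - x₀‖ + ‖y - (x₀ + e)‖ := by
        conv_lhs => rw [h3]
        exact norm_sub_le _ _
      rw [he] at h4; linarith
    rw [← dist_eq_norm] at hy1 hy2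
    rw [hb, Finset.sum_range_succ', Finset.sum_eq_zero fun j _ => ?_]
    · rw [hb0, pow_zero, div_one, one_mul, zero_add]
      refine hfull _ fun x hx => ?_
      rw [Metric.mem_closedBall] at hx ⊢
      have := dist_triangle_right x y x₀
      linarith [hr.1]
    · have h5 : r / 2 ^ (j + 1) < 4 * ρ := by
        rw [div_lt_iff₀ (by positivity)]
        have h6 : (1 : ℝ) ≤ 2 ^ j := one_le_pow₀ (by norm_num)
        rw [pow_succ]
        nlinarith [hr.2]
      have h7 : μ (Metric.closedBall y (r / 2 ^ (j + 1))) = 0 := by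
        refine hsupp _ (Set.disjoint_left.2 fun x hx hx' => ?_)
        rw [Metric.mem_closedBall] at hx hx'
        have := dist_triangle_left y x₀ x
        linarith
      rw [measureReal_def, h7]; simp
  have hmass : ENNReal.ofReal (μ.real univ) = μ univ := ENNReal.ofReal_toReal (measure_ne_top _ _)
  have hlocal : ∀ y ∈ Metric.ball (x₀ + e) (ρ / 2), c₂ * μ univ ≤ sbeLocal α p μ y := by
    intro y hy
    have h1 : ∀ r ∈ Ioo (7 * ρ) (8 * ρ), (c₁ * μ univ) ^ p / ENNReal.ofReal (8 * ρ) ≤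
        ‖r ^ (-α - d) * diffOp ⌈α + d - 1⌉₊ (fun ρ => μ.real (Metric.closedBall y ρ)) r‖ₑ ^ p
          / ENNReal.ofReal r := by
      intro r hr
      have hr0 : 0 < r := lt_trans (by positivity) hr.1
      refine ENNReal.div_le_div (ENNReal.rpow_le_rpow ?_ hp0.le)
        (ENNReal.ofReal_le_ofReal hr.2.le)
      rw [hD y hy r hr, enorm_mul, Real.enorm_of_nonneg measureReal_nonneg, hmass,
        Real.enorm_of_nonneg (Real.rpow_nonneg hr0.le _)]
      gcongr
      refine ENNReal.ofReal_le_ofReal ?_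
      exact Real.rpow_le_rpow_of_nonpos hr0 hr.2.le
        (by linarith [(Nat.cast_nonneg d : (0 : ℝ) ≤ d)])
    have h2 : (c₁ * μ univ) ^ p / ENNReal.ofReal (8 * ρ) * ENNReal.ofReal ρ
        ≤ ∫⁻ r in Ioi (0 : ℝ), ‖r ^ (-α - d)
          * diffOp ⌈α + d - 1⌉₊ (fun ρ => μ.real (Metric.closedBall y ρ)) r‖ₑ ^ p
          / ENNReal.ofReal r := by
      calc _ = ∫⁻ r in Ioo (7 * ρ) (8 * ρ), (c₁ * μ univ) ^ p / ENNReal.ofReal (8 * ρ) := by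
            rw [setLIntegral_const, Real.volume_Ioo]
            congr 2
            ring
        _ ≤ ∫⁻ r in Ioo (7 * ρ) (8 * ρ), _ := setLIntegral_mono' measurableSet_Ioo h1
        _ ≤ _ := lintegral_mono_set fun r hr => lt_trans (by positivity) hr.1
    have h3 := ENNReal.rpow_le_rpow h2 (show 0 ≤ 1 / p by positivity)
    refine le_trans (le_of_eq ?_) h3
    rw [ENNReal.mul_rpow_of_nonneg _ _ hp0.le, hc₂]
    rw [show c₁ ^ p * μ univ ^ p / ENNReal.ofReal (8 * ρ) * ENNReal.ofReal ρ
      = (c₁ ^ p / ENNReal.ofReal (8 * ρ) * ENNReal.ofReal ρ) * μ univ ^ p by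
        simp only [div_eq_mul_inv]; ring]
    rw [ENNReal.mul_rpow_of_nonneg _ (μ univ ^ p) (by positivity), ← ENNReal.rpow_mul,
      mul_one_div_cancel hp0.ne', ENNReal.rpow_one]
  have hfin : c₂ * c₃ * μ univ ≤ sbeNorm α p q μ := by
    rw [sbeNorm_eq]
    have h1 : (c₂ * μ univ) ^ q * volume (Metric.ball (0 : Euc d) (ρ / 2))
        ≤ ∫⁻ y, sbeLocal α p μ y ^ q := by
      calc _ = ∫⁻ y in Metric.ball (x₀ + e) (ρ / 2), (c₂ * μ univ) ^ q := by
            rw [setLIntegral_const, Measure.addHaar_ball_center volume (x₀ + e)]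
        _ ≤ ∫⁻ y in Metric.ball (x₀ + e) (ρ / 2), sbeLocal α p μ y ^ q :=
            setLIntegral_mono' measurableSet_ball fun y hy =>
              ENNReal.rpow_le_rpow (hlocal y hy) hq0.le
        _ ≤ _ := setLIntegral_le_lintegral _ _
    have h2 := ENNReal.rpow_le_rpow h1 (show 0 ≤ 1 / q by positivity)
    refine le_trans (le_of_eq ?_) h2
    rw [ENNReal.mul_rpow_of_nonneg _ _ (by positivity), ← ENNReal.rpow_mul,
      mul_one_div_cancel hq0.ne', ENNReal.rpow_one, hc₃]
    ring
  by_cases htop : c₂ * c₃ = ∞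
  · have : sbeNorm α p q μ = ∞ ∨ μ univ = 0 := by
      by_cases h0 : μ univ = 0
      · exact Or.inr h0
      · left
        rw [htop, ENNReal.top_mul h0] at hfin
        exact top_le_iff.1 hfin
    exfalso
    have h2 : c₂ ≠ ∞ := by
      rw [hc₂]
      refine ENNReal.rpow_ne_top_of_nonneg (by positivity) (ENNReal.mul_ne_top
        (ENNReal.div_ne_top (ENNReal.rpow_ne_top_of_nonneg hp0.le
        ENNReal.ofReal_ne_top) ?_) ENNReal.ofReal_ne_top)
      simpa using hρ0
    have h3 : c₃ ≠ ∞ := ENNReal.rpow_ne_top_of_nonneg (by positivity) measure_ball_lt_top.ne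
    exact ENNReal.mul_ne_top h2 h3 htop
  · rw [← ENNReal.div_eq_inv_mul, ENNReal.le_div_iff_mul_le (Or.inl (mul_ne_zero hc₂0 hc₃0))
      (Or.inl htop), mul_comm]
    exact hfin

end SbeEstimates

/-! ### Trilinear averages -/

section Trilinear

variable {d : ℕ}

/-- The integrable weight `(1 + ‖w‖)^{-(d+1)}`. -/
def decay (w : Euc d) : ℝ := ((1 + ‖w‖) ^ (d + 1))⁻¹

theorem decay_pos (w : Euc d) : 0 < decay w := by unfold decay; positivity

theorem decay_le_one (w : Euc d) : decay w ≤ 1 :=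
  inv_le_one_of_one_le₀ (one_le_pow₀ (by linarith [norm_nonneg w]))

theorem continuous_decay : Continuous (decay : Euc d → ℝ) := by
  unfold decay
  exact (by fun_prop : Continuous fun w : Euc d => (1 + ‖w‖) ^ (d + 1)).inv₀
    fun w => by positivity

/-- Comparability at unit distance gives one dominating function for all points of a unit ball, as
differentiation under the integral requires. -/
theorem decay_le_of_norm_sub_le {w w' : Euc d} (h : ‖w - w'‖ ≤ 1) :
    decay w ≤ 2 ^ (d + 1) * decay w' := by
  unfold decay
  rw [← div_eq_mul_inv, inv_eq_one_div, div_le_div_iff₀ (by positivity) (by positivity), one_mul,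
    ← mul_pow]
  have : ‖w'‖ ≤ ‖w‖ + ‖w - w'‖ := by
    have := norm_sub_le w (w - w')
    simpa using this
  gcongr
  linarith [norm_nonneg w]

theorem lintegral_decay_lt_top : ∫⁻ w : Euc d, ENNReal.ofReal (decay w) < ∞ := by
  have h1 : Integrable (fun w : Euc d => (1 + ‖w‖) ^ (-((d : ℝ) + 1))) :=
    integrable_one_add_norm (by simp)
  have h2 : (fun w : Euc d => (1 + ‖w‖) ^ (-((d : ℝ) + 1))) = decay := by
    funext w
    unfold decay
    rw [Real.rpow_neg (by positivity), ← Real.rpow_natCast]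
    push_cast
    rfl
  rw [h2] at h1
  exact h1.lintegral_lt_top

theorem exists_iteratedFDeriv_le_decay (H : 𝓢(Euc d, ℝ)) (j : ℕ) :
    ∃ B : ℝ, 0 < B ∧ ∀ w, ‖iteratedFDeriv ℝ j H w‖ ≤ B * decay w := by
  refine ⟨2 ^ (d + 1) * (Finset.Iic (d + 1, j)).sup (fun m => SchwartzMap.seminorm ℝ m.1 m.2) H + 1,
    by positivity, fun w => ?_⟩
  have h1 := SchwartzMap.one_add_le_sup_seminorm_apply (𝕜 := ℝ) (m := (d + 1, j)) le_rfl le_rfl H w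
  unfold decay
  rw [← div_eq_mul_inv, le_div_iff₀ (by positivity), mul_comm]
  linarith

/-- `L^p` size of a function. -/
def lpSize {F : Type*} [NormedAddCommGroup F] (p : ℝ) (f : Euc d → F) : ℝ≥0∞ :=
  (∫⁻ z, ‖f z‖ₑ ^ p) ^ (1 / p)

/-- The dimensional factor in the trilinear bound. -/
def triConst (d : ℕ) (p q c : ℝ) : ℝ≥0∞ :=
  (ENNReal.ofReal ((c ^ d)⁻¹) * ∫⁻ w : Euc d, ENNReal.ofReal (decay w)) ^ (1 - (1 / q + 1 / p - 1))

theorem triConst_ne_top {p q c : ℝ} (hp : 1 ≤ p) (hq : 1 ≤ q) : triConst d p q c ≠ ∞ := by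
  have h1 := one_sub_one_div_nonneg hp
  have h2 := one_sub_one_div_nonneg hq
  exact ENNReal.rpow_ne_top_of_nonneg (by linarith)
    (ENNReal.mul_ne_top ENNReal.ofReal_ne_top lintegral_decay_lt_top.ne)

theorem lintegral_comp_smul_euc {c : ℝ} (hc : 0 < c) (k : Euc d → ℝ≥0∞) :
    ∫⁻ w, k (c • w) = ENNReal.ofReal ((c ^ d)⁻¹) * ∫⁻ w, k w := by
  have h1 : MeasurableEmbedding fun w : Euc d => c • w :=
    (Homeomorph.smulOfNeZero c hc.ne').measurableEmbedding
  rw [← h1.lintegral_map, Measure.map_addHaar_smul volume hc.ne', lintegral_smul_measure,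
    finrank_euclideanSpace_fin, abs_of_pos (by positivity), smul_eq_mul]

variable {p q : ℝ} (hp : 1 ≤ p) (hq : 1 ≤ q) (hpq : 1 ≤ 1 / q + 1 / p)
  {f : Euc d → Euc d} {G : Euc d → ℝ} (hf : Measurable f) (hG : Measurable G)
include hp hq hpq hf hG

/-- The trilinear inequality for the kernel `B * decay (c • w)`, which is bounded by `B` and has
`L¹` norm `B c^{-d}` times a constant. The two powers of `B` combine to one, and `triConst` records
the power of `c^{-d}`. -/
theorem lintegral_decay_trilinear_le {c : ℝ} (hc : 0 < c) (B : ℝ) (X : Euc d) :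
    ∫⁻ a : Euc d × Euc d, ENNReal.ofReal (B * decay (X - c • (a.1 + a.2))) * ‖G a.2‖ₑ * ‖f a.1‖ₑ
      ≤ ENNReal.ofReal B * triConst d p q c * lpSize p f * lpSize q G := by
  have hκ0 : 0 ≤ 1 / q + 1 / p - 1 := by linarith
  have h1 := one_sub_one_div_nonneg hp
  have h2 := one_sub_one_div_nonneg hq
  rcases le_or_gt B 0 with hB | hB
  · have : ∀ a : Euc d × Euc d, ENNReal.ofReal (B * decay (X - c • (a.1 + a.2))) = 0 := fun a =>
      ENNReal.ofReal_of_nonpos (mul_nonpos_of_nonpos_of_nonneg hB (decay_pos _).le)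
    simp_rw [this]
    simp
  have hm : Measurable fun w : Euc d => ENNReal.ofReal (B * decay (c • w)) := by
    have := continuous_decay (d := d)
    exact ENNReal.measurable_ofReal.comp (by fun_prop : Continuous fun w : Euc d =>
      B * decay (c • w)).measurable
  have hL : ∫⁻ w : Euc d, ENNReal.ofReal (B * decay (c • w))
      ≤ ENNReal.ofReal B *
        (ENNReal.ofReal ((c ^ d)⁻¹) * ∫⁻ w : Euc d, ENNReal.ofReal (decay w)) := by
    rw [lintegral_comp_smul_euc hc (fun w => ENNReal.ofReal (B * decay w))]
    simp_rw [ENNReal.ofReal_mul hB.le]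
    rw [lintegral_const_mul _ (f := fun w : Euc d => ENNReal.ofReal (decay w))
      (ENNReal.measurable_ofReal.comp continuous_decay.measurable)]
    exact le_of_eq (by ring)
  have key := lintegral_trilinear_le hp hq hpq hf.enorm hm hG.enorm (S := ENNReal.ofReal B)
    (fun w => ENNReal.ofReal_le_ofReal (mul_le_of_le_one_right hB.le (decay_le_one _))) hL
    (c⁻¹ • X)
  refine le_trans (le_of_eq ?_) (key.trans (le_of_eq ?_))
  · refine lintegral_congr fun a => ?_
    rw [show c • (c⁻¹ • X - a.1 - a.2) = X - c • (a.1 + a.2) by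
      rw [smul_sub, smul_sub, smul_inv_smul₀ hc.ne', smul_add, sub_sub]]
    ring
  · rw [ENNReal.mul_rpow_of_nonneg _ _ (by linarith : 0 ≤ 1 - (1 / q + 1 / p - 1)), ← mul_assoc,
      ← ENNReal.rpow_add_of_nonneg _ _ hκ0 (by linarith)]
    unfold triConst lpSize
    rw [show 1 / q + 1 / p - 1 + (1 - (1 / q + 1 / p - 1)) = 1 by ring, ENNReal.rpow_one]

omit hp hq hpq hf hG in
/-- The trilinear average `∫∫ H(X - c(z+v)) G(v) f(z) dz dv`. -/
def triOp (c : ℝ) (H : 𝓢(Euc d, ℝ)) (f : Euc d → Euc d) (G : Euc d → ℝ) (X : Euc d) : Euc d :=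
  ∫ a : Euc d × Euc d, H (X - c • (a.1 + a.2)) • (G a.2 • f a.1)

variable (hfN : lpSize p f ≠ ∞) (hGN : lpSize q G ≠ ∞)
include hfN hGN

theorem integrable_triOp_bound {c : ℝ} (hc : 0 < c) (B : ℝ) (X : Euc d) :
    Integrable fun a : Euc d × Euc d => B * decay (X - c • (a.1 + a.2)) * ‖G a.2‖ * ‖f a.1‖ := by
  have hm : Measurable fun a : Euc d × Euc d => decay (X - c • (a.1 + a.2)) := by
    have := continuous_decay (d := d)
    exact (by fun_prop : Continuous fun a : Euc d × Euc d =>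
      decay (X - c • (a.1 + a.2))).measurable
  have h0 : Integrable fun a : Euc d × Euc d =>
      1 * decay (X - c • (a.1 + a.2)) * ‖G a.2‖ * ‖f a.1‖ := by
    refine ⟨(((hm.const_mul 1).mul (hG.norm.comp measurable_snd)).mul
      (hf.norm.comp measurable_fst)).aestronglyMeasurable, ?_⟩
    refine lt_of_le_of_lt (le_of_eq ?_) (lt_of_le_of_lt
      (lintegral_decay_trilinear_le hp hq hpq hf hG hc 1 X) ?_)
    · refine lintegral_congr fun a => ?_
      rw [enorm_mul, enorm_mul, enorm_norm, enorm_norm,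
        Real.enorm_of_nonneg (by rw [one_mul]; exact (decay_pos _).le)]
    · exact (ENNReal.mul_ne_top (ENNReal.mul_ne_top (ENNReal.mul_ne_top ENNReal.ofReal_ne_top
        (triConst_ne_top hp hq)) hfN) hGN).lt_top
  have := h0.const_mul B
  refine this.congr (Eventually.of_forall fun a => ?_)
  ring

omit hp hq hpq hfN hGN in
theorem aestronglyMeasurable_triOp {V : Type*} [NormedAddCommGroup V] [NormedSpace ℝ V]
    {k : Euc d → V} (hk : Continuous k) (c : ℝ) (X : Euc d) :
    AEStronglyMeasurable (fun a : Euc d × Euc d => k (X - c • (a.1 + a.2))) volume ∧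
    AEStronglyMeasurable (fun a : Euc d × Euc d => G a.2 • f a.1) volume :=
  ⟨(hk.comp (by fun_prop : Continuous fun a : Euc d × Euc d =>
    X - c • (a.1 + a.2))).aestronglyMeasurable,
    ((hG.comp measurable_snd).smul (hf.comp measurable_fst)).aestronglyMeasurable⟩

theorem integrable_triOp {c : ℝ} (hc : 0 < c) (H : 𝓢(Euc d, ℝ)) (X : Euc d) :
    Integrable fun a : Euc d × Euc d => H (X - c • (a.1 + a.2)) • (G a.2 • f a.1) := by
  obtain ⟨B, hB, h⟩ := exists_iteratedFDeriv_le_decay H 0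
  obtain ⟨m1, m2⟩ := aestronglyMeasurable_triOp hf hG H.continuous c X
  refine (integrable_triOp_bound hp hq hpq hf hG hfN hGN hc B X).mono' (m1.smul m2)
    (Eventually.of_forall fun a => ?_)
  rw [norm_smul, norm_smul, mul_assoc]
  gcongr
  simpa using h (X - c • (a.1 + a.2))

omit hfN hGN in
theorem enorm_triOp_le {c : ℝ} (hc : 0 < c) {H : 𝓢(Euc d, ℝ)} {B : ℝ}
    (hB : ∀ w, ‖H w‖ ≤ B * decay w) (X : Euc d) :
    ‖triOp c H f G X‖ₑ ≤ ENNReal.ofReal B * triConst d p q c * lpSize p f * lpSize q G := by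
  refine (enorm_integral_le_lintegral_enorm _).trans (le_trans (lintegral_mono fun a => ?_)
    (lintegral_decay_trilinear_le hp hq hpq hf hG hc B X))
  rw [enorm_smul, enorm_smul, ← mul_assoc]
  gcongr
  rw [← ofReal_norm]
  exact ENNReal.ofReal_le_ofReal (hB _)

omit hp hq hpq hf hG hfN hGN in
/-- The derivative of a trilinear average. -/
def triDeriv (c : ℝ) (H : 𝓢(Euc d, ℝ)) (f : Euc d → Euc d) (G : Euc d → ℝ) (X : Euc d) :
    Euc d →L[ℝ] Euc d :=
  ∫ a : Euc d × Euc d, (fderiv ℝ H (X - c • (a.1 + a.2))).smulRight (G a.2 • f a.1)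

omit hp hq hpq hfN hGN in
theorem aestronglyMeasurable_triDeriv (c : ℝ) (H : 𝓢(Euc d, ℝ)) (X : Euc d) :
    AEStronglyMeasurable (fun a : Euc d × Euc d =>
      (fderiv ℝ H (X - c • (a.1 + a.2))).smulRight (G a.2 • f a.1)) volume := by
  have hc : Continuous (fderiv ℝ H) := (H.smooth 1).continuous_fderiv (by simp)
  obtain ⟨m1, m2⟩ := aestronglyMeasurable_triOp hf hG hc c X
  exact (ContinuousLinearMap.smulRightL ℝ (Euc d) (Euc d)).continuous₂.comp_aestronglyMeasurable₂ m1 m2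

theorem integrable_triDeriv {c : ℝ} (hc : 0 < c) (H : 𝓢(Euc d, ℝ)) (X : Euc d) :
    Integrable fun a : Euc d × Euc d =>
      (fderiv ℝ H (X - c • (a.1 + a.2))).smulRight (G a.2 • f a.1) := by
  obtain ⟨B, hB, h⟩ := exists_iteratedFDeriv_le_decay H 1
  refine (integrable_triOp_bound hp hq hpq hf hG hfN hGN hc B X).mono'
    (aestronglyMeasurable_triDeriv hf hG c H X) (Eventually.of_forall fun a => ?_)
  rw [ContinuousLinearMap.norm_smulRight_apply, norm_smul, mul_assoc]
  gcongr
  have := h (X - c • (a.1 + a.2))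
  rwa [norm_iteratedFDeriv_one] at this

theorem hasFDerivAt_triOp {c : ℝ} (hc : 0 < c) (H : 𝓢(Euc d, ℝ)) (X : Euc d) :
    HasFDerivAt (triOp c H f G) (triDeriv c H f G X) X := by
  obtain ⟨B, hB, h⟩ := exists_iteratedFDeriv_le_decay H 1
  refine hasFDerivAt_integral_of_dominated_of_fderiv_le (s := Metric.ball X 1)
    (F := fun (X : Euc d) (a : Euc d × Euc d) => H (X - c • (a.1 + a.2)) • (G a.2 • f a.1))
    (F' := fun X a => (fderiv ℝ H (X - c • (a.1 + a.2))).smulRight (G a.2 • f a.1))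
    (bound := fun a => B * 2 ^ (d + 1) * decay (X - c • (a.1 + a.2)) * ‖G a.2‖ * ‖f a.1‖)
    (Metric.ball_mem_nhds X one_pos) ?_ ?_ ?_ ?_ ?_ ?_
  · exact Eventually.of_forall fun Y =>
      (integrable_triOp hp hq hpq hf hG hfN hGN hc H Y).aestronglyMeasurable
  · exact integrable_triOp hp hq hpq hf hG hfN hGN hc H X
  · exact aestronglyMeasurable_triDeriv hf hG c H X
  · refine Eventually.of_forall fun a Y hY => ?_
    rw [ContinuousLinearMap.norm_smulRight_apply, norm_smul, mul_assoc _ ‖G a.2‖]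
    gcongr
    have h1 := h (Y - c • (a.1 + a.2))
    rw [norm_iteratedFDeriv_one] at h1
    refine h1.trans ?_
    rw [mul_assoc]
    gcongr
    refine decay_le_of_norm_sub_le ?_
    rw [sub_sub_sub_cancel_right, ← dist_eq_norm]
    exact (Metric.mem_ball.1 hY).le
  · exact integrable_triOp_bound hp hq hpq hf hG hfN hGN hc _ X
  · refine Eventually.of_forall fun a Y _ => ?_
    have h1 : HasFDerivAt (fun Y : Euc d => H (Y - c • (a.1 + a.2)))
        (fderiv ℝ H (Y - c • (a.1 + a.2))) Y := by
      have := (H.hasFDerivAt (Y - c • (a.1 + a.2))).comp Y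
        ((hasFDerivAt_id Y).sub_const (c • (a.1 + a.2)))
      exact this.congr_fderiv (by ext; simp)
    exact h1.smul_const _

omit hfN hGN in
theorem enorm_triDeriv_le {c : ℝ} (hc : 0 < c) {H : 𝓢(Euc d, ℝ)} {B : ℝ}
    (hB : ∀ w, ‖fderiv ℝ H w‖ ≤ B * decay w) (X : Euc d) :
    ‖triDeriv c H f G X‖ₑ ≤ ENNReal.ofReal B * triConst d p q c * lpSize p f * lpSize q G := by
  refine (enorm_integral_le_lintegral_enorm _).trans (le_trans (lintegral_mono fun a => ?_)
    (lintegral_decay_trilinear_le hp hq hpq hf hG hc B X))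
  rw [← ofReal_norm, ContinuousLinearMap.norm_smulRight_apply, norm_smul, ← mul_assoc,
    ENNReal.ofReal_mul (by positivity), ENNReal.ofReal_mul (by positivity), ofReal_norm, ofReal_norm]
  gcongr
  · rw [← ofReal_norm]
    exact ENNReal.ofReal_le_ofReal (hB _)
  · exact (ofReal_norm _).le

theorem triDeriv_apply {c : ℝ} (hc : 0 < c) (H : 𝓢(Euc d, ℝ)) (X e : Euc d) :
    triDeriv c H f G X e = triOp c (LineDeriv.lineDerivOp e H) f G X := by
  unfold triDeriv triOp
  rw [ContinuousLinearMap.integral_apply (integrable_triDeriv hp hq hpq hf hG hfN hGN hc H X)]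
  rfl

/-- Applied to a vector, the derivative is again a trilinear average, with a directional derivative
of `H` as kernel. The mean value inequality for that average needs only second derivatives of `H`.
-/
theorem norm_triDeriv_sub_le {c : ℝ} (hc : 0 < c) {H : 𝓢(Euc d, ℝ)} {B : ℝ} (hB0 : 0 ≤ B)
    (hB : ∀ w, ‖iteratedFDeriv ℝ 2 H w‖ ≤ B * decay w) (X Y : Euc d) :
    ‖triDeriv c H f G X - triDeriv c H f G Y‖
      ≤ (ENNReal.ofReal B * triConst d p q c * lpSize p f * lpSize q G).toReal * ‖X - Y‖ := by
  have hfin : ENNReal.ofReal B * triConst d p q c * lpSize p f * lpSize q G ≠ ∞ :=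
    ENNReal.mul_ne_top (ENNReal.mul_ne_top (ENNReal.mul_ne_top ENNReal.ofReal_ne_top
        (triConst_ne_top hp hq)) hfN) hGN
  refine ContinuousLinearMap.opNorm_le_bound _ (by positivity) fun e => ?_
  have hB' : ∀ w, ‖fderiv ℝ (LineDeriv.lineDerivOp e H : 𝓢(Euc d, ℝ)) w‖ ≤ (B * ‖e‖) * decay w := by
    intro w
    have h1 : ∀ x, (LineDeriv.lineDerivOp e H : 𝓢(Euc d, ℝ)) x = fderiv ℝ H x e := fun x => rfl
    refine ContinuousLinearMap.opNorm_le_bound _ (by have := decay_pos w; positivity) fun m => ?_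
    have hdiff : DifferentiableAt ℝ (fderiv ℝ H) w :=
      ((H.smooth 2).fderiv_right (m := 1) (by norm_num)).differentiable (by simp) w
    have h2 : fderiv ℝ (LineDeriv.lineDerivOp e H : 𝓢(Euc d, ℝ)) w m
        = iteratedFDeriv ℝ 2 H w ![m, e] := by
      rw [iteratedFDeriv_two_apply]
      have h3 : ((LineDeriv.lineDerivOp e H : 𝓢(Euc d, ℝ)) : Euc d → ℝ)
        = fun x => fderiv ℝ H x e := funext h1
      rw [h3, fderiv_clm_apply hdiff (differentiableAt_const e)]
      simp
    rw [h2]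
    refine (ContinuousMultilinearMap.le_opNorm _ _).trans ?_
    rw [Fin.prod_univ_two]
    calc ‖iteratedFDeriv ℝ 2 H w‖ * (‖m‖ * ‖e‖) ≤ (B * decay w) * (‖m‖ * ‖e‖) := by
          gcongr; exact hB w
      _ = _ := by ring
  rw [sub_apply, triDeriv_apply hp hq hpq hf hG hfN hGN hc,
    triDeriv_apply hp hq hpq hf hG hfN hGN hc]
  have hmv := (convex_univ (𝕜 := ℝ) (E := Euc d)).norm_image_sub_le_of_norm_hasFDerivWithin_le
    (f := triOp c (LineDeriv.lineDerivOp e H) f G)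
    (C := (ENNReal.ofReal B * triConst d p q c * lpSize p f * lpSize q G).toReal * ‖e‖)
    (fun x _ => (hasFDerivAt_triOp hp hq hpq hf hG hfN hGN hc _ x).hasFDerivWithinAt)
    (fun x _ => ?_) (mem_univ Y) (mem_univ X)
  · calc _ ≤ _ := hmv
      _ = _ := by ring
  · have h1 := enorm_triDeriv_le hp hq hpq hf hG hc hB' x
    have h2 := ENNReal.toReal_mono (by
      rw [ENNReal.ofReal_mul hB0]
      exact ENNReal.mul_ne_top (ENNReal.mul_ne_top (ENNReal.mul_ne_top (ENNReal.mul_ne_top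
        ENNReal.ofReal_ne_top ENNReal.ofReal_ne_top) (triConst_ne_top hp hq)) hfN) hGN) h1
    rw [toReal_enorm] at h2
    refine h2.trans (le_of_eq ?_)
    rw [ENNReal.ofReal_mul hB0]
    simp only [ENNReal.toReal_mul]
    rw [ENNReal.toReal_ofReal (norm_nonneg e)]
    ring

end Trilinear

/-! ### Littlewood–Paley blocks and reproducing kernels -/

section Blocks

variable {d : ℕ}

theorem reflectTranslate_apply (φ : 𝓢(Euc d, ℝ)) (x v : Euc d) :
    reflectTranslate φ x v = φ (x - v) := by
  change φ (-(v - x)) = φ (x - v)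
  rw [neg_sub]

theorem shift_reflectTranslate (φ : 𝓢(Euc d, ℝ)) (x u : Euc d) :
    shift u (reflectTranslate φ x) = reflectTranslate φ (x - u) := by
  ext v
  rw [shift_apply, reflectTranslate_apply, reflectTranslate_apply, sub_sub, add_comm]

theorem shift_shift (φ : 𝓢(Euc d, ℝ)) (u y : Euc d) : shift u (shift y φ) = shift (u + y) φ := by
  ext v
  rw [shift_apply, shift_apply, shift_apply, add_assoc]

variable (f : VecDistribution d)

theorem continuous_apply_reflectTranslate (K : 𝓢(Euc d, ℝ)) :
    Continuous fun x => f (reflectTranslate K x) := by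
  have h : (fun x => f (reflectTranslate K x))
      = fun x => f (shift (-x) (reflectTranslate K 0)) := by
    funext x
    rw [shift_reflectTranslate, zero_sub, neg_neg]
  rw [h]
  exact (continuous_apply_shift f _).comp continuous_neg

theorem continuous_lpBlock (n : ℕ) : Continuous (lpBlock f n) :=
  continuous_apply_reflectTranslate f _

/-- Convolution identities between kernels pass to the functions obtained by convolving `f` with
them. -/
theorem apply_reflectTranslate_eq_integral {w : Euc d → ℝ}
    (hw : ∀ k : ℕ, Integrable fun u => ‖u‖ ^ k * w u) {P Q : 𝓢(Euc d, ℝ)}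
    (h : ∀ v, P v = ∫ u, w u * Q (v - u)) (x : Euc d) :
    f (reflectTranslate P x) = ∫ u, w u • f (reflectTranslate Q (x - u)) := by
  rw [apply_eq_integral_shift f hw (φ := reflectTranslate Q x) fun v => ?_]
  · simp_rw [shift_reflectTranslate]
  · simp_rw [reflectTranslate_apply, h, sub_sub]

theorem integrable_moment_schwartz (H : 𝓢(Euc d, ℝ)) (k : ℕ) :
    Integrable fun u => ‖u‖ ^ k * H u :=
  (H.integrable_pow_mul volume k).mono
    ((continuous_norm.pow k).mul H.continuous).aestronglyMeasurable
    (Eventually.of_forall fun u => by simp)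

variable {p q : ℝ} (hp : 1 ≤ p) (hq : 1 ≤ q) (hpq : 1 ≤ 1 / q + 1 / p) {A : Euc d → ℝ}
  {H K : 𝓢(Euc d, ℝ)} {c : ℝ} (hc : 0 < c) (hA : Continuous A)
  (hAm : ∀ k : ℕ, Integrable fun u => ‖u‖ ^ k * A u) (hAq : lpSize q A ≠ ∞)
  (hK : IsReproducing A (dilate c H) K)
  (hF : lpSize p (fun x => f (reflectTranslate K x)) ≠ ∞)
include hp hq hpq hc hA hAm hAq hK hF

omit hp hq hpq hc hA hAm hAq hK hF in
theorem lpSize_comp_sub (y : Euc d) : lpSize q (fun v => A (v - y)) = lpSize q A := by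
  unfold lpSize
  rw [lintegral_sub_right_eq_self (fun v => ‖A v‖ₑ ^ q) y]

/-- The reproducing identity writes the block as a triple convolution in which the shift by `y`
falls on `A` alone. Integrating in `y` against `μ` therefore replaces `A` by its average over `μ`
and leaves the other factors untouched. -/
theorem block_eq_triOp (x y : Euc d) : f (reflectTranslate K (x - y))
    = c ^ d • triOp c H (fun z => f (reflectTranslate K z)) (fun v => A (v - y)) (c • x) := by
  obtain ⟨J, hKJ, hJK⟩ := hK
  have hHm := integrable_dilate_moment hc (integrable_moment_schwartz H)
  have hint := integrable_triOp hp hq hpq (continuous_apply_reflectTranslate f K).measurable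
    (hA.comp (by fun_prop : Continuous fun v : Euc d => v - y)).measurable hF
    (by rw [show lpSize q (A ∘ fun v => v - y) = lpSize q A from lpSize_comp_sub y]; exact hAq)
    hc H (c • x)
  unfold triOp
  rw [apply_reflectTranslate_eq_integral f hAm hKJ, ← integral_sub_right_eq_self _ y,
    Measure.volume_eq_prod, integral_prod_symm _ (by rwa [Measure.volume_eq_prod] at hint),
    ← integral_smul]
  refine integral_congr_ae (Eventually.of_forall fun v => ?_)
  simp only
  rw [apply_reflectTranslate_eq_integral f hHm hJK, ← integral_smul, ← integral_smul,
    ← integral_sub_left_eq_self _ volume (x - v)]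
  refine integral_congr_ae (Eventually.of_forall fun z => ?_)
  simp only [dilate]
  rw [show c • x - c • (z + v) = c • (x - v - z) by rw [← smul_sub, sub_sub, add_comm],
    show x - y - (v - y) - (x - v - z) = z by abel, smul_smul, smul_smul, smul_smul]
  congr 1
  ring

/-- A qualitative Bernstein inequality: the reproducing identity improves `L^p` to `L^∞`. -/
theorem exists_block_bound : ∃ B : ℝ, 0 ≤ B ∧ ∀ x, ‖f (reflectTranslate K x)‖ ≤ B := by
  obtain ⟨B, hB, h⟩ := exists_iteratedFDeriv_le_decay H 0
  simp_rw [norm_iteratedFDeriv_zero] at h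
  set N : ℝ≥0∞ := ENNReal.ofReal B * triConst d p q c
    * lpSize p (fun z => f (reflectTranslate K z)) * lpSize q A with hN
  have hNt : N ≠ ∞ := ENNReal.mul_ne_top (ENNReal.mul_ne_top (ENNReal.mul_ne_top
    ENNReal.ofReal_ne_top (triConst_ne_top hp hq)) hF) hAq
  refine ⟨c ^ d * N.toReal, by positivity, fun x => ?_⟩
  have h1 := block_eq_triOp f hp hq hpq hc hA hAm hAq hK hF x 0
  rw [sub_zero] at h1
  simp only [sub_zero] at h1
  rw [h1, norm_smul, Real.norm_of_nonneg (by positivity)]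
  gcongr
  rw [← toReal_enorm]
  exact ENNReal.toReal_mono hNt
    (enorm_triOp_le hp hq hpq (continuous_apply_reflectTranslate f K).measurable hA.measurable hc h _)

/-- The convolution of a Littlewood–Paley block with a measure. -/
theorem integral_block_eq_triOp (μ : Measure (Euc d)) [IsFiniteMeasure μ] (x : Euc d) :
    ∫ y, f (reflectTranslate K (x - y)) ∂μ
      = c ^ d • triOp c H (fun z => f (reflectTranslate K z)) (fun v => ∫ y, A (v - y) ∂μ)
        (c • x) := by
  have hFc := continuous_apply_reflectTranslate f K
  simp_rw [block_eq_triOp f hp hq hpq hc hA hAm hAq hK hF x]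
  rw [integral_smul]
  congr 1
  unfold triOp
  obtain ⟨B, hB, h⟩ := exists_iteratedFDeriv_le_decay H 0
  simp_rw [norm_iteratedFDeriv_zero] at h
  have hcont : Continuous fun b : Euc d × Euc d × Euc d =>
      H (c • x - c • (b.2.1 + b.2.2)) • (A (b.2.2 - b.1) • f (reflectTranslate K b.2.1)) := by
    have h1 : Continuous fun b : Euc d × Euc d × Euc d => f (reflectTranslate K b.2.1) :=
      hFc.comp (by fun_prop)
    exact (H.continuous.comp (by fun_prop)).smul ((hA.comp (by fun_prop)).smul h1)
  -- Fubini applies because translation does not change the `L^q` size of `A`, so the inner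
  -- trilinear integrals are bounded uniformly in `y` and `μ` is finite.
  have hint : Integrable (Function.uncurry fun (y : Euc d) (a : Euc d × Euc d) =>
      H (c • x - c • (a.1 + a.2)) • (A (a.2 - y) • f (reflectTranslate K a.1)))
      (μ.prod volume) := by
    refine ⟨hcont.aestronglyMeasurable, ?_⟩
    have hm : AEMeasurable (fun b : Euc d × Euc d × Euc d =>
      ‖H (c • x - c • (b.2.1 + b.2.2)) • (A (b.2.2 - b.1) • f (reflectTranslate K b.2.1))‖ₑ)
        (μ.prod volume) := hcont.enorm.measurable.aemeasurable
    unfold HasFiniteIntegral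
    change ∫⁻ b : Euc d × Euc d × Euc d, ‖H (c • x - c • (b.2.1 + b.2.2)) •
      (A (b.2.2 - b.1) • f (reflectTranslate K b.2.1))‖ₑ ∂(μ.prod volume) < ∞
    rw [lintegral_prod _ hm]
    refine lt_of_le_of_lt (lintegral_mono (g := fun _ => ENNReal.ofReal B * triConst d p q c
      * lpSize p (fun z => f (reflectTranslate K z)) * lpSize q A) fun y => ?_) ?_
    · refine le_trans (lintegral_mono fun a => ?_) ((lintegral_decay_trilinear_le hp hq hpq
        hFc.measurable (hA.comp (by fun_prop : Continuous fun v : Euc d => v - y)).measurable hc B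
          (c • x)).trans (le_of_eq ?_))
      · rw [enorm_smul, enorm_smul, ← mul_assoc]
        gcongr
        · rw [← ofReal_norm]
          exact ENNReal.ofReal_le_ofReal (h _)
        · exact le_rfl
      · rw [show lpSize q (A ∘ fun v => v - y) = lpSize q A from lpSize_comp_sub y]
    · rw [lintegral_const]
      exact ENNReal.mul_lt_top (ENNReal.mul_ne_top (ENNReal.mul_ne_top (ENNReal.mul_ne_top
        ENNReal.ofReal_ne_top (triConst_ne_top hp hq)) hF) hAq).lt_top (measure_lt_top _ _)
  rw [integral_integral_swap hint]
  refine integral_congr_ae (Eventually.of_forall fun a => ?_)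
  simp only
  rw [integral_smul, integral_smul_const]

end Blocks

/-! ### Convergence of the Littlewood–Paley decomposition -/

section LPConvergence

variable {d : ℕ}

theorem realKernel_sub (s s' : 𝓢(Euc d, ℂ)) :
    realKernel (s - s') = realKernel s - realKernel s' := by
  unfold realKernel
  have : (𝓕⁻ (s - s') : 𝓢(Euc d, ℂ)) = 𝓕⁻ s - 𝓕⁻ s' := by
    have h := FourierInvAdd.fourierInv_add (s - s') s'
    rw [sub_add_cancel] at h
    rw [h, add_sub_cancel_right]
  rw [this, map_sub]

theorem realKernel_dilateSymbol {c : ℝ} (hc : 0 < c) (s : 𝓢(Euc d, ℂ)) (x : Euc d) :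
    realKernel (dilateSymbol c hc.ne' s) x = dilate c (realKernel s) x := by
  have h : (𝓕⁻ (dilateSymbol c hc.ne' s) : 𝓢(Euc d, ℂ)) x
      = (c ^ d : ℝ) • (𝓕⁻ s : 𝓢(Euc d, ℂ)) (c • x) := by
    rw [SchwartzMap.fourierInv_coe, SchwartzMap.fourierInv_coe, Real.fourierInv_eq,
      Real.fourierInv_eq, ← integral_comp_smul_euc (c := c⁻¹) (by positivity)
      (fun ξ => Real.fourierChar (inner ℝ ξ (c • x)) • s ξ), smul_smul, inv_pow,
      mul_inv_cancel₀ (by positivity), one_smul]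
    refine integral_congr_ae (Eventually.of_forall fun ξ => ?_)
    simp only [dilateSymbol_apply, real_inner_smul_left, real_inner_smul_right]
    rw [← mul_assoc, mul_inv_cancel₀ hc.ne', one_mul]
  rw [realKernel_apply, h, dilate, realKernel_apply, Complex.smul_re, smul_eq_mul]

/-- The symbols telescope to the cut-off at scale `2 ^ N`. -/
theorem sum_dyadicKernel (N : ℕ) (x : Euc d) :
    ∑ n ∈ Finset.range (N + 1), dyadicKernel n x = dilate (2 ^ N) (dyadicKernel (d := d) 0) x := by
  rw [dyadicKernel_eq 0]
  change _ = dilate (2 ^ N) (realKernel (cutoffS d)) x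
  rw [← realKernel_dilateSymbol (by positivity)]
  induction N with
  | zero =>
    rw [Finset.sum_range_one, dyadicKernel_eq]
    congr 2
    ext ξ
    rw [dilateSymbol_apply]
    simp
    rfl
  | succ N ih =>
    rw [Finset.sum_range_succ, ih, dyadicKernel_eq]
    have : ((hasCompactSupport_dyadicSymbol (N + 1)).toSchwartzMap (contDiff_dyadicSymbol (N + 1)) :
        𝓢(Euc d, ℂ)) = dilateSymbol (2 ^ (N + 1)) (by positivity) (cutoffS d)
          - dilateSymbol (2 ^ N) (by positivity) (cutoffS d) := by
      ext ξ
      rfl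
    rw [this, realKernel_sub, sub_apply]
    ring

theorem integral_dyadicKernel_zero : ∫ u, dyadicKernel (d := d) 0 u = 1 := by
  have hre : ∀ ξ, (starRingEnd ℂ) (cutoffS d ξ) = cutoffS d ξ := conj_cutoff
  have heven : ∀ ξ, cutoffS d (-ξ) = cutoffS d ξ := fun ξ => cutoff_congr (norm_neg ξ)
  have h := fourier_realKernel hre heven 0
  rw [cutoffS_apply, cutoff_eq_one (by simp), Real.fourier_eq] at h
  simp only [inner_zero_right, neg_zero, AddChar.map_zero_eq_one, one_smul] at h
  have h' : ((∫ u, realKernel (cutoffS d) u : ℝ) : ℂ) = 1 := by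
    rw [← integral_complex_ofReal]
    exact h
  exact_mod_cast h'

variable (f : VecDistribution d)

/-- Both sides pair `f` with the same function, written once as an average of translates of the
reflected kernel and once as an average of translates of `φ`. -/
theorem integral_smul_block_eq (K φ : 𝓢(Euc d, ℝ)) (y : Euc d) :
    ∫ x, φ (x + y) • f (reflectTranslate K x) = ∫ u, K u • f (shift (u + y) φ) := by
  have hw : ∀ k : ℕ, Integrable fun u => ‖u‖ ^ k * φ (y - u) := by
    intro k
    have h1 := (integrable_moment_schwartz (reflectTranslate φ y) k)
    simpa only [reflectTranslate_apply] using h1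
  have h := integral_apply_shift_eq f hw (integrable_moment_schwartz K)
    (φ := reflectTranslate K 0) (φ' := shift y φ) fun v => ?_
  · simp_rw [shift_shift, shift_reflectTranslate, zero_sub] at h
    rw [← h, ← integral_neg_eq_self]
    refine integral_congr_ae (Eventually.of_forall fun u => ?_)
    simp only
    rw [neg_add_eq_sub]
  · simp_rw [reflectTranslate_apply, shift_apply]
    rw [← integral_sub_left_eq_self (fun u => K u * φ (v + u + y)) volume (-v)]
    refine integral_congr_ae (Eventually.of_forall fun u => ?_)
    simp only
    rw [show 0 - (v + u) = -v - u by abel, show v + (-v - u) + y = y - u by abel, mul_comm]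

theorem integrable_smul_block (K φ : 𝓢(Euc d, ℝ)) (y : Euc d) :
    Integrable fun u => K u • f (shift (u + y) φ) := by
  have := integrable_smul_apply_shift f (integrable_moment_schwartz K) (shift y φ)
  simpa only [shift_shift] using this

/-- Partial sums of the decomposition act as an approximate identity: the translations `2^{-N} u +
y` concentrate at `y`. -/
theorem sum_integral_smul_lpBlock (φ : 𝓢(Euc d, ℝ)) (y : Euc d) (N : ℕ) :
    ∑ n ∈ Finset.range (N + 1), ∫ x, φ (x + y) • lpBlock f n x
      = ∫ u, dyadicKernel (d := d) 0 u • f (shift (((2 : ℝ) ^ N)⁻¹ • u + y) φ) := by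
  unfold lpBlock
  simp_rw [integral_smul_block_eq]
  rw [← integral_finsetSum _ fun n _ => integrable_smul_block f _ φ y]
  simp_rw [← Finset.sum_smul, sum_dyadicKernel, dilate]
  rw [← integral_comp_smul_euc (c := 2 ^ N) (by positivity) (fun u => dyadicKernel (d := d) 0 u •
    f (shift (((2 : ℝ) ^ N)⁻¹ • u + y) φ)), ← integral_smul]
  refine integral_congr_ae (Eventually.of_forall fun u => ?_)
  simp only
  rw [smul_smul, inv_smul_smul₀ (by positivity)]

/-- The majorant is uniform in `N` and in bounded `y`, so it serves both the limit at a fixed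
translation and the later limit under an integral over `μ`. -/
theorem exists_bound_smul_dyadic (φ : 𝓢(Euc d, ℝ)) (ρ : ℝ) :
    ∃ b : Euc d → ℝ, Integrable b ∧ ∀ (N : ℕ) (y u : Euc d), ‖y‖ ≤ ρ →
      ‖dyadicKernel (d := d) 0 u • f (shift (((2 : ℝ) ^ N)⁻¹ • u + y) φ)‖ ≤ b u := by
  obtain ⟨C, m, hC, h⟩ := exists_norm_apply_shift_le f φ
  refine ⟨fun u => (C * (1 + |ρ|) ^ m) * ((1 + ‖u‖) ^ m * ‖dyadicKernel (d := d) 0 u‖),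
    (integrable_one_add_pow (integrable_moment_schwartz _) m).const_mul _, fun N y u hy => ?_⟩
  rw [norm_smul]
  have h1 : ‖((2 : ℝ) ^ N)⁻¹ • u + y‖ ≤ ‖u‖ + |ρ| := by
    refine (norm_add_le _ _).trans (add_le_add ?_ (hy.trans (le_abs_self ρ)))
    rw [norm_smul]
    refine mul_le_of_le_one_left (norm_nonneg _) ?_
    rw [norm_inv, norm_pow, Real.norm_ofNat]
    exact inv_le_one_of_one_le₀ (one_le_pow₀ (by norm_num))
  calc _ ≤ ‖dyadicKernel (d := d) 0 u‖ * (C * (1 + ‖((2 : ℝ) ^ N)⁻¹ • u + y‖) ^ m) := by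
        gcongr; exact h _
    _ ≤ ‖dyadicKernel (d := d) 0 u‖ * (C * ((1 + |ρ|) * (1 + ‖u‖)) ^ m) := by
        gcongr
        nlinarith [mul_nonneg (abs_nonneg ρ) (norm_nonneg u)]
    _ = _ := by rw [mul_pow]; ring

theorem tendsto_sum_lpBlock (φ : 𝓢(Euc d, ℝ)) (y : Euc d) :
    Tendsto (fun N => ∑ n ∈ Finset.range (N + 1), ∫ x, φ (x + y) • lpBlock f n x) atTop
      (𝓝 (f (shift y φ))) := by
  simp_rw [sum_integral_smul_lpBlock]
  obtain ⟨b, hb, hbd⟩ := exists_bound_smul_dyadic f φ ‖y‖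
  have hlim : f (shift y φ) = ∫ u, dyadicKernel (d := d) 0 u • f (shift y φ) := by
    rw [integral_smul_const, integral_dyadicKernel_zero, one_smul]
  rw [hlim]
  refine tendsto_integral_of_dominated_convergence b (fun N => ?_) hb
    (fun N => Eventually.of_forall fun u => hbd N y u le_rfl) (Eventually.of_forall fun u => ?_)
  · refine Continuous.aestronglyMeasurable ?_
    exact (dyadicKernel 0).continuous.smul ((continuous_apply_shift f φ).comp (by fun_prop))
  · refine Tendsto.const_smul ?_ _
    have h1 : Tendsto (fun N : ℕ => ((2 : ℝ) ^ N)⁻¹ • u + y) atTop (𝓝 y) := by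
      have h2 : Tendsto (fun N : ℕ => ((2 : ℝ) ^ N)⁻¹) atTop (𝓝 0) :=
        tendsto_inv_atTop_zero.comp (tendsto_pow_atTop_atTop_of_one_lt one_lt_two)
      simpa using (h2.smul_const u).add_const y
    exact ((continuous_apply_shift f φ).tendsto y).comp h1

theorem exists_bound_sum_lpBlock (φ : 𝓢(Euc d, ℝ)) (ρ : ℝ) :
    ∃ B : ℝ, ∀ (N : ℕ) (y : Euc d), ‖y‖ ≤ ρ →
      ‖∑ n ∈ Finset.range (N + 1), ∫ x, φ (x + y) • lpBlock f n x‖ ≤ B := by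
  obtain ⟨b, hb, hbd⟩ := exists_bound_smul_dyadic f φ ρ
  refine ⟨∫ u, b u, fun N y hy => ?_⟩
  rw [sum_integral_smul_lpBlock]
  exact norm_integral_le_of_norm_le hb (Eventually.of_forall fun u => hbd N y u hy)

end LPConvergence

/-! ### Convolutions of distributions and measures -/

section Convolution

variable {d : ℕ}

theorem integrable_smul_bcf (φ : 𝓢(Euc d, ℝ)) (g : Euc d →ᵇ Euc d) :
    Integrable fun x => φ x • g x :=
  φ.integrable.smul_bdd ‖g‖ g.continuous.aestronglyMeasurable
    (Eventually.of_forall g.norm_coe_le_norm)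

/-- A continuous function is determined by its integrals against smooth compactly supported
functions. Linearity in `f` and additivity in `μ` thus become pointwise identities between the
continuous representatives. -/
theorem IsConvolution.unique {f : VecDistribution d} {μ : Measure (Euc d)} {g g' : Euc d →ᵇ Euc d}
    (h : IsConvolution f μ g) (h' : IsConvolution f μ g') : g = g' := by
  have hae := ae_eq_zero_of_integral_contDiff_smul_eq_zero (μ := (volume : Measure (Euc d)))
    (f := fun x => g x - g' x) ((g.continuous.sub g'.continuous).locallyIntegrable)
    fun ψ hψ hψc => by
      have h1 := h (hψc.toSchwartzMap hψ)
      rw [← h' (hψc.toSchwartzMap hψ)] at h1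
      simp_rw [smul_sub]
      exact (integral_sub (integrable_smul_bcf (hψc.toSchwartzMap hψ) g) (integrable_smul_bcf (hψc.toSchwartzMap hψ) g')).trans
        (sub_eq_zero.2 h1)
  have heq := (Continuous.ae_eq_iff_eq volume (g.continuous.sub g'.continuous)
    (continuous_const (y := (0 : Euc d)))).1 hae
  ext1 x
  exact sub_eq_zero.1 (congrFun heq x)

theorem integrable_apply_shift (f : VecDistribution d) {μ : Measure (Euc d)} [IsFiniteMeasure μ]
    {ρ : ℝ} (hρ : ∀ᵐ y ∂μ, ‖y‖ ≤ ρ) (φ : 𝓢(Euc d, ℝ)) :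
    Integrable (fun y => f (shift y φ)) μ := by
  obtain ⟨C, N, hC, h⟩ := exists_norm_apply_shift_le f φ
  refine Integrable.of_bound (continuous_apply_shift f φ).aestronglyMeasurable
    (C * (1 + ρ) ^ N) ?_
  filter_upwards [hρ] with y hy
  refine (h y).trans ?_
  gcongr

theorem IsConvolution.sub {f f' : VecDistribution d} {μ : Measure (Euc d)} [IsFiniteMeasure μ]
    {ρ : ℝ} (hρ : ∀ᵐ y ∂μ, ‖y‖ ≤ ρ) {g g' : Euc d →ᵇ Euc d}
    (h : IsConvolution f μ g) (h' : IsConvolution f' μ g') : IsConvolution (f - f') μ (g - g') := by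
  intro φ
  have h1 : ∀ y, (f - f') (shift y φ) = f (shift y φ) - f' (shift y φ) := fun y => rfl
  change _ = ∫ y, (f - f') (shift y φ) ∂μ
  simp_rw [h1, BoundedContinuousFunction.sub_apply, smul_sub]
  rw [integral_sub (integrable_smul_bcf φ g) (integrable_smul_bcf φ g'),
    integral_sub (integrable_apply_shift f hρ φ) (integrable_apply_shift f' hρ φ), h φ, h' φ]

theorem IsConvolution.add_measure {f : VecDistribution d} {μ μ' : Measure (Euc d)}
    [IsFiniteMeasure μ] [IsFiniteMeasure μ'] {ρ : ℝ} (hρ : ∀ᵐ y ∂μ, ‖y‖ ≤ ρ)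
    (hρ' : ∀ᵐ y ∂μ', ‖y‖ ≤ ρ) {g g' : Euc d →ᵇ Euc d} (h : IsConvolution f μ g)
    (h' : IsConvolution f μ' g') : IsConvolution f (μ + μ') (g + g') := by
  intro φ
  change _ = ∫ y, f (shift y φ) ∂(μ + μ')
  simp_rw [BoundedContinuousFunction.add_apply, smul_add]
  rw [integral_add (integrable_smul_bcf φ g) (integrable_smul_bcf φ g'),
    integral_add_measure (integrable_apply_shift f hρ φ) (integrable_apply_shift f hρ' φ), h φ,
    h' φ]

theorem continuous_integral_block (f : VecDistribution d) (μ : Measure (Euc d)) [IsFiniteMeasure μ]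
    {n : ℕ} {B : ℝ} (hB : ∀ x, ‖lpBlock f n x‖ ≤ B) :
    Continuous fun x => ∫ y, lpBlock f n (x - y) ∂μ := by
  refine continuous_of_dominated (bound := fun _ => B) (fun x => ?_)
    (fun x => Eventually.of_forall fun y => hB _) (integrable_const _)
    (Eventually.of_forall fun y => ?_)
  · exact ((continuous_lpBlock f n).comp
      (continuous_const.sub continuous_id)).aestronglyMeasurable
  · exact (continuous_lpBlock f n).comp (continuous_id.sub continuous_const)

theorem integral_smul_integral_block (f : VecDistribution d) (μ : Measure (Euc d))
    [IsFiniteMeasure μ] {n : ℕ} {B : ℝ} (hB : ∀ x, ‖lpBlock f n x‖ ≤ B) (φ : 𝓢(Euc d, ℝ)) :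
    Integrable (fun y => ∫ x, φ (x + y) • lpBlock f n x) μ ∧
    ∫ x, φ x • ∫ y, lpBlock f n (x - y) ∂μ = ∫ y, (∫ x, φ (x + y) • lpBlock f n x) ∂μ := by
  have hc : Continuous fun a : Euc d × Euc d => lpBlock f n (a.1 - a.2) :=
    (continuous_lpBlock f n).comp (by fun_prop)
  have hint : Integrable (Function.uncurry fun (x y : Euc d) => φ x • lpBlock f n (x - y))
      ((volume : Measure (Euc d)).prod μ) := by
    have h1 : Integrable (fun a : Euc d × Euc d => φ a.1) ((volume : Measure (Euc d)).prod μ) :=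
      φ.integrable.comp_fst μ
    exact h1.smul_bdd B hc.aestronglyMeasurable (Eventually.of_forall fun a => hB _)
  have hshift : ∀ y, ∫ x, φ x • lpBlock f n (x - y) = ∫ x, φ (x + y) • lpBlock f n x := by
    intro y
    rw [← integral_add_right_eq_self _ y]
    simp_rw [add_sub_cancel_right]
  refine ⟨(hint.integral_prod_right).congr (Eventually.of_forall fun y => hshift y), ?_⟩
  simp_rw [← integral_smul]
  rw [integral_integral_swap hint]
  simp_rw [hshift]

/-- The sum of the convolutions of the Littlewood–Paley blocks is the convolution. -/
theorem isConvolution_of_tsum (f : VecDistribution d) (μ : Measure (Euc d)) [IsFiniteMeasure μ]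
    {ρ : ℝ} (hρ : ∀ᵐ y ∂μ, ‖y‖ ≤ ρ) (hB : ∀ n, ∃ B : ℝ, ∀ x, ‖lpBlock f n x‖ ≤ B) {b : ℕ → ℝ}
    (hb : Summable b) (hbd : ∀ n x, ‖∫ y, lpBlock f n (x - y) ∂μ‖ ≤ b n) {g : Euc d →ᵇ Euc d}
    (hg : ∀ x, g x = ∑' n, ∫ y, lpBlock f n (x - y) ∂μ) : IsConvolution f μ g := by
  intro φ
  change _ = ∫ y, f (shift y φ) ∂μ
  choose B hB using hB
  have hcont := fun n => continuous_integral_block f μ (hB n)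
  have hint : ∀ n, Integrable fun x => φ x • ∫ y, lpBlock f n (x - y) ∂μ := fun n =>
    φ.integrable.smul_bdd (b n) (hcont n).aestronglyMeasurable (Eventually.of_forall (hbd n))
  have hsum : Summable fun n => ∫ x, ‖φ x • ∫ y, lpBlock f n (x - y) ∂μ‖ := by
    refine Summable.of_nonneg_of_le (fun n => integral_nonneg fun x => norm_nonneg _) (fun n => ?_)
      (hb.mul_left (∫ x, ‖φ x‖))
    rw [← integral_mul_const]
    refine integral_mono (hint n).norm (φ.integrable.norm.mul_const _) fun x => ?_
    simp only
    rw [norm_smul]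
    gcongr
    exact hbd n x
  have h1 := hasSum_integral_of_summable_integral_norm hint hsum
  have h2 := (tendsto_add_atTop_iff_nat 1).2 h1.tendsto_sum_nat
  have h3 : ∀ N, ∑ n ∈ Finset.range (N + 1), ∫ x, φ x • ∫ y, lpBlock f n (x - y) ∂μ
      = ∫ y, (∑ n ∈ Finset.range (N + 1), ∫ x, φ (x + y) • lpBlock f n x) ∂μ := by
    intro N
    rw [integral_finsetSum _ fun n _ => (integral_smul_integral_block f μ (hB n) φ).1]
    exact Finset.sum_congr rfl fun n _ => (integral_smul_integral_block f μ (hB n) φ).2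
  simp_rw [h3] at h2
  -- The partial sums have two limits: the series of block convolutions tested with `φ`, by
  -- summability of `b`, and the pairing that defines the convolution, by dominated convergence over
  -- the bounded support of `μ`.
  obtain ⟨B', hB'⟩ := exists_bound_sum_lpBlock f φ ρ
  have h4 : Tendsto (fun N => ∫ y, (∑ n ∈ Finset.range (N + 1), ∫ x, φ (x + y) • lpBlock f n x) ∂μ)
      atTop (𝓝 (∫ y, f (shift y φ) ∂μ)) := by
    refine tendsto_integral_of_dominated_convergence (fun _ => B') (fun N => ?_)
      (integrable_const _) (fun N => ?_) (Eventually.of_forall fun y => tendsto_sum_lpBlock f φ y)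
    · exact (integrable_finsetSum _ fun n _ =>
        (integral_smul_integral_block f μ (hB n) φ).1).aestronglyMeasurable
    · filter_upwards [hρ] with y hy
      exact hB' N y hy
  have h5 : ∫ x, φ x • g x = ∫ x, ∑' n, φ x • ∫ y, lpBlock f n (x - y) ∂μ := by
    refine integral_congr_ae (Eventually.of_forall fun x => ?_)
    simp only
    rw [hg x, tsum_const_smul'']
  rw [h5]
  exact tendsto_nhds_unique h2 h4

end Convolution

/-! ### Series with geometric bounds -/

section Series

variable {V : Type*} [NormedAddCommGroup V]

/-- The constant in the Hölder bound of a lacunary series. -/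
def holderConst (γ : ℝ) : ℝ := (1 - (2 : ℝ) ^ (-(1 - γ)))⁻¹ + 2 * (1 - (2 : ℝ) ^ (-γ))⁻¹

theorem two_rpow_neg_lt_one {β : ℝ} (hβ : 0 < β) : (2 : ℝ) ^ (-β) < 1 :=
  Real.rpow_lt_one_of_one_lt_of_neg one_lt_two (by linarith)

theorem two_rpow_neg_pow (β : ℝ) (n : ℕ) : ((2 : ℝ) ^ (-β)) ^ n = 2 ^ (-(n * β)) := by
  rw [← Real.rpow_natCast, ← Real.rpow_mul (by norm_num)]
  congr 1
  ring

theorem holderConst_pos {γ : ℝ} (hγ : 0 < γ) (hγ1 : γ < 1) : 0 < holderConst γ := by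
  have h1 := two_rpow_neg_lt_one hγ
  have h2 := two_rpow_neg_lt_one (show 0 < 1 - γ by linarith)
  have h3 : 0 < (1 - (2 : ℝ) ^ (-(1 - γ)))⁻¹ := inv_pos.2 (by linarith)
  have h4 : 0 < (1 - (2 : ℝ) ^ (-γ))⁻¹ := inv_pos.2 (by linarith)
  unfold holderConst
  positivity

/-- A lacunary series is bounded. -/
theorem norm_tsum_le_of_lacunary {E : Type*} [CompleteSpace V] {u : ℕ → E → V} {K γ : ℝ} (hK : 0 ≤ K)
    (hγ : 0 < γ) (hγ1 : γ < 1) (h : ∀ n x, ‖u n x‖ ≤ K * 2 ^ (-(n * γ))) (x : E) :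
    ‖∑' n, u n x‖ ≤ K * holderConst γ := by
  have h1 := two_rpow_neg_lt_one hγ
  have h2 := two_rpow_neg_lt_one (show 0 < 1 - γ by linarith)
  have hsum := (hasSum_geometric_of_lt_one (by positivity) h1).mul_left K
  refine (tsum_of_norm_bounded hsum fun n => ?_).trans ?_
  · rw [two_rpow_neg_pow]; exact h n x
  · have h3 : 0 < (1 - (2 : ℝ) ^ (-(1 - γ)))⁻¹ := inv_pos.2 (by linarith)
    have h4 : 0 < (1 - (2 : ℝ) ^ (-γ))⁻¹ := inv_pos.2 (by linarith)
    unfold holderConst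
    gcongr
    linarith

theorem summable_of_lacunary {E : Type*} [CompleteSpace V] {u : ℕ → E → V} {K γ : ℝ} (hγ : 0 < γ)
    (h : ∀ n x, ‖u n x‖ ≤ K * 2 ^ (-(n * γ))) (x : E) : Summable fun n => u n x := by
  have hsum := (summable_geometric_of_lt_one (by positivity) (two_rpow_neg_lt_one hγ)).mul_left K
  refine Summable.of_norm_bounded hsum fun n => ?_
  rw [two_rpow_neg_pow]
  exact h n x

/-- A lacunary series is Hölder continuous. -/
theorem norm_tsum_sub_le_of_lacunary {E : Type*} [NormedAddCommGroup E] [CompleteSpace V] {u : ℕ → E → V} {K γ : ℝ} (hK : 0 ≤ K)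
    (hγ : 0 < γ) (hγ1 : γ < 1) (h : ∀ n x, ‖u n x‖ ≤ K * 2 ^ (-(n * γ)))
    (h' : ∀ n x y, ‖u n x - u n y‖ ≤ K * 2 ^ (n * (1 - γ)) * ‖x - y‖) (x y : E) :
    ‖∑' n, u n x - ∑' n, u n y‖ ≤ K * holderConst γ * ‖x - y‖ ^ γ := by
  have h1 := two_rpow_neg_lt_one hγ
  have hγ' : 0 < 1 - γ := by linarith
  have h2 := two_rpow_neg_lt_one hγ'
  have h3 : 0 < (1 - (2 : ℝ) ^ (-(1 - γ)))⁻¹ := inv_pos.2 (by linarith)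
  have h4 : 0 < (1 - (2 : ℝ) ^ (-γ))⁻¹ := inv_pos.2 (by linarith)
  rw [← (summable_of_lacunary hγ h x).tsum_sub (summable_of_lacunary hγ h y)]
  set a := ‖x - y‖ with ha
  have htwo : ∀ n, ‖u n x - u n y‖ ≤ K * (2 * ((2 : ℝ) ^ (-γ)) ^ n) := fun n => by
    rw [two_rpow_neg_pow]
    have := norm_sub_le (u n x) (u n y)
    have := h n x
    have := h n y
    linarith
  rcases eq_or_lt_of_le (norm_nonneg (x - y)) with ha0 | ha0
  · have : x = y := sub_eq_zero.1 (norm_eq_zero.1 ha0.symm)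
    subst this
    simp only [sub_self, tsum_zero, norm_zero]
    exact mul_nonneg (mul_nonneg hK (holderConst_pos hγ hγ1).le) (Real.rpow_nonneg (norm_nonneg _) _)
  rw [← ha] at ha0
  rcases le_or_gt 1 a with ha1 | ha1
  · have hsum := ((hasSum_geometric_of_lt_one (by positivity) h1).mul_left 2).mul_left K
    refine (tsum_of_norm_bounded hsum htwo).trans ?_
    have h5 : 1 ≤ a ^ γ := Real.one_le_rpow ha1 hγ.le
    have h6 : K * (2 * (1 - (2 : ℝ) ^ (-γ))⁻¹) ≤ K * holderConst γ := by
      unfold holderConst; gcongr; linarith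
    have h7 : 0 ≤ K * holderConst γ := mul_nonneg hK (holderConst_pos hγ hγ1).le
    nlinarith
  -- `2 ^ (-m)` is the dyadic size of `‖x - y‖`. For `n ≤ m` the Lipschitz bound is used, for larger
  -- `n` the uniform bound; both equal `a ^ γ` times a geometric factor in the distance from `n` to
  -- `m`.
  · obtain ⟨m, hm1, hm2⟩ := exists_nat_pow_near (x := a⁻¹) (y := (2 : ℝ))
      ((one_le_inv₀ ha0).2 ha1.le) one_lt_two
    set b : ℕ → ℝ := fun n => if n < m + 1 then ((2 : ℝ) ^ (-(1 - γ))) ^ (m - n)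
      else 2 * ((2 : ℝ) ^ (-γ)) ^ (n - (m + 1)) with hb
    have hbsum : Summable b := by
      rw [← summable_nat_add_iff (m + 1)]
      have : (fun n => b (n + (m + 1))) = fun n => 2 * ((2 : ℝ) ^ (-γ)) ^ n := by
        funext n
        simp only [hb]
        rw [if_neg (by omega), Nat.add_sub_cancel]
      rw [this]
      exact (summable_geometric_of_lt_one (by positivity) h1).mul_left 2
    have hbtsum : ∑' n, b n ≤ holderConst γ := by
      rw [← hbsum.sum_add_tsum_nat_add (m + 1)]
      unfold holderConst
      refine add_le_add ?_ (le_of_eq ?_)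
      · have e1 : ∑ n ∈ Finset.range (m + 1), b n
            = ∑ n ∈ Finset.range (m + 1), ((2 : ℝ) ^ (-(1 - γ))) ^ n := by
          rw [← Finset.sum_range_reflect]
          refine Finset.sum_congr rfl fun n hn => ?_
          have := Finset.mem_range.1 hn
          simp only [hb]
          rw [if_pos (by omega)]
          congr 1
          omega
        rw [e1, ← tsum_geometric_of_lt_one (by positivity) h2]
        exact (summable_geometric_of_lt_one (by positivity) h2).sum_le_tsum _
          fun n _ => by positivity
      · have : (fun n => b (n + (m + 1))) = fun n => 2 * ((2 : ℝ) ^ (-γ)) ^ n := by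
          funext n
          simp only [hb]
          rw [if_neg (by omega), Nat.add_sub_cancel]
        rw [this, tsum_mul_left, tsum_geometric_of_lt_one (by positivity) h1]
    have ha2 : a ≤ (2 : ℝ) ^ (-(m : ℝ)) := by
      rw [Real.rpow_neg (by norm_num), Real.rpow_natCast]
      exact (le_inv_comm₀ (by positivity) ha0).1 hm1
    have ha3 : (2 : ℝ) ^ (-((m : ℝ) + 1)) ≤ a := by
      rw [Real.rpow_neg (by norm_num)]
      rw [show ((m : ℝ) + 1) = ((m + 1 : ℕ) : ℝ) by push_cast; rfl, Real.rpow_natCast]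
      exact ((inv_lt_comm₀ ha0 (by positivity)).1 hm2).le
    have hterm : ∀ n, ‖u n x - u n y‖ ≤ K * a ^ γ * b n := by
      intro n
      simp only [hb]
      split_ifs with hn
      · have hnm : n ≤ m := by omega
        have e1 : a = a ^ γ * a ^ (1 - γ) := by
          rw [← Real.rpow_add ha0]; simp
        have e2 : a ^ (1 - γ) ≤ (2 : ℝ) ^ (-((m : ℝ) * (1 - γ))) := by
          rw [← neg_mul, Real.rpow_mul (by norm_num)]
          exact Real.rpow_le_rpow ha0.le ha2 hγ'.le
        calc ‖u n x - u n y‖ ≤ K * 2 ^ (n * (1 - γ)) * a := h' n x y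
          _ = K * a ^ γ * (2 ^ (n * (1 - γ)) * a ^ (1 - γ)) := by
              conv_lhs => rw [e1]
              ring
          _ ≤ K * a ^ γ * (2 ^ (n * (1 - γ)) * (2 : ℝ) ^ (-((m : ℝ) * (1 - γ)))) := by gcongr
          _ = _ := by
              rw [two_rpow_neg_pow, ← Real.rpow_add (by norm_num), Nat.cast_sub hnm]
              congr 2
              ring
      · have hnm : m + 1 ≤ n := by omega
        have e1 : (2 : ℝ) ^ (-(((m : ℝ) + 1) * γ)) ≤ a ^ γ := by
          rw [← neg_mul, Real.rpow_mul (by norm_num)]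
          exact Real.rpow_le_rpow (by positivity) ha3 hγ.le
        calc ‖u n x - u n y‖ ≤ K * (2 * ((2 : ℝ) ^ (-γ)) ^ n) := htwo n
          _ = K * (2 : ℝ) ^ (-(((m : ℝ) + 1) * γ)) * (2 * ((2 : ℝ) ^ (-γ)) ^ (n - (m + 1))) := by
              rw [two_rpow_neg_pow, two_rpow_neg_pow, mul_assoc, mul_left_comm (2 ^ _) 2,
                ← Real.rpow_add (by norm_num), Nat.cast_sub hnm]
              congr 3
              push_cast
              ring
          _ ≤ _ := by gcongr
    refine (tsum_of_norm_bounded (hbsum.hasSum.mul_left (K * a ^ γ)) hterm).trans ?_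
    calc K * a ^ γ * ∑' n, b n ≤ K * a ^ γ * holderConst γ := by gcongr
      _ = _ := by ring

end Series

/-! ### Besov norms -/

section BesovNorm

variable {d : ℕ}

theorem seqNorm_add_le {q : ℝ≥0∞} (hq : 1 ≤ q) (a b : ℕ → ℝ≥0∞) :
    seqNorm q (fun n => a n + b n) ≤ seqNorm q a + seqNorm q b := by
  unfold seqNorm
  split_ifs with h
  · exact iSup_le fun n => add_le_add (le_iSup a n) (le_iSup b n)
  · have hq1 : 1 ≤ q.toReal := by
      rw [← ENNReal.toReal_one]; exact ENNReal.toReal_mono h hq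
    simp only [← lintegral_count]
    exact ENNReal.lintegral_Lp_add_le (Measurable.of_discrete).aemeasurable
      (Measurable.of_discrete).aemeasurable hq1

theorem seqNorm_mono (q : ℝ≥0∞) {a b : ℕ → ℝ≥0∞} (hab : ∀ n, a n ≤ b n) :
    seqNorm q a ≤ seqNorm q b := by
  unfold seqNorm
  split_ifs with h
  · exact iSup_mono hab
  · exact ENNReal.rpow_le_rpow (ENNReal.tsum_le_tsum fun n =>
      ENNReal.rpow_le_rpow (hab n) ENNReal.toReal_nonneg) (by positivity)

theorem le_seqNorm {q : ℝ≥0∞} (hq : 1 ≤ q) (a : ℕ → ℝ≥0∞) (n : ℕ) : a n ≤ seqNorm q a := by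
  unfold seqNorm
  split_ifs with h
  · exact le_iSup a n
  · have hq1 : 1 ≤ q.toReal := by
      rw [← ENNReal.toReal_one]; exact ENNReal.toReal_mono h hq
    rw [one_div, ENNReal.le_rpow_inv_iff (by linarith)]
    exact ENNReal.le_tsum n

theorem lpBlock_add (f g : VecDistribution d) (n : ℕ) :
    lpBlock (f + g) n = lpBlock f n + lpBlock g n := rfl

theorem lpBlock_neg (f : VecDistribution d) (n : ℕ) : lpBlock (-f) n = -lpBlock f n := rfl

theorem besovNorm_neg (s p : ℝ) (q : ℝ≥0∞) (f : VecDistribution d) :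
    besovNorm s p q (-f) = besovNorm s p q f := by
  unfold besovNorm
  simp_rw [lpBlock_neg, eLpNorm_neg]

theorem besovNorm_add_le (s : ℝ) {p : ℝ} (hp : 1 ≤ p) {q : ℝ≥0∞} (hq : 1 ≤ q)
    (f g : VecDistribution d) :
    besovNorm s p q (f + g) ≤ besovNorm s p q f + besovNorm s p q g := by
  refine le_trans (seqNorm_mono q fun n => ?_) (seqNorm_add_le hq _ _)
  rw [← mul_add, lpBlock_add]
  gcongr
  exact eLpNorm_add_le (continuous_lpBlock f n).aestronglyMeasurable
    (continuous_lpBlock g n).aestronglyMeasurable (by simpa using hp)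

theorem besovNorm_sub_le (s : ℝ) {p : ℝ} (hp : 1 ≤ p) {q : ℝ≥0∞} (hq : 1 ≤ q)
    (f g : VecDistribution d) :
    besovNorm s p q (f - g) ≤ besovNorm s p q f + besovNorm s p q g := by
  rw [sub_eq_add_neg, ← besovNorm_neg s p q g]
  exact besovNorm_add_le s hp hq _ _

/-- Only one block at a time is extracted from the norm; summability over blocks will come from
positive regularity instead of the summation index `q`. -/
theorem lpSize_lpBlock_le (s : ℝ) {p : ℝ} (hp : 1 ≤ p) {q : ℝ≥0∞} (hq : 1 ≤ q)
    (f : VecDistribution d) (n : ℕ) :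
    lpSize p (lpBlock f n) ≤ ENNReal.ofReal ((2 : ℝ) ^ (-((n : ℝ) * s))) * besovNorm s p q f := by
  have hp0 : 0 < p := by linarith
  have h1 : lpSize p (lpBlock f n) = eLpNorm (lpBlock f n) (ENNReal.ofReal p) volume := by
    rw [eLpNorm_eq_lintegral_rpow_enorm_toReal (by simpa using hp0) ENNReal.ofReal_ne_top,
      ENNReal.toReal_ofReal hp0.le]
    rfl
  have h2 := le_seqNorm hq (fun n => ENNReal.ofReal ((2 : ℝ) ^ ((n : ℝ) * s)) *
    eLpNorm (lpBlock f n) (ENNReal.ofReal p) volume) n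
  calc lpSize p (lpBlock f n) = ENNReal.ofReal ((2 : ℝ) ^ (-((n : ℝ) * s))) *
        (ENNReal.ofReal ((2 : ℝ) ^ ((n : ℝ) * s)) * lpSize p (lpBlock f n)) := by
        rw [← mul_assoc, ← ENNReal.ofReal_mul (by positivity), ← Real.rpow_add (by norm_num)]
        simp
    _ ≤ _ := by
        rw [h1]
        gcongr
        exact h2

end BesovNorm

/-! ### Block estimates for the convolution of a distribution and a measure -/

section BlockEstimates

variable {d : ℕ}

/-- Interpolation between `L¹` and `L^∞`. -/
theorem lpSize_le_of_bounded {F : Type*} [NormedAddCommGroup F] {q : ℝ} (hq : 1 ≤ q)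
    {G : Euc d → F} {S L : ℝ≥0∞} (hS : S ≠ ∞) (h : ∀ x, ‖G x‖ₑ ≤ S) (hL : ∫⁻ x, ‖G x‖ₑ ≤ L) :
    lpSize q G ≤ S ^ (1 - 1 / q) * L ^ (1 / q) := by
  have hq0 : 0 < q := by linarith
  have h1 : ∫⁻ x, ‖G x‖ₑ ^ q ≤ S ^ (q - 1) * L := by
    have h2 : ∀ x, ‖G x‖ₑ ^ q ≤ S ^ (q - 1) * ‖G x‖ₑ := by
      intro x
      calc ‖G x‖ₑ ^ q = ‖G x‖ₑ ^ (q - 1) * ‖G x‖ₑ := by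
            conv_rhs => rw [← ENNReal.rpow_one (‖G x‖ₑ), ← ENNReal.rpow_mul, one_mul]
            rw [← ENNReal.rpow_add_of_nonneg _ _ (by linarith) zero_le_one]
            simp
        _ ≤ _ := by
            exact mul_le_mul_left (ENNReal.rpow_le_rpow (h x) (by linarith)) _
    refine (lintegral_mono h2).trans ?_
    rw [lintegral_const_mul' _ _ (ENNReal.rpow_ne_top_of_nonneg (by linarith) hS)]
    gcongr
  unfold lpSize
  refine (ENNReal.rpow_le_rpow h1 (by positivity)).trans (le_of_eq ?_)
  rw [ENNReal.mul_rpow_of_nonneg _ _ (by positivity), ← ENNReal.rpow_mul]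
  congr 2
  field_simp

theorem lpSize_ne_top_of_bounded {q : ℝ} (hq : 1 ≤ q) {A : Euc d → ℝ} (hA : Integrable A) {S : ℝ}
    (h : ∀ x, ‖A x‖ ≤ S) : lpSize q A ≠ ∞ := by
  refine ne_top_of_le_ne_top (ENNReal.mul_ne_top
    (ENNReal.rpow_ne_top_of_nonneg (one_sub_one_div_nonneg hq) ENNReal.ofReal_ne_top)
    (ENNReal.rpow_ne_top_of_nonneg (by positivity) hA.2.ne))
    (lpSize_le_of_bounded hq (S := ENNReal.ofReal S) ENNReal.ofReal_ne_top (fun x => ?_) le_rfl)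
  rw [← ofReal_norm]
  exact ENNReal.ofReal_le_ofReal (h x)

/-- Young's inequality for the convolution of a bounded integrable function and a finite
measure. -/
theorem lpSize_average_le {q : ℝ} (hq : 1 ≤ q) {A : Euc d → ℝ} (hc : Continuous A) {S : ℝ}
    (h : ∀ x, ‖A x‖ ≤ S) (μ : Measure (Euc d)) [IsFiniteMeasure μ] :
    lpSize q (fun v => ∫ y, A (v - y) ∂μ)
      ≤ ENNReal.ofReal S ^ (1 - 1 / q) * (∫⁻ x, ‖A x‖ₑ) ^ (1 / q) * μ univ := by
  have hq0 : 0 < q := by linarith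
  have hm : Measurable fun a : Euc d × Euc d => ‖A (a.1 - a.2)‖ₑ :=
    (hc.comp (continuous_fst.sub continuous_snd)).enorm.measurable
  have h1 : ∀ v, ‖∫ y, A (v - y) ∂μ‖ₑ ≤ ENNReal.ofReal S * μ univ := by
    intro v
    refine (enorm_integral_le_lintegral_enorm _).trans ?_
    rw [← lintegral_const]
    refine lintegral_mono fun y => ?_
    rw [← ofReal_norm]
    exact ENNReal.ofReal_le_ofReal (h _)
  have h2 : ∫⁻ v, ‖∫ y, A (v - y) ∂μ‖ₑ ≤ (∫⁻ x, ‖A x‖ₑ) * μ univ := by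
    refine (lintegral_mono fun v => enorm_integral_le_lintegral_enorm _).trans ?_
    rw [lintegral_lintegral_swap hm.aemeasurable, ← lintegral_const]
    refine lintegral_mono fun y => le_of_eq ?_
    exact lintegral_sub_right_eq_self (fun v => ‖A v‖ₑ) y
  refine (lpSize_le_of_bounded hq (ENNReal.mul_ne_top ENNReal.ofReal_ne_top
    (measure_ne_top _ _)) h1 h2).trans (le_of_eq ?_)
  have h3 := one_sub_one_div_nonneg hq
  rw [ENNReal.mul_rpow_of_nonneg _ _ h3, ENNReal.mul_rpow_of_nonneg _ _ (by positivity),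
    mul_mul_mul_comm, ← ENNReal.rpow_add_of_nonneg _ _ h3 (by positivity), sub_add_cancel,
    ENNReal.rpow_one]

theorem continuous_average {A : Euc d → ℝ} (hc : Continuous A) {S : ℝ}
    (h : ∀ x, ‖A x‖ ≤ S) (μ : Measure (Euc d)) [IsFiniteMeasure μ] :
    Continuous fun v => ∫ y, A (v - y) ∂μ :=
  continuous_of_dominated (bound := fun _ => S)
    (fun v => (by fun_prop : Continuous fun y => A (v - y)).aestronglyMeasurable)
    (fun v => Eventually.of_forall fun y => h _) (integrable_const S)
    (Eventually.of_forall fun y => by fun_prop)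

/-- Reproducing kernels for the Littlewood–Paley projectors whose averages against a measure are
controlled by its `sbeNorm`. -/
theorem exists_adapted_kernels (hd : 0 < d) {α p q : ℝ} (hα : 0 < α) (hp : 1 ≤ p) (hq : 1 ≤ q)
    (R : ℝ) : ∃ (C : ℝ≥0∞) (B : ℝ) (A : ℕ → Euc d → ℝ) (H : ℕ → 𝓢(Euc d, ℝ)), C ≠ ∞ ∧ 0 ≤ B ∧
      (∀ n j w, j ≤ 2 → ‖iteratedFDeriv ℝ j (H n) w‖ ≤ B * decay w) ∧
      ∀ n, Continuous (A n) ∧ (∀ k : ℕ, Integrable fun u => ‖u‖ ^ k * A n u) ∧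
        lpSize q (A n) ≠ ∞ ∧
        IsReproducing (A n) (dilate (2 ^ n) (H n)) (dyadicKernel n : 𝓢(Euc d, ℝ)) ∧
        ∀ (μ : Measure (Euc d)) [IsFiniteMeasure μ] (x₀ : Euc d),
          μ (Metric.closedBall x₀ R)ᶜ = 0 →
            Continuous (fun v => ∫ y, A n (v - y) ∂μ) ∧
            lpSize q (fun v => ∫ y, A n (v - y) ∂μ)
              ≤ C * ENNReal.ofReal (2 ^ (-((n : ℝ) * α))) * sbeNorm α p q μ := by
  have hq0 : 0 < q := by linarith
  obtain ⟨b, -, hbk, -, hb⟩ := exists_diffOp_eq_sum ⌈α + d - 1⌉₊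
  obtain ⟨C₁, hC₁, h₁⟩ := exists_sbe_average_bound (d := d) hα hp hb
  obtain ⟨C₀, hC₀, h₀⟩ := exists_mass_bound (p := p) hd hα hp hq R
  set m := ⌈α + d - 1⌉₊ + 1 with hm
  have hm2 : ⌈α + d - 1⌉₊ + 2 = m + 1 := rfl
  rw [hm2] at h₁
  obtain ⟨ρ, hρ⟩ := exists_gaussCombHat_ne_zero (d := d) hbk
  obtain ⟨H₀, hH₀⟩ := exists_isReproducing_zero (d := d)
  obtain ⟨l, hl, H₁, hH₁⟩ := exists_isReproducing_succ
    (integrable_moment_gaussComb (d := d) b (m + 1)) (fourier_gaussComb b (m + 1))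
    (contDiff_gaussCombHat b (m + 1)) (fun ξ => by unfold gaussCombHat; simp) hρ
  choose B₀ hB₀ hB₀' using exists_iteratedFDeriv_le_decay H₀
  choose B₁ hB₁ hB₁' using exists_iteratedFDeriv_le_decay H₁
  set S := ∑ j ∈ Finset.range (m + 1), ‖b j‖ with hS
  have hH₀S : ∀ x, ‖H₀ x‖ ≤ B₀ 0 := fun x => by
    have h1 := hB₀' 0 x
    rw [norm_iteratedFDeriv_zero] at h1
    exact h1.trans (mul_le_of_le_one_right (hB₀ 0).le (decay_le_one x))
  have hH₀m := integrable_moment_schwartz H₀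
  have hGS : ∀ c : ℝ, 0 < c → ∀ x : Euc d, ‖dilate c (gaussComb b (m + 1)) x‖ ≤ c ^ d * S := by
    intro c hc x
    unfold dilate
    rw [norm_mul, Real.norm_of_nonneg (by positivity)]
    gcongr
    exact norm_gaussComb_le b (m + 1) _
  have hGc : ∀ c : ℝ, Continuous (dilate c (gaussComb (d := d) b (m + 1))) := by
    intro c
    have := continuous_gaussComb (d := d) b (m + 1)
    unfold dilate
    fun_prop
  -- The first summand of the constant serves the Gaussian kernels of positive index, with the fixed
  -- scale `l` absorbed. The second serves index zero, where a Schwartz kernel is used and only the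
  -- total mass of `μ` is available. Derivatives of the kernels up to order two are bounded by one
  -- sum.
  refine ⟨ENNReal.ofReal (C₁ * l ^ (-α)) + ENNReal.ofReal (B₀ 0) ^ (1 - 1 / q) *
      (∫⁻ x, ‖H₀ x‖ₑ) ^ (1 / q) * C₀, ∑ j ∈ Finset.range 3, (B₀ j + B₁ j),
    fun n => n.casesOn H₀ fun n => dilate (2 ^ (n + 1) * l) (gaussComb b (m + 1)),
    fun n => n.casesOn H₀ fun _ => H₁, ?_, ?_, ?_, ?_⟩
  · exact ENNReal.add_ne_top.2 ⟨ENNReal.ofReal_ne_top, ENNReal.mul_ne_top (ENNReal.mul_ne_top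
      (ENNReal.rpow_ne_top_of_nonneg (one_sub_one_div_nonneg hq) ENNReal.ofReal_ne_top)
      (ENNReal.rpow_ne_top_of_nonneg (by positivity) (integrable_of_moment hH₀m).2.ne)) hC₀⟩
  · exact Finset.sum_nonneg fun j _ => add_nonneg (hB₀ j).le (hB₁ j).le
  · intro n j w hj
    have h1 : B₀ j + B₁ j ≤ ∑ j ∈ Finset.range 3, (B₀ j + B₁ j) :=
      Finset.single_le_sum (f := fun j => B₀ j + B₁ j)
        (fun j _ => add_nonneg (hB₀ j).le (hB₁ j).le) (Finset.mem_range.2 (by omega))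
    have h2 := decay_pos w
    cases n with
    | zero =>
      refine (hB₀' j w).trans ?_
      gcongr
      linarith [hB₁ j]
    | succ n =>
      refine (hB₁' j w).trans ?_
      gcongr
      linarith [hB₀ j]
  · intro n
    cases n with
    | zero =>
      refine ⟨H₀.continuous, hH₀m, lpSize_ne_top_of_bounded hq (integrable_of_moment hH₀m) hH₀S,
        ?_, fun μ _ x₀ hμ => ⟨continuous_average H₀.continuous hH₀S μ, ?_⟩⟩
      · have : dilate (2 ^ 0) H₀ = H₀ := by
          funext x
          simp [dilate]
        change IsReproducing H₀ (dilate (2 ^ 0) H₀) _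
        rw [this]
        exact hH₀
      · refine (lpSize_average_le hq H₀.continuous hH₀S μ).trans ?_
        have h1 := h₀ μ x₀ hμ
        calc _ ≤ ENNReal.ofReal (B₀ 0) ^ (1 - 1 / q) * (∫⁻ x, ‖H₀ x‖ₑ) ^ (1 / q) *
              (C₀ * sbeNorm α p q μ) := by gcongr
          _ = (ENNReal.ofReal (B₀ 0) ^ (1 - 1 / q) * (∫⁻ x, ‖H₀ x‖ₑ) ^ (1 / q) * C₀)
              * sbeNorm α p q μ := by simp only [mul_assoc]
          _ ≤ _ := by
              simp only [CharP.cast_eq_zero, zero_mul, neg_zero, Real.rpow_zero,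
                ENNReal.ofReal_one, mul_one]
              gcongr
              exact le_add_self
    | succ n =>
      have hc : (0 : ℝ) < 2 ^ (n + 1) * l := by positivity
      have hmom := integrable_dilate_moment hc (integrable_moment_gaussComb (d := d) b (m + 1))
      refine ⟨hGc _, hmom, lpSize_ne_top_of_bounded hq (integrable_of_moment hmom) (hGS _ hc),
        hH₁ n, fun μ _ x₀ _ => ⟨continuous_average (hGc _) (hGS _ hc) μ, ?_⟩⟩
      have h1 : lpSize q (fun v => ∫ y, dilate (2 ^ (n + 1) * l) (gaussComb b (m + 1)) (v - y) ∂μ)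
          ≤ ENNReal.ofReal (C₁ * (2 ^ (n + 1) * l) ^ (-α)) * sbeNorm α p q μ := by
        rw [sbeNorm_eq]
        unfold lpSize
        refine (ENNReal.rpow_le_rpow (lintegral_mono fun v =>
          ENNReal.rpow_le_rpow (h₁ _ hc μ v) hq0.le) (by positivity)).trans (le_of_eq ?_)
        simp_rw [ENNReal.mul_rpow_of_nonneg _ _ hq0.le]
        rw [lintegral_const_mul' _ _ (ENNReal.rpow_ne_top_of_nonneg hq0.le ENNReal.ofReal_ne_top),
          ENNReal.mul_rpow_of_nonneg _ _ (by positivity), ← ENNReal.rpow_mul,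
          mul_one_div_cancel hq0.ne', ENNReal.rpow_one]
      refine h1.trans ?_
      have h2 : C₁ * ((2 : ℝ) ^ (n + 1) * l) ^ (-α)
          = C₁ * l ^ (-α) * 2 ^ (-(((n + 1 : ℕ) : ℝ) * α)) := by
        rw [Real.mul_rpow (by positivity) hl.le, ← Real.rpow_natCast, ← Real.rpow_mul (by norm_num),
          mul_neg]
        ring
      rw [h2, ENNReal.ofReal_mul (by positivity)]
      gcongr
      exact le_self_add

theorem triConst_two_pow (p q : ℝ) (hp : 1 ≤ p) (hq : 1 ≤ q) (n : ℕ) :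
    triConst d p q (2 ^ n) = ENNReal.ofReal ((2 : ℝ) ^ (-((n : ℝ) * (d * (1 - (1 / q + 1 / p - 1))))))
      * (∫⁻ w : Euc d, ENNReal.ofReal (decay w)) ^ (1 - (1 / q + 1 / p - 1)) := by
  have h1 := one_sub_one_div_nonneg hp
  have h2 := one_sub_one_div_nonneg hq
  unfold triConst
  rw [ENNReal.mul_rpow_of_nonneg _ _ (by linarith), ENNReal.ofReal_rpow_of_nonneg (by positivity)
    (by linarith), ← pow_mul, ← Real.rpow_natCast, ← Real.rpow_neg (by norm_num),
    ← Real.rpow_mul (by norm_num)]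
  congr 3
  push_cast
  ring

/-- The convolutions of the Littlewood–Paley blocks of a Besov distribution with a measure. -/
theorem exists_block_estimates (hd : 0 < d) {α p₁ q α' p γ₀ : ℝ} {q' : ℝ≥0∞} (hα : 0 < α)
    (hp₁ : 1 ≤ p₁) (hq : 1 ≤ q) (hp : 1 ≤ p) (hq' : 1 ≤ q') (hpq : 1 ≤ 1 / q + 1 / p)
    (hγ₀ : γ₀ = α + α' - d * (1 / q + 1 / p - 1)) (R : ℝ) :
    ∃ C : ℝ, 0 ≤ C ∧ ∀ (f : VecDistribution d), besovNorm α' p q' f ≠ ∞ →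
      ∀ (μ : Measure (Euc d)) [IsFiniteMeasure μ] (x₀ : Euc d), μ (Metric.closedBall x₀ R)ᶜ = 0 →
        sbeNorm α p₁ q μ ≠ ∞ →
        (∀ n, ∃ B : ℝ, ∀ x, ‖lpBlock f n x‖ ≤ B) ∧
        ∃ u' : ℕ → Euc d → Euc d →L[ℝ] Euc d,
          (∀ n x, HasFDerivAt (fun x => ∫ y, lpBlock f n (x - y) ∂μ) (u' n x) x) ∧
          (∀ n x, ‖∫ y, lpBlock f n (x - y) ∂μ‖
            ≤ C * (besovNorm α' p q' f).toReal * (sbeNorm α p₁ q μ).toReal * 2 ^ (-(n * γ₀))) ∧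
          (∀ n x, ‖u' n x‖
            ≤ C * (besovNorm α' p q' f).toReal * (sbeNorm α p₁ q μ).toReal
              * 2 ^ (n * (1 - γ₀))) ∧
          ∀ n x y, ‖u' n x - u' n y‖
            ≤ C * (besovNorm α' p q' f).toReal * (sbeNorm α p₁ q μ).toReal
              * 2 ^ (n * (2 - γ₀)) * ‖x - y‖ := by
  obtain ⟨C, B, A, H, hC, hB, hBH, hA⟩ := exists_adapted_kernels (p := p₁) hd hα hp₁ hq R
  set Dd : ℝ≥0∞ := (∫⁻ w : Euc d, ENNReal.ofReal (decay w)) ^ (1 - (1 / q + 1 / p - 1)) with hDd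
  have hDdt : Dd ≠ ∞ := ENNReal.rpow_ne_top_of_nonneg
    (by linarith [one_sub_one_div_nonneg hp, one_sub_one_div_nonneg hq])
    lintegral_decay_lt_top.ne
  refine ⟨B * Dd.toReal * C.toReal, by positivity, fun f hf μ _ x₀ hμ hM => ?_⟩
  set N := besovNorm α' p q' f with hN
  set M := sbeNorm α p₁ q μ with hMdef
  obtain ⟨G, hG⟩ : ∃ G : ℕ → Euc d → ℝ, ∀ n, G n = fun v => ∫ y, A n (v - y) ∂μ := ⟨_, fun _ => rfl⟩
  have hGc : ∀ n, Continuous (G n) := fun n => by rw [hG]; exact ((hA n).2.2.2.2 μ x₀ hμ).1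
  have hGle : ∀ n, lpSize q (G n) ≤ C * ENNReal.ofReal (2 ^ (-((n : ℝ) * α))) * M := fun n => by
    rw [hG]; exact ((hA n).2.2.2.2 μ x₀ hμ).2
  have hGt : ∀ n, lpSize q (G n) ≠ ∞ := fun n => ne_top_of_le_ne_top
    (ENNReal.mul_ne_top (ENNReal.mul_ne_top hC ENNReal.ofReal_ne_top) hM) (hGle n)
  have hFle := lpSize_lpBlock_le α' hp hq' f
  have hFt : ∀ n, lpSize p (lpBlock f n) ≠ ∞ := fun n => ne_top_of_le_ne_top
    (ENNReal.mul_ne_top ENNReal.ofReal_ne_top hf) (hFle n)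
  have hFc : ∀ n, Measurable (lpBlock f n) := fun n => (continuous_lpBlock f n).measurable
  have hc : ∀ n : ℕ, (0 : ℝ) < 2 ^ n := fun n => by positivity
  obtain ⟨K, hK⟩ : ∃ K : ℕ → ℝ≥0∞, ∀ n, K n = ENNReal.ofReal B * triConst d p q (2 ^ n)
    * lpSize p (lpBlock f n) * lpSize q (G n) := ⟨_, fun _ => rfl⟩
  have hKt : ∀ n, K n ≠ ∞ := fun n => by
    rw [hK]
    exact ENNReal.mul_ne_top (ENNReal.mul_ne_top (ENNReal.mul_ne_top
    ENNReal.ofReal_ne_top (triConst_ne_top hp hq)) (hFt n)) (hGt n)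
  -- The powers of two: `2^{nd}` from normalising the dilation, `2^{-nd(1-κ)}` with `κ = 1/q + 1/p -
  -- 1` from the trilinear inequality, `2^{-nα'}` from the block of `f` and `2^{-nα}` from the
  -- average of `μ`. Together they give `2^{-nγ₀}`.
  have hKle : ∀ n, ((2 : ℝ) ^ n) ^ d * (K n).toReal
      ≤ B * Dd.toReal * C.toReal * N.toReal * M.toReal * 2 ^ (-(n * γ₀)) := by
    intro n
    have h1 : K n ≤ ENNReal.ofReal B * (ENNReal.ofReal ((2 : ℝ) ^
          (-((n : ℝ) * (d * (1 - (1 / q + 1 / p - 1)))))) * Dd)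
        * (ENNReal.ofReal (2 ^ (-((n : ℝ) * α'))) * N)
        * (C * ENNReal.ofReal (2 ^ (-((n : ℝ) * α))) * M) := by
      rw [hK, triConst_two_pow p q hp hq]
      gcongr
      · exact hFle n
      · exact hGle n
    have h2 := ENNReal.toReal_mono (by
      exact ENNReal.mul_ne_top (ENNReal.mul_ne_top (ENNReal.mul_ne_top ENNReal.ofReal_ne_top
        (ENNReal.mul_ne_top ENNReal.ofReal_ne_top hDdt)) (ENNReal.mul_ne_top ENNReal.ofReal_ne_top
        hf)) (ENNReal.mul_ne_top (ENNReal.mul_ne_top hC ENNReal.ofReal_ne_top) hM)) h1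
    simp only [ENNReal.toReal_mul, ENNReal.toReal_ofReal hB, ENNReal.toReal_ofReal
      (Real.rpow_nonneg (zero_le_two (α := ℝ)) _)] at h2
    refine (mul_le_mul_of_nonneg_left h2 (by positivity)).trans (le_of_eq ?_)
    have h3 : (2 : ℝ) ^ (-((n : ℝ) * γ₀)) = ((2 : ℝ) ^ n) ^ d
        * 2 ^ (-((n : ℝ) * (d * (1 - (1 / q + 1 / p - 1))))) * 2 ^ (-((n : ℝ) * α'))
        * 2 ^ (-((n : ℝ) * α)) := by
      rw [← pow_mul, ← Real.rpow_natCast, ← Real.rpow_add two_pos, ← Real.rpow_add two_pos,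
        ← Real.rpow_add two_pos, hγ₀]
      congr 1
      push_cast
      ring
    rw [h3]
    ring
  have hpow : ∀ n : ℕ, (2 : ℝ) ^ n * 2 ^ (-((n : ℝ) * γ₀)) = 2 ^ ((n : ℝ) * (1 - γ₀)) := by
    intro n
    rw [← Real.rpow_natCast, ← Real.rpow_add two_pos]
    congr 1
    ring
  have hpow2 : ∀ n : ℕ, (2 : ℝ) ^ n * 2 ^ ((n : ℝ) * (1 - γ₀)) = 2 ^ ((n : ℝ) * (2 - γ₀)) := by
    intro n
    rw [← Real.rpow_natCast, ← Real.rpow_add two_pos]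
    congr 1
    ring
  have heq : ∀ n x, ∫ y, lpBlock f n (x - y) ∂μ
      = ((2 : ℝ) ^ n) ^ d • triOp (2 ^ n) (H n) (lpBlock f n) (G n) ((2 : ℝ) ^ n • x) := by
    intro n x
    rw [hG]
    exact integral_block_eq_triOp f hp hq hpq (hc n) (hA n).1 (hA n).2.1 (hA n).2.2.1
      (hA n).2.2.2.1 (hFt n) μ x
  have hH0 : ∀ n w, ‖H n w‖ ≤ B * decay w := fun n w => by
    have := hBH n 0 w (by norm_num)
    rwa [norm_iteratedFDeriv_zero] at this
  have hH1 : ∀ n w, ‖fderiv ℝ (H n) w‖ ≤ B * decay w := fun n w => by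
    have := hBH n 1 w (by norm_num)
    rwa [norm_iteratedFDeriv_one] at this
  obtain ⟨V, hV⟩ : ∃ V : ℕ → Euc d → Euc d →L[ℝ] Euc d, ∀ n x,
    V n x = triDeriv (2 ^ n) (H n) (lpBlock f n) (G n) ((2 : ℝ) ^ n • x) := ⟨_, fun _ _ => rfl⟩
  have hVle : ∀ n x, ‖V n x‖ ≤ (K n).toReal := fun n x => by
    have h1 := enorm_triDeriv_le hp hq hpq (hFc n) (hGc n).measurable (hc n) (hH1 n)
      ((2 : ℝ) ^ n • x)
    rw [← hK, ← hV] at h1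
    have h2 := ENNReal.toReal_mono (hKt n) h1
    rwa [toReal_enorm] at h2
  have hVlip : ∀ n x y, ‖V n x - V n y‖ ≤ (K n).toReal * (2 ^ n * ‖x - y‖) := fun n x y => by
    have h1 := norm_triDeriv_sub_le hp hq hpq (hFc n) (hGc n).measurable (hFt n) (hGt n) (hc n) hB
      (fun w => hBH n 2 w le_rfl) ((2 : ℝ) ^ n • x) ((2 : ℝ) ^ n • y)
    rw [← hK, ← hV, ← hV, ← smul_sub, norm_smul, Real.norm_of_nonneg (hc n).le] at h1
    exact h1
  refine ⟨fun n => exists_block_bound f hp hq hpq (hc n) (hA n).1 (hA n).2.1 (hA n).2.2.1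
      (hA n).2.2.2.1 (hFt n) |>.imp fun _ h => h.2,
    -- The trilinear average is evaluated at `2 ^ n • x`, so the chain rule yields one factor `2 ^
    -- n` per derivative.
    fun n x => (((2 : ℝ) ^ n) ^ d * 2 ^ n) • V n x, fun n x => ?_, fun n x => ?_, fun n x => ?_,
    fun n x y => ?_⟩
  · simp_rw [heq]
    have h1 := (hasFDerivAt_triOp hp hq hpq (hFc n) (hGc n).measurable (hFt n) (hGt n) (hc n)
      (H n) ((2 : ℝ) ^ n • x)).comp x ((hasFDerivAt_id x).fun_const_smul ((2 : ℝ) ^ n))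
    have h2 := h1.fun_const_smul (((2 : ℝ) ^ n) ^ d)
    rw [← hV] at h2
    refine h2.congr_fderiv ?_
    ext e
    simp [mul_smul]
  · rw [heq, norm_smul, Real.norm_of_nonneg (by positivity)]
    refine le_trans ?_ (hKle n)
    gcongr
    have h1 := enorm_triOp_le hp hq hpq (hFc n) (hGc n).measurable (hc n) (hH0 n)
      ((2 : ℝ) ^ n • x)
    rw [← hK] at h1
    have h2 := ENNReal.toReal_mono (hKt n) h1
    rwa [toReal_enorm] at h2
  · rw [norm_smul, Real.norm_of_nonneg (by positivity), ← hpow, mul_comm (((2 : ℝ) ^ n) ^ d),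
      mul_assoc, mul_left_comm _ ((2 : ℝ) ^ n)]
    refine mul_le_mul_of_nonneg_left (le_trans ?_ (hKle n)) (hc n).le
    gcongr
    exact hVle n x
  · change ‖(((2 : ℝ) ^ n) ^ d * 2 ^ n) • V n x - (((2 : ℝ) ^ n) ^ d * 2 ^ n) • V n y‖ ≤ _
    have hsub : (((2 : ℝ) ^ n) ^ d * 2 ^ n) • V n x - (((2 : ℝ) ^ n) ^ d * 2 ^ n) • V n y
        = (((2 : ℝ) ^ n) ^ d * 2 ^ n) • (V n x - V n y) := (smul_sub _ _ _).symm
    rw [hsub, norm_smul, Real.norm_of_nonneg (by positivity), ← hpow2, ← hpow]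
    calc ((2 : ℝ) ^ n) ^ d * 2 ^ n * ‖V n x - V n y‖
        ≤ ((2 : ℝ) ^ n) ^ d * 2 ^ n * ((K n).toReal * (2 ^ n * ‖x - y‖)) := by
          gcongr
          exact hVlip n x y
      _ = (((2 : ℝ) ^ n) ^ d * (K n).toReal) * (2 ^ n * 2 ^ n * ‖x - y‖) := by ring
      _ ≤ (B * Dd.toReal * C.toReal * N.toReal * M.toReal * 2 ^ (-(n * γ₀)))
          * (2 ^ n * 2 ^ n * ‖x - y‖) := by
          exact mul_le_mul_of_nonneg_right (hKle n) (by positivity)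
      _ = _ := by ring

theorem ae_norm_le_of_support {μ : Measure (Euc d)} {x₀ : Euc d} {R : ℝ}
    (hμ : μ (Metric.closedBall x₀ R)ᶜ = 0) : ∀ᵐ y ∂μ, ‖y‖ ≤ R + ‖x₀‖ := by
  have h : ∀ᵐ y ∂μ, y ∈ Metric.closedBall x₀ R := hμ
  filter_upwards [h] with y hy
  have h1 : ‖y - x₀‖ ≤ R := by rwa [mem_closedBall_iff_norm] at hy
  linarith [norm_le_norm_add_norm_sub' y x₀]

theorem two_rpow_natCast_mul_le (n : ℕ) {a b : ℝ} (h : a ≤ b) :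
    (2 : ℝ) ^ ((n : ℝ) * a) ≤ 2 ^ ((n : ℝ) * b) :=
  Real.rpow_le_rpow_of_exponent_le one_le_two (mul_le_mul_of_nonneg_left h n.cast_nonneg)

theorem two_rpow_neg_natCast_mul_le (n : ℕ) {a b : ℝ} (h : a ≤ b) :
    (2 : ℝ) ^ (-((n : ℝ) * b)) ≤ 2 ^ (-((n : ℝ) * a)) :=
  Real.rpow_le_rpow_of_exponent_le one_le_two
    (neg_le_neg (mul_le_mul_of_nonneg_left h n.cast_nonneg))

/-- The convolution of a Besov distribution with a measure of finite `sbeNorm` is bounded and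
Hölder continuous. -/
theorem exists_isConvolution (hd : 0 < d) {α p₁ q α' p γ₀ γ : ℝ} {q' : ℝ≥0∞} (hα : 0 < α)
    (hp₁ : 1 ≤ p₁) (hq : 1 ≤ q) (hp : 1 ≤ p) (hq' : 1 ≤ q') (hpq : 1 ≤ 1 / q + 1 / p)
    (hγ₀ : γ₀ = α + α' - d * (1 / q + 1 / p - 1)) (R : ℝ) (hγ : 0 < γ) (hγ1 : γ < 1)
    (hγγ₀ : γ ≤ γ₀) :
    ∃ C : ℝ, 0 ≤ C ∧ ∀ (f : VecDistribution d), besovNorm α' p q' f ≠ ∞ →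
      ∀ (μ : Measure (Euc d)) [IsFiniteMeasure μ] (x₀ : Euc d), μ (Metric.closedBall x₀ R)ᶜ = 0 →
        sbeNorm α p₁ q μ ≠ ∞ → ∃ g : Euc d →ᵇ Euc d, IsConvolution f μ g ∧
          (∀ x, ‖g x‖ ≤ C * (besovNorm α' p q' f).toReal * (sbeNorm α p₁ q μ).toReal) ∧
          ∀ x y, ‖g x - g y‖
            ≤ C * (besovNorm α' p q' f).toReal * (sbeNorm α p₁ q μ).toReal * ‖x - y‖ ^ γ := by
  obtain ⟨C, hC, h⟩ := exists_block_estimates hd hα hp₁ hq hp hq' hpq hγ₀ R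
  have hh := holderConst_pos hγ hγ1
  refine ⟨C * holderConst γ, by positivity, fun f hf μ _ x₀ hμ hM => ?_⟩
  obtain ⟨hB, u', hu', h0, h1, -⟩ := h f hf μ x₀ hμ hM
  obtain ⟨K, hKdef⟩ : ∃ K, K = C * (besovNorm α' p q' f).toReal * (sbeNorm α p₁ q μ).toReal :=
    ⟨_, rfl⟩
  have hK : 0 ≤ K := by rw [hKdef]; positivity
  rw [← hKdef] at h0 h1
  -- The regularity `γ₀` may exceed one; lowering it to `γ < 1` puts the series in the range of the
  -- Hölder lemma.
  have e0 : ∀ n x, ‖∫ y, lpBlock f n (x - y) ∂μ‖ ≤ K * 2 ^ (-(n * γ)) := fun n x =>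
    (h0 n x).trans (mul_le_mul_of_nonneg_left (two_rpow_neg_natCast_mul_le n hγγ₀) hK)
  have e1 : ∀ n x y, ‖∫ z, lpBlock f n (x - z) ∂μ - ∫ z, lpBlock f n (y - z) ∂μ‖
      ≤ K * 2 ^ (n * (1 - γ)) * ‖x - y‖ := fun n x y =>
    (convex_univ.norm_image_sub_le_of_norm_hasFDerivWithin_le
      (fun z _ => (hu' n z).hasFDerivWithinAt) (fun z _ => (h1 n z).trans
        (mul_le_mul_of_nonneg_left (two_rpow_natCast_mul_le n (by linarith)) hK))
      (mem_univ y) (mem_univ x))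
  have hbd := norm_tsum_le_of_lacunary hK hγ hγ1 e0
  have hhol := norm_tsum_sub_le_of_lacunary hK hγ hγ1 e0 e1
  have hcont : Continuous fun x => ∑' n, ∫ y, lpBlock f n (x - y) ∂μ :=
    continuous_tsum (fun n => continuous_iff_continuousAt.2 fun x => (hu' n x).continuousAt)
      ((summable_geometric_of_lt_one (by positivity) (two_rpow_neg_lt_one hγ)).mul_left K)
      fun n x => by rw [two_rpow_neg_pow]; exact e0 n x
  have hcK : C * holderConst γ * (besovNorm α' p q' f).toReal * (sbeNorm α p₁ q μ).toReal
      = K * holderConst γ := by rw [hKdef]; ring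
  rw [hcK]
  refine ⟨BoundedContinuousFunction.ofNormedAddCommGroup _ hcont _ hbd,
    isConvolution_of_tsum f μ (ae_norm_le_of_support hμ) hB
      ((summable_geometric_of_lt_one (by positivity) (two_rpow_neg_lt_one hγ)).mul_left K)
      (fun n x => by rw [two_rpow_neg_pow]; exact e0 n x) fun x => rfl, hbd, hhol⟩

/-- The convolution is differentiable with Hölder continuous derivative when there is more than
one order of regularity. -/
theorem exists_hasFDerivAt_of_isConvolution (hd : 0 < d) {α p₁ q α' p γ₀ γ : ℝ} {q' : ℝ≥0∞}
    (hα : 0 < α) (hp₁ : 1 ≤ p₁) (hq : 1 ≤ q) (hp : 1 ≤ p) (hq' : 1 ≤ q')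
    (hpq : 1 ≤ 1 / q + 1 / p)
    (hγ₀ : γ₀ = α + α' - d * (1 / q + 1 / p - 1)) (R : ℝ) (hγ : 0 < γ) (hγ1 : γ < 1)
    (hγγ₀ : γ ≤ γ₀ - 1) :
    ∃ C : ℝ, 0 ≤ C ∧ ∀ (f : VecDistribution d), besovNorm α' p q' f ≠ ∞ →
      ∀ (μ : Measure (Euc d)) [IsFiniteMeasure μ] (x₀ : Euc d), μ (Metric.closedBall x₀ R)ᶜ = 0 →
        sbeNorm α p₁ q μ ≠ ∞ → ∀ g : Euc d →ᵇ Euc d, IsConvolution f μ g →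
          ∃ g' : Euc d → Euc d →L[ℝ] Euc d, (∀ x, HasFDerivAt g (g' x) x) ∧
          (∀ x, ‖g' x‖ ≤ C * (besovNorm α' p q' f).toReal * (sbeNorm α p₁ q μ).toReal) ∧
          ∀ x y, ‖g' x - g' y‖
            ≤ C * (besovNorm α' p q' f).toReal * (sbeNorm α p₁ q μ).toReal * ‖x - y‖ ^ γ := by
  obtain ⟨C, hC, h⟩ := exists_block_estimates hd hα hp₁ hq hp hq' hpq hγ₀ R
  have hh := holderConst_pos hγ hγ1
  refine ⟨C * holderConst γ, by positivity, fun f hf μ _ x₀ hμ hM g hg => ?_⟩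
  obtain ⟨hB, u', hu', h0, h1, h2⟩ := h f hf μ x₀ hμ hM
  obtain ⟨K, hKdef⟩ : ∃ K, K = C * (besovNorm α' p q' f).toReal * (sbeNorm α p₁ q μ).toReal :=
    ⟨_, rfl⟩
  have hK : 0 ≤ K := by rw [hKdef]; positivity
  rw [← hKdef] at h0 h1 h2
  have e0 : ∀ n x, ‖∫ y, lpBlock f n (x - y) ∂μ‖ ≤ K * 2 ^ (-(n * γ)) := fun n x =>
    (h0 n x).trans (mul_le_mul_of_nonneg_left
      (two_rpow_neg_natCast_mul_le n (by linarith)) hK)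
  -- Since `1 - γ₀ ≤ -γ`, the derivatives of the blocks form a lacunary series of order `γ`
  -- themselves.
  have e1 : ∀ n x, ‖u' n x‖ ≤ K * 2 ^ (-(n * γ)) := fun n x =>
    (h1 n x).trans (mul_le_mul_of_nonneg_left (by
      rw [← mul_neg]; exact two_rpow_natCast_mul_le n (by linarith)) hK)
  have e2 : ∀ n x y, ‖u' n x - u' n y‖ ≤ K * 2 ^ (n * (1 - γ)) * ‖x - y‖ := fun n x y =>
    (h2 n x y).trans (mul_le_mul_of_nonneg_right (mul_le_mul_of_nonneg_left
      (two_rpow_natCast_mul_le n (by linarith)) hK) (norm_nonneg _))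
  have hsum := (summable_geometric_of_lt_one (by positivity) (two_rpow_neg_lt_one hγ)).mul_left K
  have hbd := norm_tsum_le_of_lacunary hK hγ hγ1 e0
  have hcont : Continuous fun x => ∑' n, ∫ y, lpBlock f n (x - y) ∂μ :=
    continuous_tsum (fun n => continuous_iff_continuousAt.2 fun x => (hu' n x).continuousAt)
      hsum fun n x => by rw [two_rpow_neg_pow]; exact e0 n x
  -- Any convolution coincides with the series of blocks, so the given `g` may be differentiated
  -- term by term.
  have hg' : g = BoundedContinuousFunction.ofNormedAddCommGroup _ hcont _ hbd := hg.unique <|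
    isConvolution_of_tsum f μ (ae_norm_le_of_support hμ) hB hsum
      (fun n x => by rw [two_rpow_neg_pow]; exact e0 n x) fun x => rfl
  have hgfun : (g : Euc d → Euc d) = fun x => ∑' n, ∫ y, lpBlock f n (x - y) ∂μ := by
    rw [hg']; rfl
  have hcK : C * holderConst γ * (besovNorm α' p q' f).toReal * (sbeNorm α p₁ q μ).toReal
      = K * holderConst γ := by rw [hKdef]; ring
  rw [hcK, hgfun]
  exact ⟨fun x => ∑' n, u' n x, fun x => hasFDerivAt_tsum hsum hu'
      (fun n x => by rw [two_rpow_neg_pow]; exact e1 n x) (summable_of_lacunary hγ e0 0) x,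
    norm_tsum_le_of_lacunary hK hγ hγ1 e1, norm_tsum_sub_le_of_lacunary hK hγ hγ1 e1 e2⟩

end BlockEstimates

/-! ### Sewing of evaluations of a nonlinear Young field -/

section YoungField

variable {T : ℝ} {κ : Type*} [Fintype κ] {E F : Type*} [NormedAddCommGroup E]
  [NormedAddCommGroup F]

/-- The constant in the sewing bound with finitely many controls. -/
def youngConst (κ : Type*) [Fintype κ] (z : ℝ) : ℝ := sewConst z * (Fintype.card κ : ℝ) ^ (z - 1)

theorem youngConst_nonneg {z : ℝ} (hz : 1 < z) : 0 ≤ youngConst κ z :=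
  mul_nonneg (sewConst_pos hz).le (by positivity)

/-- Bounds under which the local descriptions `Ψ(s; s, t; s)` can be sewn. The arguments of `Ψ`
are the time at which the field is frozen, the two times of the increment, and the time at which
the path is evaluated. -/
structure IsSewable (Ψ : Icc (0 : ℝ) T → Icc (0 : ℝ) T → Icc (0 : ℝ) T → Icc (0 : ℝ) T → F)
    (V : Icc (0 : ℝ) T → ℝ) (a z P : ℝ) (A : κ → ℝ) (U : κ → Icc (0 : ℝ) T → ℝ) (b u : κ → ℝ) :
    Prop where
  add : ∀ v w s r t, s ≤ r → r ≤ t → Ψ v s t w = Ψ v s r w + Ψ v r t w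
  mono : Monotone V
  cont : Continuous V
  apos : 0 < a
  hA : ∀ j, 0 ≤ A j
  monoU : ∀ j, Monotone (U j)
  contU : ∀ j, Continuous (U j)
  bpos : ∀ j, 0 < b j
  one_lt : 1 < z
  le_add : ∀ j, z ≤ a + b j
  le_u : ∀ j s t, U j t - U j s ≤ u j
  bound : ∀ s t, s ≤ t → ‖Ψ s s t s‖ ≤ P * (V t - V s) ^ a
  incr : ∀ s r t, s ≤ r → r ≤ t → ‖Ψ s r t s - Ψ r r t s‖ + ‖Ψ r r t s - Ψ r r t r‖
    ≤ (V t - V r) ^ a * ∑ j, A j * (U j r - U j s) ^ b j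

namespace IsSewable

variable {Ψ : Icc (0 : ℝ) T → Icc (0 : ℝ) T → Icc (0 : ℝ) T → Icc (0 : ℝ) T → F}
  {V : Icc (0 : ℝ) T → ℝ} {a z P : ℝ} {A : κ → ℝ} {U : κ → Icc (0 : ℝ) T → ℝ} {b u : κ → ℝ}
  (h : IsSewable Ψ V a z P A U b u)
include h

theorem diag (t : Icc (0 : ℝ) T) : Ψ t t t t = 0 := by
  have := h.add t t t t t le_rfl le_rfl
  simpa using this

/-- By additivity in time the defect lives on `[r,t]` and splits in two: the field is frozen at `r`
instead of `s`, and the path is evaluated at `r` instead of `s`. -/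
theorem delta (s r t : Icc (0 : ℝ) T) (hsr : s ≤ r) (hrt : r ≤ t) :
    ‖Ψ s s t s - Ψ s s r s - Ψ r r t r‖ ≤ (V t - V s) ^ a * ∑ j, A j * (U j t - U j s) ^ b j := by
  have h1 : Ψ s s t s - Ψ s s r s - Ψ r r t r
      = (Ψ s r t s - Ψ r r t s) + (Ψ r r t s - Ψ r r t r) := by
    rw [h.add s s s r t hsr hrt]; abel
  have h2 : 0 ≤ V t - V r := sub_nonneg.2 (h.mono hrt)
  have h3 : V r ≥ V s := h.mono hsr
  have hA := h.hA
  have hb := h.bpos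
  have ha := h.apos
  have h4 : ∀ j, 0 ≤ U j r - U j s := fun j => sub_nonneg.2 (h.monoU j hsr)
  have h5 : ∀ j, U j r ≤ U j t := fun j => h.monoU j hrt
  rw [h1]
  refine (norm_add_le _ _).trans ((h.incr s r t hsr hrt).trans ?_)
  have h6 : ∀ j, A j * (U j r - U j s) ^ b j ≤ A j * (U j t - U j s) ^ b j := fun j =>
    mul_le_mul_of_nonneg_left (Real.rpow_le_rpow (h4 j) (by linarith [h5 j]) (hb j).le) (hA j)
  refine mul_le_mul (Real.rpow_le_rpow h2 (by linarith) ha.le)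
    (Finset.sum_le_sum fun j _ => h6 j)
    (Finset.sum_nonneg fun j _ => mul_nonneg (hA j) (Real.rpow_nonneg (h4 j) _))
    (Real.rpow_nonneg (by linarith) _)

theorem exists_path [ProperSpace F] (hT : 0 < T) :
    ∃ I : Icc (0 : ℝ) T → F, (∀ t : Icc (0 : ℝ) T, (t : ℝ) = 0 → I t = 0) ∧
      ∃ w, IsControl w ∧ ∀ s t, s ≤ t → ‖I t - I s - Ψ s s t s‖ ≤ w s t ^ z :=
  exists_young_sewing (χ := fun s t => Ψ s s t s) h.diag h.mono h.cont h.apos h.hA h.monoU h.contU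
    h.bpos h.one_lt h.le_add h.delta hT

/-- The bound holds for every path with a negligible error, not only for the one constructed by
sewing. It therefore applies to differences and remainders of integrals that are already given. -/
theorem norm_incr_le {I : Icc (0 : ℝ) T → F} {e : Icc (0 : ℝ) T → Icc (0 : ℝ) T → ℝ}
    (he : IsNegligible e) (hI : ∀ s t, s ≤ t → ‖I t - I s - Ψ s s t s‖ ≤ e s t)
    {s t : Icc (0 : ℝ) T} (hst : s ≤ t) :
    ‖I t - I s‖ ≤ (P + youngConst κ z * ∑ j, A j * u j ^ b j) * (V t - V s) ^ a := by
  refine norm_incr_le_young (χ := fun s t => Ψ s s t s) h.mono h.hA h.monoU h.bpos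
    (youngConst_nonneg h.one_lt) h.le_u h.bound (fun s t hst => ?_) hst
  refine (norm_incr_sub_le_young (χ := fun s t => Ψ s s t s) h.diag h.mono h.cont h.apos h.hA
    h.monoU h.contU h.bpos h.one_lt h.le_add h.delta he hI hst).trans (le_of_eq ?_)
  rw [youngConst, mul_assoc]

end IsSewable

/-- Two paths from `0` with the same local descriptions up to negligible errors agree. -/
theorem eq_of_negligible {χ : Icc (0 : ℝ) T → Icc (0 : ℝ) T → F} {I J : Icc (0 : ℝ) T → F}
    (hT : 0 < T)
    {e e' : Icc (0 : ℝ) T → Icc (0 : ℝ) T → ℝ} (he : IsNegligible e) (he' : IsNegligible e')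
    (hI0 : ∀ t : Icc (0 : ℝ) T, (t : ℝ) = 0 → I t = 0)
    (hJ0 : ∀ t : Icc (0 : ℝ) T, (t : ℝ) = 0 → J t = 0)
    (hI : ∀ s t, s ≤ t → ‖I t - I s - χ s t‖ ≤ e s t)
    (hJ : ∀ s t, s ≤ t → ‖J t - J s - χ s t‖ ≤ e' s t) : I = J := by
  -- The difference of the two paths is sewn from the zero field without any controls, so the
  -- general bound says that it is constant.
  have h : IsSewable (κ := Fin 0) (fun _ _ _ _ : Icc (0 : ℝ) T => (0 : F)) (fun _ => 0) 1 2 0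
      (fun _ => 0) (fun _ _ => 0) (fun _ => 1) (fun _ => 0) :=
    { add := by simp
      mono := monotone_const
      cont := continuous_const
      apos := one_pos
      hA := by simp
      monoU := fun _ => monotone_const
      contU := fun _ => continuous_const
      bpos := by simp
      one_lt := one_lt_two
      le_add := by simp
      le_u := by simp
      bound := by simp
      incr := by simp }
  funext t
  have h0 : (⟨0, le_rfl, hT.le⟩ : Icc (0 : ℝ) T) ≤ t := t.2.1
  have h1 := h.norm_incr_le (I := fun t => I t - J t) (he.add he') (fun s t hst => ?_) h0
  · rw [hI0 ⟨0, le_rfl, hT.le⟩ rfl, hJ0 ⟨0, le_rfl, hT.le⟩ rfl] at h1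
    simp only [sub_self, sub_zero, zero_add, Finset.univ_eq_empty, Finset.sum_empty, mul_zero,
      zero_mul] at h1
    exact sub_eq_zero.1 (norm_le_zero_iff.1 h1)
  · have h2 : I t - J t - (I s - J s) - 0 = (I t - I s - χ s t) - (J t - J s - χ s t) := by abel
    rw [h2]
    exact (norm_sub_le _ _).trans (add_le_add (hI s t hst) (hJ s t hst))

/-- A monotone continuous function controlling the `r`-variation of a path. -/
structure IsPathControl (θ : Icc (0 : ℝ) T → E) (W : Icc (0 : ℝ) T → ℝ) (r Θ : ℝ) : Prop where
  mono : Monotone W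
  cont : Continuous W
  rpos : 0 < r
  le : ∀ s t, s ≤ t → ‖θ t - θ s‖ ^ r ≤ W t - W s
  total : ∀ s t, W t - W s ≤ Θ ^ r

theorem IsPathControl.rpow_le {θ : Icc (0 : ℝ) T → E} {W : Icc (0 : ℝ) T → ℝ} {r Θ : ℝ}
    (h : IsPathControl θ W r Θ) {c : ℝ} (hc : 0 < c) {s t : Icc (0 : ℝ) T} (hst : s ≤ t) :
    ‖θ t - θ s‖ ^ c ≤ (W t - W s) ^ (c / r) := by
  have hr := h.rpos
  calc ‖θ t - θ s‖ ^ c = (‖θ t - θ s‖ ^ r) ^ (c / r) := by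
        rw [← Real.rpow_mul (norm_nonneg _), mul_div_cancel₀ _ hr.ne']
    _ ≤ _ := Real.rpow_le_rpow (by positivity) (h.le s t hst) (by positivity)

theorem rpow_rpow_div {Θ r c : ℝ} (hΘ : 0 ≤ Θ) (hr : 0 < r) : (Θ ^ r) ^ (c / r) = Θ ^ c := by
  rw [← Real.rpow_mul hΘ, mul_div_cancel₀ _ hr.ne']

/-- A field `G(v; s, t; x)`, frozen at time `v` and additive over `[s, t]`, with the bounds that
the convolutions `(f_v ⋆ μ_{s,t})(x)` satisfy. -/
structure IsYoungField (G : Icc (0 : ℝ) T → Icc (0 : ℝ) T → Icc (0 : ℝ) T → E → F)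
    (V₁ V₂ : Icc (0 : ℝ) T → ℝ) (a b γ L N Φ : ℝ) : Prop where
  mono₁ : Monotone V₁
  cont₁ : Continuous V₁
  mono₂ : Monotone V₂
  cont₂ : Continuous V₂
  apos : 0 < a
  bpos : 0 < b
  γpos : 0 < γ
  Lnonneg : 0 ≤ L
  Nnonneg : 0 ≤ N
  Φnonneg : 0 ≤ Φ
  total₂ : ∀ s t, V₂ t - V₂ s ≤ Φ ^ b⁻¹
  add : ∀ v s r t x, s ≤ r → r ≤ t → G v s t x = G v s r x + G v r t x
  bound : ∀ v s t x, s ≤ t → ‖G v s t x‖ ≤ L * N * (V₁ t - V₁ s) ^ a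
  holder : ∀ v s t x y, s ≤ t →
    ‖G v s t x - G v s t y‖ ≤ L * N * (V₁ t - V₁ s) ^ a * ‖x - y‖ ^ γ
  incr_bound : ∀ v v' s t x, v ≤ v' → s ≤ t →
    ‖G v s t x - G v' s t x‖ ≤ L * ((V₁ t - V₁ s) ^ a * (V₂ v' - V₂ v) ^ b)
  incr_holder : ∀ v v' s t x y, v ≤ v' → s ≤ t →
    ‖(G v s t x - G v' s t x) - (G v s t y - G v' s t y)‖
      ≤ L * ((V₁ t - V₁ s) ^ a * (V₂ v' - V₂ v) ^ b) * ‖x - y‖ ^ γ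

namespace IsYoungField

variable {G : Icc (0 : ℝ) T → Icc (0 : ℝ) T → Icc (0 : ℝ) T → E → F}
  {V₁ V₂ : Icc (0 : ℝ) T → ℝ} {a b γ L N Φ : ℝ} (h : IsYoungField G V₁ V₂ a b γ L N Φ)
include h

theorem total_rpow : (Φ ^ b⁻¹) ^ b = Φ := by
  rw [← Real.rpow_mul h.Φnonneg, inv_mul_cancel₀ h.bpos.ne', Real.rpow_one]

/-- Evaluation along a path. -/
theorem isSewable_eval {θ : Icc (0 : ℝ) T → E} {W : Icc (0 : ℝ) T → ℝ} {r Θ z : ℝ}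
    (hθ : IsPathControl θ W r Θ) (hz : 1 < z) (hz₂ : z ≤ a + b) (hz₃ : z ≤ a + γ / r) :
    IsSewable (fun v s t w => G v s t (θ w)) V₁ a z (L * N) ![L, L * N] ![V₂, W] ![b, γ / r]
      ![Φ ^ b⁻¹, Θ ^ r] where
  add v w s r t := h.add v s r t _
  mono := h.mono₁
  cont := h.cont₁
  apos := h.apos
  hA j := by fin_cases j; exacts [h.Lnonneg, mul_nonneg h.Lnonneg h.Nnonneg]
  monoU j := by fin_cases j; exacts [h.mono₂, hθ.mono]
  contU j := by fin_cases j; exacts [h.cont₂, hθ.cont]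
  bpos j := by fin_cases j; exacts [h.bpos, div_pos h.γpos hθ.rpos]
  one_lt := hz
  le_add j := by fin_cases j; exacts [hz₂, hz₃]
  le_u j := by fin_cases j; exacts [h.total₂, hθ.total]
  bound s t hst := h.bound _ _ _ _ hst
  incr s r t hsr hrt := by
    have h1 := h.incr_bound s r r t (θ s) hsr hrt
    have h2 := h.holder r r t (θ s) (θ r) hrt
    have h3 := hθ.rpow_le h.γpos hsr
    have h4 : 0 ≤ (V₁ t - V₁ r) ^ a := Real.rpow_nonneg (sub_nonneg.2 (h.mono₁ hrt)) _
    have h5 := mul_nonneg h.Lnonneg h.Nnonneg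
    rw [Fin.sum_univ_two]
    simp only [Matrix.cons_val_zero, Matrix.cons_val_one]
    rw [norm_sub_rev] at h3
    have h6 := mul_le_mul_of_nonneg_left h3 (mul_nonneg h5 h4)
    linarith

/-- Difference of the evaluations along two paths. -/
theorem isSewable_sub {θ₁ θ₂ : Icc (0 : ℝ) T → E} {W₁ W₂ : Icc (0 : ℝ) T → ℝ}
    {r Θ₁ Θ₂ z l D : ℝ} (hθ₁ : IsPathControl θ₁ W₁ r Θ₁) (hθ₂ : IsPathControl θ₂ W₂ r Θ₂)
    (hl : 0 < l) (hl1 : l < 1) (hD0 : 0 ≤ D) (hD : ∀ t, ‖θ₁ t - θ₂ t‖ ≤ D)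
    (hz : 1 < z) (hz₂ : z ≤ a + b) (hz₃ : z ≤ a + γ * (1 - l) / r) :
    IsSewable (fun v s t w => G v s t (θ₁ w) - G v s t (θ₂ w)) V₁ a z (L * N * D ^ γ)
      ![L * D ^ γ, 2 * (L * N) * D ^ (l * γ), 2 * (L * N) * D ^ (l * γ)] ![V₂, W₁, W₂]
      ![b, γ * (1 - l) / r, γ * (1 - l) / r] ![Φ ^ b⁻¹, Θ₁ ^ r, Θ₂ ^ r] := by
  have hLN := mul_nonneg h.Lnonneg h.Nnonneg
  have hl' : 0 < 1 - l := by linarith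
  have hc : 0 < γ * (1 - l) := mul_pos h.γpos hl'
  have hDγ : ∀ t, ‖θ₁ t - θ₂ t‖ ^ γ ≤ D ^ γ := fun t =>
    Real.rpow_le_rpow (norm_nonneg _) (hD t) h.γpos.le
  refine ⟨fun v w s r t h1 h2 => ?_, h.mono₁, h.cont₁, h.apos, fun j => ?_, fun j => ?_, fun j => ?_,
    fun j => ?_, hz, fun j => ?_, fun j => ?_, fun s t hst => ?_, fun s m t hsr hrt => ?_⟩
  · rw [h.add v s r t _ h1 h2, h.add v s r t (θ₂ w) h1 h2]; abel
  · have := h.Lnonneg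
    fin_cases j <;> simp <;> positivity
  · fin_cases j; exacts [h.mono₂, hθ₁.mono, hθ₂.mono]
  · fin_cases j; exacts [h.cont₂, hθ₁.cont, hθ₂.cont]
  · fin_cases j; exacts [h.bpos, div_pos hc hθ₁.rpos, div_pos hc hθ₁.rpos]
  · fin_cases j; exacts [hz₂, hz₃, hz₃]
  · fin_cases j; exacts [h.total₂, hθ₁.total, hθ₂.total]
  · have h4 : 0 ≤ (V₁ t - V₁ s) ^ a := Real.rpow_nonneg (sub_nonneg.2 (h.mono₁ hst)) _
    refine (h.holder s s t _ _ hst).trans ?_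
    rw [mul_right_comm (L * N)]
    exact mul_le_mul_of_nonneg_right (mul_le_mul_of_nonneg_left (hDγ s) hLN) h4
  · have h4 : 0 ≤ (V₁ t - V₁ m) ^ a := Real.rpow_nonneg (sub_nonneg.2 (h.mono₁ hrt)) _
    have h5 : 0 ≤ (V₂ m - V₂ s) ^ b := Real.rpow_nonneg (sub_nonneg.2 (h.mono₂ hsr)) _
    have hL := h.Lnonneg
    have h1 : ‖G s m t (θ₁ s) - G s m t (θ₂ s) - (G m m t (θ₁ s) - G m m t (θ₂ s))‖
        ≤ L * ((V₁ t - V₁ m) ^ a * (V₂ m - V₂ s) ^ b) * D ^ γ := by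
      have h6 := h.incr_holder s m m t (θ₁ s) (θ₂ s) hsr hrt
      rw [sub_sub_sub_comm]
      exact h6.trans (mul_le_mul_of_nonneg_left (hDγ s) (by positivity))
    set X := ‖G m m t (θ₁ s) - G m m t (θ₂ s) - (G m m t (θ₁ m) - G m m t (θ₂ m))‖ with hX
    set K := L * N * (V₁ t - V₁ m) ^ a with hK
    have hK0 : 0 ≤ K := by positivity
    -- The mixed difference is bounded in two ways: pairing equal times gives a power of the
    -- distance `D` of the paths, pairing equal paths gives powers of their increments. The
    -- geometric mean with weights `l` and `1 - l` keeps a part of both.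
    have hX1 : X ≤ K * (2 * D ^ γ) := by
      have e1 := (h.holder m m t (θ₁ s) (θ₂ s) hrt).trans
        (mul_le_mul_of_nonneg_left (hDγ s) hK0)
      have e2 := (h.holder m m t (θ₁ m) (θ₂ m) hrt).trans
        (mul_le_mul_of_nonneg_left (hDγ m) hK0)
      have e3 := norm_sub_le (G m m t (θ₁ s) - G m m t (θ₂ s)) (G m m t (θ₁ m) - G m m t (θ₂ m))
      linarith
    have hX2 : X ≤ K * (‖θ₁ m - θ₁ s‖ ^ γ + ‖θ₂ m - θ₂ s‖ ^ γ) := by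
      have e1 := h.holder m m t (θ₁ s) (θ₁ m) hrt
      have e2 := h.holder m m t (θ₂ s) (θ₂ m) hrt
      rw [norm_sub_rev (θ₁ s)] at e1
      rw [norm_sub_rev (θ₂ s)] at e2
      have e3 := norm_sub_le (G m m t (θ₁ s) - G m m t (θ₁ m)) (G m m t (θ₂ s) - G m m t (θ₂ m))
      rw [sub_sub_sub_comm] at hX
      linarith
    have hX3 : X ≤ 2 * K * D ^ (l * γ) * (‖θ₁ m - θ₁ s‖ ^ (γ * (1 - l))
        + ‖θ₂ m - θ₂ s‖ ^ (γ * (1 - l))) := by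
      have hX0 : 0 ≤ X := norm_nonneg _
      have hD1 : 0 ≤ D ^ γ := by positivity
      have hn1 : 0 ≤ ‖θ₁ m - θ₁ s‖ ^ γ := by positivity
      have hn2 : 0 ≤ ‖θ₂ m - θ₂ s‖ ^ γ := by positivity
      calc X = X ^ l * X ^ (1 - l) := by
            rw [← Real.rpow_add_of_nonneg hX0 hl.le hl'.le]; simp
        _ ≤ (K * (2 * D ^ γ)) ^ l * (K * (‖θ₁ m - θ₁ s‖ ^ γ + ‖θ₂ m - θ₂ s‖ ^ γ)) ^ (1 - l) := by
            gcongr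
        _ = (K ^ l * K ^ (1 - l)) * (2 ^ l * D ^ (l * γ)
              * (‖θ₁ m - θ₁ s‖ ^ γ + ‖θ₂ m - θ₂ s‖ ^ γ) ^ (1 - l)) := by
            rw [Real.mul_rpow hK0 (by positivity), Real.mul_rpow hK0 (by positivity),
              Real.mul_rpow zero_le_two hD1, ← Real.rpow_mul hD0, mul_comm γ l]
            ring
        _ ≤ K * (2 * D ^ (l * γ) * (‖θ₁ m - θ₁ s‖ ^ (γ * (1 - l))
              + ‖θ₂ m - θ₂ s‖ ^ (γ * (1 - l)))) := by
            have e1 : K ^ l * K ^ (1 - l) = K := by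
              rw [← Real.rpow_add_of_nonneg hK0 hl.le hl'.le]; simp
            have e2 : (2 : ℝ) ^ l ≤ 2 := by
              calc (2 : ℝ) ^ l ≤ 2 ^ (1 : ℝ) :=
                    Real.rpow_le_rpow_of_exponent_le one_le_two hl1.le
                _ = 2 := Real.rpow_one 2
            have e3 := Real.rpow_add_le_add_rpow hn1 hn2 hl'.le (by linarith : 1 - l ≤ 1)
            rw [← Real.rpow_mul (norm_nonneg _), ← Real.rpow_mul (norm_nonneg _)] at e3
            rw [e1]
            gcongr
        _ = _ := by ring
    rw [Fin.sum_univ_three]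
    simp only [Matrix.cons_val_zero, Matrix.cons_val_one, Matrix.cons_val_two, Matrix.tail_cons,
      Matrix.head_cons]
    have e1 := hθ₁.rpow_le hc hsr
    have e2 := hθ₂.rpow_le hc hsr
    have e3 : 2 * K * D ^ (l * γ) * (‖θ₁ m - θ₁ s‖ ^ (γ * (1 - l))
        + ‖θ₂ m - θ₂ s‖ ^ (γ * (1 - l))) ≤ 2 * K * D ^ (l * γ) *
          ((W₁ m - W₁ s) ^ (γ * (1 - l) / r) + (W₂ m - W₂ s) ^ (γ * (1 - l) / r)) :=
      mul_le_mul_of_nonneg_left (add_le_add e1 e2) (by positivity)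
    refine (add_le_add h1 (hX3.trans e3)).trans (le_of_eq ?_)
    rw [hK]
    ring

end IsYoungField

end YoungField

/-! ### First-order remainders and derivative fields -/

section Remainder

variable {E F : Type*} [NormedAddCommGroup E] [NormedAddCommGroup F] [NormedSpace ℝ E]
  [NormedSpace ℝ F]

/-- The first-order Taylor remainder of `g`. -/
def taylorRem (g : E → F) (g' : E → E →L[ℝ] F) (x k : E) : F := g (x + k) - g x - g' x k

variable {g : E → F} {g' : E → E →L[ℝ] F} (hg : ∀ x, HasFDerivAt g (g' x) x) {K γ : ℝ}
  (hγ : 0 < γ) (hK : ∀ x y, ‖g' x - g' y‖ ≤ K * ‖x - y‖ ^ γ) (hK0 : 0 ≤ K)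
include hg hγ hK hK0

/-- As a function of `k` the remainder has derivative `g' (x + k) - g' x`, which is at most `K e ^
γ` on the ball of radius `e`. -/
theorem norm_taylorRem_sub_le {x k k' : E} {e : ℝ} (hk : ‖k‖ ≤ e) (hk' : ‖k'‖ ≤ e) :
    ‖taylorRem g g' x k - taylorRem g g' x k'‖ ≤ K * e ^ γ * ‖k - k'‖ := by
  have h := (convex_closedBall (0 : E) e).norm_image_sub_le_of_norm_hasFDerivWithin_le'
    (f := fun k => g (x + k)) (f' := fun k => g' (x + k)) (φ := g' x) (C := K * e ^ γ)
    (fun z _ => ((hasFDerivAt_comp_add_left x).2 (hg (x + z))).hasFDerivWithinAt) (fun z hz => by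
      refine (hK _ _).trans ?_
      rw [add_sub_cancel_left]
      rw [mem_closedBall_zero_iff] at hz
      gcongr) (mem_closedBall_zero_iff.2 hk') (mem_closedBall_zero_iff.2 hk)
  refine le_trans (le_of_eq ?_) h
  unfold taylorRem
  rw [map_sub]
  congr 1
  abel

theorem norm_taylorRem_le {x k : E} {e : ℝ} (hk : ‖k‖ ≤ e) :
    ‖taylorRem g g' x k‖ ≤ K * e ^ (1 + γ) := by
  have he : 0 ≤ e := (norm_nonneg _).trans hk
  have h := norm_taylorRem_sub_le hg hγ hK hK0 (x := x) hk (k' := 0) (by simpa using he)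
  have h0 : taylorRem g g' x 0 = 0 := by simp [taylorRem]
  rw [h0, sub_zero, sub_zero] at h
  refine h.trans ?_
  rw [add_comm, Real.rpow_add_one' he (by linarith), mul_assoc]
  gcongr

/-- The derivative in `k` of the difference is bounded both by `2 K e ^ γ` and by `2 K ‖x - y‖ ^ γ`.
Interpolating keeps a superlinear power of `e`, needed for differentiability, and a positive power
of `‖x - y‖`, needed for sewing. -/
theorem norm_taylorRem_sub_left_le {x y k : E} {e l : ℝ} (hl : 0 < l) (hl1 : l < 1)
    (hk : ‖k‖ ≤ e) : ‖taylorRem g g' x k - taylorRem g g' y k‖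
      ≤ 2 * K * e ^ (1 + l * γ) * ‖x - y‖ ^ (γ * (1 - l)) := by
  have he : 0 ≤ e := (norm_nonneg _).trans hk
  have hl' : 0 < 1 - l := by linarith
  have h : ∀ C, (∀ z, ‖z‖ ≤ e → ‖g' (x + z) - g' (y + z) - (g' x - g' y)‖ ≤ C) →
      ‖taylorRem g g' x k - taylorRem g g' y k‖ ≤ C * e := by
    intro C hC
    have hC0 : 0 ≤ C := (norm_nonneg _).trans (hC 0 (by simpa using he))
    have h1 := (convex_closedBall (0 : E) e).norm_image_sub_le_of_norm_hasFDerivWithin_le'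
      (f := fun k => g (x + k) - g (y + k)) (f' := fun k => g' (x + k) - g' (y + k))
      (φ := g' x - g' y) (C := C)
      (fun z _ => (((hasFDerivAt_comp_add_left x).2 (hg (x + z))).sub
        ((hasFDerivAt_comp_add_left y).2 (hg (y + z)))).hasFDerivWithinAt)
      (fun z hz => hC z (mem_closedBall_zero_iff.1 hz)) (x := 0) (y := k)
      (mem_closedBall_zero_iff.2 (by simpa using he)) (mem_closedBall_zero_iff.2 hk)
    refine le_trans (le_of_eq ?_) (h1.trans (by rw [sub_zero]; gcongr))
    unfold taylorRem
    simp only [add_zero, sub_zero, _root_.sub_apply]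
    congr 1
    abel
  have hA := h (K * (2 * e ^ γ)) fun z hz => by
    have e1 := hK (x + z) x
    have e2 := hK (y + z) y
    rw [add_sub_cancel_left] at e1 e2
    have e3 : ‖z‖ ^ γ ≤ e ^ γ := Real.rpow_le_rpow (norm_nonneg _) hz hγ.le
    have e4 := mul_le_mul_of_nonneg_left e3 hK0
    rw [sub_sub_sub_comm]
    have := norm_sub_le (g' (x + z) - g' x) (g' (y + z) - g' y)
    linarith
  have hB := h (K * (2 * ‖x - y‖ ^ γ)) fun z _ => by
    have e1 := hK (x + z) (y + z)
    have e2 := hK x y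
    rw [add_sub_add_right_eq_sub] at e1
    have := norm_sub_le (g' (x + z) - g' (y + z)) (g' x - g' y)
    linarith
  set X := ‖taylorRem g g' x k - taylorRem g g' y k‖ with hX
  have hX0 : 0 ≤ X := norm_nonneg _
  have hne : (0 : ℝ) ≤ ‖x - y‖ := norm_nonneg _
  calc X = X ^ l * X ^ (1 - l) := by
        rw [← Real.rpow_add_of_nonneg hX0 hl.le hl'.le]; simp
    _ ≤ (K * (2 * e ^ γ) * e) ^ l * (K * (2 * ‖x - y‖ ^ γ) * e) ^ (1 - l) := by gcongr
    _ = ((2 * K * e) * e ^ γ) ^ l * ((2 * K * e) * ‖x - y‖ ^ γ) ^ (1 - l) := by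
        congr 2 <;> ring
    _ = ((2 * K * e) ^ l * (2 * K * e) ^ (1 - l)) * (e ^ (l * γ) * ‖x - y‖ ^ (γ * (1 - l))) := by
        have h2 : 0 ≤ 2 * K * e := by positivity
        rw [Real.mul_rpow h2 (by positivity), Real.mul_rpow h2 (by positivity),
          ← Real.rpow_mul he, ← Real.rpow_mul hne, mul_comm γ l]
        ring
    _ = _ := by
        rw [← Real.rpow_add_of_nonneg (by positivity) hl.le hl'.le, add_sub_cancel, Real.rpow_one,
          add_comm 1, Real.rpow_add_one' he (by positivity)]
        ring

end Remainder

section DerivativeField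

variable {T : ℝ} {E F : Type*} [NormedAddCommGroup E] [NormedAddCommGroup F] [NormedSpace ℝ E]
  [NormedSpace ℝ F] {G : Icc (0 : ℝ) T → Icc (0 : ℝ) T → Icc (0 : ℝ) T → E → F}
  {G' : Icc (0 : ℝ) T → Icc (0 : ℝ) T → Icc (0 : ℝ) T → E → E →L[ℝ] F}
  {V₁ V₂ : Icc (0 : ℝ) T → ℝ} {a b γ L N Φ : ℝ}

namespace IsYoungField

variable (h : IsYoungField G' V₁ V₂ a b γ L N Φ)
include h

/-- The derivative field evaluated along a path and applied to a direction. -/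
theorem isSewable_apply {θ η : Icc (0 : ℝ) T → E} {W Y : Icc (0 : ℝ) T → ℝ} {r Θ H D z : ℝ}
    (hθ : IsPathControl θ W r Θ) (hη : IsPathControl η Y r H) (hD0 : 0 ≤ D)
    (hD : ∀ t, ‖η t‖ ≤ D) (hγ1 : γ < 1)
    (hz : 1 < z) (hz₂ : z ≤ a + b) (hz₃ : z ≤ a + γ / r) :
    IsSewable (fun v s t w => G' v s t (θ w) (η w)) V₁ a z (L * N * D)
      ![L * D, L * N * D, L * N] ![V₂, W, Y] ![b, γ / r, 1 / r] ![Φ ^ b⁻¹, Θ ^ r, H ^ r] := by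
  have hLN := mul_nonneg h.Lnonneg h.Nnonneg
  have hL := h.Lnonneg
  have hz₄ : z ≤ a + 1 / r := hz₃.trans (by have := hθ.rpos; gcongr)
  have happ : ∀ (S : E →L[ℝ] F) t, ‖S (η t)‖ ≤ ‖S‖ * D := fun S t =>
    (S.le_opNorm _).trans (mul_le_mul_of_nonneg_left (hD t) (norm_nonneg _))
  refine ⟨fun v w s r t h1 h2 => ?_, h.mono₁, h.cont₁, h.apos, fun j => ?_, fun j => ?_, fun j => ?_,
    fun j => ?_, hz, fun j => ?_, fun j => ?_, fun s t hst => ?_, fun s m t hsm hmt => ?_⟩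
  · rw [h.add v s r t _ h1 h2]; rfl
  · fin_cases j <;> simp <;> positivity
  · fin_cases j; exacts [h.mono₂, hθ.mono, hη.mono]
  · fin_cases j; exacts [h.cont₂, hθ.cont, hη.cont]
  · fin_cases j; exacts [h.bpos, div_pos h.γpos hθ.rpos, div_pos one_pos hθ.rpos]
  · fin_cases j; exacts [hz₂, hz₃, hz₄]
  · fin_cases j; exacts [h.total₂, hθ.total, hη.total]
  · refine (happ _ _).trans ?_
    rw [mul_right_comm (L * N)]
    exact mul_le_mul_of_nonneg_right (h.bound s s t _ hst) hD0
  · have h4 : 0 ≤ (V₁ t - V₁ m) ^ a := Real.rpow_nonneg (sub_nonneg.2 (h.mono₁ hmt)) _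
    have h1 : ‖G' s m t (θ s) (η s) - G' m m t (θ s) (η s)‖
        ≤ L * ((V₁ t - V₁ m) ^ a * (V₂ m - V₂ s) ^ b) * D := by
      rw [← _root_.sub_apply]
      exact (happ _ _).trans (mul_le_mul_of_nonneg_right (h.incr_bound s m m t _ hsm hmt) hD0)
    have h2 : ‖G' m m t (θ s) (η s) - G' m m t (θ m) (η s)‖
        ≤ L * N * (V₁ t - V₁ m) ^ a * (W m - W s) ^ (γ / r) * D := by
      rw [← _root_.sub_apply]
      refine (happ _ _).trans (mul_le_mul_of_nonneg_right
        ((h.holder m m t (θ s) (θ m) hmt).trans ?_) hD0)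
      rw [norm_sub_rev]
      exact mul_le_mul_of_nonneg_left (hθ.rpow_le h.γpos hsm) (by positivity)
    have h3 : ‖G' m m t (θ m) (η s) - G' m m t (θ m) (η m)‖
        ≤ L * N * (V₁ t - V₁ m) ^ a * (Y m - Y s) ^ (1 / r) := by
      rw [← map_sub]
      refine ((G' m m t (θ m)).le_opNorm _).trans ?_
      have e1 := hη.rpow_le one_pos hsm
      rw [Real.rpow_one] at e1
      rw [norm_sub_rev]
      exact mul_le_mul (h.bound _ _ _ _ hmt) e1 (norm_nonneg _) (by positivity)
    have h5 := norm_sub_le_norm_sub_add_norm_sub (G' m m t (θ s) (η s)) (G' m m t (θ m) (η s))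
      (G' m m t (θ m) (η m))
    rw [Fin.sum_univ_three]
    simp only [Matrix.cons_val_zero, Matrix.cons_val_one, Matrix.cons_val_two, Matrix.tail_cons,
      Matrix.head_cons]
    refine (add_le_add h1 (h5.trans (add_le_add h2 h3))).trans (le_of_eq ?_)
    ring

/-- The first-order remainder along a path in a direction. -/
theorem isSewable_taylorRem (hadd : ∀ v s r t x, s ≤ r → r ≤ t → G v s t x = G v s r x + G v r t x)
    (hG : ∀ v s t x, s ≤ t → HasFDerivAt (G v s t) (G' v s t x) x)
    {θ η : Icc (0 : ℝ) T → E} {W Y : Icc (0 : ℝ) T → ℝ} {r Θ H D z l : ℝ}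
    (hθ : IsPathControl θ W r Θ) (hη : IsPathControl η Y r H) (hD0 : 0 ≤ D)
    (hD : ∀ t, ‖η t‖ ≤ D) (hγ1 : γ < 1) (hl : 0 < l) (hl1 : l < 1)
    (hz : 1 < z) (hz₂ : z ≤ a + b) (hz₃ : z ≤ a + γ * (1 - l) / r) :
    IsSewable (fun v s t w => taylorRem (G v s t) (G' v s t) (θ w) (η w)) V₁ a z
      (L * N * D ^ (1 + γ))
      ![L * D ^ (1 + γ), 2 * (L * N) * D ^ (1 + l * γ), L * N * D ^ γ] ![V₂, W, Y]
      ![b, γ * (1 - l) / r, 1 / r] ![Φ ^ b⁻¹, Θ ^ r, H ^ r] := by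
  have hLN := mul_nonneg h.Lnonneg h.Nnonneg
  have hL := h.Lnonneg
  have hγ := h.γpos
  have hc : 0 < γ * (1 - l) := mul_pos hγ (by linarith)
  have hz₄ : z ≤ a + 1 / r := hz₃.trans (by
    have := hθ.rpos
    gcongr
    nlinarith)
  refine ⟨fun v w s r t h1 h2 => ?_, h.mono₁, h.cont₁, h.apos, fun j => ?_, fun j => ?_, fun j => ?_,
    fun j => ?_, hz, fun j => ?_, fun j => ?_, fun s t hst => ?_, fun s m t hsm hmt => ?_⟩
  · unfold taylorRem
    rw [h.add v s r t _ h1 h2, hadd v s r t _ h1 h2, hadd v s r t _ h1 h2, _root_.add_apply]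
    abel
  · fin_cases j <;> simp <;> positivity
  · fin_cases j; exacts [h.mono₂, hθ.mono, hη.mono]
  · fin_cases j; exacts [h.cont₂, hθ.cont, hη.cont]
  · fin_cases j; exacts [h.bpos, div_pos hc hθ.rpos, div_pos one_pos hθ.rpos]
  · fin_cases j; exacts [hz₂, hz₃, hz₄]
  · fin_cases j; exacts [h.total₂, hθ.total, hη.total]
  · have h4 : 0 ≤ (V₁ t - V₁ s) ^ a := Real.rpow_nonneg (sub_nonneg.2 (h.mono₁ hst)) _
    refine (norm_taylorRem_le (fun x => hG s s t x hst) hγ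
      (fun x y => h.holder s s t x y hst) (by positivity) (hD s)).trans (le_of_eq ?_)
    ring
  · have h4 : 0 ≤ (V₁ t - V₁ m) ^ a := Real.rpow_nonneg (sub_nonneg.2 (h.mono₁ hmt)) _
    have h5 : 0 ≤ (V₂ m - V₂ s) ^ b := Real.rpow_nonneg (sub_nonneg.2 (h.mono₂ hsm)) _
    have h1 : ‖taylorRem (G s m t) (G' s m t) (θ s) (η s)
          - taylorRem (G m m t) (G' m m t) (θ s) (η s)‖
        ≤ L * ((V₁ t - V₁ m) ^ a * (V₂ m - V₂ s) ^ b) * D ^ (1 + γ) := by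
      -- Taylor remainders are linear in the field, so freezing at another time is estimated by the
      -- remainder of the increment field.
      have e1 := norm_taylorRem_le (g := fun x => G s m t x - G m m t x)
        (g' := fun x => G' s m t x - G' m m t x)
        (fun x => (hG s m t x hmt).sub (hG m m t x hmt)) hγ
        (fun x y => h.incr_holder s m m t x y hsm hmt) (by positivity) (x := θ s) (hD s)
      refine le_trans (le_of_eq ?_) e1
      simp only [taylorRem, _root_.sub_apply]
      congr 1
      abel
    have h2 : ‖taylorRem (G m m t) (G' m m t) (θ s) (η s)
          - taylorRem (G m m t) (G' m m t) (θ m) (η s)‖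
        ≤ 2 * (L * N * (V₁ t - V₁ m) ^ a) * D ^ (1 + l * γ)
          * (W m - W s) ^ (γ * (1 - l) / r) := by
      refine (norm_taylorRem_sub_left_le (fun x => hG m m t x hmt) hγ
        (fun x y => h.holder m m t x y hmt) (by positivity) hl hl1 (hD s)).trans ?_
      rw [norm_sub_rev]
      exact mul_le_mul_of_nonneg_left (hθ.rpow_le hc hsm) (by positivity)
    have h3 : ‖taylorRem (G m m t) (G' m m t) (θ m) (η s)
          - taylorRem (G m m t) (G' m m t) (θ m) (η m)‖
        ≤ L * N * (V₁ t - V₁ m) ^ a * D ^ γ * (Y m - Y s) ^ (1 / r) := by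
      refine (norm_taylorRem_sub_le (fun x => hG m m t x hmt) hγ
        (fun x y => h.holder m m t x y hmt) (by positivity) (hD s) (hD m)).trans ?_
      have e1 := hη.rpow_le one_pos hsm
      rw [Real.rpow_one] at e1
      rw [norm_sub_rev]
      exact mul_le_mul_of_nonneg_left e1 (by positivity)
    have h6 := norm_sub_le_norm_sub_add_norm_sub
      (taylorRem (G m m t) (G' m m t) (θ s) (η s)) (taylorRem (G m m t) (G' m m t) (θ m) (η s))
      (taylorRem (G m m t) (G' m m t) (θ m) (η m))
    rw [Fin.sum_univ_three]
    simp only [Matrix.cons_val_zero, Matrix.cons_val_one, Matrix.cons_val_two, Matrix.tail_cons,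
      Matrix.head_cons]
    refine (add_le_add h1 (h6.trans (add_le_add h2 h3))).trans (le_of_eq ?_)
    ring

end IsYoungField

end DerivativeField

/-! ### The Young field of an occupation measure and a Besov path -/

section Occupation

variable {d : ℕ} {T : ℝ} (ω : C(Icc (0 : ℝ) T, Euc d))

instance isFiniteMeasure_occupation (s t : Icc (0 : ℝ) T) :
    IsFiniteMeasure (occupation ω s t) := by
  have : IsFiniteMeasure ((volume : Measure ℝ).comap (Subtype.val : Icc (0 : ℝ) T → ℝ)) := by
    refine ⟨?_⟩
    rw [(MeasurableEmbedding.subtype_coe measurableSet_Icc).comap_apply]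
    exact (measure_mono (by rintro _ ⟨x, -, rfl⟩; exact x.2)).trans_lt
      (measure_Icc_lt_top (a := 0) (b := T))
  unfold occupation
  infer_instance

theorem occupation_add {s r t : Icc (0 : ℝ) T} (hsr : s ≤ r) (hrt : r ≤ t) :
    occupation ω s t = occupation ω s r + occupation ω r t := by
  unfold occupation
  rw [← Measure.map_add _ _ ω.continuous.measurable, ← Measure.restrict_union
    (Ioc_disjoint_Ioc_of_le le_rfl) measurableSet_Ioc, Ioc_union_Ioc_eq_Ioc hsr hrt]

theorem occupation_compl_closedBall {R : ℝ} (hω : ∀ s t, dist (ω s) (ω t) ≤ R)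
    (t₀ s t : Icc (0 : ℝ) T) : occupation ω s t (Metric.closedBall (ω t₀) R)ᶜ = 0 := by
  unfold occupation
  rw [Measure.map_apply ω.continuous.measurable Metric.isClosed_closedBall.measurableSet.compl]
  have : ω ⁻¹' (Metric.closedBall (ω t₀) R)ᶜ = ∅ :=
    eq_empty_of_forall_notMem fun x hx => hx (hω x t₀)
  rw [this, measure_empty]

theorem diffOp_occupation_add {s r t : Icc (0 : ℝ) T} (hsr : s ≤ r) (hrt : r ≤ t) (k : ℕ)
    (y : Euc d) (x : ℝ) :
    diffOp k (fun ρ => (occupation ω s t).real (Metric.closedBall y ρ)) x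
      = diffOp k (fun ρ => (occupation ω s r).real (Metric.closedBall y ρ)) x
        + diffOp k (fun ρ => (occupation ω r t).real (Metric.closedBall y ρ)) x := by
  rw [← diffOp_add]
  congr 1
  funext ρ
  rw [occupation_add ω hsr hrt, measureReal_add_apply]

end Occupation

/-! ### Controls for the data and the Young fields they produce -/

section Controls

variable {d : ℕ} {T : ℝ}

theorem le_pVar {ι : Type*} [Preorder ι] (δ : ι → ι → ℝ≥0∞) {r : ℝ} (hr : 0 < r) {s t : ι}
    (hst : s ≤ t) : δ s t ≤ pVar δ r := by
  have hu : Monotone fun i : ℕ => if i = 0 then s else t := by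
    intro i j hij
    by_cases hi : i = 0
    · by_cases hj : j = 0 <;> simp [hi, hj, hst]
    · simp [hi, show j ≠ 0 by omega]
  have h := sum_le_of_pVar (d := δ) hr 1 hu
  simp only [Finset.sum_range_one, if_true, zero_add, one_ne_zero, if_false] at h
  exact (ENNReal.rpow_le_rpow_iff hr).1 h

/-- A control for the occupation measures of `ω`. -/
structure IsSbeControl (α p q r : ℝ) (ω : C(Icc (0 : ℝ) T, Euc d)) (V : Icc (0 : ℝ) T → ℝ)
    (M : ℝ) : Prop where
  mono : Monotone V
  cont : Continuous V
  nonneg : 0 ≤ M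
  ne_top : ∀ s t, s ≤ t → sbeIncr α p q ω s t ≠ ∞
  le : ∀ s t, s ≤ t → (sbeIncr α p q ω s t).toReal ≤ (V t - V s) ^ (1 / r)
  total : ∀ s t, V t - V s ≤ M ^ r

theorem le_rpow_one_div {x y r : ℝ} (hx : 0 ≤ x) (hr : 0 < r) (h : x ^ r ≤ y) :
    x ≤ y ^ (1 / r) := by
  have h1 := Real.rpow_le_rpow (by positivity) h (by positivity : 0 ≤ 1 / r)
  rwa [← Real.rpow_mul hx, mul_one_div_cancel hr.ne', Real.rpow_one] at h1

theorem exists_isSbeControl {α p q r : ℝ} (hp : 1 ≤ p) (hq : 1 ≤ q) (hr : 0 < r)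
    (ω : C(Icc (0 : ℝ) T, Euc d)) (h : IsCVar (sbeIncr α p q ω) r) :
    ∃ V, IsSbeControl α p q r ω V (sbeVar α p q r ω).toReal := by
  have hadd := fun s u t hsu hut => diffOp_occupation_add ω (s := s) (r := u) (t := t) hsu hut
    ⌈α + d - 1⌉₊
  -- Measures cannot be subtracted, so the last two triangle inequalities are checked on the
  -- difference operators of ball masses, which are additive in the time interval.
  obtain ⟨V, hV, hVc, hle, htot⟩ := exists_control_of_isCVar hr h
    (fun s u t hsu hut => sbeNorm_le_add hp hq fun y x => by
      rw [hadd s u t hsu hut]; exact abs_add_le _ _)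
    (fun s u t hsu hut => sbeNorm_le_add hp hq fun y x => by
      have h1 := abs_sub (diffOp ⌈α + d - 1⌉₊
          (fun ρ => (occupation ω s t).real (Metric.closedBall y ρ)) x)
        (diffOp ⌈α + d - 1⌉₊ (fun ρ => (occupation ω u t).real (Metric.closedBall y ρ)) x)
      rwa [hadd s u t hsu hut, add_sub_cancel_right, ← hadd s u t hsu hut] at h1)
    (fun s u t hsu hut => sbeNorm_le_add hp hq fun y x => by
      have h1 := abs_sub (diffOp ⌈α + d - 1⌉₊
          (fun ρ => (occupation ω s t).real (Metric.closedBall y ρ)) x)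
        (diffOp ⌈α + d - 1⌉₊ (fun ρ => (occupation ω s u).real (Metric.closedBall y ρ)) x)
      rwa [hadd s u t hsu hut, add_sub_cancel_left, ← hadd s u t hsu hut] at h1)
  exact ⟨V, hV, hVc, ENNReal.toReal_nonneg,
    fun s t hst => ne_top_of_le_ne_top h.finite (le_pVar _ hr hst),
    fun s t hst => le_rpow_one_div ENNReal.toReal_nonneg hr (hle s t hst), htot⟩

/-- A control for a path of Besov distributions. -/
structure IsBesovControl (σ p : ℝ) (q : ℝ≥0∞) (r : ℝ) (f : Icc (0 : ℝ) T → VecDistribution d)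
    (V : Icc (0 : ℝ) T → ℝ) (N Φ : ℝ) : Prop where
  mono : Monotone V
  cont : Continuous V
  nonneg : 0 ≤ N
  nonneg' : 0 ≤ Φ
  ne_top : ∀ t, besovNorm σ p q (f t) ≠ ∞
  ne_top' : ∀ s t, s ≤ t → besovNorm σ p q (f s - f t) ≠ ∞
  norm_le : ∀ t, (besovNorm σ p q (f t)).toReal ≤ N
  le : ∀ s t, s ≤ t → (besovNorm σ p q (f s - f t)).toReal ≤ (V t - V s) ^ (1 / r)
  total : ∀ s t, V t - V s ≤ Φ ^ r

theorem besovSup_ne_top {σ p : ℝ} {q : ℝ≥0∞} {r : ℝ} (hT : 0 < T) (hp : 1 ≤ p) (hq : 1 ≤ q)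
    (hr : 0 < r) {f : Icc (0 : ℝ) T → VecDistribution d} (h : MemVarBesov σ p q r f) :
    besovSup σ p q f ≠ ∞ := by
  refine ne_top_of_le_ne_top (ENNReal.add_ne_top.2 ⟨h.isCVar.finite, h.mem ⟨0, le_rfl, hT.le⟩⟩)
    (iSup_le fun t => ?_)
  have h1 := besovNorm_add_le σ hp hq (f t - f ⟨0, le_rfl, hT.le⟩) (f ⟨0, le_rfl, hT.le⟩)
  rw [sub_add_cancel] at h1
  exact h1.trans (add_le_add_left (le_pVar (besovIncr σ p q f) hr t.2.1) _)

theorem exists_isBesovControl {σ p : ℝ} {q : ℝ≥0∞} {r : ℝ} (hT : 0 < T) (hp : 1 ≤ p) (hq : 1 ≤ q)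
    (hr : 0 < r) {f : Icc (0 : ℝ) T → VecDistribution d} (h : MemVarBesov σ p q r f) :
    ∃ V, IsBesovControl σ p q r f V (besovSup σ p q f).toReal (besovVar σ p q r f).toReal := by
  obtain ⟨V, hV, hVc, hle, htot⟩ := exists_control_of_isCVar hr h.isCVar
    (fun s u t _ _ => by
      unfold besovIncr
      rw [← sub_add_sub_cancel' (f u) (f s) (f t)]
      exact besovNorm_add_le σ hp hq _ _)
    (fun s u t _ _ => by
      unfold besovIncr
      rw [show f u - f s = (f t - f s) - (f t - f u) by abel]
      exact besovNorm_sub_le σ hp hq _ _)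
    (fun s u t _ _ => by
      unfold besovIncr
      rw [show f t - f u = (f t - f s) - (f u - f s) by abel]
      exact besovNorm_sub_le σ hp hq _ _)
  have hneg : ∀ s t, besovNorm σ p q (f s - f t) = besovIncr σ p q f s t := fun s t => by
    rw [← besovNorm_neg, neg_sub]; rfl
  refine ⟨V, hV, hVc, ENNReal.toReal_nonneg, ENNReal.toReal_nonneg, h.mem, fun s t hst => ?_,
    fun t => ENNReal.toReal_mono (besovSup_ne_top hT hp hq hr h) 
      (le_iSup (fun t => besovNorm σ p q (f t)) t), fun s t hst => ?_, htot⟩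
  · rw [hneg]
    exact ne_top_of_le_ne_top h.isCVar.finite (le_pVar _ hr hst)
  · rw [hneg]
    exact le_rpow_one_div ENNReal.toReal_nonneg hr (hle s t hst)

theorem VarPath.exists_isPathControl {F : Type*} [NormedAddCommGroup F] [NormedSpace ℝ F]
    {r : ℝ} [hr : Fact (0 < r)] (θ : VarPath T r F) :
    ∃ W, IsPathControl θ.toC W r θ.var.toReal := by
  have hcv : IsCVar (normIncr θ.toC) r := by
    refine ⟨fun t => ?_, θ.var_ne_top⟩
    have h1 : Continuous fun s => normIncr θ.toC (min s t) (max s t) := by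
      unfold normIncr
      fun_prop
    have h2 := h1.tendsto t
    simpa [normIncr] using h2
  obtain ⟨W, hW, hWc, hle, htot⟩ := exists_control_of_isCVar hr.out hcv
    (fun s u t _ _ => by
      unfold normIncr
      rw [← sub_add_sub_cancel' (θ.toC u) (θ.toC s) (θ.toC t)]
      exact enorm_add_le _ _)
    (fun s u t _ _ => by
      unfold normIncr
      rw [show θ.toC u - θ.toC s = (θ.toC t - θ.toC s) - (θ.toC t - θ.toC u) by abel]
      exact enorm_sub_le)
    (fun s u t _ _ => by
      unfold normIncr
      rw [show θ.toC t - θ.toC u = (θ.toC t - θ.toC s) - (θ.toC u - θ.toC s) by abel]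
      exact enorm_sub_le)
  refine ⟨W, hW, hWc, hr.out, fun s t hst => ?_, htot⟩
  have := hle s t hst
  rwa [normIncr, toReal_enorm] at this

variable {α p₁ q α' p r₁ r₂ γ₀ γ : ℝ} {q' : ℝ≥0∞} (hd : 0 < d) (hα : 0 < α) (hp₁ : 1 ≤ p₁)
  (hq : 1 ≤ q) (hp : 1 ≤ p) (hq' : 1 ≤ q') (hpq : 1 ≤ 1 / q + 1 / p)
  (hγ₀ : γ₀ = α + α' - d * (1 / q + 1 / p - 1)) (R : ℝ) (hγ : 0 < γ) (hγ1 : γ < 1)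
  (hr₁ : 0 < r₁) (hr₂ : 0 < r₂)
include hd hα hp₁ hq hp hq' hpq hγ₀ hγ hγ1 hr₁ hr₂

/-- The convolutions of the Besov path with the occupation measures form a Young field. -/
theorem exists_isYoungField (hγγ₀ : γ ≤ γ₀) : ∃ L : ℝ, 0 ≤ L ∧ ∀ T : ℝ, 0 < T →
    ∀ ω : C(Icc (0 : ℝ) T, Euc d), (∀ s t, dist (ω s) (ω t) ≤ R) →
    ∀ (f : Icc (0 : ℝ) T → VecDistribution d) (V₁ V₂ : Icc (0 : ℝ) T → ℝ) (M N Φ : ℝ),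
      IsSbeControl α p₁ q r₁ ω V₁ M → IsBesovControl α' p q' r₂ f V₂ N Φ →
      ∃ G : Icc (0 : ℝ) T → Icc (0 : ℝ) T → Icc (0 : ℝ) T → Euc d →ᵇ Euc d,
        (∀ v s t, s ≤ t → IsConvolution (f v) (occupation ω s t) (G v s t)) ∧
        IsYoungField (fun v s t x => G v s t x) V₁ V₂ (1 / r₁) (1 / r₂) γ L N Φ := by
  obtain ⟨C, hC, h⟩ := exists_isConvolution hd hα hp₁ hq hp hq' hpq hγ₀ R hγ hγ1 hγγ₀
  refine ⟨C, hC, fun T hT ω hω f V₁ V₂ M N Φ hV₁ hV₂ => ?_⟩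
  have hsupp := occupation_compl_closedBall ω hω ⟨0, le_rfl, hT.le⟩
  have hae := fun s t => ae_norm_le_of_support (hsupp s t)
  have key : ∀ v s t, ∃ g : Euc d →ᵇ Euc d, s ≤ t →
      IsConvolution (f v) (occupation ω s t) g ∧ (∀ x, ‖g x‖ ≤ C *
        (besovNorm α' p q' (f v)).toReal * (sbeNorm α p₁ q (occupation ω s t)).toReal) ∧
        ∀ x y, ‖g x - g y‖ ≤ C * (besovNorm α' p q' (f v)).toReal *
          (sbeNorm α p₁ q (occupation ω s t)).toReal * ‖x - y‖ ^ γ := by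
    intro v s t
    by_cases hst : s ≤ t
    · obtain ⟨g, hg⟩ := h (f v) (hV₂.ne_top v) (occupation ω s t) _ (hsupp s t)
        (hV₁.ne_top s t hst)
      exact ⟨g, fun _ => hg⟩
    · exact ⟨0, fun h => absurd h hst⟩
  choose G hG using key
  have hle : ∀ {x y s t}, s ≤ t → 0 ≤ x → x ≤ y → C * x * (sbeNorm α p₁ q (occupation ω s t)).toReal
      ≤ C * y * (V₁ t - V₁ s) ^ (1 / r₁) := by
    intro x y s t hst hx hxy
    exact mul_le_mul (mul_le_mul_of_nonneg_left hxy hC) (hV₁.le s t hst) ENNReal.toReal_nonneg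
      (mul_nonneg hC (hx.trans hxy))
  -- The increment of the field in its frozen time is the convolution of `f v - f v'` with the same
  -- measure, by uniqueness, so the analytic estimate applies to it directly.
  have hdiff : ∀ v v' s t, v ≤ v' → s ≤ t →
      (∀ x, ‖G v s t x - G v' s t x‖ ≤ C * ((V₁ t - V₁ s) ^ (1 / r₁) *
        (V₂ v' - V₂ v) ^ (1 / r₂))) ∧
      ∀ x y, ‖(G v s t x - G v' s t x) - (G v s t y - G v' s t y)‖
        ≤ C * ((V₁ t - V₁ s) ^ (1 / r₁) * (V₂ v' - V₂ v) ^ (1 / r₂)) * ‖x - y‖ ^ γ := by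
    intro v v' s t hv hst
    obtain ⟨g, hg, hg1, hg2⟩ := h (f v - f v') (hV₂.ne_top' v v' hv) (occupation ω s t) _
      (hsupp s t) (hV₁.ne_top s t hst)
    have heq := ((hG v s t hst).1.sub (hae s t) (hG v' s t hst).1).unique hg
    have h1 := (hle hst ENNReal.toReal_nonneg (hV₂.le v v' hv)).trans_eq
      (by rw [mul_assoc, mul_comm ((V₂ v' - V₂ v) ^ (1 / r₂))])
    have hx : ∀ x, G v s t x - G v' s t x = g x := fun x => by rw [← heq]; rfl
    simp_rw [hx]
    exact ⟨fun x => (hg1 x).trans h1, fun x y => (hg2 x y).trans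
      (mul_le_mul_of_nonneg_right h1 (by positivity))⟩
  refine ⟨G, fun v s t hst => (hG v s t hst).1, ⟨hV₁.mono, hV₁.cont, hV₂.mono, hV₂.cont,
    by positivity, by positivity, hγ, hC, hV₂.nonneg, hV₂.nonneg', fun s t => ?_,
    fun v s r t x hsr hrt => ?_, fun v s t x hst => ?_, fun v s t x y hst => ?_,
    fun v v' s t x hv hst => (hdiff v v' s t hv hst).1 x,
    fun v v' s t x y hv hst => (hdiff v v' s t hv hst).2 x y⟩⟩
  · rw [one_div, inv_inv]; exact hV₂.total s t
  · have h1 := (hG v s t (hsr.trans hrt)).1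
    rw [occupation_add ω hsr hrt] at h1
    rw [h1.unique ((hG v s r hsr).1.add_measure (hae s r) (hae r t) (hG v r t hrt).1)]
    rfl
  · exact ((hG v s t hst).2.1 x).trans (hle hst ENNReal.toReal_nonneg (hV₂.norm_le v))
  · exact ((hG v s t hst).2.2 x y).trans (mul_le_mul_of_nonneg_right
      (hle hst ENNReal.toReal_nonneg (hV₂.norm_le v)) (by positivity))

/-- The derivatives of the convolutions form a Young field. -/
theorem exists_isYoungField_fderiv (hγγ₀ : γ ≤ γ₀ - 1) : ∃ L : ℝ, 0 ≤ L ∧ ∀ T : ℝ, 0 < T →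
    ∀ ω : C(Icc (0 : ℝ) T, Euc d), (∀ s t, dist (ω s) (ω t) ≤ R) →
    ∀ (f : Icc (0 : ℝ) T → VecDistribution d) (V₁ V₂ : Icc (0 : ℝ) T → ℝ) (M N Φ : ℝ),
      IsSbeControl α p₁ q r₁ ω V₁ M → IsBesovControl α' p q' r₂ f V₂ N Φ →
      ∀ G : Icc (0 : ℝ) T → Icc (0 : ℝ) T → Icc (0 : ℝ) T → Euc d →ᵇ Euc d,
        (∀ v s t, s ≤ t → IsConvolution (f v) (occupation ω s t) (G v s t)) →
        ∃ G' : Icc (0 : ℝ) T → Icc (0 : ℝ) T → Icc (0 : ℝ) T → Euc d → Euc d →L[ℝ] Euc d,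
          (∀ v s t x, s ≤ t → HasFDerivAt (G v s t) (G' v s t x) x) ∧
          IsYoungField G' V₁ V₂ (1 / r₁) (1 / r₂) γ L N Φ := by
  obtain ⟨C, hC, h⟩ := exists_hasFDerivAt_of_isConvolution hd hα hp₁ hq hp hq' hpq hγ₀ R hγ hγ1 hγγ₀
  refine ⟨C, hC, fun T hT ω hω f V₁ V₂ M N Φ hV₁ hV₂ G hG => ?_⟩
  have hsupp := occupation_compl_closedBall ω hω ⟨0, le_rfl, hT.le⟩
  have hae := fun s t => ae_norm_le_of_support (hsupp s t)
  have key : ∀ v s t, ∃ g' : Euc d → Euc d →L[ℝ] Euc d, s ≤ t →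
      (∀ x, HasFDerivAt (G v s t) (g' x) x) ∧ (∀ x, ‖g' x‖ ≤ C *
        (besovNorm α' p q' (f v)).toReal * (sbeNorm α p₁ q (occupation ω s t)).toReal) ∧
        ∀ x y, ‖g' x - g' y‖ ≤ C * (besovNorm α' p q' (f v)).toReal *
          (sbeNorm α p₁ q (occupation ω s t)).toReal * ‖x - y‖ ^ γ := by
    intro v s t
    by_cases hst : s ≤ t
    · obtain ⟨g, hg⟩ := h (f v) (hV₂.ne_top v) (occupation ω s t) _ (hsupp s t)
        (hV₁.ne_top s t hst) _ (hG v s t hst)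
      exact ⟨g, fun _ => hg⟩
    · exact ⟨0, fun h => absurd h hst⟩
  choose G' hG' using key
  have hle : ∀ {x y s t}, s ≤ t → 0 ≤ x → x ≤ y → C * x * (sbeNorm α p₁ q (occupation ω s t)).toReal
      ≤ C * y * (V₁ t - V₁ s) ^ (1 / r₁) := by
    intro x y s t hst hx hxy
    exact mul_le_mul (mul_le_mul_of_nonneg_left hxy hC) (hV₁.le s t hst) ENNReal.toReal_nonneg
      (mul_nonneg hC (hx.trans hxy))
  have hdiff : ∀ v v' s t, v ≤ v' → s ≤ t →
      (∀ x, ‖G' v s t x - G' v' s t x‖ ≤ C * ((V₁ t - V₁ s) ^ (1 / r₁) *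
        (V₂ v' - V₂ v) ^ (1 / r₂))) ∧
      ∀ x y, ‖(G' v s t x - G' v' s t x) - (G' v s t y - G' v' s t y)‖
        ≤ C * ((V₁ t - V₁ s) ^ (1 / r₁) * (V₂ v' - V₂ v) ^ (1 / r₂)) * ‖x - y‖ ^ γ := by
    intro v v' s t hv hst
    obtain ⟨g, hg, hg1, hg2⟩ := h (f v - f v') (hV₂.ne_top' v v' hv) (occupation ω s t) _
      (hsupp s t) (hV₁.ne_top s t hst) _ ((hG v s t hst).sub (hae s t) (hG v' s t hst))
    have h1 := (hle hst ENNReal.toReal_nonneg (hV₂.le v v' hv)).trans_eq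
      (by rw [mul_assoc, mul_comm ((V₂ v' - V₂ v) ^ (1 / r₂))])
    -- Linearity passes to the derivatives because derivatives are unique.
    have hx : ∀ x, G' v s t x - G' v' s t x = g x := fun x =>
      (((hG' v s t hst).1 x).sub ((hG' v' s t hst).1 x)).unique (hg x)
    simp_rw [hx]
    exact ⟨fun x => (hg1 x).trans h1, fun x y => (hg2 x y).trans
      (mul_le_mul_of_nonneg_right h1 (by positivity))⟩
  refine ⟨G', fun v s t x hst => (hG' v s t hst).1 x, ⟨hV₁.mono, hV₁.cont, hV₂.mono, hV₂.cont,
    by positivity, by positivity, hγ, hC, hV₂.nonneg, hV₂.nonneg', fun s t => ?_,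
    fun v s r t x hsr hrt => ?_, fun v s t x hst => ?_, fun v s t x y hst => ?_,
    fun v v' s t x hv hst => (hdiff v v' s t hv hst).1 x,
    fun v v' s t x y hv hst => (hdiff v v' s t hv hst).2 x y⟩⟩
  · rw [one_div, inv_inv]; exact hV₂.total s t
  · have h1 := hG v s t (hsr.trans hrt)
    rw [occupation_add ω hsr hrt] at h1
    have h2 := h1.unique ((hG v s r hsr).add_measure (hae s r) (hae r t) (hG v r t hrt))
    have h3 := (hG' v s t (hsr.trans hrt)).1 x
    rw [h2] at h3
    exact h3.unique (((hG' v s r hsr).1 x).add ((hG' v r t hrt).1 x))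
  · exact ((hG' v s t hst).2.1 x).trans (hle hst ENNReal.toReal_nonneg (hV₂.norm_le v))
  · exact ((hG' v s t hst).2.2 x y).trans (mul_le_mul_of_nonneg_right
      (hle hst ENNReal.toReal_nonneg (hV₂.norm_le v)) (by positivity))

end Controls

/-! ### Nonlinear Young integrals -/

/-! ### Collecting the constants of the sewing bounds -/

section Arithmetic

variable {L N Φ K M D H X S A B Z : ℝ} (hL : 0 ≤ L) (hN : 0 ≤ N) (hΦ : 0 ≤ Φ) (hK : 0 ≤ K)
  (hM : 0 ≤ M)
include hL hN hΦ hK hM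

theorem sub_bound_arith (hX : 0 ≤ X) (hS : 0 ≤ S) (hZ : Z ≤ X * S) (hA : A ≤ S) (hB : B ≤ S) :
    (L * N * Z + K * (L * Z * Φ + 2 * (L * N) * X * A + 2 * (L * N) * X * B)) * M
      ≤ L * (1 + 4 * K) * M * (N + Φ) * X * S := by
  calc _ ≤ (L * N * (X * S) + K * (L * (X * S) * Φ + 2 * (L * N) * X * S
          + 2 * (L * N) * X * S)) * M := by gcongr
    _ = (L * (X * S) * M) * (N + K * (Φ + 4 * N)) := by ring
    _ ≤ (L * (X * S) * M) * ((1 + 4 * K) * (N + Φ)) := by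
        gcongr
        nlinarith [mul_nonneg hK hΦ]
    _ = _ := by ring

theorem apply_bound_arith (hX : 0 ≤ X) (hD : 0 ≤ D) (hH : 0 ≤ H)
    (h : Z ≤ (L * N * D + K * (L * D * Φ + L * N * D * X + L * N * H)) * M) :
    2 * Z ≤ 2 * (L * (1 + K)) * M * (Φ + (1 + X) * N) * (D + H) := by
  calc 2 * Z ≤ 2 * ((L * N * D + K * (L * D * Φ + L * N * D * X + L * N * H)) * M) := by gcongr
    _ = (2 * L * M) * (N * D + K * (D * Φ + N * D * X + N * H)) := by ring
    _ ≤ (2 * L * M) * ((1 + K) * ((Φ + (1 + X) * N) * (D + H))) := by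
        refine mul_le_mul_of_nonneg_left ?_ (by positivity)
        have e1 : N * D ≤ (Φ + (1 + X) * N) * (D + H) := by
          refine mul_le_mul ?_ (by linarith) hD (by positivity)
          nlinarith [mul_nonneg hX hN]
        have e2 : D * Φ + N * D * X + N * H ≤ (Φ + (1 + X) * N) * (D + H) := by
          have := mul_nonneg hΦ hH
          have := mul_nonneg (mul_nonneg hX hN) hH
          have := mul_nonneg hN hD
          nlinarith
        nlinarith [mul_le_mul_of_nonneg_left e2 hK]
    _ = _ := by ring

theorem rem_bound_arith {p₁ p₂ p₃ n₁ n₂ e : ℝ} (hX : 0 ≤ X) (h₁ : p₁ ≤ n₁ * e) (h₂ : p₂ ≤ n₂ * e)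
    (h₃ : p₃ * H ≤ n₁ * e)
    (h : Z ≤ (L * N * p₁ + K * (L * p₁ * Φ + 2 * (L * N) * p₂ * X + L * N * p₃ * H)) * M) :
    2 * Z ≤ (2 * M * (L * N + K * (L * Φ + L * N)) * n₁
        + 2 * M * (K * (2 * (L * N) * X)) * n₂) * e := by
  calc 2 * Z ≤ 2 * ((L * N * p₁ + K * (L * p₁ * Φ + 2 * (L * N) * p₂ * X + L * N * p₃ * H)) * M) := by
        gcongr
    _ = 2 * ((L * N * p₁ + K * (L * p₁ * Φ + 2 * (L * N) * p₂ * X + L * N * (p₃ * H))) * M) := by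
        ring
    _ ≤ 2 * ((L * N * (n₁ * e) + K * (L * (n₁ * e) * Φ + 2 * (L * N) * (n₂ * e) * X
          + L * N * (n₁ * e))) * M) := by gcongr
    _ = _ := by ring

end Arithmetic

/-! ### Existence, uniqueness and regularity of the integral -/

section YoungIntegral

variable {d : ℕ} {T : ℝ}

theorem VarPath.ext_apply {F : Type*} [NormedAddCommGroup F] [NormedSpace ℝ F] {r : ℝ}
    [Fact (0 < r)] {θ η : VarPath T r F} (h : (θ.toC : Icc (0 : ℝ) T → F) = η.toC) : θ = η :=
  Subtype.ext (ContinuousMap.ext fun t => congrFun h t)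

theorem VarPath.norm_apply_le {F : Type*} [NormedAddCommGroup F] [NormedSpace ℝ F] {r : ℝ}
    [Fact (0 < r)] (θ : VarPath T r F) (t : Icc (0 : ℝ) T) : ‖θ.toC t‖ ≤ ‖θ.toC‖ :=
  θ.toC.norm_coe_le_norm t

/-- The norm of a path that starts at `0` is controlled by its variation. -/
theorem VarPath.norm_le_two_mul_var {F : Type*} [NormedAddCommGroup F] [NormedSpace ℝ F] {r : ℝ}
    [hr : Fact (0 < r)] (hT : 0 < T) (θ : VarPath T r F)
    (h0 : ∀ t : Icc (0 : ℝ) T, (t : ℝ) = 0 → θ.toC t = 0) : ‖θ‖ ≤ 2 * θ.var.toReal := by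
  have h1 : ‖θ.toC‖ ≤ θ.var.toReal := by
    refine (ContinuousMap.norm_le _ ENNReal.toReal_nonneg).2 fun t => ?_
    have h2 := ENNReal.toReal_mono θ.var_ne_top
      (le_pVar (normIncr θ.toC) hr.out (s := ⟨0, le_rfl, hT.le⟩) (t := t) t.2.1)
    rwa [normIncr, h0 ⟨0, le_rfl, hT.le⟩ rfl, sub_zero, toReal_enorm] at h2
  rw [VarPath.norm_def]
  linarith

variable {ω : C(Icc (0 : ℝ) T, Euc d)} {f : Icc (0 : ℝ) T → VecDistribution d}
  {G : Icc (0 : ℝ) T → Icc (0 : ℝ) T → Icc (0 : ℝ) T → Euc d →ᵇ Euc d}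

/-- The convolutions hidden in the definition are unique, so they may be replaced by the fixed field
`G`. -/
theorem IsYoungIntegral.exists_negligible
    (hG : ∀ v s t, s ≤ t → IsConvolution (f v) (occupation ω s t) (G v s t))
    {θ J : C(Icc (0 : ℝ) T, Euc d)} (hJ : IsYoungIntegral ω f θ J) :
    ∃ e, IsNegligible e ∧ ∀ s t, s ≤ t → ‖J t - J s - G s s t (θ s)‖ ≤ e s t := by
  obtain ⟨-, g, hg, ρ, σ, a, b, hρ, hσ, ha, hb, hab, h⟩ := hJ
  refine ⟨_, hρ.isNegligible_rpow_mul_rpow hσ ha hb hab, fun s t hst => ?_⟩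
  rw [(hG s s t hst).unique (hg s t hst)]
  exact h s t hst

/-- A single control raised to the power `z` is split evenly into two factors of exponent `z / 2`.
-/
theorem isYoungIntegral_of_sewing
    (hG : ∀ v s t, s ≤ t → IsConvolution (f v) (occupation ω s t) (G v s t))
    {θ J : C(Icc (0 : ℝ) T, Euc d)} (h0 : ∀ t : Icc (0 : ℝ) T, (t : ℝ) = 0 → J t = 0)
    {w : Icc (0 : ℝ) T → Icc (0 : ℝ) T → ℝ} (hw : IsControl w) {z : ℝ} (hz : 1 < z)
    (h : ∀ s t, s ≤ t → ‖J t - J s - G s s t (θ s)‖ ≤ w s t ^ z) : IsYoungIntegral ω f θ J := by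
  refine ⟨h0, fun s t => G s s t, fun s t hst => hG s s t hst, w, w, z / 2, z / 2, hw, hw,
    by linarith, by linarith, by linarith, fun s t hst => (h s t hst).trans (le_of_eq ?_)⟩
  rw [← Real.rpow_add_of_nonneg (hw.nonneg s t hst) (by linarith) (by linarith), add_halves]

section Paths

variable {κ : Type*} [Fintype κ] {F : Type*} [NormedAddCommGroup F] [NormedSpace ℝ F]
  {Ψ : Icc (0 : ℝ) T → Icc (0 : ℝ) T → Icc (0 : ℝ) T → Icc (0 : ℝ) T → F}
  {V : Icc (0 : ℝ) T → ℝ} {r z P M : ℝ} {A : κ → ℝ} {U : κ → Icc (0 : ℝ) T → ℝ} {b u : κ → ℝ}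

omit [NormedSpace ℝ F] in
theorem IsSewable.pVar_normIncr_le (h : IsSewable Ψ V (1 / r) z P A U b u) (hr : 0 < r)
    (hQ : 0 ≤ P + youngConst κ z * ∑ j, A j * u j ^ b j) (hM : 0 ≤ M)
    (hVM : ∀ s t, V t - V s ≤ M ^ r) {I : Icc (0 : ℝ) T → F}
    {e : Icc (0 : ℝ) T → Icc (0 : ℝ) T → ℝ}
    (he : IsNegligible e) (hI : ∀ s t, s ≤ t → ‖I t - I s - Ψ s s t s‖ ≤ e s t) :
    pVar (normIncr I) r ≤ ENNReal.ofReal ((P + youngConst κ z * ∑ j, A j * u j ^ b j) * M) :=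
  SBEPaths.pVar_normIncr_le hr hQ hM h.mono hVM fun _ _ hst => h.norm_incr_le he hI hst

theorem IsSewable.exists_varPath [ProperSpace F] [hr : Fact (0 < r)] (hT : 0 < T)
    (h : IsSewable Ψ V (1 / r) z P A U b u)
    (hQ : 0 ≤ P + youngConst κ z * ∑ j, A j * u j ^ b j) (hM : 0 ≤ M)
    (hVM : ∀ s t, V t - V s ≤ M ^ r) :
    ∃ I : VarPath T r F, (∀ t : Icc (0 : ℝ) T, (t : ℝ) = 0 → I.toC t = 0) ∧
      ∃ w, IsControl w ∧ ∀ s t, s ≤ t → ‖I.toC t - I.toC s - Ψ s s t s‖ ≤ w s t ^ z := by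
  obtain ⟨I, hI0, w, hw, hI⟩ := h.exists_path hT
  have he := hw.isNegligible_rpow h.one_lt
  have hc : Continuous I := continuous_of_norm_incr_le h.apos h.cont fun s t hst =>
    h.norm_incr_le he hI hst
  exact ⟨⟨⟨I, hc⟩, ne_top_of_le_ne_top ENNReal.ofReal_ne_top
    (h.pVar_normIncr_le hr.out hQ hM hVM he hI)⟩, hI0, w, hw, hI⟩

end Paths

variable {r₁ r₃ b γ L N Φ M : ℝ} [hr₁ : Fact (0 < r₁)] [hr₃ : Fact (0 < r₃)]
  {V₁ V₂ : Icc (0 : ℝ) T → ℝ} (hT : 0 < T)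
  (hG : ∀ v s t, s ≤ t → IsConvolution (f v) (occupation ω s t) (G v s t))
  (h : IsYoungField (fun v s t x => G v s t x) V₁ V₂ (1 / r₁) b γ L N Φ) (hM : 0 ≤ M)
  (hV : ∀ s t, V₁ t - V₁ s ≤ M ^ r₁) (hb : 1 < 1 / r₁ + b)
include hT hG h hM hV hb

/-- Existence, uniqueness and variation bound of the nonlinear Young integral. -/
theorem exists_youngIntegral (hγ : 1 < 1 / r₁ + γ / r₃) (θ : VarPath T r₃ (Euc d)) :
    ∃ I : VarPath T r₁ (Euc d), IsYoungIntegral ω f θ.toC I.toC ∧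
      (∀ J : C(Icc (0 : ℝ) T, Euc d), IsYoungIntegral ω f θ.toC J → J = I.toC) ∧
      I.var ≤ ENNReal.ofReal
        (L * (1 + youngConst (Fin 2) (min (1 / r₁ + b) (1 / r₁ + γ / r₃)))
          * (Φ + (1 + θ.var.toReal ^ γ) * N) * M) := by
  -- The smaller of the two Young exponents, one for the variation of `f` and one for that of `θ`;
  -- both exceed one.
  set z := min (1 / r₁ + b) (1 / r₁ + γ / r₃) with hzdef
  have hz : 1 < z := lt_min hb hγ
  set K := youngConst (Fin 2) z with hK
  have hK0 : 0 ≤ K := youngConst_nonneg hz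
  have hL := h.Lnonneg
  have hN := h.Nnonneg
  have hΦ := h.Φnonneg
  obtain ⟨W, hW⟩ := θ.exists_isPathControl
  set Θ := θ.var.toReal with hΘdef
  have hΘ : 0 ≤ Θ := ENNReal.toReal_nonneg
  have hS := h.isSewable_eval hW hz (min_le_left _ _) (min_le_right _ _)
  have hsum : ∑ j, (![L, L * N] : Fin 2 → ℝ) j * (![Φ ^ b⁻¹, Θ ^ r₃] : Fin 2 → ℝ) j ^
      (![b, γ / r₃] : Fin 2 → ℝ) j = L * Φ + L * N * Θ ^ γ := by
    rw [Fin.sum_univ_two]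
    simp only [Matrix.cons_val_zero, Matrix.cons_val_one]
    rw [h.total_rpow, rpow_rpow_div hΘ hr₃.out]
  have hQ : 0 ≤ L * N + K * ∑ j, (![L, L * N] : Fin 2 → ℝ) j *
      (![Φ ^ b⁻¹, Θ ^ r₃] : Fin 2 → ℝ) j ^ (![b, γ / r₃] : Fin 2 → ℝ) j := by
    rw [hsum]; positivity
  obtain ⟨I, hI0, w, hw, hI⟩ := hS.exists_varPath hT hQ hM hV
  refine ⟨I, isYoungIntegral_of_sewing hG hI0 hw hz hI, fun J hJ => ?_, ?_⟩
  · obtain ⟨e, he, hJe⟩ := hJ.exists_negligible hG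
    exact ContinuousMap.ext fun t => congrFun (eq_of_negligible hT he (hw.isNegligible_rpow hz)
      hJ.1 hI0 hJe hI) t
  · refine (hS.pVar_normIncr_le hr₁.out hQ hM hV (hw.isNegligible_rpow hz) hI).trans
      (ENNReal.ofReal_le_ofReal (mul_le_mul_of_nonneg_right ?_ hM))
    rw [hsum]
    have h1 : 0 ≤ Θ ^ γ := by positivity
    have h2 : 0 ≤ L * Φ := by positivity
    have h3 : 0 ≤ L * (Θ ^ γ * N) := by positivity
    have h4 : 0 ≤ K * (L * N) := by positivity
    nlinarith

omit hT in
/-- Hölder continuity of the nonlinear Young integral in the path. -/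
theorem var_youngIntegral_sub_le {l : ℝ} (hl : 0 < l) (hl1 : l < 1)
    (hγ : 1 < 1 / r₁ + γ * (1 - l) / r₃) (θ₁ θ₂ : VarPath T r₃ (Euc d))
    {I₁ I₂ : VarPath T r₁ (Euc d)} (h₁ : IsYoungIntegral ω f θ₁.toC I₁.toC)
    (h₂ : IsYoungIntegral ω f θ₂.toC I₂.toC) :
    (I₁ - I₂).var ≤ ENNReal.ofReal
      (L * (1 + 4 * youngConst (Fin 3) (min (1 / r₁ + b) (1 / r₁ + γ * (1 - l) / r₃)))
        * M * (N + Φ) * ‖θ₁.toC - θ₂.toC‖ ^ (l * γ)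
        * (‖θ₁.toC - θ₂.toC‖ + θ₁.var.toReal + θ₂.var.toReal) ^ (γ * (1 - l))) := by
  set z := min (1 / r₁ + b) (1 / r₁ + γ * (1 - l) / r₃) with hzdef
  have hz : 1 < z := lt_min hb hγ
  set K := youngConst (Fin 3) z with hK
  have hK0 : 0 ≤ K := youngConst_nonneg hz
  have hL := h.Lnonneg
  have hN := h.Nnonneg
  have hΦ := h.Φnonneg
  have hγ0 := h.γpos
  have hl' : 0 < 1 - l := by linarith
  obtain ⟨W₁, hW₁⟩ := θ₁.exists_isPathControl
  obtain ⟨W₂, hW₂⟩ := θ₂.exists_isPathControl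
  set Θ₁ := θ₁.var.toReal with hΘ₁def
  set Θ₂ := θ₂.var.toReal with hΘ₂def
  have hΘ₁ : 0 ≤ Θ₁ := ENNReal.toReal_nonneg
  have hΘ₂ : 0 ≤ Θ₂ := ENNReal.toReal_nonneg
  set D := ‖θ₁.toC - θ₂.toC‖ with hD
  have hD0 : 0 ≤ D := norm_nonneg _
  have hS := h.isSewable_sub hW₁ hW₂ hl hl1 hD0
    (fun t => (θ₁.toC - θ₂.toC).norm_coe_le_norm t) hz (min_le_left _ _) (min_le_right _ _)
  obtain ⟨e₁, he₁, hI₁⟩ := h₁.exists_negligible hG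
  obtain ⟨e₂, he₂, hI₂⟩ := h₂.exists_negligible hG
  have hsum : ∑ j, (![L * D ^ γ, 2 * (L * N) * D ^ (l * γ), 2 * (L * N) * D ^ (l * γ)] :
      Fin 3 → ℝ) j * (![Φ ^ b⁻¹, Θ₁ ^ r₃, Θ₂ ^ r₃] : Fin 3 → ℝ) j ^
      (![b, γ * (1 - l) / r₃, γ * (1 - l) / r₃] : Fin 3 → ℝ) j
      = L * D ^ γ * Φ + 2 * (L * N) * D ^ (l * γ) * Θ₁ ^ (γ * (1 - l))
        + 2 * (L * N) * D ^ (l * γ) * Θ₂ ^ (γ * (1 - l)) := by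
    rw [Fin.sum_univ_three]
    simp only [Matrix.cons_val_zero, Matrix.cons_val_one, Matrix.cons_val_two, Matrix.tail_cons,
      Matrix.head_cons]
    rw [h.total_rpow, rpow_rpow_div hΘ₁ hr₃.out, rpow_rpow_div hΘ₂ hr₃.out]
  have hX : 0 ≤ D ^ (l * γ) := by positivity
  -- The terms without path increments carry the full power of `D`; including `D` in the last factor
  -- brings them to the common form.
  have hDγ : D ^ γ ≤ D ^ (l * γ) * (D + Θ₁ + Θ₂) ^ (γ * (1 - l)) := by
    calc D ^ γ = D ^ (l * γ) * D ^ (γ * (1 - l)) := by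
          rw [← Real.rpow_add_of_nonneg hD0 (by positivity) (by positivity)]
          congr 1
          ring
      _ ≤ _ := by
          gcongr
          linarith
  -- The difference of the two integrals is sewn from the difference of the two evaluations.
  refine (hS.pVar_normIncr_le (I := (I₁ - I₂).toC) hr₁.out (by rw [hsum]; positivity) hM hV
    (he₁.add he₂) fun s t hst => ?_).trans (ENNReal.ofReal_le_ofReal ?_)
  · have e1 : (I₁ - I₂).toC t - (I₁ - I₂).toC s - (G s s t (θ₁.toC s) - G s s t (θ₂.toC s))
        = (I₁.toC t - I₁.toC s - G s s t (θ₁.toC s))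
          - (I₂.toC t - I₂.toC s - G s s t (θ₂.toC s)) := by
      change (I₁.toC t - I₂.toC t) - (I₁.toC s - I₂.toC s) - _ = _
      abel
    rw [e1]
    exact (norm_sub_le _ _).trans (add_le_add (hI₁ s t hst) (hI₂ s t hst))
  · rw [hsum]
    set S := (D + Θ₁ + Θ₂) ^ (γ * (1 - l)) with hSdef
    have hS0 : 0 ≤ S := by positivity
    have hc : 0 ≤ γ * (1 - l) := by positivity
    have hS₁ : Θ₁ ^ (γ * (1 - l)) ≤ S := Real.rpow_le_rpow hΘ₁ (by linarith) hc
    have hS₂ : Θ₂ ^ (γ * (1 - l)) ≤ S := Real.rpow_le_rpow hΘ₂ (by linarith) hc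
    exact sub_bound_arith hL hN hΦ hK0 hM hX hS0 hDγ hS₁ hS₂

/-! ### Differentiability in the path -/

section Derivative

variable {L' γ' : ℝ}
  {G' : Icc (0 : ℝ) T → Icc (0 : ℝ) T → Icc (0 : ℝ) T → Euc d → Euc d →L[ℝ] Euc d}
  (h' : IsYoungField G' V₁ V₂ (1 / r₁) b γ' L' N Φ) (hγ1 : γ' < 1)
include h' hγ1

omit hG h in
/-- The derivative of the nonlinear Young integral in a direction. -/
theorem exists_youngIntegral_deriv (hγ : 1 < 1 / r₁ + γ' / r₃) (θ η : VarPath T r₃ (Euc d)) :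
    ∃ J : VarPath T r₁ (Euc d),
      (∀ t : Icc (0 : ℝ) T, (t : ℝ) = 0 → J.toC t = 0) ∧
      (∃ e, IsNegligible e ∧ ∀ s t, s ≤ t →
        ‖J.toC t - J.toC s - G' s s t (θ.toC s) (η.toC s)‖ ≤ e s t) ∧
      ‖J‖ ≤ 2 * (L' * (1 + youngConst (Fin 3) (min (1 / r₁ + b) (1 / r₁ + γ' / r₃)))) * M
        * (Φ + (1 + θ.var.toReal ^ γ') * N) * ‖η‖ := by
  have hL := h'.Lnonneg
  have hN := h'.Nnonneg
  have hΦ := h'.Φnonneg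
  have hγ0 := h'.γpos
  obtain ⟨W, hW⟩ := θ.exists_isPathControl
  set Θ := θ.var.toReal with hΘdef
  have hΘ : 0 ≤ Θ := ENNReal.toReal_nonneg
  set z := min (1 / r₁ + b) (1 / r₁ + γ' / r₃) with hzdef
  have hz : 1 < z := lt_min hb hγ
  set K := youngConst (Fin 3) z with hK
  have hK0 : 0 ≤ K := youngConst_nonneg hz
  obtain ⟨Y, hY⟩ := η.exists_isPathControl
  set H := η.var.toReal with hHdef
  have hH : 0 ≤ H := ENNReal.toReal_nonneg
  set D := ‖η.toC‖ with hD
  have hD0 : 0 ≤ D := norm_nonneg _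
  have hS := h'.isSewable_apply hW hY hD0 η.norm_apply_le hγ1 hz (min_le_left _ _)
    (min_le_right _ _)
  have hsum : ∑ j, (![L' * D, L' * N * D, L' * N] : Fin 3 → ℝ) j *
      (![Φ ^ b⁻¹, Θ ^ r₃, H ^ r₃] : Fin 3 → ℝ) j ^ (![b, γ' / r₃, 1 / r₃] : Fin 3 → ℝ) j
      = L' * D * Φ + L' * N * D * Θ ^ γ' + L' * N * H := by
    rw [Fin.sum_univ_three]
    simp only [Matrix.cons_val_zero, Matrix.cons_val_one, Matrix.cons_val_two, Matrix.tail_cons,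
      Matrix.head_cons]
    rw [h'.total_rpow, rpow_rpow_div hΘ hr₃.out, rpow_rpow_div hH hr₃.out, Real.rpow_one]
  have hQ : 0 ≤ L' * N * D + K * ∑ j, (![L' * D, L' * N * D, L' * N] : Fin 3 → ℝ) j *
      (![Φ ^ b⁻¹, Θ ^ r₃, H ^ r₃] : Fin 3 → ℝ) j ^ (![b, γ' / r₃, 1 / r₃] : Fin 3 → ℝ) j := by
    rw [hsum]; positivity
  obtain ⟨J, hJ0, w, hw, hJ⟩ := hS.exists_varPath hT hQ hM hV
  have he := hw.isNegligible_rpow hz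
  refine ⟨J, hJ0, ⟨_, he, hJ⟩, (J.norm_le_two_mul_var hT hJ0).trans ?_⟩
  have h1 := ENNReal.toReal_mono ENNReal.ofReal_ne_top
    (hS.pVar_normIncr_le hr₁.out hQ hM hV he hJ)
  rw [ENNReal.toReal_ofReal (mul_nonneg hQ hM), hsum] at h1
  change J.var.toReal ≤ _ at h1
  have h2 : ‖η‖ = D + H := rfl
  rw [h2]
  exact apply_bound_arith hL hN hΦ hK0 hM (by positivity) hD0 hH h1

/-- The first-order remainder of the nonlinear Young integral. -/
theorem norm_youngIntegral_rem_le
    (hG' : ∀ v s t x, s ≤ t → HasFDerivAt (G v s t) (G' v s t x) x) {l : ℝ} (hl : 0 < l)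
    (hl1 : l < 1) (hlγ : 1 < 1 / r₁ + γ' * (1 - l) / r₃) {θ η : VarPath T r₃ (Euc d)}
    {I I' J : VarPath T r₁ (Euc d)} (hI : IsYoungIntegral ω f θ.toC I.toC)
    (hI' : IsYoungIntegral ω f (θ + η).toC I'.toC)
    (hJ0 : ∀ t : Icc (0 : ℝ) T, (t : ℝ) = 0 → J.toC t = 0)
    (hJ : ∃ e, IsNegligible e ∧ ∀ s t, s ≤ t →
        ‖J.toC t - J.toC s - G' s s t (θ.toC s) (η.toC s)‖ ≤ e s t) :
    ‖I' - I - J‖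
      ≤ (2 * M * (L' * N + youngConst (Fin 3) (min (1 / r₁ + b) (1 / r₁ + γ' * (1 - l) / r₃))
          * (L' * Φ + L' * N)) * ‖η‖ ^ γ'
        + 2 * M * (youngConst (Fin 3) (min (1 / r₁ + b) (1 / r₁ + γ' * (1 - l) / r₃))
          * (2 * (L' * N) * θ.var.toReal ^ (γ' * (1 - l)))) * ‖η‖ ^ (l * γ')) * ‖η‖ := by
  set z := min (1 / r₁ + b) (1 / r₁ + γ' * (1 - l) / r₃) with hzdef
  have hz : 1 < z := lt_min hb hlγ
  set K := youngConst (Fin 3) z with hK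
  have hK0 : 0 ≤ K := youngConst_nonneg hz
  have hL := h'.Lnonneg
  have hN := h'.Nnonneg
  have hΦ := h'.Φnonneg
  have hγ0 := h'.γpos
  obtain ⟨W, hW⟩ := θ.exists_isPathControl
  set Θ := θ.var.toReal with hΘdef
  have hΘ : 0 ≤ Θ := ENNReal.toReal_nonneg
  obtain ⟨Y, hY⟩ := η.exists_isPathControl
  set H := η.var.toReal with hHdef
  have hH : 0 ≤ H := ENNReal.toReal_nonneg
  set D := ‖η.toC‖ with hD
  have hD0 : 0 ≤ D := norm_nonneg _
  have hS := h'.isSewable_taylorRem (G := fun v s t x => G v s t x) h.add hG' hW hY hD0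
    η.norm_apply_le hγ1 hl hl1 hz (min_le_left _ _) (min_le_right _ _)
  have hsum : ∑ j, (![L' * D ^ (1 + γ'), 2 * (L' * N) * D ^ (1 + l * γ'), L' * N * D ^ γ'] :
      Fin 3 → ℝ) j * (![Φ ^ b⁻¹, Θ ^ r₃, H ^ r₃] : Fin 3 → ℝ) j ^
        (![b, γ' * (1 - l) / r₃, 1 / r₃] : Fin 3 → ℝ) j
      = L' * D ^ (1 + γ') * Φ + 2 * (L' * N) * D ^ (1 + l * γ') * Θ ^ (γ' * (1 - l))
        + L' * N * D ^ γ' * H := by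
    rw [Fin.sum_univ_three]
    simp only [Matrix.cons_val_zero, Matrix.cons_val_one, Matrix.cons_val_two, Matrix.tail_cons,
      Matrix.head_cons]
    rw [h'.total_rpow, rpow_rpow_div hΘ hr₃.out, rpow_rpow_div hH hr₃.out, Real.rpow_one]
  obtain ⟨e₁, he₁, hI₁⟩ := hI'.exists_negligible hG
  obtain ⟨e₂, he₂, hI₂⟩ := hI.exists_negligible hG
  obtain ⟨e₃, he₃, hI₃⟩ := hJ
  have h0 : ∀ t : Icc (0 : ℝ) T, (t : ℝ) = 0 → (I' - I - J).toC t = 0 := by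
    intro t ht
    change I'.toC t - I.toC t - J.toC t = 0
    rw [hI'.1 t ht, hI.1 t ht, hJ0 t ht, sub_zero, sub_zero]
  have hQ : 0 ≤ L' * N * D ^ (1 + γ') + K * (L' * D ^ (1 + γ') * Φ
      + 2 * (L' * N) * D ^ (1 + l * γ') * Θ ^ (γ' * (1 - l)) + L' * N * D ^ γ' * H) := by
    positivity
  have h1 := ENNReal.toReal_mono ENNReal.ofReal_ne_top
    -- The remainder of the integral is sewn from the Taylor remainder of the field, with the sum of
    -- the three errors as its negligible error.
    (hS.pVar_normIncr_le (I := (I' - I - J).toC) hr₁.out (by rwa [hsum]) hM hV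
    ((he₁.add he₂).add he₃) fun s t hst => by
      have e1 : (I' - I - J).toC t - (I' - I - J).toC s
            - taylorRem (G s s t) (G' s s t) (θ.toC s) (η.toC s)
          = (I'.toC t - I'.toC s - G s s t ((θ + η).toC s))
            - (I.toC t - I.toC s - G s s t (θ.toC s))
            - (J.toC t - J.toC s - G' s s t (θ.toC s) (η.toC s)) := by
        unfold taylorRem
        change (I'.toC t - I.toC t - J.toC t)
          - (I'.toC s - I.toC s - J.toC s)
          - (G s s t ((θ + η).toC s) - _ - _) = _
        abel
      exact (congrArg norm e1).trans_le ((norm_sub_le _ _).trans (add_le_add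
        ((norm_sub_le _ _).trans (add_le_add (hI₁ s t hst) (hI₂ s t hst))) (hI₃ s t hst))))
  rw [hsum, ENNReal.toReal_ofReal (mul_nonneg hQ hM)] at h1
  change (I' - I - J).var.toReal ≤ _ at h1
  refine ((I' - I - J).norm_le_two_mul_var hT h0).trans ?_
  have hη : ‖η‖ = D + H := rfl
  have hη0 : 0 ≤ ‖η‖ := norm_nonneg _
  have hDη : D ≤ ‖η‖ := by linarith
  have hHη : H ≤ ‖η‖ := by linarith
  have p1 : D ^ (1 + γ') ≤ ‖η‖ ^ γ' * ‖η‖ := by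
    rw [← Real.rpow_add_one' hη0 (by linarith), add_comm]
    gcongr
  have p2 : D ^ (1 + l * γ') ≤ ‖η‖ ^ (l * γ') * ‖η‖ := by
    rw [← Real.rpow_add_one' hη0 (by positivity), add_comm]
    gcongr
  have p3 : D ^ γ' * H ≤ ‖η‖ ^ γ' * ‖η‖ := by gcongr
  exact rem_bound_arith hL hN hΦ hK0 hM (by positivity) p1 p2 p3 h1

/-- Fréchet differentiability of the nonlinear Young integral in the path. -/
theorem exists_hasFDerivAt_youngIntegral
    (hG' : ∀ v s t x, s ≤ t → HasFDerivAt (G v s t) (G' v s t x) x)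
    (hγ : 1 < 1 / r₁ + γ' / r₃) {𝓘 : VarPath T r₃ (Euc d) → VarPath T r₁ (Euc d)}
    (h𝓘 : ∀ θ, IsYoungIntegral ω f θ.toC (𝓘 θ).toC) (θ : VarPath T r₃ (Euc d)) :
    ∃ D𝓘 : VarPath T r₃ (Euc d) →L[ℝ] VarPath T r₁ (Euc d), HasFDerivAt 𝓘 D𝓘 θ ∧
      ‖D𝓘‖ ≤ 2 * (L' * (1 + youngConst (Fin 3) (min (1 / r₁ + b) (1 / r₁ + γ' / r₃)))) * M
        * (Φ + (1 + θ.var.toReal ^ γ') * N) := by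
  have hL := h'.Lnonneg
  have hN := h'.Nnonneg
  have hΦ := h'.Φnonneg
  have hγ0 := h'.γpos
  set Θ := θ.var.toReal with hΘdef
  have hΘ : 0 ≤ Θ := ENNReal.toReal_nonneg
  choose J hJ0 hJ hJn using exists_youngIntegral_deriv hT hM hV hb h' hγ1 hγ θ
  -- The paths `J η` are chosen one direction at a time. Their linearity follows from uniqueness,
  -- since the local descriptions are linear in the direction.
  have hJadd : ∀ η η', J (η + η') = J η + J η' := by
    intro η η'
    obtain ⟨e, he, hJe⟩ := hJ (η + η')
    obtain ⟨e₁, he₁, hJe₁⟩ := hJ η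
    obtain ⟨e₂, he₂, hJe₂⟩ := hJ η'
    refine VarPath.ext_apply (eq_of_negligible hT he (he₁.add he₂) (hJ0 _) (fun t ht => ?_) hJe
      fun s t hst => ?_)
    · change (J η).toC t + (J η').toC t = 0
      rw [hJ0 η t ht, hJ0 η' t ht, add_zero]
    · have e1 : (J η + J η').toC t - (J η + J η').toC s - G' s s t (θ.toC s) ((η + η').toC s)
          = ((J η).toC t - (J η).toC s - G' s s t (θ.toC s) (η.toC s))
            + ((J η').toC t - (J η').toC s - G' s s t (θ.toC s) (η'.toC s)) := by
        change ((J η).toC t + (J η').toC t) - ((J η).toC s + (J η').toC s)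
          - G' s s t (θ.toC s) (η.toC s + η'.toC s) = _
        rw [map_add]
        abel
      rw [e1]
      exact (norm_add_le _ _).trans (add_le_add (hJe₁ s t hst) (hJe₂ s t hst))
  have hJsmul : ∀ (c : ℝ) η, J (c • η) = c • J η := by
    intro c η
    obtain ⟨e, he, hJe⟩ := hJ (c • η)
    obtain ⟨e₁, he₁, hJe₁⟩ := hJ η
    refine VarPath.ext_apply (eq_of_negligible hT he (he₁.const_mul ‖c‖) (hJ0 _) (fun t ht => ?_)
      hJe fun s t hst => ?_)
    · change c • (J η).toC t = 0
      rw [hJ0 η t ht, smul_zero]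
    · have e1 : (c • J η).toC t - (c • J η).toC s - G' s s t (θ.toC s) ((c • η).toC s)
          = c • ((J η).toC t - (J η).toC s - G' s s t (θ.toC s) (η.toC s)) := by
        change c • (J η).toC t - c • (J η).toC s - G' s s t (θ.toC s) (c • η.toC s) = _
        rw [map_smul, smul_sub, smul_sub]
      rw [e1, norm_smul]
      exact mul_le_mul_of_nonneg_left (hJe₁ s t hst) (norm_nonneg _)
  refine ⟨LinearMap.mkContinuous ⟨⟨J, hJadd⟩, hJsmul⟩ _ hJn, ?_,
    LinearMap.mkContinuous_norm_le _ ?_ _⟩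
  swap
  · have := youngConst_nonneg (κ := Fin 3) (lt_min hb hγ)
    positivity
  -- The Young condition is strict, so a small share `l` of the Hölder exponent can be spent on
  -- making the remainder superlinear in the direction.
  obtain ⟨l, hl, hl1, hlγ⟩ : ∃ l : ℝ, 0 < l ∧ l < 1 ∧ 1 < 1 / r₁ + γ' * (1 - l) / r₃ := by
    have hlim : Tendsto (fun l : ℝ => 1 / r₁ + γ' * (1 - l) / r₃) (𝓝[>] 0)
        (𝓝 (1 / r₁ + γ' / r₃)) := by
      have hc : Continuous fun l : ℝ => 1 / r₁ + γ' * (1 - l) / r₃ := by fun_prop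
      have := (hc.tendsto 0).mono_left (nhdsWithin_le_nhds (s := Ioi 0))
      simpa using this
    obtain ⟨l, hl⟩ := ((hlim.eventually_const_lt hγ).and (Ioo_mem_nhdsGT one_pos)).exists
    exact ⟨l, hl.2.1, hl.2.2, hl.1⟩
  set z := min (1 / r₁ + b) (1 / r₁ + γ' * (1 - l) / r₃) with hzdef
  have hz : 1 < z := lt_min hb hlγ
  set K := youngConst (Fin 3) z with hK
  have hK0 : 0 ≤ K := youngConst_nonneg hz
  have hrem := fun η => norm_youngIntegral_rem_le hT hG h hM hV hb h' hγ1 hG' hl hl1 hlγ (h𝓘 θ)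
    (h𝓘 (θ + η)) (hJ0 η) (hJ η)
  rw [← hzdef, ← hK] at hrem
  rw [hasFDerivAt_iff_isLittleO_nhds_zero, Asymptotics.isLittleO_iff]
  intro c hc
  -- The remainder is this factor times `‖η‖`, and the factor tends to zero because both exponents
  -- are positive.
  have hcont : Tendsto (fun η : VarPath T r₃ (Euc d) =>
      2 * M * (L' * N + K * (L' * Φ + L' * N)) * ‖η‖ ^ γ'
        + 2 * M * (K * (2 * (L' * N) * Θ ^ (γ' * (1 - l)))) * ‖η‖ ^ (l * γ')) (𝓝 0) (𝓝 0) := by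
    have hc1 : Continuous fun η : VarPath T r₃ (Euc d) =>
        2 * M * (L' * N + K * (L' * Φ + L' * N)) * ‖η‖ ^ γ'
        + 2 * M * (K * (2 * (L' * N) * Θ ^ (γ' * (1 - l)))) * ‖η‖ ^ (l * γ') :=
      (continuous_const.mul (continuous_norm.rpow_const fun _ => Or.inr hγ0.le)).add
        (continuous_const.mul (continuous_norm.rpow_const fun _ => Or.inr (by positivity)))
    have h2 := hc1.tendsto 0
    have h3 : l * γ' ≠ 0 := by positivity
    simpa only [norm_zero, Real.zero_rpow hγ0.ne', Real.zero_rpow h3, mul_zero, add_zero] using h2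
  filter_upwards [hcont.eventually_lt_const hc] with η hη
  exact (hrem η).trans (mul_le_mul_of_nonneg_right hη.le (norm_nonneg _))

end Derivative

end YoungIntegral

end SBEPaths

end

/-! ### Assembly of the three claims -/

theorem proposition6p3 (d : ℕ) (hd : 0 < d)
    (p₁ q₁ p₂ α₁ α₂ r₁ r₂ r₃ : ℝ) (q₂ : ℝ≥0∞)
    (hp₁ : 1 ≤ p₁) (hq₁ : 1 ≤ q₁) (hp₂ : 1 ≤ p₂) (hq₂ : 1 ≤ q₂) (hα₁ : 0 < α₁)
    [hr₁ : Fact (0 < r₁)] (hr₂ : 0 < r₂) [hr₃ : Fact (0 < r₃)]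
    (hlow : 1 < 1 / q₁ + 1 / p₂) (hupp : 1 / q₁ + 1 / p₂ < 1 + (α₁ + α₂) / d)
    (hr₁₂ : 1 < 1 / r₁ + 1 / r₂)
    (γ₀ : ℝ) (hγ₀ : γ₀ = α₁ + α₂ - d * (1 / q₁ + 1 / p₂ - 1)) (R : ℝ) :
    -- existence, uniqueness and bound
    (∀ γ : ℝ, 0 < γ → γ < 1 → γ ≤ γ₀ → 1 < 1 / r₁ + γ / r₃ →
      ∃ C : ℝ≥0, ∀ T : ℝ, 0 < T →
      ∀ ω : C(Icc (0 : ℝ) T, Euc d), (∀ s t, dist (ω s) (ω t) ≤ R) →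
        IsCVar (sbeIncr α₁ p₁ q₁ ω) r₁ →
      ∀ f : Icc (0 : ℝ) T → VecDistribution d,
        MemVarBesov α₂ p₂ q₂ r₂ f →
      ∀ θ : VarPath T r₃ (Euc d),
        ∃ I : VarPath T r₁ (Euc d),
          IsYoungIntegral ω f θ.toC I.toC ∧
          (∀ J : C(Icc (0 : ℝ) T, Euc d),
            IsYoungIntegral ω f θ.toC J → J = I.toC) ∧
          I.var ≤ C * (besovVar α₂ p₂ q₂ r₂ f
              + (1 + θ.var ^ γ) * besovSup α₂ p₂ q₂ f)
            * sbeVar α₁ p₁ q₁ r₁ ω) ∧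
    -- Hölder-type continuity in `θ`
    (∀ γ l : ℝ, 0 < γ → γ < 1 → γ ≤ γ₀ → 0 < l → l < 1 → 1 < 1 / r₁ + γ * (1 - l) / r₃ →
      ∃ C : ℝ≥0, ∀ T : ℝ, 0 < T →
      ∀ ω : C(Icc (0 : ℝ) T, Euc d), (∀ s t, dist (ω s) (ω t) ≤ R) →
        IsCVar (sbeIncr α₁ p₁ q₁ ω) r₁ →
      ∀ f : Icc (0 : ℝ) T → VecDistribution d,
        MemVarBesov α₂ p₂ q₂ r₂ f →
      ∀ (θ₁ θ₂ : VarPath T r₃ (Euc d))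
        (I₁ I₂ : VarPath T r₁ (Euc d)),
        IsYoungIntegral ω f θ₁.toC I₁.toC →
        IsYoungIntegral ω f θ₂.toC I₂.toC →
          (I₁ - I₂).var ≤ C * sbeVar α₁ p₁ q₁ r₁ ω
            * (besovSup α₂ p₂ q₂ f + besovVar α₂ p₂ q₂ r₂ f)
            * ‖θ₁.toC - θ₂.toC‖ₑ ^ (l * γ)
            * (‖θ₁.toC - θ₂.toC‖ₑ + θ₁.var + θ₂.var) ^ (γ * (1 - l))) ∧
    -- Fréchet differentiability in `θ`
    (1 < γ₀ → ∀ γ : ℝ, 0 < γ → γ < 1 → γ ≤ γ₀ - 1 → 1 < 1 / r₁ + γ / r₃ →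
      ∃ C : ℝ≥0, ∀ T : ℝ, 0 < T →
      ∀ ω : C(Icc (0 : ℝ) T, Euc d), (∀ s t, dist (ω s) (ω t) ≤ R) →
        IsCVar (sbeIncr α₁ p₁ q₁ ω) r₁ →
      ∀ f : Icc (0 : ℝ) T → VecDistribution d,
        MemVarBesov α₂ p₂ q₂ r₂ f →
        ∃ (𝓘 : VarPath T r₃ (Euc d) → VarPath T r₁ (Euc d))
          (D𝓘 : VarPath T r₃ (Euc d) →
            VarPath T r₃ (Euc d) →L[ℝ] VarPath T r₁ (Euc d)),
          (∀ θ, IsYoungIntegral ω f θ.toC (𝓘 θ).toC) ∧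
          ∀ θ, HasFDerivAt 𝓘 (D𝓘 θ) θ ∧
            ‖D𝓘 θ‖ₑ ≤ C * sbeVar α₁ p₁ q₁ r₁ ω
              * (besovVar α₂ p₂ q₂ r₂ f
                + (1 + θ.var ^ γ) * besovSup α₂ p₂ q₂ f)) := by
  have hb : 1 < 1 / r₁ + 1 / r₂ := hr₁₂
  refine ⟨fun γ hγ hγ1 hγγ₀ hγr => ?_, fun γ l hγ hγ1 hγγ₀ hl hl1 hγr => ?_,
    fun hγ₀1 γ hγ hγ1 hγγ₀ hγr => ?_⟩
  · obtain ⟨L, hL, hfield⟩ := exists_isYoungField hd hα₁ hp₁ hq₁ hp₂ hq₂ hlow.le hγ₀ R hγ hγ1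
      hr₁.out hr₂ hγγ₀
    refine ⟨(L * (1 + youngConst (Fin 2) (min (1 / r₁ + 1 / r₂) (1 / r₁ + γ / r₃)))).toNNReal,
      fun T hT ω hω hωv f hf θ => ?_⟩
    obtain ⟨V₁, hV₁⟩ := exists_isSbeControl hp₁ hq₁ hr₁.out ω hωv
    obtain ⟨V₂, hV₂⟩ := exists_isBesovControl hT hp₂ hq₂ hr₂ hf
    obtain ⟨G, hG, hGf⟩ := hfield T hT ω hω f V₁ V₂ _ _ _ hV₁ hV₂
    obtain ⟨I, hI, huniq, hIv⟩ := exists_youngIntegral hT hG hGf hV₁.nonneg hV₁.total hb hγr θ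
    refine ⟨I, hI, huniq, hIv.trans (ENNReal.ofReal_le_of_le_toReal (le_of_eq ?_))⟩
    have hK := youngConst_nonneg (κ := Fin 2) (lt_min hb hγr)
    have hΘ : θ.var ^ γ ≠ ∞ := ENNReal.rpow_ne_top_of_nonneg hγ.le θ.var_ne_top
    have hN := besovSup_ne_top hT hp₂ hq₂ hr₂ hf
    have hF : besovVar α₂ p₂ q₂ r₂ f ≠ ∞ := hf.isCVar.finite
    rw [ENNReal.toReal_mul, ENNReal.toReal_mul, ENNReal.toReal_add hF
      (ENNReal.mul_ne_top (ENNReal.add_ne_top.2 ⟨ENNReal.one_ne_top, hΘ⟩) hN), ENNReal.toReal_mul,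
      ENNReal.toReal_add ENNReal.one_ne_top hΘ, ENNReal.toReal_one, ENNReal.coe_toReal,
      Real.coe_toNNReal _ (by positivity), ENNReal.toReal_rpow]
  · obtain ⟨L, hL, hfield⟩ := exists_isYoungField hd hα₁ hp₁ hq₁ hp₂ hq₂ hlow.le hγ₀ R hγ hγ1
      hr₁.out hr₂ hγγ₀
    refine ⟨(L * (1 + 4 * youngConst (Fin 3)
      (min (1 / r₁ + 1 / r₂) (1 / r₁ + γ * (1 - l) / r₃)))).toNNReal,
      fun T hT ω hω hωv f hf θ₁ θ₂ I₁ I₂ hI₁ hI₂ => ?_⟩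
    obtain ⟨V₁, hV₁⟩ := exists_isSbeControl hp₁ hq₁ hr₁.out ω hωv
    obtain ⟨V₂, hV₂⟩ := exists_isBesovControl hT hp₂ hq₂ hr₂ hf
    obtain ⟨G, hG, hGf⟩ := hfield T hT ω hω f V₁ V₂ _ _ _ hV₁ hV₂
    refine (var_youngIntegral_sub_le hG hGf hV₁.nonneg hV₁.total hb hl hl1 hγr θ₁ θ₂ hI₁
      hI₂).trans (ENNReal.ofReal_le_of_le_toReal (le_of_eq ?_))
    have hK := youngConst_nonneg (κ := Fin 3) (lt_min hb hγr)
    have hN := besovSup_ne_top hT hp₂ hq₂ hr₂ hf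
    have hF : besovVar α₂ p₂ q₂ r₂ f ≠ ∞ := hf.isCVar.finite
    rw [ENNReal.toReal_mul, ENNReal.toReal_mul, ENNReal.toReal_mul, ENNReal.toReal_mul,
      ENNReal.toReal_add hN hF, ENNReal.coe_toReal,
      Real.coe_toNNReal _ (by positivity), ← ENNReal.toReal_rpow, ← ENNReal.toReal_rpow,
      ENNReal.toReal_add (ENNReal.add_ne_top.2 ⟨enorm_ne_top, θ₁.var_ne_top⟩) θ₂.var_ne_top,
      ENNReal.toReal_add enorm_ne_top θ₁.var_ne_top, toReal_enorm]
  -- As `γ ≤ γ₀ - 1` implies `γ ≤ γ₀`, the same exponent serves the field and its derivative, and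
  -- the integral itself is available from the first claim.
  · obtain ⟨L, hL, hfield⟩ := exists_isYoungField hd hα₁ hp₁ hq₁ hp₂ hq₂ hlow.le hγ₀ R hγ hγ1
      hr₁.out hr₂ (by linarith)
    obtain ⟨L', hL', hfield'⟩ := exists_isYoungField_fderiv hd hα₁ hp₁ hq₁ hp₂ hq₂ hlow.le hγ₀ R
      hγ hγ1 hr₁.out hr₂ hγγ₀
    refine ⟨(2 * (L' * (1 + youngConst (Fin 3)
      (min (1 / r₁ + 1 / r₂) (1 / r₁ + γ / r₃))))).toNNReal, fun T hT ω hω hωv f hf => ?_⟩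
    obtain ⟨V₁, hV₁⟩ := exists_isSbeControl hp₁ hq₁ hr₁.out ω hωv
    obtain ⟨V₂, hV₂⟩ := exists_isBesovControl hT hp₂ hq₂ hr₂ hf
    obtain ⟨G, hG, hGf⟩ := hfield T hT ω hω f V₁ V₂ _ _ _ hV₁ hV₂
    obtain ⟨G', hG', hGf'⟩ := hfield' T hT ω hω f V₁ V₂ _ _ _ hV₁ hV₂ G hG
    choose 𝓘 h𝓘 _ _ using exists_youngIntegral hT hG hGf hV₁.nonneg hV₁.total hb hγr
    choose D𝓘 hD𝓘 hn using exists_hasFDerivAt_youngIntegral hT hG hGf hV₁.nonneg hV₁.total hb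
      hGf' hγ1 hG' hγr h𝓘
    refine ⟨𝓘, D𝓘, h𝓘, fun θ => ⟨hD𝓘 θ, ?_⟩⟩
    rw [← ofReal_norm]
    refine ENNReal.ofReal_le_of_le_toReal ((hn θ).trans (le_of_eq ?_))
    have hK := youngConst_nonneg (κ := Fin 3) (lt_min hb hγr)
    have hΘ : θ.var ^ γ ≠ ∞ := ENNReal.rpow_ne_top_of_nonneg hγ.le θ.var_ne_top
    have hN := besovSup_ne_top hT hp₂ hq₂ hr₂ hf
    have hF : besovVar α₂ p₂ q₂ r₂ f ≠ ∞ := hf.isCVar.finite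
    rw [ENNReal.toReal_mul, ENNReal.toReal_mul, ENNReal.toReal_add hF
      (ENNReal.mul_ne_top (ENNReal.add_ne_top.2 ⟨ENNReal.one_ne_top, hΘ⟩) hN), ENNReal.toReal_mul,
      ENNReal.toReal_add ENNReal.one_ne_top hΘ, ENNReal.toReal_one, ENNReal.coe_toReal,
      Real.coe_toNNReal _ (by positivity), ← ENNReal.toReal_rpow]
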